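/- Theorem 1.2. Let $n\ge 1$ and let $\mu$ be a Borel measure on $\mathbf{R}^n$ with $0<\mu(B)<\infty$ for all balls $B$ and $\mu(2B)\le 2^{\nu}\mu(B)$ for all balls $B$; write $|E|=\mu(E)$, $\langle f\rangle_{p,E}=\|f\chi_E\|_{L^p(|E|^{-1}d\mu)}$, $\langle f,g\rangle=\int fg\,d\mu$, and $p'=p/(p-1)$. For $\alpha\in\{0,\frac13,\frac23\}^n$ let $\mathscr{D}^\alpha=\bigcup_{k\in\mathbf{Z}}\{2^{-k}([0,1)^n+m+(-1)^k\alpha):m\in\mathbf{Z}^n\}$ and $\mathscr{D}=\bigcup_\alpha\mathscr{D}^\alpha$. A collection $\mathscr{S}\subseteq\mathscr{D}$ is $\eta$-sparse if for each $\alpha$ there are pairwise disjoint measurable sets $E_Q\subseteq Q$, $Q\in\mathscr{S}\cap\mathscr{D}^\alpha$, with $|Q|\le\eta^{-1}|E_Q|$. A weight is a measurable function $w:\mathbf{R}^n\to(0,\infty)$ that is $\mu$-integrable over balls, and $w(E)=\int_E w\,d\mu$. Put $$[w]_{A_1}=\sup_{Q\in\mathscr{D}}\langle w\rangle_{1,Q}\langle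 w^{-1}\rangle_{\infty,Q},\qquad [w]_{A_\infty}=\sup_{B}\frac1{w(B)}\int_B\mathscr{M}^{\mathscr{B}}(w\chi_B)\,d\mu,\qquad [w]_{RH_s}=\sup_{Q\in\mathscr{D}}\langle w\rangle_{s,Q}\langle w\rangle_{1,Q}^{-1}\quad(1<s\le\infty),$$ where $B$ runs over all balls and $\mathscr{M}^{\mathscr{B}}$ is the uncentered maximal operator over balls. The classes $A_1$, $A_\infty$, $RH_s$ consist of the weights for which the respective constant is finite, and $RH_1=A_\infty$ with $[w]_{RH_1}=1$. Let $\mathcal{D}$ be a linear space of real- or complex-valued functions that is contained and dense in $L^p(w)$ for all $1\le p<\infty$ and all $w\in A_\infty$, and such that a measurable function $u$ with $ug$ integrable and $\langle u,g\rangle=0$ for all $g\in\mathcal{D}$ vanishes a.e. (for example $\mathcal{D}=C_c^\infty(\mathbf{R}^n)$). For $1\le p_0<q_0\le\infty$ we write $T\in S(p_0,q_0)$, with constants $c_T>0$ and $0<\eta\le1$, if $T$ maps $\mathcal{D}$ into the measurable functions, is linear or sublinear (that is, $|T(f+g)|\le|Tf|+|Tg|$ and $|T(af)|=|a||Tf|$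 a.e.), and for all $f,g\in\mathcal{D}$ the product $(Tf)g$ is integrable and there is an $\eta$-sparse collection $\mathscr{S}\subseteq\mathscr{D}$ with $$|\langle Tf,g\rangle|\le c_T\sum_{Q\in\mathscr{S}}\langle f\rangle_{p_0,Q}\langle g\rangle_{q_0',Q}|Q|.$$ Let $1\le p_0<q_0\le\infty$. Then there is a constant $c>0$, depending only on $c_T,\eta,p_0,q_0,\nu,n$, such that for every $\mu$ and $\mathcal{D}$ as above, every $T\in S(p_0,q_0)$ with constants $c_T,\eta$, and every $w\in A_1\cap RH_{(q_0/p_0)'}$, the quantity $$\psi(w)=\begin{cases} [w]_{A_1}\log(e+[w]_{A_\infty}) & \text{if } p_0=1,\ q_0=\infty;\\ [w]_{A_1}^{1/p_0}[w]_{A_\infty}^{1/p_0'}\log(e+[w]_{A_\infty})^{2/p_0} & \text{if } p_0>1,\ q_0=\infty;\\ [w^{q_0'}]_{A_\infty}[w]_{A_1}[w]_{RH_{q_0'}} & \text{if } p_0=1,\ q_0<\infty;\\ [w^{(q_0/p_0)'}]_{A_\infty}^{1+1/p_0}\left([w]_{A_1}[w]_{RH_{(q_0/p_0)'}}\right)^{1/p_0}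 & \text{if } p_0>1,\ q_0<\infty \end{cases}$$ is finite, and $T$ extends from $\mathcal{D}$ to a sublinear operator (linear, if $T$ is linear) on all of $L^{p_0}(w)$ with $$\|Tf\|_{L^{p_0,\infty}(w)}=\sup_{t>0}t\,w(\{|Tf|>t\})^{1/p_0}\le c\,\psi(w)\,\|f\|_{L^{p_0}(w)}\qquad\text{for all } f\in L^{p_0}(w).$$ -/

import Mathlib

open MeasureTheory Set
open scoped ENNReal NNReal

noncomputable section

namespace SparseDom

/-- `μ` is a Borel measure on `ℝⁿ` with `0 < μ(B) < ∞` for all balls `B` which is doubling with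
constant `2 ^ ν`, i.e. whose doubling dimension is at most `ν`. -/
structure IsDoubling {n : ℕ} (ν : ℝ) (μ : Measure (EuclideanSpace ℝ (Fin n))) : Prop where
  ball_pos : ∀ x r, 0 < r → 0 < μ (Metric.ball x r)
  ball_lt_top : ∀ x r, μ (Metric.ball x r) < ∞
  doubling : ∀ x r, 0 < r →
    μ (Metric.ball x (2 * r)) ≤ ENNReal.ofReal ((2 : ℝ) ^ ν) * μ (Metric.ball x r)

/-- The cube `2⁻ᵏ ([0,1)ⁿ + m + (-1)ᵏ α)`, where the shift `α ∈ {0, 1/3, 2/3}ⁿ` is encoded by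
`3 α ∈ {0, 1, 2}ⁿ`. -/
def dyadicCube {n : ℕ} (α : Fin n → Fin 3) (k : ℤ) (m : Fin n → ℤ) :
    Set (EuclideanSpace ℝ (Fin n)) :=
  {x | ∀ i, x i ∈ Ico
    ((2 : ℝ) ^ (-k) * ((m i : ℝ) + (-1 : ℝ) ^ k * (((α i : ℕ) : ℝ) / 3)))
    ((2 : ℝ) ^ (-k) * (1 + (m i : ℝ) + (-1 : ℝ) ^ k * (((α i : ℕ) : ℝ) / 3)))}

/-- The translated dyadic system `𝒟^α`. -/
def dyadicGrid {n : ℕ} (α : Fin n → Fin 3) : Set (Set (EuclideanSpace ℝ (Fin n))) :=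
  {Q | ∃ k m, Q = dyadicCube α k m}

/-- The union `𝒟` of the `3ⁿ` translated dyadic systems. -/
def dyadicCubes (n : ℕ) : Set (Set (EuclideanSpace ℝ (Fin n))) :=
  {Q | ∃ α, Q ∈ dyadicGrid α}

/-- `η`-sparse collections of dyadic cubes. -/
def IsSparse {n : ℕ} (μ : Measure (EuclideanSpace ℝ (Fin n))) (η : ℝ)
    (S : Set (Set (EuclideanSpace ℝ (Fin n)))) : Prop :=
  S ⊆ dyadicCubes n ∧ ∀ α : Fin n → Fin 3,
    ∃ E : Set (EuclideanSpace ℝ (Fin n)) → Set (EuclideanSpace ℝ (Fin n)),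
      (S ∩ dyadicGrid α).PairwiseDisjoint E ∧
      ∀ Q ∈ S ∩ dyadicGrid α, MeasurableSet (E Q) ∧ E Q ⊆ Q ∧
        μ Q ≤ (ENNReal.ofReal η)⁻¹ * μ (E Q)

/-- The average `⟨f⟩_{p,E}`, the `Lᵖ` norm of `f χ_E` for the measure `μ(E)⁻¹ dμ`. -/
def avg {X F : Type*} [MeasurableSpace X] [NormedAddCommGroup F] (μ : Measure X) (p : ℝ≥0∞)
    (E : Set X) (f : X → F) : ℝ≥0∞ :=
  eLpNorm f p ((μ E)⁻¹ • μ.restrict E)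

/-- The measure `w dμ`. -/
def wMeasure {X : Type*} [MeasurableSpace X] (μ : Measure X) (w : X → ℝ) : Measure X :=
  μ.withDensity fun x => ENNReal.ofReal (w x)

/-- Weights: measurable functions with values in `(0, ∞)` which are integrable over balls (the
latter is implied by the `A_1` condition, and is needed for the `A_∞` constant to make sense). -/
structure IsWeight {n : ℕ} (μ : Measure (EuclideanSpace ℝ (Fin n)))
    (w : EuclideanSpace ℝ (Fin n) → ℝ) : Prop where
  measurable : Measurable w
  pos : ∀ x, 0 < w x
  ball_lt_top : ∀ x r, wMeasure μ w (Metric.ball x r) < ∞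

/-- The `A_1` constant `sup_{Q ∈ 𝒟} ⟨w⟩_{1,Q} ⟨w⁻¹⟩_{∞,Q}`. -/
def A1const {n : ℕ} (μ : Measure (EuclideanSpace ℝ (Fin n)))
    (w : EuclideanSpace ℝ (Fin n) → ℝ) : ℝ≥0∞ :=
  ⨆ Q ∈ dyadicCubes n, avg μ 1 Q w * avg μ ∞ Q (fun x => (w x)⁻¹)

/-- The uncentered maximal operator with respect to balls. -/
def ballMaximal {n : ℕ} (μ : Measure (EuclideanSpace ℝ (Fin n)))
    (f : EuclideanSpace ℝ (Fin n) → ℝ) (x : EuclideanSpace ℝ (Fin n)) : ℝ≥0∞ :=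
  ⨆ (y : EuclideanSpace ℝ (Fin n)) (r : ℝ) (_ : 0 < r) (_ : x ∈ Metric.ball y r),
    avg μ 1 (Metric.ball y r) f

/-- Wilson's `A_∞` constant `sup_B w(B)⁻¹ ∫_B M(w χ_B) dμ`. -/
def AinftyConst {n : ℕ} (μ : Measure (EuclideanSpace ℝ (Fin n)))
    (w : EuclideanSpace ℝ (Fin n) → ℝ) : ℝ≥0∞ :=
  ⨆ (y : EuclideanSpace ℝ (Fin n)) (r : ℝ) (_ : 0 < r),
    (wMeasure μ w (Metric.ball y r))⁻¹ *
      ∫⁻ x in Metric.ball y r, ballMaximal μ ((Metric.ball y r).indicator w) x ∂μ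

/-- The reverse Hölder constant `sup_{Q ∈ 𝒟} ⟨w⟩_{s,Q} ⟨w⟩_{1,Q}⁻¹`, with value `1` if `s = 1`. -/
def RHconst {n : ℕ} (μ : Measure (EuclideanSpace ℝ (Fin n)))
    (w : EuclideanSpace ℝ (Fin n) → ℝ) (s : ℝ≥0∞) : ℝ≥0∞ :=
  open Classical in
  if s = 1 then 1 else ⨆ Q ∈ dyadicCubes n, avg μ s Q w * (avg μ 1 Q w)⁻¹

/-- `w ∈ A_1`. -/
def InA1 {n : ℕ} (μ : Measure (EuclideanSpace ℝ (Fin n)))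
    (w : EuclideanSpace ℝ (Fin n) → ℝ) : Prop :=
  IsWeight μ w ∧ A1const μ w < ∞

/-- `w ∈ A_∞`. -/
def InAinfty {n : ℕ} (μ : Measure (EuclideanSpace ℝ (Fin n)))
    (w : EuclideanSpace ℝ (Fin n) → ℝ) : Prop :=
  IsWeight μ w ∧ AinftyConst μ w < ∞

/-- `w ∈ RH_s` for `1 ≤ s ≤ ∞`, with `RH_1 = A_∞`. -/
def InRH {n : ℕ} (μ : Measure (EuclideanSpace ℝ (Fin n)))
    (w : EuclideanSpace ℝ (Fin n) → ℝ) (s : ℝ≥0∞) : Prop :=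
  (s = 1 → InAinfty μ w) ∧ (s ≠ 1 → IsWeight μ w ∧ RHconst μ w s < ∞)

/-- A space `D` of test functions: it is contained and dense in `Lᵖ(w)` for all `1 ≤ p < ∞` and
all `w ∈ A_∞`, and the pairing `⟨u, g⟩ = ∫ u g dμ` with the functions `g ∈ D` determines `u`. -/
structure IsTestSpace {n : ℕ} {𝕜 : Type*} [RCLike 𝕜] (μ : Measure (EuclideanSpace ℝ (Fin n)))
    (D : Submodule 𝕜 (EuclideanSpace ℝ (Fin n) → 𝕜)) : Prop where
  memLp : ∀ w, InAinfty μ w → ∀ p : ℝ≥0∞, 1 ≤ p → p < ∞ → ∀ f ∈ D, MemLp f p (wMeasure μ w)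
  dense : ∀ w, InAinfty μ w → ∀ p : ℝ≥0∞, 1 ≤ p → p < ∞ →
    ∀ f : EuclideanSpace ℝ (Fin n) → 𝕜, MemLp f p (wMeasure μ w) → ∀ ε : ℝ≥0∞, 0 < ε →
      ∃ g ∈ D, eLpNorm (f - g) p (wMeasure μ w) ≤ ε
  separating : ∀ u : EuclideanSpace ℝ (Fin n) → 𝕜, AEStronglyMeasurable u μ →
    (∀ g ∈ D, Integrable (fun x => u x * g x) μ ∧ ∫ x, u x * g x ∂μ = 0) → u =ᵐ[μ] 0

/-- `T` is sublinear on the set `V` of functions. Only the values of `T` on `V` matter. -/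
def IsSublinearOn {X 𝕜 : Type*} [MeasurableSpace X] [RCLike 𝕜] (μ : Measure X)
    (V : Set (X → 𝕜)) (T : (X → 𝕜) → X → 𝕜) : Prop :=
  (∀ f ∈ V, ∀ g ∈ V, ∀ᵐ x ∂μ, ‖T (f + g) x‖ ≤ ‖T f x‖ + ‖T g x‖) ∧
  (∀ a : 𝕜, ∀ f ∈ V, ∀ᵐ x ∂μ, ‖T (a • f) x‖ = ‖a‖ * ‖T f x‖)

/-- `T` is linear on the set `V` of functions. Only the values of `T` on `V` matter. -/
def IsLinearOn {X 𝕜 : Type*} [MeasurableSpace X] [RCLike 𝕜] (μ : Measure X)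
    (V : Set (X → 𝕜)) (T : (X → 𝕜) → X → 𝕜) : Prop :=
  (∀ f ∈ V, ∀ g ∈ V, T (f + g) =ᵐ[μ] T f + T g) ∧
  (∀ a : 𝕜, ∀ f ∈ V, T (a • f) =ᵐ[μ] a • T f)

/-- `T`, a (sub)linear operator defined on the test functions `D`, belongs to `S(p₀, q₀)` with
constants `c` and `η` in the sparse domination property. -/
structure SparselyDominated {n : ℕ} {𝕜 : Type*} [RCLike 𝕜]
    (μ : Measure (EuclideanSpace ℝ (Fin n))) (D : Submodule 𝕜 (EuclideanSpace ℝ (Fin n) → 𝕜))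
    (p₀ q₀ : ℝ≥0∞) (c η : ℝ)
    (T : (EuclideanSpace ℝ (Fin n) → 𝕜) → EuclideanSpace ℝ (Fin n) → 𝕜) : Prop where
  sublinear : IsSublinearOn μ (D : Set (EuclideanSpace ℝ (Fin n) → 𝕜)) T
  aestronglyMeasurable : ∀ f ∈ D, AEStronglyMeasurable (T f) μ
  integrable : ∀ f ∈ D, ∀ g ∈ D, Integrable (fun x => T f x * g x) μ
  sparse : ∀ f ∈ D, ∀ g ∈ D, ∃ S : Set (Set (EuclideanSpace ℝ (Fin n))), IsSparse μ η S ∧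
    ‖∫ x, T f x * g x ∂μ‖ₑ ≤ ENNReal.ofReal c *
      ∑' Q : S, avg μ p₀ (Q : Set _) f * avg μ q₀.conjExponent (Q : Set _) g * μ (Q : Set _)

/-- The quasinorm of `L^{p,∞}(m)`, `sup_{t > 0} t m({|f| > t})^{1/p}`, for `0 < p < ∞`. -/
def weakLpNorm {X F : Type*} [MeasurableSpace X] [NormedAddCommGroup F] (f : X → F) (p : ℝ≥0∞)
    (m : Measure X) : ℝ≥0∞ :=
  ⨆ t : ℝ≥0, (t : ℝ≥0∞) * m {x | (t : ℝ) < ‖f x‖} ^ (1 / p.toReal)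

/-- `log (e + a)` for `a ∈ [0, ∞]`. -/
def logE (a : ℝ≥0∞) : ℝ≥0∞ :=
  (ENNReal.log (ENNReal.ofReal (Real.exp 1) + a)).toENNReal

/-- The exponent `(q₀ / p₀)'`. -/
def rhExp (p₀ q₀ : ℝ≥0∞) : ℝ≥0∞ := (q₀ / p₀).conjExponent

/-- The mixed `A_1`–`A_∞` expression `ψ(w)`. -/
def psi {n : ℕ} (μ : Measure (EuclideanSpace ℝ (Fin n))) (p₀ q₀ : ℝ≥0∞)
    (w : EuclideanSpace ℝ (Fin n) → ℝ) : ℝ≥0∞ :=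
  open Classical in
  if q₀ = ∞ then
    if p₀ = 1 then A1const μ w * logE (AinftyConst μ w)
    else A1const μ w ^ (1 / p₀.toReal) * AinftyConst μ w ^ (1 / p₀.conjExponent.toReal) *
      logE (AinftyConst μ w) ^ (2 / p₀.toReal)
  else
    if p₀ = 1 then AinftyConst μ (fun x => w x ^ q₀.conjExponent.toReal) * A1const μ w *
      RHconst μ w q₀.conjExponent
    else AinftyConst μ (fun x => w x ^ (rhExp p₀ q₀).toReal) ^ (1 + 1 / p₀.toReal) *
      (A1const μ w * RHconst μ w (rhExp p₀ q₀)) ^ (1 / p₀.toReal)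

end SparseDom

end

open MeasureTheory Set
open scoped ENNReal NNReal

noncomputable section

namespace SparseDom

/-! ### Laminar families, depth, and the Carleson packing condition -/

section Laminar

variable {X : Type*}

/-! Fix `t > 0` and put `h = (|f|/t)^p₀`. Let `Ω` be the union of the dyadic cubes over which the
average of `h` exceeds `1`. The `A_1` condition gives `w(Ω) ≲ [w]_{A_1} ∫ h w`
(`wMeasure_large_cubes_le`), so only `E = {|Tf| > t} \ Ω` matters. Pairing `Tf` with `w χ_E` times
the conjugate phase of `Tf` gives `t w(E) ≤ |⟨Tf, g⟩|`, and in the dominating sparse form only cubes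
meeting `E` survive; on these the averages of `h` are at most `1`. The heart of the matter is
`exists_grid_bound`: for every `ζ > 0` such a form, restricted to one grid and divided by `t`, is at
most `ζ w(E) + C ψ(w)^p₀ ∫ h w`. For small `ζ` the first term is absorbed on the left.

For the estimate in one grid, sparseness becomes a Carleson packing condition. The part of a cube
`Q` covered many times by smaller members (its deep part) then has measure decaying exponentially in
the depth (`IsCarleson.measure_deep_le`), while the remaining shallow parts overlap in a controlled
way (`IsLaminar.sum_shallow_le`). Cubes are sorted into layers on which the average of `h` is about
`2^(-k)`. Whatever is bounded by a multiple of `∫_Q h` times an average of the weight goes to `∫ h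
w`, by the `A_1` condition and the bounded overlap inside a layer (`IsCarleson.sum_layer_le`).

The `A_∞` constant enters through `exists_exceptional_set`. With `K` comparable to `[w]_{A_∞}`, the
weight is at most about `2^t` times its average outside a set that carries about a `(1 - 1/K)^t`
fraction of its mass. So the weight of deep parts halves about every `K` generations.

Case `q₀ = ∞`, with `γ = 1/p₀`: layers below a threshold `k₀` and the deep parts of the later layers
are charged to `∫ h w`; the shallow parts of the later layers are charged to `w(E)` with coefficient
about `K 2^(-γ k₀)`. Taking `k₀` about `γ⁻¹ log₂ K` makes this small, and the price is the sum of
`2^((1-γ)k)` over `k ≤ k₀`: of order `log K` if `p₀ = 1`, of order `K^(p₀-1)` otherwise.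

Case `q₀ < ∞`: the power `v = w^σ`, `σ = (q₀/p₀)'`, is again an `A_1` weight. The average `⟨w
χ_E⟩_{q₀'}` is interpolated between averages of `w χ_E` and of `v`, inside and outside an
exceptional set of `v` at the height given by the layer (`interpolated_average_le`), and a weighted
arithmetic-geometric mean inequality separates the two factors (`IsCarleson.sum_interpolated_le`).

Two functional-analytic points remain. The function `g` above is not a test function, so `Tf` is
first identified with the density of a bounded functional on an unweighted `L^r`
(`exists_exponent_domination`). Finally the weak type bound on test functions is extended by
continuity in measure (`exists_extension`); for nonlinear `T` only the modulus of `Tf` is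
continuous, and it is the modulus that is extended. -/

open Classical in
/-- Summing over a finite chain of sets a function of the rank. -/
lemma sum_rank_of_chain {M : Type*} [AddCommMonoid M] (C : Finset (Set X))
    (hC : ∀ P ∈ C, ∀ R ∈ C, P ⊆ R ∨ R ⊆ P) (f : ℕ → M) :
    ∑ R ∈ C, f (C.filter (· ⊂ R)).card = ∑ i ∈ Finset.range C.card, f i := by
  have hmono : ∀ P ∈ C, ∀ R ∈ C, P ⊂ R → (C.filter (· ⊂ P)).card < (C.filter (· ⊂ R)).card := by
    intro P hP R hR hPR
    apply Finset.card_lt_card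
    refine ⟨fun A hA => ?_, fun h => ?_⟩
    · simp only [Finset.mem_filter] at hA ⊢
      exact ⟨hA.1, hA.2.trans hPR⟩
    · have := h (Finset.mem_filter.2 ⟨hP, hPR⟩)
      exact (ssubset_irrefl P) (Finset.mem_filter.1 this).2
  have hinj : Set.InjOn (fun R => (C.filter (· ⊂ R)).card) (C : Set (Set X)) := by
    intro P hP R hR h
    by_contra hne
    rcases hC P hP R hR with h' | h'
    · exact (hmono P hP R hR (h'.ssubset_of_ne hne)).ne h
    · exact (hmono R hR P hP (h'.ssubset_of_ne (Ne.symm hne))).ne h.symm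
  -- The rank is strictly increasing along the chain, hence injective, and its values lie below the
  -- cardinality; so it is a bijection onto the initial segment.
  have himg : C.image (fun R => (C.filter (· ⊂ R)).card) = Finset.range C.card := by
    apply Finset.eq_of_subset_of_card_le
    · intro i hi
      obtain ⟨R, hR, rfl⟩ := Finset.mem_image.1 hi
      rw [Finset.mem_range]
      apply Finset.card_lt_card
      refine ⟨Finset.filter_subset _ _, fun h => ?_⟩
      exact (ssubset_irrefl R) (Finset.mem_filter.1 (h hR)).2
    · rw [Finset.card_range, Finset.card_image_of_injOn hinj]
  rw [← himg, Finset.sum_image hinj]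

/-- Any two members are nested or disjoint. -/
def IsLaminar (S : Finset (Set X)) : Prop :=
  ∀ P ∈ S, ∀ R ∈ S, P ⊆ R ∨ R ⊆ P ∨ Disjoint P R

open Classical in
/-- The number of members of `S` strictly inside `Q` which contain `x`. -/
def depth (S : Finset (Set X)) (Q : Set X) (x : X) : ℕ :=
  (S.filter fun R => R ⊂ Q ∧ x ∈ R).card

/-- The part of `Q` covered at least `t` times by strictly smaller members of `S`. -/
def deep (S : Finset (Set X)) (Q : Set X) (t : ℕ) : Set X :=
  {x | x ∈ Q ∧ t ≤ depth S Q x}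

lemma deep_subset (S : Finset (Set X)) (Q : Set X) (t : ℕ) : deep S Q t ⊆ Q := fun _ h => h.1

-- In a laminar family the members containing a given point form a chain, and the depth of such a
-- member at that point is its rank in the chain.
open Classical in
lemma IsLaminar.sum_depth_below {M : Type*} [AddCommMonoid M] {S : Finset (Set X)}
    (hS : IsLaminar S) (Q : Set X) (x : X) (f : ℕ → M) :
    ∑ R ∈ S.filter (fun R => R ⊂ Q ∧ x ∈ R), f (depth S R x) =
      ∑ i ∈ Finset.range (depth S Q x), f i := by
  have := sum_rank_of_chain (S.filter fun R => R ⊂ Q ∧ x ∈ R) (fun P hP R hR => by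
    simp only [Finset.mem_filter] at hP hR
    rcases hS P hP.1 R hR.1 with h | h | h
    · exact Or.inl h
    · exact Or.inr h
    · exact absurd hR.2.2 (Set.disjoint_left.1 h hP.2.2)) f
  rw [depth, ← this]
  refine Finset.sum_congr rfl fun R hR => ?_
  simp only [Finset.mem_filter] at hR
  congr 1
  rw [depth]
  congr 1
  ext P
  simp only [Finset.mem_filter]
  constructor
  · rintro ⟨h1, h2, h3⟩
    exact ⟨⟨h1, h2.trans hR.2.1, h3⟩, h2⟩
  · rintro ⟨⟨h1, _, h3⟩, h2⟩
    exact ⟨h1, h2, h3⟩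

open Classical in
lemma IsLaminar.sum_depth {M : Type*} [AddCommMonoid M] {S : Finset (Set X)}
    (hS : IsLaminar S) (x : X) (f : ℕ → M) :
    ∑ R ∈ S.filter (fun R => x ∈ R), f (depth S R x) =
      ∑ i ∈ Finset.range (S.filter fun R => x ∈ R).card, f i := by
  have := sum_rank_of_chain (S.filter fun R => x ∈ R) (fun P hP R hR => by
    simp only [Finset.mem_filter] at hP hR
    rcases hS P hP.1 R hR.1 with h | h | h
    · exact Or.inl h
    · exact Or.inr h
    · exact absurd hR.2 (Set.disjoint_left.1 h hP.2)) f
  rw [← this]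
  refine Finset.sum_congr rfl fun R hR => ?_
  congr 1
  rw [depth]
  congr 1
  ext P
  simp only [Finset.mem_filter]
  tauto

lemma sum_range_choose_eq (N t : ℕ) :
    ∑ i ∈ Finset.range N, i.choose t = N.choose (t + 1) := by
  induction N with
  | zero => simp
  | succ N ih => rw [Finset.sum_range_succ, ih, Nat.choose_succ_succ, add_comm]

/-- Each induction step gains a factor `s`, because `C(s(t+1), t+1) = s C(s(t+1) - 1, t)`. With `s =
4Λ` this turns binomial moments of order `Λ^t` into decay `4^(-t)`. -/
lemma pow_le_choose_mul (s t : ℕ) (hs : 1 ≤ s) : s ^ t ≤ (s * t).choose t := by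
  induction t with
  | zero => simp
  | succ t ih =>
    obtain ⟨n, hn⟩ : ∃ n, s * (t + 1) = n + 1 := ⟨s * (t + 1) - 1, by
      have : 1 ≤ s * (t + 1) := Nat.mul_pos hs (Nat.succ_pos t)
      omega⟩
    have h1 : (n + 1) * n.choose t = (n + 1).choose (t + 1) * (t + 1) := Nat.add_one_mul_choose_eq n t
    rw [hn]
    have h2 : (s * t).choose t ≤ n.choose t := by
      apply Nat.choose_le_choose
      have : s * (t + 1) = s * t + s := by ring
      omega
    rw [← hn] at h1
    have h3 : (s * (t + 1)).choose (t + 1) = s * n.choose t := by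
      apply Nat.eq_of_mul_eq_mul_right (Nat.succ_pos t)
      rw [Nat.succ_eq_add_one, ← h1]; ring
    rw [← hn, h3, pow_succ, mul_comm]
    exact Nat.mul_le_mul_left _ (ih.trans h2)

open Classical in
lemma depth_eq_sum (S : Finset (Set X)) (Q : Set X) (x : X) :
    depth S Q x = ∑ R ∈ S.filter (· ⊂ Q), R.indicator (fun _ => 1) x := by
  rw [depth, Finset.card_eq_sum_ones, ← Finset.filter_filter, Finset.sum_filter]
  rfl

variable [MeasurableSpace X] {μ : Measure X}

open Classical in
/-- A finite laminar family of sets of positive and finite measure satisfying the Carleson packing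
condition with constant `Λ`. -/
structure IsCarleson (μ : Measure X) (S : Finset (Set X)) (Λ : ℕ) : Prop where
  laminar : IsLaminar S
  measurable : ∀ Q ∈ S, MeasurableSet Q
  ne_zero : ∀ Q ∈ S, μ Q ≠ 0
  ne_top : ∀ Q ∈ S, μ Q ≠ ∞
  packing : ∀ Q ∈ S, ∑ R ∈ S.filter (· ⊆ Q), μ R ≤ Λ * μ Q

open Classical in
lemma IsCarleson.mono {S S' : Finset (Set X)} {Λ : ℕ} (h : IsCarleson μ S Λ) (hS : S' ⊆ S) :
    IsCarleson μ S' Λ where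
  laminar P hP R hR := h.laminar P (hS hP) R (hS hR)
  measurable Q hQ := h.measurable Q (hS hQ)
  ne_zero Q hQ := h.ne_zero Q (hS hQ)
  ne_top Q hQ := h.ne_top Q (hS hQ)
  packing Q hQ := (Finset.sum_le_sum_of_subset (Finset.filter_subset_filter _ hS)).trans
    (h.packing Q (hS hQ))

lemma measurable_depth {S : Finset (Set X)} (hS : ∀ Q ∈ S, MeasurableSet Q) (Q : Set X) :
    Measurable (depth S Q) := by
  classical
  have : depth S Q = fun x => ∑ R ∈ S.filter (· ⊂ Q), R.indicator (fun _ => 1) x :=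
    funext fun x => depth_eq_sum S Q x
  rw [this]
  exact Finset.measurable_sum _ fun R hR =>
    measurable_const.indicator (hS R (Finset.mem_filter.1 hR).1)

lemma measurableSet_deep {S : Finset (Set X)} (hS : ∀ Q ∈ S, MeasurableSet Q) {Q : Set X}
    (hQ : MeasurableSet Q) (t : ℕ) : MeasurableSet (deep S Q t) :=
  hQ.inter (measurable_depth hS Q (measurableSet_Ici (a := t)))

-- Binomial moments iterate the packing condition exactly: the hockey-stick identity along the chain
-- of members through a point writes `C(depth of Q, t+1)` as the sum of `C(depth of R, t)` over the
-- members `R` strictly inside `Q`, so each order costs one factor `Λ`.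
open Classical in
lemma IsCarleson.lintegral_choose_depth_le {S : Finset (Set X)} {Λ : ℕ} (h : IsCarleson μ S Λ)
    (t : ℕ) : ∀ Q ∈ S, ∫⁻ x in Q, ((depth S Q x).choose t : ℝ≥0∞) ∂μ ≤ Λ ^ t * μ Q := by
  induction t with
  | zero => intro Q hQ; simp
  | succ t ih =>
    intro Q hQ
    have hpt : ∀ x, ((depth S Q x).choose (t + 1) : ℝ≥0∞) =
        ∑ R ∈ S.filter (· ⊂ Q), R.indicator (fun x => ((depth S R x).choose t : ℝ≥0∞)) x := by
      intro x
      rw [← sum_range_choose_eq, Nat.cast_sum,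
        ← h.laminar.sum_depth_below Q x (fun i => ((i.choose t : ℕ) : ℝ≥0∞)),
        ← Finset.filter_filter, Finset.sum_filter]
      rfl
    have hm : ∀ R : Set X, Measurable fun x => ((depth S R x).choose t : ℝ≥0∞) := fun R =>
      (measurable_from_nat (f := fun k : ℕ => ((k.choose t : ℕ) : ℝ≥0∞))).comp
        (measurable_depth h.measurable R)
    simp_rw [hpt]
    rw [lintegral_finsetSum _ fun R hR =>
      (hm R).indicator (h.measurable R (Finset.mem_filter.1 hR).1)]
    calc ∑ R ∈ S.filter (· ⊂ Q),
          ∫⁻ x in Q, R.indicator (fun x => ((depth S R x).choose t : ℝ≥0∞)) x ∂μ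
        ≤ ∑ R ∈ S.filter (· ⊂ Q), Λ ^ t * μ R := by
          refine Finset.sum_le_sum fun R hR => ?_
          have hR' := (Finset.mem_filter.1 hR)
          rw [lintegral_indicator (h.measurable R hR'.1)]
          refine le_trans (lintegral_mono' ?_ le_rfl) (ih R hR'.1)
          rw [Measure.restrict_restrict (h.measurable R hR'.1)]
          exact Measure.restrict_mono inter_subset_left le_rfl
      _ ≤ Λ ^ t * ∑ R ∈ S.filter (· ⊆ Q), μ R := by
          rw [← Finset.mul_sum]
          gcongr with R
          exact fun h => h.subset
      _ ≤ Λ ^ t * (Λ * μ Q) := by gcongr; exact h.packing Q hQ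
      _ = Λ ^ (t + 1) * μ Q := by rw [pow_succ, mul_assoc]

/-- Exponential decay of the measure of the deep part of a member of a Carleson family. -/
lemma IsCarleson.measure_deep_le {S : Finset (Set X)} {Λ : ℕ} (h : IsCarleson μ S Λ) (hΛ : 1 ≤ Λ)
    {Q : Set X} (hQ : Q ∈ S) (t : ℕ) : 4 ^ t * μ (deep S Q (4 * Λ * t)) ≤ μ Q := by
  have h1 := h.lintegral_choose_depth_le t Q hQ
  -- Chebyshev's inequality for the binomial moment of order `t`: at depth at least `4Λt` the
  -- binomial coefficient is at least `(4Λ)^t`.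
  have h2 : ((4 * Λ : ℕ) : ℝ≥0∞) ^ t * μ (deep S Q (4 * Λ * t)) ≤
      ∫⁻ x in Q, ((depth S Q x).choose t : ℝ≥0∞) ∂μ := by
    calc _ = ∫⁻ x in deep S Q (4 * Λ * t), ((4 * Λ : ℕ) : ℝ≥0∞) ^ t ∂μ := by
          rw [setLIntegral_const]
      _ ≤ ∫⁻ x in deep S Q (4 * Λ * t), ((depth S Q x).choose t : ℝ≥0∞) ∂μ := by
          refine setLIntegral_mono' (measurableSet_deep h.measurable (h.measurable Q hQ) _) ?_
          intro x hx
          have := (pow_le_choose_mul (4 * Λ) t (by omega)).trans (Nat.choose_le_choose t hx.2)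
          exact_mod_cast this
      _ ≤ _ := lintegral_mono' (Measure.restrict_mono (deep_subset _ _ _) le_rfl) le_rfl
  have h3 := h2.trans h1
  have hL : ((Λ : ℝ≥0∞) ^ t) ≠ 0 := by
    apply pow_ne_zero; exact_mod_cast (by omega : Λ ≠ 0)
  have hL' : ((Λ : ℝ≥0∞) ^ t) ≠ ∞ := ENNReal.pow_ne_top (ENNReal.natCast_ne_top _)
  rw [← ENNReal.mul_le_mul_iff_right hL hL']
  calc _ = ((4 * Λ : ℕ) : ℝ≥0∞) ^ t * μ (deep S Q (4 * Λ * t)) := by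
        push_cast; rw [mul_pow]; ring
    _ ≤ _ := h3

open Classical in
/-- The overlap estimate for the shallow parts of the members of a laminar family. -/
lemma IsLaminar.sum_shallow_le {S : Finset (Set X)} (hS : IsLaminar S)
    (hm : ∀ Q ∈ S, MeasurableSet Q) (w : X → ℝ≥0∞) (E : Set X)
    (c : Set X → ℝ≥0∞) (n : Set X → ℕ) (D : ℕ → ℝ≥0∞)
    (hD : ∀ Q ∈ S, ∀ i < n Q, c Q ≤ D i) :
    ∑ Q ∈ S, c Q * ∫⁻ x in E ∩ (Q \ deep S Q (n Q)), w x ∂μ ≤ (∑' i, D i) * ∫⁻ x in E, w x ∂μ := by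
  have hms : ∀ Q ∈ S, MeasurableSet (Q \ deep S Q (n Q)) := fun Q hQ =>
    (hm Q hQ).diff (measurableSet_deep hm (hm Q hQ) _)
  set ν := (μ.restrict E).withDensity w with hν
  -- The members through `x` have the distinct depths `0, 1, 2, ...` there, and a member whose
  -- shallow part contains `x` has depth below `n Q`, so it can be charged to the value of `D` at
  -- its depth.
  have key : ∀ x, ∑ Q ∈ S, (Q \ deep S Q (n Q)).indicator (fun _ => c Q) x ≤ ∑' i, D i := by
    intro x
    calc ∑ Q ∈ S, (Q \ deep S Q (n Q)).indicator (fun _ => c Q) x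
        ≤ ∑ Q ∈ S.filter (fun Q => x ∈ Q), D (depth S Q x) := by
          rw [Finset.sum_filter]
          refine Finset.sum_le_sum fun Q hQ => ?_
          by_cases hx : x ∈ Q \ deep S Q (n Q)
          · rw [indicator_of_mem hx, if_pos hx.1]
            apply hD Q hQ
            by_contra hlt
            exact hx.2 ⟨hx.1, not_lt.1 hlt⟩
          · rw [indicator_of_notMem hx]; exact zero_le
      _ ≤ _ := by
          rw [hS.sum_depth]
          exact ENNReal.sum_le_tsum _
  calc ∑ Q ∈ S, c Q * ∫⁻ x in E ∩ (Q \ deep S Q (n Q)), w x ∂μ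
      = ∑ Q ∈ S, ∫⁻ x, (Q \ deep S Q (n Q)).indicator (fun _ => c Q) x ∂ν := by
        refine Finset.sum_congr rfl fun Q hQ => ?_
        rw [lintegral_indicator (hms Q hQ), setLIntegral_const, hν,
          withDensity_apply _ (hms Q hQ), Measure.restrict_restrict (hms Q hQ), inter_comm]
    _ = ∫⁻ x, ∑ Q ∈ S, (Q \ deep S Q (n Q)).indicator (fun _ => c Q) x ∂ν := by
        rw [lintegral_finsetSum]
        exact fun Q hQ => measurable_const.indicator (hms Q hQ)
    _ ≤ ∫⁻ x, ∑' i, D i ∂ν := lintegral_mono key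
    _ = _ := by
        rw [lintegral_const, hν, withDensity_apply _ MeasurableSet.univ, Measure.restrict_univ]

/-- On a layer of a Carleson family, in which all averages of `h` are comparable to `A`, the
averages are controlled by a sum of boundedly overlapping integrals. -/
lemma IsCarleson.sum_layer_le {S : Finset (Set X)} {Λ : ℕ} (hS : IsCarleson μ S Λ) (hΛ : 1 ≤ Λ)
    {h w : X → ℝ≥0∞} (hh : Measurable h) (hw : Measurable w) (A : ℝ≥0∞) (hA : A ≠ ∞)
    (Y : Set X → ℝ≥0∞) (B : ℝ≥0∞)
    (h1 : ∀ Q ∈ S, ∫⁻ x in Q, h x ∂μ ≤ A * μ Q)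
    (h2 : ∀ Q ∈ S, A * μ Q ≤ 2 * ∫⁻ x in Q, h x ∂μ)
    (hY : ∀ Q ∈ S, ∀ᵐ x ∂μ.restrict Q, Y Q ≤ B * w x) :
    ∑ Q ∈ S, Y Q * ∫⁻ x in Q, h x ∂μ ≤ 8 * Λ * (B * ∫⁻ x, h x * w x ∂μ) := by
  classical
  set m := 4 * Λ with hm
  have hmeas : ∀ Q ∈ S, MeasurableSet (deep S Q m) := fun Q hQ =>
    measurableSet_deep hS.measurable (hS.measurable Q hQ) _
  -- The deep part carries at most half of `∫_Q h`: the depth is at least `4Λ` there, whereas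
  -- packing bounds the integral of `depth · h` over `Q` by `Λ A μ(Q) ≤ 2Λ ∫_Q h`.
  have hdeep : ∀ Q ∈ S, ∫⁻ x in Q, h x ∂μ ≤ 2 * ∫⁻ x in Q \ deep S Q m, h x ∂μ := by
    intro Q hQ
    have hfin : ∫⁻ x in Q, h x ∂μ ≠ ∞ :=
      ne_top_of_le_ne_top (ENNReal.mul_ne_top hA (hS.ne_top Q hQ)) (h1 Q hQ)
    have e1 : (m : ℝ≥0∞) * ∫⁻ x in deep S Q m, h x ∂μ ≤ Λ * (A * μ Q) := by
      calc (m : ℝ≥0∞) * ∫⁻ x in deep S Q m, h x ∂μ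
          = ∫⁻ x in deep S Q m, m * h x ∂μ := (lintegral_const_mul _ hh).symm
        _ ≤ ∫⁻ x in deep S Q m, depth S Q x * h x ∂μ := by
            refine setLIntegral_mono' (hmeas Q hQ) fun x hx => ?_
            gcongr
            exact hx.2
        _ ≤ ∫⁻ x in Q, depth S Q x * h x ∂μ :=
            lintegral_mono' (Measure.restrict_mono (deep_subset _ _ _) le_rfl) le_rfl
        _ = ∫⁻ x in Q, ∑ R ∈ S.filter (· ⊂ Q), R.indicator h x ∂μ := by
            refine lintegral_congr fun x => ?_
            rw [depth_eq_sum, Nat.cast_sum, Finset.sum_mul]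
            refine Finset.sum_congr rfl fun R hR => ?_
            by_cases hx : x ∈ R <;> simp [hx]
        _ = ∑ R ∈ S.filter (· ⊂ Q), ∫⁻ x in Q, R.indicator h x ∂μ :=
            lintegral_finsetSum _ fun R hR =>
              hh.indicator (hS.measurable R (Finset.mem_filter.1 hR).1)
        _ ≤ ∑ R ∈ S.filter (· ⊂ Q), A * μ R := by
            refine Finset.sum_le_sum fun R hR => ?_
            have hR' := Finset.mem_filter.1 hR
            rw [lintegral_indicator (hS.measurable R hR'.1)]
            refine le_trans (lintegral_mono' ?_ le_rfl) (h1 R hR'.1)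
            rw [Measure.restrict_restrict (hS.measurable R hR'.1)]
            exact Measure.restrict_mono inter_subset_left le_rfl
        _ ≤ A * ∑ R ∈ S.filter (· ⊆ Q), μ R := by
            rw [← Finset.mul_sum]
            gcongr with R
            exact fun h => h.subset
        _ ≤ A * (Λ * μ Q) := by gcongr; exact hS.packing Q hQ
        _ = _ := by ring
    have e2 : 2 * ∫⁻ x in deep S Q m, h x ∂μ ≤ ∫⁻ x in Q, h x ∂μ := by
      have hL : (2 * Λ : ℝ≥0∞) ≠ 0 :=
        mul_ne_zero two_ne_zero (by exact_mod_cast (by omega : Λ ≠ 0))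
      have hL' : (2 * Λ : ℝ≥0∞) ≠ ∞ := ENNReal.mul_ne_top ENNReal.ofNat_ne_top (ENNReal.natCast_ne_top _)
      rw [← ENNReal.mul_le_mul_iff_right hL hL']
      calc 2 * (Λ : ℝ≥0∞) * (2 * ∫⁻ x in deep S Q m, h x ∂μ)
          = (m : ℝ≥0∞) * ∫⁻ x in deep S Q m, h x ∂μ := by rw [hm]; push_cast; ring
        _ ≤ Λ * (A * μ Q) := e1
        _ ≤ Λ * (2 * ∫⁻ x in Q, h x ∂μ) := mul_le_mul_right (h2 Q hQ) _
        _ = _ := by ring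
    have e3 : ∫⁻ x in Q, h x ∂μ = ∫⁻ x in deep S Q m, h x ∂μ + ∫⁻ x in Q \ deep S Q m, h x ∂μ := by
      rw [← lintegral_inter_add_sdiff (μ := μ) h Q (hmeas Q hQ),
        inter_eq_self_of_subset_right (deep_subset _ _ _)]
    have e4 : ∫⁻ x in deep S Q m, h x ∂μ ≤ ∫⁻ x in Q \ deep S Q m, h x ∂μ := by
      have hf : ∫⁻ x in deep S Q m, h x ∂μ ≠ ∞ := ne_top_of_le_ne_top hfin (by
        rw [e3]; exact le_self_add)
      rw [e3, two_mul] at e2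
      exact (ENNReal.add_le_add_iff_left hf).1 e2
    calc _ = ∫⁻ x in deep S Q m, h x ∂μ + ∫⁻ x in Q \ deep S Q m, h x ∂μ := e3
      _ ≤ _ := by rw [two_mul]; gcongr
  -- Passing to shallow parts costs a factor `2`; there `Y Q ≤ B w` moves the weight under the
  -- integral, and the overlap of the shallow parts is at most `4Λ`.
  calc ∑ Q ∈ S, Y Q * ∫⁻ x in Q, h x ∂μ
      ≤ ∑ Q ∈ S, (2 * B) * ∫⁻ x in univ ∩ (Q \ deep S Q m), h x * w x ∂μ := by
        refine Finset.sum_le_sum fun Q hQ => ?_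
        rw [univ_inter]
        calc Y Q * ∫⁻ x in Q, h x ∂μ ≤ Y Q * (2 * ∫⁻ x in Q \ deep S Q m, h x ∂μ) := by
              gcongr; exact hdeep Q hQ
          _ = 2 * ∫⁻ x in Q \ deep S Q m, Y Q * h x ∂μ := by
              rw [lintegral_const_mul _ hh]; ring
          _ ≤ 2 * ∫⁻ x in Q \ deep S Q m, B * (h x * w x) ∂μ := by
              gcongr 2 * ?_
              refine lintegral_mono_ae ?_
              have := ae_restrict_of_ae_restrict_of_subset (sdiff_subset (t := deep S Q m)) (hY Q hQ)
              filter_upwards [this] with x hx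
              calc Y Q * h x ≤ B * w x * h x := by gcongr
                _ = _ := by ring
          _ = _ := by rw [lintegral_const_mul B (f := fun x => h x * w x) (hh.mul hw)]; ring
    _ ≤ (∑' i : ℕ, if i < m then 2 * B else 0) * ∫⁻ x in univ, h x * w x ∂μ := by
        refine hS.laminar.sum_shallow_le hS.measurable _ univ (fun _ => 2 * B) (fun _ => m) _ ?_
        intro Q hQ i hi
        rw [if_pos hi]
    _ = _ := by
        rw [tsum_eq_sum (s := Finset.range m) (fun i hi => by
          rw [if_neg (by simpa using hi)]), Finset.sum_congr rfl (fun i hi => by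
          rw [if_pos (by simpa using hi)]), Finset.sum_const, Finset.card_range,
          Measure.restrict_univ, hm]
        simp only [nsmul_eq_mul]
        push_cast; ring

/-- Summation of `IsCarleson.sum_layer_le` over all layers. -/
lemma IsCarleson.sum_layers_le {S : Finset (Set X)} {Λ : ℕ} (hS : IsCarleson μ S Λ) (hΛ : 1 ≤ Λ)
    {h w : X → ℝ≥0∞} (hh : Measurable h) (hw : Measurable w) (k : Set X → ℕ)
    (Y : Set X → ℝ≥0∞) (B : ℝ≥0∞) (c : ℕ → ℝ≥0∞)
    (h1 : ∀ Q ∈ S, ∫⁻ x in Q, h x ∂μ ≤ 2⁻¹ ^ k Q * μ Q)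
    (h2 : ∀ Q ∈ S, 2⁻¹ ^ k Q * μ Q ≤ 2 * ∫⁻ x in Q, h x ∂μ)
    (hY : ∀ Q ∈ S, ∀ᵐ x ∂μ.restrict Q, Y Q ≤ B * w x) :
    ∑ Q ∈ S, c (k Q) * (Y Q * ∫⁻ x in Q, h x ∂μ) ≤
      8 * Λ * ((∑' i, c i) * (B * ∫⁻ x, h x * w x ∂μ)) := by
  classical
  rw [← Finset.sum_fiberwise_of_maps_to (fun Q hQ => Finset.mem_image_of_mem k hQ)]
  calc _ ≤ ∑ i ∈ S.image k, c i * (8 * Λ * (B * ∫⁻ x, h x * w x ∂μ)) := by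
        refine Finset.sum_le_sum fun i _ => ?_
        have := (hS.mono (Finset.filter_subset (fun Q => k Q = i) S)).sum_layer_le hΛ hh hw
          (2⁻¹ ^ i) (ENNReal.pow_ne_top (by simp)) Y B
          (fun Q hQ => by
            have := Finset.mem_filter.1 hQ
            rw [← this.2]; exact h1 Q this.1)
          (fun Q hQ => by
            have := Finset.mem_filter.1 hQ
            rw [← this.2]; exact h2 Q this.1)
          (fun Q hQ => hY Q (Finset.mem_filter.1 hQ).1)
        refine le_trans (le_of_eq ?_) (mul_le_mul_right this (c i))
        rw [Finset.mul_sum]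
        refine Finset.sum_congr rfl fun Q hQ => ?_
        rw [(Finset.mem_filter.1 hQ).2]
    _ = (∑ i ∈ S.image k, c i) * (8 * Λ * (B * ∫⁻ x, h x * w x ∂μ)) := by rw [Finset.sum_mul]
    _ ≤ (∑' i, c i) * (8 * Λ * (B * ∫⁻ x, h x * w x ∂μ)) := by
        gcongr; exact ENNReal.sum_le_tsum _
    _ = _ := by ring

end Laminar

/-! ### Numerical series and decay rates -/

lemma tsum_comp_div (f : ℕ → ℝ≥0∞) (N : ℕ) (hN : N ≠ 0) : ∑' i, f (i / N) = N * ∑' l, f l := by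
  have : NeZero N := ⟨hN⟩
  rw [← (Nat.divModEquiv N).symm.tsum_eq fun i => f (i / N), ENNReal.tsum_prod',
    ← ENNReal.tsum_mul_left]
  refine tsum_congr fun l => ?_
  have : ∀ b : Fin N, f ((Nat.divModEquiv N).symm (l, b) / N) = f l := by
    intro b
    congr 1
    have h1 := (Nat.divModEquiv N).apply_symm_apply (l, b)
    have h2 := congrArg Prod.fst h1
    simpa using h2
  simp_rw [this]
  simp

/-- A weighted form of the inequality between geometric and arithmetic means. -/
lemma rpow_mul_rpow_le_add (a b M : ℝ≥0∞) (hM : M ≠ 0) (hM' : M ≠ ∞) {g : ℝ} (hg : 0 ≤ g)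
    (hg1 : g ≤ 1) : a ^ g * b ^ (1 - g) ≤ M ^ (1 - g) * a + M ^ (-g) * b := by
  have h1 : 0 ≤ 1 - g := by linarith
  have e : a ^ g * b ^ (1 - g) = (M ^ (1 - g) * a) ^ g * (M ^ (-g) * b) ^ (1 - g) := by
    rw [ENNReal.mul_rpow_of_nonneg _ _ hg, ENNReal.mul_rpow_of_nonneg _ _ h1, ← ENNReal.rpow_mul,
      ← ENNReal.rpow_mul]
    have : M ^ ((1 - g) * g) * M ^ (-g * (1 - g)) = 1 := by
      rw [← ENNReal.rpow_add _ _ hM hM', show (1 - g) * g + -g * (1 - g) = 0 by ring,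
        ENNReal.rpow_zero]
    calc a ^ g * b ^ (1 - g) = (M ^ ((1 - g) * g) * M ^ (-g * (1 - g))) * (a ^ g * b ^ (1 - g)) := by
          rw [this, one_mul]
      _ = _ := by ring
  rw [e]
  set u := M ^ (1 - g) * a
  set v := M ^ (-g) * b
  calc u ^ g * v ^ (1 - g) ≤ (u + v) ^ g * (u + v) ^ (1 - g) := by
        gcongr
        · exact le_self_add
        · exact le_add_self
    _ = u + v := by
        rw [← ENNReal.rpow_add_of_nonneg _ _ hg h1]; simp

lemma one_sub_inv_eq_ofReal {K : ℕ} (hK : 2 ≤ K) :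
    (1 - (K : ℝ≥0∞)⁻¹) = ENNReal.ofReal (1 - 1 / K) := by
  have : (0 : ℝ) < K := by exact_mod_cast (by omega : 0 < K)
  rw [ENNReal.ofReal_sub _ (by positivity), ENNReal.ofReal_one, one_div,
    ENNReal.ofReal_inv_of_pos this, ENNReal.ofReal_natCast]

/-- Gaining a factor `2` at the rate `1 - 1/K` takes `K` steps; this makes the number of generations
to be skipped linear in the `A_∞` constant. -/
lemma one_sub_inv_pow_le {K : ℕ} (hK : 2 ≤ K) : (1 - (K : ℝ≥0∞)⁻¹) ^ K ≤ 2⁻¹ := by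
  have hK0 : (0 : ℝ) < K := by exact_mod_cast (by omega : 0 < K)
  have h2 : (2 : ℝ) ≤ K := by exact_mod_cast hK
  have h0 : (0 : ℝ) ≤ 1 - 1 / K := by
    rw [sub_nonneg, div_le_one hK0]; linarith
  rw [one_sub_inv_eq_ofReal hK, ← ENNReal.ofReal_pow h0]
  have h1 : (1 - 1 / K : ℝ) ≤ Real.exp (-(1 / K)) := Real.one_sub_le_exp_neg _
  have h3 : (1 - 1 / K : ℝ) ^ K ≤ Real.exp (-1) := by
    calc (1 - 1 / K : ℝ) ^ K ≤ Real.exp (-(1 / K)) ^ K := by gcongr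
      _ = Real.exp (-1) := by
          rw [← Real.exp_nat_mul]; congr 1; field_simp
  have h4 : Real.exp (-1) ≤ 2⁻¹ := by
    rw [Real.exp_neg]
    gcongr
    have := Real.add_one_le_exp (1 : ℝ)
    linarith
  calc ENNReal.ofReal ((1 - 1 / K : ℝ) ^ K) ≤ ENNReal.ofReal 2⁻¹ :=
        ENNReal.ofReal_le_ofReal (h3.trans h4)
    _ = 2⁻¹ := by rw [ENNReal.ofReal_inv_of_pos two_pos]; simp

lemma inv_two_le_one_sub_inv {K : ℕ} (hK : 2 ≤ K) : 2⁻¹ ≤ (1 - (K : ℝ≥0∞)⁻¹) := by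
  have : (K : ℝ≥0∞)⁻¹ ≤ 2⁻¹ := by
    apply ENNReal.inv_le_inv.2; exact_mod_cast hK
  calc (2⁻¹ : ℝ≥0∞) = 1 - 2⁻¹ := ENNReal.one_sub_inv_two.symm
    _ ≤ _ := tsub_le_tsub_left this 1

lemma inv_four_eq : (4⁻¹ : ℝ≥0∞) = 2⁻¹ * 2⁻¹ := by
  rw [← ENNReal.mul_inv (by simp) (by simp)]; norm_num

lemma two_mul_inv_two_pow_succ (k : ℕ) : (2 : ℝ≥0∞) * 2⁻¹ ^ (k + 1) = 2⁻¹ ^ k := by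
  rw [pow_succ, mul_comm, mul_assoc, ENNReal.inv_mul_cancel (by simp) (by simp), mul_one]

/-- Bounds the total coefficient of `∫ h w`. Past the threshold the growth `(2a)^i` of the layer
coefficients is at most `2^i` beyond its value at `k₀`, so the decay `4^(-(i-k₀+1))` of the deep
parts makes the tail comparable to the single term at `k₀`. -/
lemma tsum_layer_coeff_le (C : ℝ≥0∞) {a : ℝ≥0∞} (ha1 : a ≤ 1) (k₀ : ℕ) :
    (∑' i : ℕ, if i < k₀ then 2 * C * (2 * a) ^ i else
      2 * C * (2 * (2 * a) ^ i * 4⁻¹ ^ (i - k₀ + 1))) ≤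
      4 * C * ∑ i ∈ Finset.range (k₀ + 1), (2 * a) ^ i := by
  have h := Summable.sum_add_tsum_nat_add' (k := k₀) (f := fun i : ℕ =>
    if i < k₀ then 2 * C * (2 * a) ^ i else 2 * C * (2 * (2 * a) ^ i * 4⁻¹ ^ (i - k₀ + 1)))
    ENNReal.summable
  rw [← h]
  have t1 : ∑ i ∈ Finset.range k₀, (if i < k₀ then 2 * C * (2 * a) ^ i else
      2 * C * (2 * (2 * a) ^ i * 4⁻¹ ^ (i - k₀ + 1))) =
      2 * C * ∑ i ∈ Finset.range k₀, (2 * a) ^ i := by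
    rw [Finset.mul_sum]
    exact Finset.sum_congr rfl fun i hi => if_pos (Finset.mem_range.1 hi)
  have t2 : (∑' i : ℕ, if i + k₀ < k₀ then 2 * C * (2 * a) ^ (i + k₀) else
      2 * C * (2 * (2 * a) ^ (i + k₀) * 4⁻¹ ^ (i + k₀ - k₀ + 1))) ≤
      4 * C * (2 * a) ^ k₀ := by
    calc _ ≤ ∑' i : ℕ, 4 * C * (2 * a) ^ k₀ * 2⁻¹ ^ (i + 1) := by
          refine ENNReal.tsum_le_tsum fun i => ?_
          rw [if_neg (by omega), Nat.add_sub_cancel]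
          calc 2 * C * (2 * (2 * a) ^ (i + k₀) * 4⁻¹ ^ (i + 1))
              = 4 * C * (2 * a) ^ k₀ * ((2 * a) ^ i * 4⁻¹ ^ (i + 1)) := by
                rw [pow_add]; ring
            _ ≤ 4 * C * (2 * a) ^ k₀ * (2 ^ (i + 1) * 4⁻¹ ^ (i + 1)) := by
                refine mul_le_mul_right (mul_le_mul_left ?_ _) _
                calc (2 * a) ^ i ≤ (2 * 1) ^ i := by gcongr
                  _ = 2 ^ i * 1 := by simp
                  _ ≤ 2 ^ i * 2 := by gcongr; norm_num
                  _ = 2 ^ (i + 1) := by rw [pow_succ]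
            _ = _ := by
                rw [← mul_pow, inv_four_eq, ← mul_assoc (2 : ℝ≥0∞) 2⁻¹,
                  ENNReal.mul_inv_cancel (by simp) (by simp), one_mul]
      _ = _ := by
          rw [ENNReal.tsum_mul_left, ENNReal.tsum_geometric_add_one, ENNReal.one_sub_inv_two,
            inv_inv, ENNReal.inv_mul_cancel (by simp) (by simp), mul_one]
  calc _ ≤ 4 * C * ∑ i ∈ Finset.range k₀, (2 * a) ^ i + 4 * C * (2 * a) ^ k₀ := by
        rw [t1]
        gcongr
        norm_num
    _ = _ := by rw [Finset.sum_range_succ, mul_add]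

/-! ### Core estimates for one Carleson family -/

variable {X : Type*} [MeasurableSpace X] {μ : Measure X}

/-- Decay of a weight with the `A_∞`-type property `hW` on the deep parts of a Carleson family. -/
lemma IsCarleson.weight_deep_le {S : Finset (Set X)} {Λ : ℕ} (hS : IsCarleson μ S Λ) (hΛ : 1 ≤ Λ)
    {w : X → ℝ≥0∞} {K : ℕ} (hK : 2 ≤ K) {C : ℝ≥0∞} {lam : Set X → ℝ≥0∞}
    (hW : ∀ Q ∈ S, ∀ t : ℕ, ∃ G ⊆ Q, MeasurableSet G ∧
      ∫⁻ x in G, w x ∂μ ≤ C * ((1 - (K : ℝ≥0∞)⁻¹) ^ t * (lam Q * μ Q)) ∧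
      ∀ᵐ x ∂μ.restrict Q, x ∉ G → w x ≤ C * (2 ^ t * lam Q))
    {Q : Set X} (hQ : Q ∈ S) (t : ℕ) :
    ∫⁻ x in deep S Q (4 * Λ * t), w x ∂μ ≤
      2 * C * ((1 - (K : ℝ≥0∞)⁻¹) ^ t * (lam Q * μ Q)) := by
  obtain ⟨G, hGQ, hGm, hG1, hG2⟩ := hW Q hQ t
  set U := deep S Q (4 * Λ * t) with hU
  have hUm : MeasurableSet U := measurableSet_deep hS.measurable (hS.measurable Q hQ) _
  have hUμ : μ U ≤ 4⁻¹ ^ t * μ Q := by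
    have := hS.measure_deep_le hΛ hQ t
    rw [← ENNReal.inv_pow, mul_comm, ← div_eq_mul_inv, ENNReal.le_div_iff_mul_le (by simp)
      (by simp), mul_comm]
    exact this
  rw [← lintegral_inter_add_sdiff (μ := μ) w U hGm]
  -- On `G` the weight is small by assumption. Off `G` the bound `2^t lam` meets the measure `4^(-t)
  -- μ(Q)` of the deep part, which leaves `2^(-t) ≤ (1 - 1/K)^t`.
  have e1 : ∫⁻ x in U ∩ G, w x ∂μ ≤ C * ((1 - (K : ℝ≥0∞)⁻¹) ^ t * (lam Q * μ Q)) :=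
    (lintegral_mono' (Measure.restrict_mono inter_subset_right le_rfl) le_rfl).trans hG1
  have e2 : ∫⁻ x in U \ G, w x ∂μ ≤ C * ((1 - (K : ℝ≥0∞)⁻¹) ^ t * (lam Q * μ Q)) := by
    calc ∫⁻ x in U \ G, w x ∂μ ≤ ∫⁻ x in U \ G, C * (2 ^ t * lam Q) ∂μ := by
          refine lintegral_mono_ae ?_
          have h1 : U \ G ⊆ Q := sdiff_subset.trans (deep_subset _ _ _)
          filter_upwards [ae_restrict_of_ae_restrict_of_subset h1 hG2,
            ae_restrict_mem (hUm.diff hGm)] with x hx hx2 using hx hx2.2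
      _ = C * (2 ^ t * lam Q) * μ (U \ G) := by rw [setLIntegral_const]
      _ ≤ C * (2 ^ t * lam Q) * (4⁻¹ ^ t * μ Q) := by
          gcongr; exact (measure_mono sdiff_subset).trans hUμ
      _ = C * ((2 ^ t * 4⁻¹ ^ t) * (lam Q * μ Q)) := by ring
      _ ≤ _ := by
          gcongr
          rw [← mul_pow]
          gcongr
          rw [inv_four_eq, ← mul_assoc, ENNReal.mul_inv_cancel (by simp) (by simp), one_mul]
          exact inv_two_le_one_sub_inv hK
  calc _ ≤ _ := add_le_add e1 e2
    _ = _ := by ring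

/-- The core estimate for a sparse form in a single grid in the case `q₀ = ∞`. -/
lemma IsCarleson.sum_weight_le {S : Finset (Set X)} {Λ : ℕ} (hS : IsCarleson μ S Λ) (hΛ : 1 ≤ Λ)
    {h w : X → ℝ≥0∞} (hh : Measurable h) (hw : Measurable w) (k : Set X → ℕ)
    (h1 : ∀ Q ∈ S, ∫⁻ x in Q, h x ∂μ ≤ 2⁻¹ ^ k Q * μ Q)
    (h2 : ∀ Q ∈ S, 2⁻¹ ^ k Q * μ Q ≤ 2 * ∫⁻ x in Q, h x ∂μ)
    {K : ℕ} (hK : 2 ≤ K) {C B : ℝ≥0∞} {lam : Set X → ℝ≥0∞}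
    (hT : ∀ Q ∈ S, ∫⁻ x in Q, w x ∂μ ≤ C * (lam Q * μ Q))
    (hW : ∀ Q ∈ S, ∀ t : ℕ, ∃ G ⊆ Q, MeasurableSet G ∧
      ∫⁻ x in G, w x ∂μ ≤ C * ((1 - (K : ℝ≥0∞)⁻¹) ^ t * (lam Q * μ Q)) ∧
      ∀ᵐ x ∂μ.restrict Q, x ∉ G → w x ≤ C * (2 ^ t * lam Q))
    (hB : ∀ Q ∈ S, ∀ᵐ x ∂μ.restrict Q, lam Q ≤ B * w x)
    {E : Set X} (a : ℝ≥0∞) (ha1 : a ≤ 1) (k₀ : ℕ) :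
    ∑ Q ∈ S, a ^ k Q * ∫⁻ x in E ∩ Q, w x ∂μ ≤
      a ^ k₀ * (8 * Λ * K) * (1 - a)⁻¹ * ∫⁻ x in E, w x ∂μ +
      32 * Λ * C * (∑ i ∈ Finset.range (k₀ + 1), (2 * a) ^ i) * (B * ∫⁻ x, h x * w x ∂μ) := by
  classical
  -- Inside a layer, measure is traded for the integral of `h` at the price `2^k`.
  have h2' : ∀ Q ∈ S, a ^ k Q * μ Q ≤ 2 * (2 * a) ^ k Q * ∫⁻ x in Q, h x ∂μ := fun Q hQ => by
    calc a ^ k Q * μ Q = (2 * a) ^ k Q * (2⁻¹ ^ k Q * μ Q) := by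
          rw [← mul_assoc, ← mul_pow, mul_right_comm, ENNReal.mul_inv_cancel (by simp) (by simp),
            one_mul]
      _ ≤ (2 * a) ^ k Q * (2 * ∫⁻ x in Q, h x ∂μ) := mul_le_mul_right (h2 Q hQ) _
      _ = _ := by ring
  set N : ℕ := 4 * Λ * (2 * K) with hN
  have hN0 : N ≠ 0 := by positivity
  -- The deep part decays by `1 - 1/K` per block of `4Λ` generations, so `2K` blocks gain a factor
  -- `4`. The truncated subtraction is harmless: shallow parts enter only in layers `k₀ ≤ k Q`.
  set n : Set X → ℕ := fun Q => 4 * Λ * (2 * K * (k Q - k₀ + 1)) with hn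
  have hdeep : ∀ Q ∈ S, ∫⁻ x in deep S Q (n Q), w x ∂μ ≤
      2 * C * (4⁻¹ ^ (k Q - k₀ + 1) * (lam Q * μ Q)) := by
    intro Q hQ
    refine (hS.weight_deep_le hΛ hK hW hQ _).trans ?_
    refine mul_le_mul_right (mul_le_mul_left ?_ _) _
    rw [pow_mul, mul_comm 2 K, pow_mul, inv_four_eq, ← pow_two]
    exact pow_le_pow_left₀ zero_le (pow_le_pow_left₀ zero_le (one_sub_inv_pow_le hK) _) _
  -- Below the threshold the whole cube is charged to `h`. Above it only the deep part is, and the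
  -- shallow part is left to be charged to `w(E)`.
  have hsplit : ∀ Q ∈ S, a ^ k Q * ∫⁻ x in E ∩ Q, w x ∂μ ≤
      (if k₀ ≤ k Q then a ^ k Q else 0) * ∫⁻ x in E ∩ (Q \ deep S Q (n Q)), w x ∂μ +
      (if k Q < k₀ then 2 * C * (2 * a) ^ k Q else
        2 * C * (2 * (2 * a) ^ k Q * 4⁻¹ ^ (k Q - k₀ + 1))) *
        (lam Q * ∫⁻ x in Q, h x ∂μ) := by
    intro Q hQ
    by_cases hk : k Q < k₀
    · rw [if_neg (by omega), if_pos hk, zero_mul, zero_add]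
      calc a ^ k Q * ∫⁻ x in E ∩ Q, w x ∂μ ≤ a ^ k Q * (C * (lam Q * μ Q)) := by
            gcongr
            exact (lintegral_mono' (Measure.restrict_mono inter_subset_right le_rfl) le_rfl).trans
              (hT Q hQ)
        _ = C * lam Q * (a ^ k Q * μ Q) := by ring
        _ ≤ C * lam Q * (2 * (2 * a) ^ k Q * ∫⁻ x in Q, h x ∂μ) := mul_le_mul_right (h2' Q hQ) _
        _ = _ := by ring
    · rw [if_pos (by omega), if_neg hk]
      have hsub : E ∩ Q ⊆ (E ∩ (Q \ deep S Q (n Q))) ∪ deep S Q (n Q) := by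
        rintro x ⟨hx1, hx2⟩
        by_cases hx : x ∈ deep S Q (n Q)
        · exact Or.inr hx
        · exact Or.inl ⟨hx1, hx2, hx⟩
      calc a ^ k Q * ∫⁻ x in E ∩ Q, w x ∂μ
          ≤ a ^ k Q * (∫⁻ x in E ∩ (Q \ deep S Q (n Q)), w x ∂μ +
            ∫⁻ x in deep S Q (n Q), w x ∂μ) := by
            gcongr
            exact (lintegral_mono_set hsub).trans (lintegral_union_le _ _ _)
        _ ≤ a ^ k Q * (∫⁻ x in E ∩ (Q \ deep S Q (n Q)), w x ∂μ +
            2 * C * (4⁻¹ ^ (k Q - k₀ + 1) * (lam Q * μ Q))) := by gcongr; exact hdeep Q hQ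
        _ = a ^ k Q * ∫⁻ x in E ∩ (Q \ deep S Q (n Q)), w x ∂μ +
            2 * C * (4⁻¹ ^ (k Q - k₀ + 1) * lam Q) * (a ^ k Q * μ Q) := by ring
        _ ≤ a ^ k Q * ∫⁻ x in E ∩ (Q \ deep S Q (n Q)), w x ∂μ +
            2 * C * (4⁻¹ ^ (k Q - k₀ + 1) * lam Q) *
              (2 * (2 * a) ^ k Q * ∫⁻ x in Q, h x ∂μ) :=
            add_le_add le_rfl (mul_le_mul_right (h2' Q hQ) _)
        _ = _ := by ring
  refine (Finset.sum_le_sum hsplit).trans ?_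
  rw [Finset.sum_add_distrib]
  gcongr ?_ + ?_
  -- A cube at depth `i < n Q` has `k Q ≥ k₀ + i / N`, so its coefficient is at most `a^(k₀ + i/N)`;
  -- summation over all depths gives `N a^k₀ / (1 - a)`.
  · refine (hS.laminar.sum_shallow_le hS.measurable w E _ n (fun i => a ^ (k₀ + i / N)) ?_).trans ?_
    · intro Q hQ i hi
      split_ifs with hk
      · apply pow_le_pow_of_le_one zero_le ha1
        have : i / N < k Q - k₀ + 1 := by
          rw [Nat.div_lt_iff_lt_mul (Nat.pos_of_ne_zero hN0)]
          calc i < 4 * Λ * (2 * K * (k Q - k₀ + 1)) := hi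
            _ = (k Q - k₀ + 1) * N := by rw [hN]; ring
        omega
      · exact zero_le
    · rw [tsum_comp_div (fun l => a ^ (k₀ + l)) N hN0]
      simp_rw [pow_add]
      rw [ENNReal.tsum_mul_left, ENNReal.tsum_geometric, hN]
      push_cast
      apply le_of_eq; ring
  · refine (hS.sum_layers_le hΛ hh hw k lam B (fun i => if i < k₀ then 2 * C * (2 * a) ^ i else
        2 * C * (2 * (2 * a) ^ i * 4⁻¹ ^ (i - k₀ + 1))) h1 h2 hB).trans ?_
    have hsum := tsum_layer_coeff_le C ha1 k₀
    calc _ ≤ 8 * (Λ : ℝ≥0∞) * ((4 * C * ∑ i ∈ Finset.range (k₀ + 1), (2 * a) ^ i) *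
          (B * ∫⁻ x, h x * w x ∂μ)) := by gcongr
      _ = _ := by ring

/-- The core estimate for a sparse form in a single grid in the case `q₀ < ∞`. -/
lemma IsCarleson.sum_interpolated_le {S : Finset (Set X)} {Λ : ℕ} (hS : IsCarleson μ S Λ)
    (hΛ : 1 ≤ Λ) {h w : X → ℝ≥0∞} (hh : Measurable h) (hw : Measurable w) (k : Set X → ℕ)
    (h1 : ∀ Q ∈ S, ∫⁻ x in Q, h x ∂μ ≤ 2⁻¹ ^ k Q * μ Q)
    (h2 : ∀ Q ∈ S, 2⁻¹ ^ k Q * μ Q ≤ 2 * ∫⁻ x in Q, h x ∂μ)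
    {C B : ℝ≥0∞} {Y : Set X → ℝ≥0∞} {d : ℕ} (hd : d ≠ 0)
    (hU : ∀ Q ∈ S, ∀ t : ℕ, ∫⁻ x in deep S Q (4 * Λ * (d * t)), w x ∂μ ≤
      C * (4⁻¹ ^ t * (Y Q * μ Q)))
    (hB : ∀ Q ∈ S, ∀ᵐ x ∂μ.restrict Q, Y Q ≤ B * w x)
    {E : Set X} {r M : ℝ≥0∞} (hr : r ≤ 1) (hM : M ≠ 0) (hM' : M ≠ ∞) {g : ℝ} (hg : 0 ≤ g)
    (hg1 : g ≤ 1) :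
    ∑ Q ∈ S, r ^ k Q * ((2⁻¹ ^ k Q * Y Q) ^ g * ((μ Q)⁻¹ * ∫⁻ x in E ∩ Q, w x ∂μ) ^ (1 - g)) * μ Q ≤
      (16 * Λ * M ^ (1 - g) * (1 - r)⁻¹ + M ^ (-g) * (32 * Λ * C)) * (B * ∫⁻ x, h x * w x ∂μ) +
      M ^ (-g) * (4 * Λ * d) * (1 - r)⁻¹ * ∫⁻ x in E, w x ∂μ := by
  classical
  set N : ℕ := 4 * Λ * d with hN
  have hN0 : N ≠ 0 := by positivity
  -- With `k Q + 1` blocks, `i < n Q` gives `i / N ≤ k Q`, which is what makes the shallow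
  -- coefficients summable over the depth.
  set n : Set X → ℕ := fun Q => 4 * Λ * (d * (k Q + 1)) with hn
  -- The weighted arithmetic-geometric mean inequality with free parameter `M` separates the
  -- product: the first factor goes to `h`, the second is split into shallow and deep part.
  have hsplit : ∀ Q ∈ S, r ^ k Q * ((2⁻¹ ^ k Q * Y Q) ^ g *
      ((μ Q)⁻¹ * ∫⁻ x in E ∩ Q, w x ∂μ) ^ (1 - g)) * μ Q ≤
      2 * M ^ (1 - g) * (r ^ k Q * (Y Q * ∫⁻ x in Q, h x ∂μ)) +
      (M ^ (-g) * (r ^ k Q * ∫⁻ x in E ∩ (Q \ deep S Q (n Q)), w x ∂μ) +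
      2 * C * M ^ (-g) * (2⁻¹ ^ k Q * (Y Q * ∫⁻ x in Q, h x ∂μ))) := by
    intro Q hQ
    have hμ : μ Q * (μ Q)⁻¹ = 1 := ENNReal.mul_inv_cancel (hS.ne_zero Q hQ) (hS.ne_top Q hQ)
    have hsub : E ∩ Q ⊆ (E ∩ (Q \ deep S Q (n Q))) ∪ deep S Q (n Q) := by
      rintro x ⟨hx1, hx2⟩
      by_cases hx : x ∈ deep S Q (n Q)
      · exact Or.inr hx
      · exact Or.inl ⟨hx1, hx2, hx⟩
    -- Of the decay `4^(-k)` of the deep part one factor `2^(-k)` converts `μ(Q)` into `∫_Q h`; the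
    -- other makes the sum over the layers converge.
    have e1 : r ^ k Q * ∫⁻ x in E ∩ Q, w x ∂μ ≤
        r ^ k Q * ∫⁻ x in E ∩ (Q \ deep S Q (n Q)), w x ∂μ +
        2 * C * (2⁻¹ ^ k Q * (Y Q * ∫⁻ x in Q, h x ∂μ)) := by
      calc r ^ k Q * ∫⁻ x in E ∩ Q, w x ∂μ
          ≤ r ^ k Q * (∫⁻ x in E ∩ (Q \ deep S Q (n Q)), w x ∂μ +
            ∫⁻ x in deep S Q (n Q), w x ∂μ) := by
            gcongr
            exact (lintegral_mono_set hsub).trans (lintegral_union_le _ _ _)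
        _ ≤ r ^ k Q * ∫⁻ x in E ∩ (Q \ deep S Q (n Q)), w x ∂μ +
            1 * (C * (4⁻¹ ^ k Q * (Y Q * μ Q))) := by
            rw [mul_add]
            gcongr
            · exact pow_le_one₀ zero_le hr
            · refine (hU Q hQ (k Q + 1)).trans ?_
              refine mul_le_mul_right (mul_le_mul_left (pow_le_pow_of_le_one zero_le ?_
                (Nat.le_succ _)) _) _
              rw [ENNReal.inv_le_one]; norm_num
        _ = r ^ k Q * ∫⁻ x in E ∩ (Q \ deep S Q (n Q)), w x ∂μ +
            C * 2⁻¹ ^ k Q * Y Q * (2⁻¹ ^ k Q * μ Q) := by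
            rw [inv_four_eq, mul_pow]; ring
        _ ≤ r ^ k Q * ∫⁻ x in E ∩ (Q \ deep S Q (n Q)), w x ∂μ +
            C * 2⁻¹ ^ k Q * Y Q * (2 * ∫⁻ x in Q, h x ∂μ) :=
            add_le_add le_rfl (mul_le_mul_right (h2 Q hQ) _)
        _ = _ := by ring
    calc _ ≤ r ^ k Q * (M ^ (1 - g) * (2⁻¹ ^ k Q * Y Q) +
          M ^ (-g) * ((μ Q)⁻¹ * ∫⁻ x in E ∩ Q, w x ∂μ)) * μ Q := by
          gcongr
          exact rpow_mul_rpow_le_add _ _ _ hM hM' hg hg1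
      _ = r ^ k Q * M ^ (1 - g) * Y Q * (2⁻¹ ^ k Q * μ Q) +
          M ^ (-g) * (r ^ k Q * ∫⁻ x in E ∩ Q, w x ∂μ) * (μ Q * (μ Q)⁻¹) := by ring
      _ ≤ r ^ k Q * M ^ (1 - g) * Y Q * (2 * ∫⁻ x in Q, h x ∂μ) +
          M ^ (-g) * (r ^ k Q * ∫⁻ x in E ∩ (Q \ deep S Q (n Q)), w x ∂μ +
        2 * C * (2⁻¹ ^ k Q * (Y Q * ∫⁻ x in Q, h x ∂μ))) := by
          rw [hμ, mul_one]
          exact add_le_add (mul_le_mul_right (h2 Q hQ) _) (mul_le_mul_right e1 _)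
      _ = _ := by ring
  refine (Finset.sum_le_sum hsplit).trans ?_
  rw [Finset.sum_add_distrib, Finset.sum_add_distrib, ← Finset.mul_sum, ← Finset.mul_sum,
    ← Finset.mul_sum]
  have s1 := hS.sum_layers_le hΛ hh hw k Y B (fun i => r ^ i) h1 h2 hB
  have s2 := hS.sum_layers_le hΛ hh hw k Y B (fun i => 2⁻¹ ^ i) h1 h2 hB
  have s3 := hS.laminar.sum_shallow_le (μ := μ) hS.measurable w E (fun Q => r ^ k Q) n
    (fun i => r ^ (i / N)) (by
      intro Q hQ i hi
      apply pow_le_pow_of_le_one zero_le hr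
      have : i / N < k Q + 1 := by
        rw [Nat.div_lt_iff_lt_mul (Nat.pos_of_ne_zero hN0)]
        calc i < 4 * Λ * (d * (k Q + 1)) := hi
          _ = (k Q + 1) * N := by rw [hN]; ring
      omega)
  rw [tsum_comp_div (fun l => r ^ l) N hN0] at s3
  rw [ENNReal.tsum_geometric] at s1 s2 s3
  rw [ENNReal.one_sub_inv_two, inv_inv] at s2
  calc _ ≤ _ := add_le_add (mul_le_mul_right s1 _) (add_le_add (mul_le_mul_right s3 _)
        (mul_le_mul_right s2 _))
    _ = _ := by rw [hN]; push_cast; ring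

/-! ### Dyadic grids and the one-third trick -/

variable {n : ℕ}

lemma coe_neg_one_zpow (k : ℤ) : ((((-1 : ℤˣ) ^ k : ℤˣ) : ℤ) : ℝ) = (-1 : ℝ) ^ k := by
  rcases Int.even_or_odd k with ⟨l, rfl⟩ | ⟨l, rfl⟩
  · rw [zpow_add, Int.units_mul_self, zpow_add₀ (by norm_num : (-1 : ℝ) ≠ 0), ← mul_zpow]
    norm_num
  · rw [zpow_add, zpow_mul', ← zpow_mul', zpow_mul, zpow_add₀ (by norm_num : (-1 : ℝ) ≠ 0), zpow_mul]
    norm_num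

/-- The index of the cube of level `k` in the grid `𝒟^α` which contains `x`. -/
def idx (α : Fin n → Fin 3) (k : ℤ) (x : EuclideanSpace ℝ (Fin n)) : Fin n → ℤ :=
  fun i => ⌊(2 : ℝ) ^ k * x i - (-1 : ℝ) ^ k * (((α i : ℕ) : ℝ) / 3)⌋

lemma mem_dyadicCube_iff {α : Fin n → Fin 3} {k : ℤ} {m : Fin n → ℤ}
    {x : EuclideanSpace ℝ (Fin n)} : x ∈ dyadicCube α k m ↔ idx α k x = m := by
  have h2 : (0 : ℝ) < 2 ^ k := by positivity
  simp only [dyadicCube, mem_ofPred_eq, mem_Ico, funext_iff, idx, Int.floor_eq_iff]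
  refine forall_congr' fun i => and_congr ?_ ?_
  · rw [zpow_neg, inv_mul_le_iff₀ h2, le_sub_iff_add_le]
  · rw [zpow_neg, lt_inv_mul_iff₀ h2, sub_lt_iff_lt_add]
    constructor <;> intro h <;> linarith

/-- The alternating sign of the shift is what makes the levels nested: `2^(k+1) x - (-1)^(k+1) α`
equals `2 (2^k x - (-1)^k α)` plus `3 (-1)^k α`, and `3α` is an integer vector. -/
lemma idx_eq_of_succ {α : Fin n → Fin 3} {k : ℤ} {x y : EuclideanSpace ℝ (Fin n)}
    (h : idx α (k + 1) x = idx α (k + 1) y) : idx α k x = idx α k y := by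
  have key : ∀ (s t : ℝ) (j : ℤ), ⌊2 * s + j⌋ = ⌊2 * t + j⌋ → ⌊s⌋ ≤ ⌊t⌋ := by
    intro s t j hj
    rw [Int.floor_add_intCast, Int.floor_add_intCast, add_left_inj] at hj
    rw [Int.le_floor]
    have h1 : (2 * ⌊s⌋ : ℤ) ≤ ⌊2 * s⌋ := by
      rw [Int.le_floor]; push_cast
      have := Int.floor_le s
      linarith
    rw [hj, Int.le_floor] at h1
    push_cast at h1
    linarith
  funext i
  have hi := congrFun h i
  simp only [idx] at hi ⊢
  have e : ∀ z : ℝ, (2 : ℝ) ^ (k + 1) * z - (-1 : ℝ) ^ (k + 1) * (((α i : ℕ) : ℝ) / 3) =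
      2 * ((2 : ℝ) ^ k * z - (-1 : ℝ) ^ k * (((α i : ℕ) : ℝ) / 3)) +
        (((-1 : ℤˣ) ^ k : ℤˣ) * (α i : ℕ) : ℤ) := by
    intro z
    rw [zpow_add₀ two_ne_zero, zpow_add₀ (by norm_num : (-1 : ℝ) ≠ 0)]
    rw [Int.cast_mul, coe_neg_one_zpow, Int.cast_natCast]
    ring
  rw [e, e] at hi
  exact le_antisymm (key _ _ _ hi) (key _ _ _ hi.symm)

lemma idx_eq_of_le {α : Fin n → Fin 3} {k l : ℤ} (hkl : k ≤ l) {x y : EuclideanSpace ℝ (Fin n)}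
    (h : idx α l x = idx α l y) : idx α k x = idx α k y := by
  induction l, hkl using Int.leInduction with
  | base => exact h
  | succ l _ ih => exact ih (idx_eq_of_succ h)

lemma measurable_idx (α : Fin n → Fin 3) (k : ℤ) : Measurable (idx α k) := by
  refine measurable_pi_lambda _ fun i => ?_
  refine Int.measurable_floor.comp ?_
  fun_prop

lemma dyadicCube_eq_preimage (α : Fin n → Fin 3) (k : ℤ) (m : Fin n → ℤ) :
    dyadicCube α k m = idx α k ⁻¹' {m} := by
  ext x
  exact mem_dyadicCube_iff

lemma measurableSet_dyadicCube (α : Fin n → Fin 3) (k : ℤ) (m : Fin n → ℤ) :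
    MeasurableSet (dyadicCube α k m) := by
  rw [dyadicCube_eq_preimage]
  exact measurable_idx α k (measurableSet_singleton m)

lemma dyadicCube_subset_or_disjoint {α : Fin n → Fin 3} {k l : ℤ} (hkl : k ≤ l)
    (m m' : Fin n → ℤ) : dyadicCube α l m' ⊆ dyadicCube α k m ∨
      Disjoint (dyadicCube α l m') (dyadicCube α k m) := by
  by_cases h : Disjoint (dyadicCube α l m') (dyadicCube α k m)
  · exact Or.inr h
  · obtain ⟨x, hx1, hx2⟩ := Set.not_disjoint_iff.1 h
    refine Or.inl fun y hy => ?_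
    rw [mem_dyadicCube_iff] at *
    rw [← hx2]
    exact idx_eq_of_le hkl (hy.trans hx1.symm)

lemma isLaminar_of_subset_dyadicGrid {α : Fin n → Fin 3}
    {S : Finset (Set (EuclideanSpace ℝ (Fin n)))} (hS : ∀ Q ∈ S, Q ∈ dyadicGrid α) :
    IsLaminar S := by
  intro P hP R hR
  obtain ⟨k, m, rfl⟩ := hS P hP
  obtain ⟨l, m', rfl⟩ := hS R hR
  rcases le_total k l with h | h
  · rcases dyadicCube_subset_or_disjoint h m m' with h' | h'
    · exact Or.inr (Or.inl h')
    · exact Or.inr (Or.inr h'.symm)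
  · rcases dyadicCube_subset_or_disjoint h m' m with h' | h'
    · exact Or.inl h'
    · exact Or.inr (Or.inr h')

lemma countable_dyadicCubes : (dyadicCubes n).Countable := by
  have : dyadicCubes n ⊆ range fun p : (Fin n → Fin 3) × ℤ × (Fin n → ℤ) =>
      dyadicCube p.1 p.2.1 p.2.2 := by
    rintro Q ⟨α, k, m, rfl⟩
    exact ⟨(α, k, m), rfl⟩
  exact (countable_range _).mono this

lemma norm_le_of_forall_abs_le {v : EuclideanSpace ℝ (Fin n)} {a : ℝ} (ha : 0 ≤ a)
    (h : ∀ i, |v i| ≤ a) : ‖v‖ ≤ n * a := by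
  rw [EuclideanSpace.norm_eq]
  apply Real.sqrt_le_iff.2
  refine ⟨by positivity, ?_⟩
  calc ∑ i, ‖v i‖ ^ 2 ≤ ∑ _i : Fin n, a ^ 2 := by
        refine Finset.sum_le_sum fun i _ => ?_
        rw [Real.norm_eq_abs]
        gcongr
        exact h i
    _ = n * a ^ 2 := by simp
    _ ≤ (n * a) ^ 2 := by
        rw [mul_pow]
        gcongr
        have : (n : ℕ) ≤ n ^ 2 := Nat.le_self_pow two_ne_zero n
        exact_mod_cast this

lemma abs_coord_sub_le (x y : EuclideanSpace ℝ (Fin n)) (i : Fin n) : |x i - y i| ≤ dist x y := by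
  rw [dist_eq_norm, ← Real.norm_eq_abs]
  exact PiLp.norm_apply_le (x - y) i

/-- The centre of a dyadic cube. -/
def center (α : Fin n → Fin 3) (k : ℤ) (m : Fin n → ℤ) : EuclideanSpace ℝ (Fin n) :=
  WithLp.toLp 2 fun i => (2 : ℝ) ^ (-k) * (m i + (-1 : ℝ) ^ k * (((α i : ℕ) : ℝ) / 3) + 1 / 2)

lemma abs_coord_sub_lt_of_mem {α : Fin n → Fin 3} {k : ℤ} {m : Fin n → ℤ}
    {x y : EuclideanSpace ℝ (Fin n)} (hx : x ∈ dyadicCube α k m) (hy : y ∈ dyadicCube α k m)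
    (i : Fin n) : |x i - y i| ≤ (2 : ℝ) ^ (-k) := by
  have h1 := hx i
  have h2 := hy i
  rw [mem_Ico] at h1 h2
  rw [abs_le]
  constructor <;> linarith

lemma dist_le_of_mem {α : Fin n → Fin 3} {k : ℤ} {m : Fin n → ℤ}
    {x y : EuclideanSpace ℝ (Fin n)} (hx : x ∈ dyadicCube α k m) (hy : y ∈ dyadicCube α k m) :
    dist x y ≤ n * (2 : ℝ) ^ (-k) := by
  rw [dist_eq_norm]
  exact norm_le_of_forall_abs_le (by positivity) fun i => abs_coord_sub_lt_of_mem hx hy i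

lemma dist_center_le {α : Fin n → Fin 3} {k : ℤ} {m : Fin n → ℤ}
    {x : EuclideanSpace ℝ (Fin n)} (hx : x ∈ dyadicCube α k m) :
    dist x (center α k m) ≤ n * ((2 : ℝ) ^ (-k) / 2) := by
  rw [dist_eq_norm]
  refine norm_le_of_forall_abs_le (by positivity) fun i => ?_
  have h1 := hx i
  rw [mem_Ico] at h1
  simp only [center, PiLp.sub_apply]
  rw [abs_le]
  constructor <;> linarith

lemma ball_center_subset (α : Fin n → Fin 3) (k : ℤ) (m : Fin n → ℤ) :
    Metric.ball (center α k m) ((2 : ℝ) ^ (-k) / 2) ⊆ dyadicCube α k m := by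
  intro x hx i
  have h1 := (abs_coord_sub_le x (center α k m) i).trans_lt (Metric.mem_ball.1 hx)
  simp only [center] at h1
  rw [abs_lt] at h1
  constructor <;> linarith [h1.1, h1.2]

lemma center_mem (α : Fin n → Fin 3) (k : ℤ) (m : Fin n → ℤ) :
    center α k m ∈ dyadicCube α k m :=
  ball_center_subset α k m (Metric.mem_ball_self (by positivity))

/-- A ball containing a dyadic cube and, when the cube is not minimal, the balls associated with
its descendants. -/
def cubeBall (α : Fin n → Fin 3) (k : ℤ) (m : Fin n → ℤ) : Set (EuclideanSpace ℝ (Fin n)) :=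
  Metric.ball (center α k m) (2 * n * (2 : ℝ) ^ (-k))

lemma dyadicCube_subset_cubeBall (hn : 1 ≤ n) (α : Fin n → Fin 3) (k : ℤ) (m : Fin n → ℤ) :
    dyadicCube α k m ⊆ cubeBall α k m := by
  intro x hx
  have h := dist_center_le hx
  have hn' : (1 : ℝ) ≤ n := by exact_mod_cast hn
  have h2 : (0 : ℝ) < 2 ^ (-k) := by positivity
  rw [cubeBall, Metric.mem_ball]
  nlinarith

/-- A descendant's ball has radius at most `n 2^(-k)`, and its centre is within `n 2^(-k) / 2` of
the ancestor's centre. The radius `2n 2^(-k)` leaves room for both, so the balls are nested like the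
cubes. -/
lemma cubeBall_subset_of_lt {α : Fin n → Fin 3} {k l : ℤ} (hkl : k < l)
    (x : EuclideanSpace ℝ (Fin n)) :
    cubeBall α l (idx α l x) ⊆ cubeBall α k (idx α k x) := by
  have h2 : (0 : ℝ) < 2 ^ (-k) := by positivity
  have hl : (2 : ℝ) ^ (-l) ≤ 2 ^ (-k) / 2 := by
    calc (2 : ℝ) ^ (-l) ≤ 2 ^ (-k - 1) := zpow_le_zpow_right₀ (by norm_num) (by omega)
      _ = _ := by rw [zpow_sub_one₀ two_ne_zero]; rfl
  have hc : center α l (idx α l x) ∈ dyadicCube α k (idx α k x) := by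
    rw [mem_dyadicCube_iff]
    exact idx_eq_of_le hkl.le (mem_dyadicCube_iff.1 (center_mem α l (idx α l x)))
  have h1 := dist_center_le hc
  apply Metric.ball_subset_ball'
  have hn' : (0 : ℝ) ≤ n := n.cast_nonneg
  nlinarith [mul_le_mul_of_nonneg_left hl hn']

/-- The one-third trick in one coordinate. -/
lemma exists_shift (e : ℤˣ) (y : ℝ) : ∃ a : Fin 3, ∃ m : ℤ,
    (m : ℝ) + 1 / 3 ≤ y - ((e : ℤ) : ℝ) * (((a : ℕ) : ℝ) / 3) ∧
      y - ((e : ℤ) : ℝ) * (((a : ℕ) : ℝ) / 3) < m + 2 / 3 := by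
  set z := ⌊3 * y⌋ with hz
  have h1 := Int.floor_le (3 * y)
  have h2 := Int.lt_floor_add_one (3 * y)
  rw [← hz] at h1 h2
  -- Solving for the residue of `⌊3y⌋` modulo `3` places the shifted point in the middle third of a
  -- unit interval, with a margin of at least `1/3` on either side.
  obtain ⟨a, m, ham⟩ : ∃ a : Fin 3, ∃ m : ℤ, z = 3 * m + 1 + (e : ℤ) * ((a : ℕ) : ℤ) := by
    rcases Int.units_eq_one_or e with rfl | rfl
    · have h3 := Int.emod_nonneg (z - 1) (by norm_num : (3 : ℤ) ≠ 0)
      have h4 := Int.emod_lt_of_pos (z - 1) (by norm_num : (0 : ℤ) < 3)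
      refine ⟨⟨((z - 1) % 3).toNat, by omega⟩, (z - 1) / 3, ?_⟩
      simp only [Units.val_one]
      omega
    · have h3 := Int.emod_nonneg (1 - z) (by norm_num : (3 : ℤ) ≠ 0)
      have h4 := Int.emod_lt_of_pos (1 - z) (by norm_num : (0 : ℤ) < 3)
      refine ⟨⟨((1 - z) % 3).toNat, by omega⟩, -((1 - z) / 3), ?_⟩
      simp only [Units.val_neg, Units.val_one]
      omega
  refine ⟨a, m, ?_, ?_⟩
  · rw [ham] at h1; push_cast at h1; linarith
  · rw [ham] at h2; push_cast at h2; linarith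

/-- Every ball is contained in a dyadic cube of comparable size, from one of the grids. -/
lemma exists_ball_subset_dyadicCube (x : EuclideanSpace ℝ (Fin n)) {r : ℝ} (hr : 0 < r) :
    ∃ α k m, Metric.ball x r ⊆ dyadicCube (n := n) α k m ∧ (2 : ℝ) ^ (-k) ≤ 12 * r := by
  -- The scale is fixed by `6r ≤ 2^(-k) ≤ 12r`: after rescaling the radius is at most `1/6`, below
  -- the margin `1/3` supplied by the choice of the shift in each coordinate.
  obtain ⟨j, hj1, hj2⟩ := exists_mem_Ioc_zpow (x := 6 * r) (y := (2 : ℝ)) (by positivity)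
    (by norm_num)
  set k : ℤ := -(j + 1) with hk
  have hk1 : (2 : ℝ) ^ (-k) ≤ 12 * r := by
    rw [hk, neg_neg, zpow_add_one₀ two_ne_zero]; linarith
  have hk2 : 6 * r ≤ (2 : ℝ) ^ (-k) := by rw [hk, neg_neg]; exact hj2
  have hkr : (2 : ℝ) ^ k * r ≤ 1 / 6 := by
    rw [zpow_neg] at hk2
    have h2 : (0 : ℝ) < 2 ^ k := by positivity
    rw [le_inv_comm₀ (by positivity) h2, le_inv_comm₀ h2 (by positivity)] at hk2
    have := mul_le_mul_of_nonneg_left hk2 h2.le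
    rw [mul_inv_cancel₀ h2.ne'] at this
    linarith
  choose α m h1 h2 using fun i : Fin n => exists_shift ((-1 : ℤˣ) ^ k) ((2 : ℝ) ^ k * x i)
  refine ⟨α, k, m, fun y hy => ?_, hk1⟩
  rw [mem_dyadicCube_iff]
  funext i
  rw [idx, Int.floor_eq_iff]
  have hy' := (abs_coord_sub_le y x i).trans_lt (Metric.mem_ball.1 hy)
  have h3 : |(2 : ℝ) ^ k * y i - 2 ^ k * x i| ≤ 1 / 6 := by
    rw [← mul_sub, abs_mul, abs_of_pos (by positivity : (0 : ℝ) < 2 ^ k)]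
    refine le_trans ?_ hkr
    gcongr
  have h1i := h1 i
  have h2i := h2 i
  rw [coe_neg_one_zpow] at h1i h2i
  rw [abs_le] at h3
  constructor <;> linarith [h3.1, h3.2]

/-! ### Doubling measures on cubes and balls -/

/-- The constant in the comparison of the measure of a large ball with that of a cube. -/
def doublingConst (n : ℕ) (ν : ℝ) : ℝ≥0 := (Real.toNNReal ((2 : ℝ) ^ ν)) ^ (2 * n + 7)

variable {ν : ℝ} {μ : Measure (EuclideanSpace ℝ (Fin n))}

lemma IsDoubling.measure_ball_le (hμ : IsDoubling ν μ) (x : EuclideanSpace ℝ (Fin n)) {r : ℝ}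
    (hr : 0 < r) : μ (Metric.ball x (64 * n ^ 2 * (2 * r))) ≤
      doublingConst n ν * μ (Metric.ball x r) := by
  have h1 : ∀ j : ℕ, μ (Metric.ball x (2 ^ j * r)) ≤
      (Real.toNNReal ((2 : ℝ) ^ ν) : ℝ≥0∞) ^ j * μ (Metric.ball x r) := by
    intro j
    induction j with
    | zero => simp
    | succ j ih =>
      calc μ (Metric.ball x (2 ^ (j + 1) * r)) = μ (Metric.ball x (2 * (2 ^ j * r))) := by
            congr 2; ring
        _ ≤ _ := hμ.doubling x _ (by positivity)
        _ ≤ ENNReal.ofReal ((2 : ℝ) ^ ν) *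
            ((Real.toNNReal ((2 : ℝ) ^ ν) : ℝ≥0∞) ^ j * μ (Metric.ball x r)) := by gcongr
        _ = _ := by rw [pow_succ, ENNReal.ofReal]; ring
  refine le_trans (measure_mono (Metric.ball_subset_ball ?_)) ((h1 (2 * n + 7)).trans (le_of_eq ?_))
  -- Since `n ≤ 2^n`, the dilation factor `128 n²` is at most `2^(2n+7)`; hence the exponent in
  -- `doublingConst`.
  · have : (n : ℝ) ≤ 2 ^ n := by exact_mod_cast Nat.lt_two_pow_self.le
    calc 64 * (n : ℝ) ^ 2 * (2 * r) ≤ 64 * (2 ^ n) ^ 2 * (2 * r) := by gcongr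
      _ = _ := by ring
  · rw [doublingConst]; push_cast; rfl

lemma IsDoubling.measure_ball_le_cube (hμ : IsDoubling ν μ) (α : Fin n → Fin 3) (k : ℤ)
    (m : Fin n → ℤ) : μ (Metric.ball (center α k m) (64 * n ^ 2 * (2 : ℝ) ^ (-k))) ≤
      doublingConst n ν * μ (dyadicCube α k m) := by
  have := hμ.measure_ball_le (center α k m) (r := (2 : ℝ) ^ (-k) / 2) (by positivity)
  rw [mul_div_cancel₀ _ (two_ne_zero' ℝ)] at this
  refine this.trans ?_
  gcongr
  exact ball_center_subset α k m

lemma IsDoubling.cube_ne_zero (hμ : IsDoubling ν μ) (α : Fin n → Fin 3) (k : ℤ)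
    (m : Fin n → ℤ) : μ (dyadicCube α k m) ≠ 0 :=
  ((hμ.ball_pos (center α k m) _ (by positivity)).trans_le
    (measure_mono (ball_center_subset α k m))).ne'

lemma dyadicCube_subset_ball (α : Fin n → Fin 3) (k : ℤ) (m : Fin n → ℤ) :
    dyadicCube α k m ⊆ Metric.ball (center α k m) (n * ((2 : ℝ) ^ (-k) / 2) + 1) := fun x hx => by
  rw [Metric.mem_ball]
  linarith [dist_center_le hx]

lemma IsDoubling.cube_ne_top (hμ : IsDoubling ν μ) (α : Fin n → Fin 3) (k : ℤ)
    (m : Fin n → ℤ) : μ (dyadicCube α k m) ≠ ∞ :=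
  ne_top_of_le_ne_top (hμ.ball_lt_top _ _).ne (measure_mono (dyadicCube_subset_ball α k m))

lemma IsDoubling.cubeBall_ne_zero (hn : 1 ≤ n) (hμ : IsDoubling ν μ) (α : Fin n → Fin 3) (k : ℤ)
    (m : Fin n → ℤ) : μ (cubeBall α k m) ≠ 0 := fun h =>
  hμ.cube_ne_zero α k m (measure_mono_null (dyadicCube_subset_cubeBall hn α k m) h)

lemma IsDoubling.cubeBall_le (hn : 1 ≤ n) (hμ : IsDoubling ν μ) (α : Fin n → Fin 3) (k : ℤ)
    (m : Fin n → ℤ) : μ (cubeBall α k m) ≤ doublingConst n ν * μ (dyadicCube α k m) := by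
  refine (measure_mono (Metric.ball_subset_ball ?_)).trans (hμ.measure_ball_le_cube α k m)
  have hn' : (1 : ℝ) ≤ n := by exact_mod_cast hn
  have h2 : (0 : ℝ) < 2 ^ (-k) := by positivity
  gcongr ?_ * _
  nlinarith

/-- Doubling measures are locally finite. -/
lemma IsDoubling.isLocallyFiniteMeasure (hμ : IsDoubling ν μ) : IsLocallyFiniteMeasure μ :=
  ⟨fun x => ⟨Metric.ball x 1, Metric.ball_mem_nhds x one_pos, hμ.ball_lt_top x 1⟩⟩

lemma avg_one {X F : Type*} [MeasurableSpace X] [NormedAddCommGroup F] (μ : Measure X) (E : Set X)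
    (f : X → F) : avg μ 1 E f = (μ E)⁻¹ * ∫⁻ x in E, ‖f x‖ₑ ∂μ := by
  rw [avg, eLpNorm_one_eq_lintegral_enorm, lintegral_smul_measure, smul_eq_mul]

/-! ### Weights, the `A_1` condition and the `A_∞` constant -/

section Weights

variable {w : EuclideanSpace ℝ (Fin n) → ℝ}

lemma IsWeight.measurable_ofReal (hw : IsWeight μ w) :
    Measurable fun x => ENNReal.ofReal (w x) := hw.measurable.ennreal_ofReal

lemma IsWeight.enorm_eq (hw : IsWeight μ w) (x : EuclideanSpace ℝ (Fin n)) :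
    ‖w x‖ₑ = ENNReal.ofReal (w x) := by
  rw [Real.enorm_eq_ofReal (hw.pos x).le]

lemma wMeasure_apply {E : Set (EuclideanSpace ℝ (Fin n))} (hE : MeasurableSet E) :
    wMeasure μ w E = ∫⁻ x in E, ENNReal.ofReal (w x) ∂μ := by
  rw [wMeasure, withDensity_apply _ hE]

lemma IsWeight.avg_one_eq (hw : IsWeight μ w) {E : Set (EuclideanSpace ℝ (Fin n))}
    (hE : MeasurableSet E) : avg μ 1 E w = (μ E)⁻¹ * wMeasure μ w E := by
  rw [avg_one, wMeasure_apply hE]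
  simp_rw [hw.enorm_eq]

lemma IsWeight.ae_iff (hw : IsWeight μ w) {p : EuclideanSpace ℝ (Fin n) → Prop} :
    (∀ᵐ x ∂wMeasure μ w, p x) ↔ ∀ᵐ x ∂μ, p x := by
  rw [wMeasure, ae_withDensity_iff hw.measurable_ofReal]
  refine Filter.eventually_congr (Filter.Eventually.of_forall fun x => ?_)
  have : ENNReal.ofReal (w x) ≠ 0 := by
    rw [Ne, ENNReal.ofReal_eq_zero, not_le]; exact hw.pos x
  simp [this]

lemma IsWeight.wMeasure_ne_zero (hw : IsWeight μ w) {E : Set (EuclideanSpace ℝ (Fin n))}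
    (hE : μ E ≠ 0) : wMeasure μ w E ≠ 0 := by
  intro h
  apply hE
  have h1 : ∀ᵐ x ∂wMeasure μ w, x ∉ E := measure_eq_zero_iff_ae_notMem.1 h
  exact measure_eq_zero_iff_ae_notMem.2 (hw.ae_iff.1 h1)

lemma A1_ae (hμ : IsDoubling ν μ) (hw : IsWeight μ w) (α : Fin n → Fin 3) (k : ℤ)
    (m : Fin n → ℤ) : ∀ᵐ y ∂μ.restrict (dyadicCube α k m),
      wMeasure μ w (dyadicCube α k m) ≤
        A1const μ w * μ (dyadicCube α k m) * ENNReal.ofReal (w y) := by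
  set Q := dyadicCube α k m with hQ
  have h0 : μ Q ≠ 0 := hμ.cube_ne_zero α k m
  have ht : μ Q ≠ ∞ := hμ.cube_ne_top α k m
  have hle : avg μ 1 Q w * avg μ ∞ Q (fun x => (w x)⁻¹) ≤ A1const μ w :=
    le_iSup₂ (f := fun (Q : Set (EuclideanSpace ℝ (Fin n))) (_ : Q ∈ dyadicCubes n) =>
      avg μ 1 Q w * avg μ ∞ Q (fun x => (w x)⁻¹)) Q ⟨α, k, m, rfl⟩
  have hae : ∀ᵐ y ∂μ.restrict Q, ‖(w y)⁻¹‖ₑ ≤ avg μ ∞ Q (fun x => (w x)⁻¹) := by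
    rw [avg, eLpNorm_exponent_top]
    have := ae_le_eLpNormEssSup (f := fun x => (w x)⁻¹) (μ := (μ Q)⁻¹ • μ.restrict Q)
    exact (Measure.ae_ennreal_smul_measure_iff (ENNReal.inv_ne_zero.2 ht)).1 this
  filter_upwards [hae] with y hy
  have hwy : ENNReal.ofReal (w y) ≠ 0 := by
    rw [Ne, ENNReal.ofReal_eq_zero, not_le]; exact hw.pos y
  have e1 : ‖(w y)⁻¹‖ₑ = (ENNReal.ofReal (w y))⁻¹ := by
    rw [Real.enorm_eq_ofReal (inv_pos.2 (hw.pos y)).le, ENNReal.ofReal_inv_of_pos (hw.pos y)]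
  rw [e1] at hy
  calc wMeasure μ w Q = ((μ Q)⁻¹ * wMeasure μ w Q) * μ Q *
        ((ENNReal.ofReal (w y))⁻¹ * ENNReal.ofReal (w y)) := by
        rw [ENNReal.inv_mul_cancel hwy ENNReal.ofReal_ne_top, mul_one, mul_comm (μ Q)⁻¹, mul_assoc,
          ENNReal.inv_mul_cancel h0 ht, mul_one]
    _ = ((μ Q)⁻¹ * wMeasure μ w Q) * (ENNReal.ofReal (w y))⁻¹ * μ Q * ENNReal.ofReal (w y) := by
        ring
    _ ≤ avg μ 1 Q w * avg μ ∞ Q (fun x => (w x)⁻¹) * μ Q * ENNReal.ofReal (w y) := by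
        rw [hw.avg_one_eq (measurableSet_dyadicCube α k m)]
        gcongr
    _ ≤ _ := by gcongr

/-- There are countably many cubes, so a single null set serves all of them. -/
lemma A1_ae_forall (hμ : IsDoubling ν μ) (hw : IsWeight μ w) : ∀ᵐ y ∂μ,
    ∀ α k m, y ∈ dyadicCube α k m → wMeasure μ w (dyadicCube α k m) ≤
        A1const μ w * μ (dyadicCube α k m) * ENNReal.ofReal (w y) := by
  simp_rw [ae_all_iff]
  intro α k m
  exact (ae_restrict_iff' (measurableSet_dyadicCube α k m)).1 (A1_ae hμ hw α k m)

/-- By the one-third trick a ball lies in a dyadic cube of comparable size, hence of comparable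
measure; thus the dyadic `A_1` condition yields the one over balls. The null set does not depend on
the ball. -/
lemma A1_ball_ae (hμ : IsDoubling ν μ) (hn : 1 ≤ n) (hw : IsWeight μ w) : ∀ᵐ y ∂μ, ∀ x r, 0 < r →
    y ∈ Metric.ball x r → wMeasure μ w (Metric.ball x r) ≤
      doublingConst n ν * A1const μ w * μ (Metric.ball x r) * ENNReal.ofReal (w y) := by
  filter_upwards [A1_ae_forall hμ hw] with y hy x r hr hyr
  obtain ⟨α, k, m, hsub, hk⟩ := exists_ball_subset_dyadicCube x hr
  have h1 : μ (dyadicCube α k m) ≤ doublingConst n ν * μ (Metric.ball x r) := by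
    refine (measure_mono fun z hz => ?_).trans (hμ.measure_ball_le x hr)
    have h2 := dist_le_of_mem hz (hsub (Metric.mem_ball_self hr))
    have hn' : (1 : ℝ) ≤ n := by exact_mod_cast hn
    rw [Metric.mem_ball]
    calc dist z x ≤ n * (2 : ℝ) ^ (-k) := h2
      _ ≤ n * (12 * r) := by gcongr
      _ < 64 * n ^ 2 * (2 * r) := by
        have : (n : ℝ) ≤ n ^ 2 := by nlinarith
        nlinarith
  calc wMeasure μ w (Metric.ball x r) ≤ wMeasure μ w (dyadicCube α k m) := measure_mono hsub
    _ ≤ A1const μ w * μ (dyadicCube α k m) * ENNReal.ofReal (w y) := hy α k m (hsub hyr)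
    _ ≤ A1const μ w * (doublingConst n ν * μ (Metric.ball x r)) * ENNReal.ofReal (w y) := by gcongr
    _ = _ := by ring

/-- The average of a weight over the ball associated with a cube. -/
def ballAvg (μ : Measure (EuclideanSpace ℝ (Fin n))) (w : EuclideanSpace ℝ (Fin n) → ℝ)
    (α : Fin n → Fin 3) (k : ℤ) (m : Fin n → ℤ) : ℝ≥0∞ :=
  (μ (cubeBall α k m))⁻¹ * wMeasure μ w (cubeBall α k m)

lemma IsDoubling.cubeBall_ne_top (hμ : IsDoubling ν μ) (α : Fin n → Fin 3) (k : ℤ)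
    (m : Fin n → ℤ) : μ (cubeBall α k m) ≠ ∞ := (hμ.ball_lt_top _ _).ne

lemma ballAvg_mul (hμ : IsDoubling ν μ) (hn : 1 ≤ n) (α : Fin n → Fin 3) (k : ℤ)
    (m : Fin n → ℤ) :
    ballAvg μ w α k m * μ (cubeBall α k m) = wMeasure μ w (cubeBall α k m) := by
  rw [ballAvg, mul_comm, ← mul_assoc, ENNReal.mul_inv_cancel (hμ.cubeBall_ne_zero hn α k m)
    (hμ.cubeBall_ne_top α k m), one_mul]

lemma wMeasure_cube_le_ballAvg (hμ : IsDoubling ν μ) (hn : 1 ≤ n) (α : Fin n → Fin 3) (k : ℤ)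
    (m : Fin n → ℤ) : wMeasure μ w (dyadicCube α k m) ≤
      doublingConst n ν * (ballAvg μ w α k m * μ (dyadicCube α k m)) := by
  calc wMeasure μ w (dyadicCube α k m) ≤ wMeasure μ w (cubeBall α k m) :=
        measure_mono (dyadicCube_subset_cubeBall hn α k m)
    _ = ballAvg μ w α k m * μ (cubeBall α k m) := (ballAvg_mul hμ hn α k m).symm
    _ ≤ ballAvg μ w α k m * (doublingConst n ν * μ (dyadicCube α k m)) := by
        gcongr; exact hμ.cubeBall_le hn α k m
    _ = _ := by ring

lemma A1_ballAvg_ae (hμ : IsDoubling ν μ) (hn : 1 ≤ n) (hw : IsWeight μ w) : ∀ᵐ y ∂μ,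
    ∀ α k m, y ∈ dyadicCube α k m →
      ballAvg μ w α k m ≤ doublingConst n ν * A1const μ w * ENNReal.ofReal (w y) := by
  filter_upwards [A1_ball_ae hμ hn hw] with y hy α k m hm
  have hpos : (0 : ℝ) < 2 * n * 2 ^ (-k) := by
    have : (0 : ℝ) < n := by exact_mod_cast hn
    positivity
  have := hy (center α k m) _ hpos (dyadicCube_subset_cubeBall hn α k m hm)
  rw [ballAvg]
  calc (μ (cubeBall α k m))⁻¹ * wMeasure μ w (cubeBall α k m)
      ≤ (μ (cubeBall α k m))⁻¹ * (doublingConst n ν * A1const μ w * μ (cubeBall α k m) *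
        ENNReal.ofReal (w y)) := by gcongr; exact this
    _ = ((μ (cubeBall α k m))⁻¹ * μ (cubeBall α k m)) *
        (doublingConst n ν * A1const μ w * ENNReal.ofReal (w y)) := by ring
    _ = _ := by
        rw [ENNReal.inv_mul_cancel (hμ.cubeBall_ne_zero hn α k m) (hμ.cubeBall_ne_top α k m),
          one_mul]

/-- For an `A_1` weight the maximal function is bounded a.e. by a multiple of the weight itself.
Used only to know that the `A_∞` constants are finite. -/
lemma AinftyConst_le (hμ : IsDoubling ν μ) (hn : 1 ≤ n) (hw : IsWeight μ w) :
    AinftyConst μ w ≤ doublingConst n ν * A1const μ w := by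
  refine iSup_le fun y => iSup_le fun r => iSup_le fun hr => ?_
  have hB : MeasurableSet (Metric.ball y r) := measurableSet_ball
  set C : ℝ≥0∞ := doublingConst n ν * A1const μ w with hC
  have h1 : ∫⁻ x in Metric.ball y r, ballMaximal μ ((Metric.ball y r).indicator w) x ∂μ ≤
      C * wMeasure μ w (Metric.ball y r) := by
    rw [wMeasure_apply hB, ← lintegral_const_mul _ hw.measurable_ofReal]
    refine lintegral_mono_ae (ae_restrict_of_ae ?_)
    filter_upwards [A1_ball_ae hμ hn hw] with x hx
    refine iSup_le fun z => iSup_le fun s => iSup_le fun hs => iSup_le fun hxs => ?_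
    rw [avg_one]
    have hb0 := (hμ.ball_pos z s hs).ne'
    have hbt := (hμ.ball_lt_top z s).ne
    calc (μ (Metric.ball z s))⁻¹ * ∫⁻ x in Metric.ball z s, ‖(Metric.ball y r).indicator w x‖ₑ ∂μ
        ≤ (μ (Metric.ball z s))⁻¹ * wMeasure μ w (Metric.ball z s) := by
          rw [wMeasure_apply measurableSet_ball]
          gcongr with u
          by_cases hu : u ∈ Metric.ball y r
          · rw [indicator_of_mem hu, hw.enorm_eq]
          · simp [indicator_of_notMem hu]
      _ ≤ (μ (Metric.ball z s))⁻¹ * (C * μ (Metric.ball z s) * ENNReal.ofReal (w x)) := by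
          gcongr; exact hx z s hs hxs
      _ = (μ (Metric.ball z s))⁻¹ * μ (Metric.ball z s) * (C * ENNReal.ofReal (w x)) := by ring
      _ = _ := by rw [ENNReal.inv_mul_cancel hb0 hbt, one_mul]
  calc _ ≤ (wMeasure μ w (Metric.ball y r))⁻¹ * (C * wMeasure μ w (Metric.ball y r)) := by gcongr
    _ = C * ((wMeasure μ w (Metric.ball y r))⁻¹ * wMeasure μ w (Metric.ball y r)) := by ring
    _ ≤ C * 1 := by gcongr; exact ENNReal.inv_mul_le_one _
    _ = C := mul_one C

/-- On a ball `B` the maximal function of `w χ_B` is at least the average over `B`. This permits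
absorbing absolute constants into the `A_∞` constant. -/
lemma one_le_AinftyConst (hμ : IsDoubling ν μ) (hw : IsWeight μ w) : 1 ≤ AinftyConst μ w := by
  set B : Set (EuclideanSpace ℝ (Fin n)) := Metric.ball 0 1 with hB
  have hBm : MeasurableSet B := measurableSet_ball
  have h0 : μ B ≠ 0 := (hμ.ball_pos 0 1 one_pos).ne'
  have ht : μ B ≠ ∞ := (hμ.ball_lt_top 0 1).ne
  have hw0 := hw.wMeasure_ne_zero h0
  have hwt : wMeasure μ w B ≠ ∞ := (hw.ball_lt_top 0 1).ne
  have h1 : (wMeasure μ w B)⁻¹ * ∫⁻ x in B, ballMaximal μ (B.indicator w) x ∂μ ≤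
      AinftyConst μ w :=
    le_iSup_of_le 0 (le_iSup_of_le 1 (le_iSup_of_le one_pos le_rfl))
  refine le_trans ?_ h1
  have h2 : wMeasure μ w B ≤ ∫⁻ x in B, ballMaximal μ (B.indicator w) x ∂μ := by
    calc wMeasure μ w B = ((μ B)⁻¹ * wMeasure μ w B) * μ B := by
          rw [mul_comm, ← mul_assoc, ENNReal.mul_inv_cancel h0 ht, one_mul]
      _ = ∫⁻ x in B, (μ B)⁻¹ * wMeasure μ w B ∂μ := by rw [setLIntegral_const]
      _ ≤ _ := by
          refine setLIntegral_mono' hBm fun x hx => ?_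
          refine le_trans ?_ (le_iSup_of_le 0 (le_iSup_of_le 1 (le_iSup_of_le one_pos
            (le_iSup_of_le hx le_rfl))))
          rw [avg_one, wMeasure_apply hBm]
          gcongr ?_ * ?_
          · exact le_rfl
          · refine setLIntegral_mono' hBm fun u hu => ?_
            rw [indicator_of_mem hu, hw.enorm_eq]
  calc (1 : ℝ≥0∞) = (wMeasure μ w B)⁻¹ * wMeasure μ w B := (ENNReal.inv_mul_cancel hw0 hwt).symm
    _ ≤ _ := by gcongr

end Weights

/-! ### The quantitative `A_∞` property via level sets of a maximal function -/

/-- The terms form a geometric progression cut off at `y`. Applied pointwise with `y` the maximal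
function, it bounds a sum over level sets by an integral of the maximal function. -/
lemma tsum_pow_two_lt_le (c y : ℝ≥0∞) :
    ∑' i : ℕ, (if 2 ^ i * c < y then 2 ^ i * c else 0) ≤ 2 * y := by
  refine ENNReal.tsum_le_of_sum_range_le fun N => ?_
  have hgeom : ∀ N : ℕ, ∑ i ∈ Finset.range N, (if 2 ^ i * c < y then 2 ^ i * c else 0) ≤
      2 ^ N * c := by
    intro N
    induction N with
    | zero => simp
    | succ N ih =>
      rw [Finset.sum_range_succ, pow_succ, mul_two, add_mul]
      gcongr
      split_ifs <;> simp
  induction N with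
  | zero => simp
  | succ N ih =>
    by_cases h : 2 ^ N * c < y
    · calc _ ≤ 2 ^ (N + 1) * c := hgeom _
        _ = 2 * (2 ^ N * c) := by rw [pow_succ]; ring
        _ ≤ 2 * y := by gcongr
    · rw [Finset.sum_range_succ, if_neg h, add_zero]
      exact ih

/-- A sequence dominating its tails up to a factor `K` is, up to a window of length `K`,
geometrically decaying. -/
lemma exists_le_of_tail_le {a : ℕ → ℝ≥0∞} {K : ℕ} (hK : 2 ≤ K) (ha : a 0 ≠ ∞)
    (h : ∀ j, ∑' i, a (j + i) ≤ K * a j) (j : ℕ) :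
    ∃ i < K, a (j + i) ≤ (1 - (K : ℝ≥0∞)⁻¹) ^ j * a 0 := by
  have hK0 : (K : ℝ≥0∞) ≠ 0 := by exact_mod_cast (by omega : K ≠ 0)
  have hKt : (K : ℝ≥0∞) ≠ ∞ := ENNReal.natCast_ne_top K
  set s : ℕ → ℝ≥0∞ := fun j => ∑' i, a (j + i) with hs
  have hsucc : ∀ j, s j = a j + s (j + 1) := by
    intro j
    simp only [hs]
    rw [tsum_eq_zero_add' ENNReal.summable, add_zero]
    congr 1
    refine tsum_congr fun i => ?_
    congr 1; ring
  -- The tails satisfy `s (j+1) = s j - a j ≤ (1 - 1/K) s j`, so they decay geometrically;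
  -- finiteness is needed for the subtraction.
  have hbound : ∀ j, s j ≤ (1 - (K : ℝ≥0∞)⁻¹) ^ j * (K * a 0) := by
    intro j
    induction j with
    | zero => simpa [hs] using h 0
    | succ j ih =>
      have hfin : s j ≠ ∞ := ne_top_of_le_ne_top (ENNReal.mul_ne_top (ENNReal.pow_ne_top (by simp))
        (ENNReal.mul_ne_top hKt ha)) ih
      have h1 : (K : ℝ≥0∞)⁻¹ * s j ≤ a j := by
        rw [ENNReal.inv_mul_le_iff hK0 hKt]; exact h j
      have h2 : s (j + 1) ≤ (1 - (K : ℝ≥0∞)⁻¹) * s j := by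
        rw [ENNReal.sub_mul (fun _ _ => hfin), one_mul]
        apply ENNReal.le_sub_of_add_le_left (ENNReal.mul_ne_top (by simpa using hK0) hfin)
        calc (K : ℝ≥0∞)⁻¹ * s j + s (j + 1) ≤ a j + s (j + 1) := by gcongr
          _ = s j := (hsucc j).symm
      calc s (j + 1) ≤ (1 - (K : ℝ≥0∞)⁻¹) * s j := h2
        _ ≤ (1 - (K : ℝ≥0∞)⁻¹) * ((1 - (K : ℝ≥0∞)⁻¹) ^ j * (K * a 0)) := by gcongr
        _ = _ := by rw [pow_succ]; ring
  -- If all `K` terms of the window exceeded the bound, their sum would exceed the bound just found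
  -- for the tail starting at `j`.
  by_contra hcon
  push Not at hcon
  set b := (1 - (K : ℝ≥0∞)⁻¹) ^ j * a 0 with hb
  have h1 : ∑ i ∈ Finset.range K, b < ∑ i ∈ Finset.range K, a (j + i) := by
    apply ENNReal.sum_lt_sum_of_nonempty ⟨0, by simp; omega⟩
    intro i hi
    exact hcon i (Finset.mem_range.1 hi)
  have h2 : ∑ i ∈ Finset.range K, a (j + i) ≤ s j := ENNReal.sum_le_tsum _
  have h3 := h1.trans_le (h2.trans (hbound j))
  rw [Finset.sum_const, Finset.card_range, nsmul_eq_mul, hb] at h3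
  apply h3.ne
  ring

/-- A shift of at most `K` steps changes the decay only by an absolute factor, so the window in
`exists_le_of_tail_le` is harmless. -/
lemma inv_eight_le_one_sub_inv_pow {K : ℕ} (hK : 2 ≤ K) : 8⁻¹ ≤ (1 - (K : ℝ≥0∞)⁻¹) ^ K := by
  have h2 : (2 : ℝ) ≤ K := by exact_mod_cast hK
  have hK0 : (0 : ℝ) < K := by linarith
  have hK1 : (0 : ℝ) < K - 1 := by linarith
  have h0 : (0 : ℝ) < 1 - 1 / K := by
    rw [sub_pos, div_lt_one hK0]; linarith
  rw [one_sub_inv_eq_ofReal hK, ← ENNReal.ofReal_pow h0.le]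
  have e1 : (1 - 1 / K : ℝ)⁻¹ = 1 / (K - 1) + 1 := by field_simp; ring
  have h1 : ((1 - 1 / K : ℝ)⁻¹) ^ K ≤ 8 := by
    calc ((1 - 1 / K : ℝ)⁻¹) ^ K ≤ Real.exp (1 / (K - 1)) ^ K := by
          gcongr
          rw [e1]; exact Real.add_one_le_exp _
      _ = Real.exp (K * (1 / (K - 1))) := by rw [Real.exp_nat_mul]
      _ ≤ Real.exp 2 := by
          apply Real.exp_le_exp.2
          rw [mul_one_div, div_le_iff₀ hK1]; linarith
      _ = Real.exp 1 ^ 2 := by rw [← Real.exp_nat_mul]; norm_num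
      _ ≤ 2.72 ^ 2 := by
          gcongr
          exact Real.exp_one_lt_d9.le.trans (by norm_num)
      _ ≤ 8 := by norm_num
  have h3 : (8 : ℝ)⁻¹ ≤ (1 - 1 / K : ℝ) ^ K := by
    rw [inv_pow] at h1
    exact inv_le_of_inv_le₀ (by positivity) h1
  calc (8⁻¹ : ℝ≥0∞) = ENNReal.ofReal (8⁻¹) := by
        rw [ENNReal.ofReal_inv_of_pos (by norm_num)]; simp
    _ ≤ _ := ENNReal.ofReal_le_ofReal h3

variable {n : ℕ} {ν : ℝ} {μ : Measure (EuclideanSpace ℝ (Fin n))}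
  {w : EuclideanSpace ℝ (Fin n) → ℝ}

/-- The averages of a weight over the balls associated with the cubes of the levels `k + i`
which contain the point `x`. -/
def ballAvgAt (μ : Measure (EuclideanSpace ℝ (Fin n))) (w : EuclideanSpace ℝ (Fin n) → ℝ)
    (α : Fin n → Fin 3) (k : ℤ) (i : ℕ) (x : EuclideanSpace ℝ (Fin n)) : ℝ≥0∞ :=
  ballAvg μ w α (k + i) (idx α (k + i) x)

/-- A dyadic maximal function built from averages over the enlarged balls. -/
def cubeMaximal (μ : Measure (EuclideanSpace ℝ (Fin n))) (w : EuclideanSpace ℝ (Fin n) → ℝ)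
    (α : Fin n → Fin 3) (k : ℤ) (x : EuclideanSpace ℝ (Fin n)) : ℝ≥0∞ :=
  ⨆ i, ballAvgAt μ w α k i x

lemma measurable_ballAvgAt (α : Fin n → Fin 3) (k : ℤ) (i : ℕ) :
    Measurable (ballAvgAt μ w α k i) :=
  (Measurable.of_discrete (f := ballAvg μ w α (k + i))).comp (measurable_idx α (k + i))

lemma measurable_cubeMaximal (α : Fin n → Fin 3) (k : ℤ) :
    Measurable (cubeMaximal μ w α k) :=
  Measurable.iSup fun i => measurable_ballAvgAt α k i

lemma ballAvgAt_congr {α : Fin n → Fin 3} {k : ℤ} {i j : ℕ} (hji : j ≤ i)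
    {x y : EuclideanSpace ℝ (Fin n)} (h : idx α (k + i) x = idx α (k + i) y) :
    ballAvgAt μ w α k j x = ballAvgAt μ w α k j y := by
  rw [ballAvgAt, ballAvgAt, idx_eq_of_le (by omega : k + (j : ℤ) ≤ k + i) h]

/-- The points of a cube of level `k` where the average exceeds `lam` at the level `k + i` for
the first time, in the cube with index `p`. -/
def stoppingSet (μ : Measure (EuclideanSpace ℝ (Fin n))) (w : EuclideanSpace ℝ (Fin n) → ℝ)
    (α : Fin n → Fin 3) (k : ℤ) (m : Fin n → ℤ) (lam : ℝ≥0∞) (i : ℕ) (p : Fin n → ℤ) :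
    Set (EuclideanSpace ℝ (Fin n)) :=
  {x | x ∈ dyadicCube α k m ∧ idx α (k + i) x = p ∧ lam < ballAvgAt μ w α k i x ∧
    ∀ j < i, ballAvgAt μ w α k j x ≤ lam}

/-- The stopping condition at level `k + i` involves only averages over cubes of that level and of
coarser ones, so it is constant on cubes of level `k + i`. -/
lemma stoppingSet_eq {α : Fin n → Fin 3} {k : ℤ} {m : Fin n → ℤ} {lam : ℝ≥0∞} {i : ℕ}
    {p : Fin n → ℤ} {x : EuclideanSpace ℝ (Fin n)} (hx : x ∈ stoppingSet μ w α k m lam i p) :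
    stoppingSet μ w α k m lam i p = dyadicCube α (k + i) p := by
  obtain ⟨h1, h2, h3, h4⟩ := hx
  ext y
  rw [mem_dyadicCube_iff]
  refine ⟨fun hy => hy.2.1, fun hy => ?_⟩
  have hxy : idx α (k + i) x = idx α (k + i) y := h2.trans hy.symm
  refine ⟨?_, hy, ?_, fun j hj => ?_⟩
  · rw [mem_dyadicCube_iff] at h1 ⊢
    rw [← h1]
    exact (idx_eq_of_le (by omega) hxy).symm
  · rwa [← ballAvgAt_congr le_rfl hxy]
  · rw [← ballAvgAt_congr hj.le hxy]; exact h4 j hj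

lemma measurableSet_stoppingSet (α : Fin n → Fin 3) (k : ℤ) (m : Fin n → ℤ) (lam : ℝ≥0∞) (i : ℕ)
    (p : Fin n → ℤ) : MeasurableSet (stoppingSet μ w α k m lam i p) := by
  rcases (stoppingSet μ w α k m lam i p).eq_empty_or_nonempty with h | ⟨x, hx⟩
  · rw [h]; exact MeasurableSet.empty
  · rw [stoppingSet_eq hx]; exact measurableSet_dyadicCube _ _ _

/-- The part of a cube of level `k` where the maximal function exceeds `lam`. -/
def levelSet (μ : Measure (EuclideanSpace ℝ (Fin n))) (w : EuclideanSpace ℝ (Fin n) → ℝ)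
    (α : Fin n → Fin 3) (k : ℤ) (m : Fin n → ℤ) (lam : ℝ≥0∞) : Set (EuclideanSpace ℝ (Fin n)) :=
  {x | x ∈ dyadicCube α k m ∧ lam < cubeMaximal μ w α k x}

lemma measurableSet_levelSet (α : Fin n → Fin 3) (k : ℤ) (m : Fin n → ℤ) (lam : ℝ≥0∞) :
    MeasurableSet (levelSet μ w α k m lam) :=
  (measurableSet_dyadicCube α k m).inter
    (measurableSet_lt measurable_const (measurable_cubeMaximal α k))

lemma levelSet_eq_iUnion (α : Fin n → Fin 3) (k : ℤ) (m : Fin n → ℤ) (lam : ℝ≥0∞) :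
    levelSet μ w α k m lam =
      ⋃ q : ℕ × (Fin n → ℤ), stoppingSet μ w α k m lam q.1 q.2 := by
  classical
  ext x
  simp only [levelSet, mem_iUnion, Prod.exists]
  constructor
  · rintro ⟨hx, hlt⟩
    have hex : ∃ i, lam < ballAvgAt μ w α k i x := lt_iSup_iff.1 hlt
    refine ⟨Nat.find hex, _, hx, rfl, Nat.find_spec hex, fun j hj => ?_⟩
    exact not_lt.1 (Nat.find_min hex hj)
  · rintro ⟨i, p, hx, _, hlt, _⟩
    exact ⟨hx, hlt.trans_le (le_iSup (fun i => ballAvgAt μ w α k i x) i)⟩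

lemma pairwise_disjoint_stoppingSet (α : Fin n → Fin 3) (k : ℤ) (m : Fin n → ℤ) (lam : ℝ≥0∞) :
    Pairwise (Function.onFun Disjoint
      fun q : ℕ × (Fin n → ℤ) => stoppingSet μ w α k m lam q.1 q.2) := by
  rintro ⟨i, p⟩ ⟨j, q⟩ hne
  refine Set.disjoint_left.2 fun x ⟨_, h2, h3, h4⟩ ⟨_, h2', h3', h4'⟩ => hne ?_
  have hij : i = j := by
    rcases lt_trichotomy i j with h | h | h
    · exact absurd (h4' i h) (not_le.2 h3)
    · exact h
    · exact absurd (h4 j h) (not_le.2 h3')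
  subst hij
  simp only at h2 h2'
  rw [← h2, ← h2']

lemma lintegral_levelSet_le_of_stoppingSet {α : Fin n → Fin 3} {k : ℤ} {m : Fin n → ℤ}
    {lam : ℝ≥0∞} (f : EuclideanSpace ℝ (Fin n) → ℝ≥0∞) (c : ℝ≥0∞)
    (h : ∀ i p x, x ∈ stoppingSet μ w α k m lam i p →
      ∫⁻ y in stoppingSet μ w α k m lam i p, f y ∂μ ≤ c * μ (stoppingSet μ w α k m lam i p)) :
    ∫⁻ y in levelSet μ w α k m lam, f y ∂μ ≤ c * μ (levelSet μ w α k m lam) := by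
  have hm : ∀ q : ℕ × (Fin n → ℤ), MeasurableSet (stoppingSet μ w α k m lam q.1 q.2) := fun q =>
    measurableSet_stoppingSet α k m lam q.1 q.2
  have hd := pairwise_disjoint_stoppingSet (μ := μ) (w := w) α k m lam
  have h1 := lintegral_iUnion (μ := μ) hm hd f
  have h2 := measure_iUnion (μ := μ) hd hm
  rw [levelSet_eq_iUnion, h1, h2, ← ENNReal.tsum_mul_left]
  refine ENNReal.tsum_le_tsum fun q => ?_
  rcases (stoppingSet μ w α k m lam q.1 q.2).eq_empty_or_nonempty with h' | ⟨x, hx⟩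
  · rw [h']; simp
  · exact h _ _ _ hx

/-- The weight of the ball associated with a stopping cube is controlled through its parent. -/
lemma wMeasure_cubeBall_le_of_mem_stoppingSet (hμ : IsDoubling ν μ) (hn : 1 ≤ n)
    {α : Fin n → Fin 3} {k : ℤ} {m : Fin n → ℤ} {lam : ℝ≥0∞} (hlam : ballAvg μ w α k m ≤ lam)
    {i : ℕ} {p : Fin n → ℤ} {x : EuclideanSpace ℝ (Fin n)}
    (hx : x ∈ stoppingSet μ w α k m lam i p) :
    wMeasure μ w (cubeBall α (k + i) p) ≤
      doublingConst n ν * lam * μ (dyadicCube α (k + i) p) := by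
  obtain ⟨h1, h2, h3, h4⟩ := hx
  -- The top cube is never stopping, since its average is at most `lam`; hence the stopping cube has
  -- a parent whose average is still at most `lam`.
  obtain ⟨j, rfl⟩ : ∃ j, i = j + 1 := by
    refine Nat.exists_eq_succ_of_ne_zero ?_
    rintro rfl
    rw [mem_dyadicCube_iff] at h1
    rw [ballAvgAt, Nat.cast_zero, add_zero, h1] at h3
    exact absurd hlam (not_le.2 h3)
  have hj := h4 j (Nat.lt_succ_self j)
  set l : ℤ := k + j with hl
  have hl1 : k + ((j + 1 : ℕ) : ℤ) = l + 1 := by push_cast; ring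
  rw [hl1] at h2 ⊢
  have hsub : cubeBall α (l + 1) p ⊆ cubeBall α l (idx α l x) := by
    rw [← h2]; exact cubeBall_subset_of_lt (by omega) x
  -- The ball of the parent lies in a fixed dilate of the ball about the centre of the stopping
  -- cube, so doubling compares its measure with that of the stopping cube.
  have hsub2 : cubeBall α l (idx α l x) ⊆
      Metric.ball (center α (l + 1) p) (64 * n ^ 2 * (2 : ℝ) ^ (-(l + 1))) := by
    apply Metric.ball_subset_ball'
    have hc : center α (l + 1) p ∈ dyadicCube α l (idx α l x) := by
      rw [mem_dyadicCube_iff]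
      apply idx_eq_of_le (by omega : l ≤ l + 1)
      rw [h2]; exact mem_dyadicCube_iff.1 (center_mem α (l + 1) p)
    have hd := dist_center_le hc
    rw [dist_comm] at hd
    have h2' : (2 : ℝ) ^ (-l) = 2 * 2 ^ (-(l + 1)) := by
      rw [← zpow_one_add₀ two_ne_zero]; congr 1; ring
    have hpos : (0 : ℝ) < 2 ^ (-(l + 1)) := by positivity
    have hn' : (1 : ℝ) ≤ n := by exact_mod_cast hn
    rw [h2'] at hd ⊢
    have hnn : (n : ℝ) ≤ n ^ 2 := by nlinarith
    have := mul_le_mul_of_nonneg_right hnn hpos.le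
    nlinarith
  calc wMeasure μ w (cubeBall α (l + 1) p) ≤ wMeasure μ w (cubeBall α l (idx α l x)) :=
        measure_mono hsub
    _ = ballAvg μ w α l (idx α l x) * μ (cubeBall α l (idx α l x)) := (ballAvg_mul hμ hn α l _).symm
    _ ≤ lam * (doublingConst n ν * μ (dyadicCube α (l + 1) p)) := by
        gcongr
        · exact hj
        · exact (measure_mono hsub2).trans (hμ.measure_ball_le_cube α (l + 1) p)
    _ = _ := by ring

lemma lintegral_ballMaximal_le (hμ : IsDoubling ν μ) (hw : IsWeight μ w)
    (y : EuclideanSpace ℝ (Fin n)) {r : ℝ} (hr : 0 < r) :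
    ∫⁻ x in Metric.ball y r, ballMaximal μ ((Metric.ball y r).indicator w) x ∂μ ≤
      AinftyConst μ w * wMeasure μ w (Metric.ball y r) := by
  have h0 := hw.wMeasure_ne_zero (hμ.ball_pos y r hr).ne'
  have ht := (hw.ball_lt_top y r).ne
  rw [mul_comm, ← ENNReal.inv_mul_le_iff h0 ht]
  exact le_iSup_of_le y (le_iSup_of_le r (le_iSup_of_le hr le_rfl))

/-- On a stopping cube the coarser averages are below the one at the stopping level, and all finer
balls lie in the ball of the cube. So the maximal function is that of `w` restricted to this ball,
the definition of the `A_∞` constant applies, and the parent controls the weight of the ball. -/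
lemma lintegral_cubeMaximal_levelSet_le (hμ : IsDoubling ν μ) (hn : 1 ≤ n) (hw : IsWeight μ w)
    {α : Fin n → Fin 3} {k : ℤ} {m : Fin n → ℤ} {lam : ℝ≥0∞} (hlam : ballAvg μ w α k m ≤ lam) :
    ∫⁻ x in levelSet μ w α k m lam, cubeMaximal μ w α k x ∂μ ≤
      AinftyConst μ w * (doublingConst n ν * lam) * μ (levelSet μ w α k m lam) := by
  refine lintegral_levelSet_le_of_stoppingSet _ _ fun i p x hx => ?_
  have hR := stoppingSet_eq hx
  have hpos : (0 : ℝ) < 2 * n * 2 ^ (-(k + (i : ℤ))) := by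
    have : (0 : ℝ) < n := by exact_mod_cast hn
    positivity
  have hmax : ∀ y ∈ stoppingSet μ w α k m lam i p, cubeMaximal μ w α k y ≤
      ballMaximal μ ((cubeBall α (k + i) p).indicator w) y := by
    intro y hy
    have hbig : ∀ j, i ≤ j → ballAvgAt μ w α k j y ≤
        ballMaximal μ ((cubeBall α (k + i) p).indicator w) y := by
      intro j hij
      have hsub : cubeBall α (k + j) (idx α (k + j) y) ⊆ cubeBall α (k + i) p := by
        rw [← hy.2.1]
        rcases hij.eq_or_lt with rfl | h
        · exact subset_rfl
        · exact cubeBall_subset_of_lt (by omega) y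
      have hpos' : (0 : ℝ) < 2 * n * 2 ^ (-(k + (j : ℤ))) := by
        have : (0 : ℝ) < n := by exact_mod_cast hn
        positivity
      have hmem : y ∈ cubeBall α (k + j) (idx α (k + j) y) :=
        dyadicCube_subset_cubeBall hn _ _ _ (mem_dyadicCube_iff.2 rfl)
      refine le_trans ?_ (le_iSup_of_le (center α (k + j) (idx α (k + j) y)) (le_iSup_of_le _
        (le_iSup_of_le hpos' (le_iSup_of_le hmem le_rfl))))
      rw [avg_one, ballAvgAt, ballAvg, cubeBall, wMeasure_apply measurableSet_ball]
      refine mul_le_mul_right (setLIntegral_mono' measurableSet_ball fun u hu => ?_) _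
      rw [indicator_of_mem (hsub hu), hw.enorm_eq]
    refine iSup_le fun j => ?_
    rcases le_or_gt i j with h | h
    · exact hbig j h
    · exact ((hy.2.2.2 j h).trans hy.2.2.1.le).trans (hbig i le_rfl)
  calc ∫⁻ y in stoppingSet μ w α k m lam i p, cubeMaximal μ w α k y ∂μ
      ≤ ∫⁻ y in stoppingSet μ w α k m lam i p,
          ballMaximal μ ((cubeBall α (k + i) p).indicator w) y ∂μ :=
        setLIntegral_mono' (measurableSet_stoppingSet _ _ _ _ _ _) hmax
    _ ≤ ∫⁻ y in cubeBall α (k + i) p, ballMaximal μ ((cubeBall α (k + i) p).indicator w) y ∂μ := by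
        rw [hR]
        exact lintegral_mono_set (dyadicCube_subset_cubeBall hn _ _ _)
    _ ≤ AinftyConst μ w * wMeasure μ w (cubeBall α (k + i) p) :=
        lintegral_ballMaximal_le hμ hw _ hpos
    _ ≤ AinftyConst μ w * (doublingConst n ν * lam * μ (dyadicCube α (k + i) p)) := by
        gcongr
        exact wMeasure_cubeBall_le_of_mem_stoppingSet hμ hn hlam hx
    _ = _ := by rw [hR]; ring

lemma lintegral_weight_levelSet_le (hμ : IsDoubling ν μ) (hn : 1 ≤ n)
    {α : Fin n → Fin 3} {k : ℤ} {m : Fin n → ℤ} {lam : ℝ≥0∞} (hlam : ballAvg μ w α k m ≤ lam) :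
    ∫⁻ x in levelSet μ w α k m lam, ENNReal.ofReal (w x) ∂μ ≤
      doublingConst n ν * lam * μ (levelSet μ w α k m lam) := by
  refine lintegral_levelSet_le_of_stoppingSet _ _ fun i p x hx => ?_
  rw [stoppingSet_eq hx, ← wMeasure_apply (measurableSet_dyadicCube _ _ _)]
  exact (measure_mono (dyadicCube_subset_cubeBall hn _ _ _)).trans
    (wMeasure_cubeBall_le_of_mem_stoppingSet hμ hn hlam hx)

lemma IsWeight.isLocallyFiniteMeasure (hw : IsWeight μ w) :
    IsLocallyFiniteMeasure (wMeasure μ w) :=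
  ⟨fun x => ⟨Metric.ball x 1, Metric.ball_mem_nhds x one_pos, hw.ball_lt_top x 1⟩⟩

/-- Lebesgue differentiation of the measure `w dμ`, with centred balls compared by doubling to the
balls attached to the cubes through `x`. -/
lemma ae_le_cubeMaximal (hμ : IsDoubling ν μ) (hn : 1 ≤ n) (hw : IsWeight μ w)
    (α : Fin n → Fin 3) (k : ℤ) : ∀ᵐ x ∂μ,
      ENNReal.ofReal (w x) ≤ doublingConst n ν * cubeMaximal μ w α k x := by
  have := hμ.isLocallyFiniteMeasure
  have := hw.isLocallyFiniteMeasure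
  have h1 := Besicovitch.ae_tendsto_rnDeriv (wMeasure μ w) μ
  have h2 : (wMeasure μ w).rnDeriv μ =ᵐ[μ] fun x => ENNReal.ofReal (w x) :=
    Measure.rnDeriv_withDensity μ hw.measurable_ofReal
  filter_upwards [h1, h2] with x hx1 hx2
  rw [hx2] at hx1
  have hr : Filter.Tendsto (fun i : ℕ => (2 : ℝ) ^ (-(k + (i : ℤ)))) Filter.atTop
      (nhdsWithin 0 (Ioi 0)) := by
    rw [tendsto_nhdsWithin_iff]
    refine ⟨?_, Filter.Eventually.of_forall fun i => by
      rw [mem_Ioi]; positivity⟩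
    have e : (fun i : ℕ => (2 : ℝ) ^ (-(k + (i : ℤ)))) = fun i => 2 ^ (-k) * (1 / 2 : ℝ) ^ i := by
      funext i
      rw [neg_add, zpow_add₀ two_ne_zero, zpow_neg 2 (i : ℤ), zpow_natCast, one_div, inv_pow]
    rw [e, ← mul_zero ((2 : ℝ) ^ (-k))]
    exact (tendsto_pow_atTop_nhds_zero_of_lt_one (by norm_num) (by norm_num)).const_mul _
  refine le_of_tendsto (hx1.comp hr) (Filter.Eventually.of_forall fun i => ?_)
  simp only [Function.comp_apply]
  set l : ℤ := k + i with hl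
  have hl0 : (0 : ℝ) < 2 ^ (-l) := by positivity
  have hn' : (1 : ℝ) ≤ n := by exact_mod_cast hn
  have hxm : x ∈ dyadicCube α l (idx α l x) := mem_dyadicCube_iff.2 rfl
  have hd := dist_center_le hxm
  have hs1 : Metric.closedBall x ((2 : ℝ) ^ (-l)) ⊆ cubeBall α l (idx α l x) := by
    intro y hy
    rw [cubeBall, Metric.mem_ball]
    have := dist_triangle y x (center α l (idx α l x))
    have hy' := Metric.mem_closedBall.1 hy
    nlinarith
  have hs2 : cubeBall α l (idx α l x) ⊆ Metric.ball x (64 * n ^ 2 * (2 * (2 : ℝ) ^ (-l))) := by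
    apply Metric.ball_subset_ball'
    rw [dist_comm]
    have hnn : (n : ℝ) ≤ n ^ 2 := by nlinarith
    have := mul_le_mul_of_nonneg_right hnn hl0.le
    nlinarith
  have hb : Metric.ball x ((2 : ℝ) ^ (-l)) ⊆ Metric.closedBall x ((2 : ℝ) ^ (-l)) :=
    Metric.ball_subset_closedBall
  have h0 : μ (Metric.closedBall x ((2 : ℝ) ^ (-l))) ≠ 0 :=
    ((hμ.ball_pos x _ hl0).trans_le (measure_mono hb)).ne'
  have ht : μ (Metric.closedBall x ((2 : ℝ) ^ (-l))) ≠ ∞ :=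
    ne_top_of_le_ne_top (hμ.cubeBall_ne_top α l _) (measure_mono hs1)
  rw [ENNReal.div_le_iff h0 ht]
  calc wMeasure μ w (Metric.closedBall x ((2 : ℝ) ^ (-l)))
      ≤ wMeasure μ w (cubeBall α l (idx α l x)) := measure_mono hs1
    _ = ballAvg μ w α l (idx α l x) * μ (cubeBall α l (idx α l x)) := (ballAvg_mul hμ hn α l _).symm
    _ ≤ cubeMaximal μ w α k x * (doublingConst n ν *
          μ (Metric.closedBall x ((2 : ℝ) ^ (-l)))) := by
        gcongr
        · exact le_iSup (fun i => ballAvgAt μ w α k i x) i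
        · exact (measure_mono hs2).trans ((hμ.measure_ball_le x hl0).trans (by gcongr))
    _ = _ := by ring

lemma ballAvg_ne_zero (hμ : IsDoubling ν μ) (hn : 1 ≤ n) (hw : IsWeight μ w) (α : Fin n → Fin 3)
    (k : ℤ) (m : Fin n → ℤ) : ballAvg μ w α k m ≠ 0 :=
  mul_ne_zero (ENNReal.inv_ne_zero.2 (hμ.cubeBall_ne_top α k m))
    (hw.wMeasure_ne_zero (hμ.cubeBall_ne_zero hn α k m))

lemma ballAvg_ne_top (hμ : IsDoubling ν μ) (hn : 1 ≤ n) (hw : IsWeight μ w) (α : Fin n → Fin 3)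
    (k : ℤ) (m : Fin n → ℤ) : ballAvg μ w α k m ≠ ∞ :=
  ENNReal.mul_ne_top (ENNReal.inv_ne_top.2 (hμ.cubeBall_ne_zero hn α k m)) (hw.ball_lt_top _ _).ne

/-- For `a j = 2^j μ{M > 2^j lam}`, with `M` the maximal function, the tail from `j` on times `lam`
is at most `2 ∫ M` over the `j`-th level set, which the `A_∞` constant bounds by `K (a j) lam`. A
sequence dominating its tails in this way decays geometrically up to a window. -/
lemma exists_levelSet_small (hμ : IsDoubling ν μ) (hn : 1 ≤ n) (hw : IsWeight μ w) {K : ℕ}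
    (hK : 2 ≤ K) (hKA : 2 * (doublingConst n ν * AinftyConst μ w) ≤ K) (α : Fin n → Fin 3)
    (k : ℤ) (m : Fin n → ℤ) (j : ℕ) : ∃ i < K,
      2 ^ (j + i) * μ (levelSet μ w α k m (2 ^ (j + i) * ballAvg μ w α k m)) ≤
        (1 - (K : ℝ≥0∞)⁻¹) ^ j * μ (dyadicCube α k m) := by
  set lam := ballAvg μ w α k m with hlam
  have hl0 : lam ≠ 0 := ballAvg_ne_zero hμ hn hw α k m
  have hlt : lam ≠ ∞ := ballAvg_ne_top hμ hn hw α k m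
  set L : ℕ → Set (EuclideanSpace ℝ (Fin n)) := fun j => levelSet μ w α k m (2 ^ j * lam) with hL
  have hLm : ∀ j, MeasurableSet (L j) := fun j => measurableSet_levelSet _ _ _ _
  set a : ℕ → ℝ≥0∞ := fun j => 2 ^ j * μ (L j) with ha
  have hLQ : ∀ j, L j ⊆ dyadicCube α k m := fun j x hx => hx.1
  have ha0 : a 0 ≤ μ (dyadicCube α k m) := by
    simp only [ha, pow_zero, one_mul]; exact measure_mono (hLQ 0)
  have hle : ∀ j : ℕ, lam ≤ 2 ^ j * lam := fun j =>
    le_mul_of_one_le_left zero_le (one_le_pow₀ (by norm_num))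
  have htail : ∀ j, ∑' i, a (j + i) ≤ K * a j := by
    intro j
    rw [← ENNReal.mul_le_mul_iff_left hl0 hlt]
    calc (∑' i, a (j + i)) * lam = ∑' i, 2 ^ i * (2 ^ j * lam) * μ (L (j + i)) := by
          rw [← ENNReal.tsum_mul_right]
          refine tsum_congr fun i => ?_
          simp only [ha, pow_add]; ring
      _ = ∑' i, ∫⁻ x in L j, (L (j + i)).indicator (fun _ => 2 ^ i * (2 ^ j * lam)) x ∂μ := by
          refine tsum_congr fun i => ?_
          rw [lintegral_indicator (hLm _), setLIntegral_const, Measure.restrict_apply (hLm _),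
            inter_eq_self_of_subset_left]
          intro x hx
          refine ⟨hx.1, lt_of_le_of_lt ?_ hx.2⟩
          gcongr
          · norm_num
          · omega
      _ = ∫⁻ x in L j, ∑' i, (L (j + i)).indicator (fun _ => 2 ^ i * (2 ^ j * lam)) x ∂μ := by
          rw [lintegral_tsum]
          exact fun i => (measurable_const.indicator (hLm _)).aemeasurable
      _ ≤ ∫⁻ x in L j, 2 * cubeMaximal μ w α k x ∂μ := by
          refine lintegral_mono fun x => ?_
          refine le_trans (ENNReal.tsum_le_tsum fun i => ?_)
            (tsum_pow_two_lt_le (2 ^ j * lam) (cubeMaximal μ w α k x))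
          by_cases hx : x ∈ L (j + i)
          · rw [indicator_of_mem hx, if_pos]
            have := hx.2
            rwa [pow_add, mul_comm ((2 : ℝ≥0∞) ^ j), mul_assoc] at this
          · rw [indicator_of_notMem hx]; exact zero_le
      _ = 2 * ∫⁻ x in L j, cubeMaximal μ w α k x ∂μ :=
          lintegral_const_mul _ (measurable_cubeMaximal α k)
      _ ≤ 2 * (AinftyConst μ w * (doublingConst n ν * (2 ^ j * lam)) * μ (L j)) := by
          gcongr
          exact lintegral_cubeMaximal_levelSet_le hμ hn hw (hle j)
      _ = 2 * (doublingConst n ν * AinftyConst μ w) * (2 ^ j * μ (L j)) * lam := by ring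
      _ ≤ K * a j * lam := by gcongr
  obtain ⟨i, hi, h⟩ := exists_le_of_tail_le hK
    (ne_top_of_le_ne_top (hμ.cube_ne_top α k m) ha0) htail j
  exact ⟨i, hi, h.trans (by gcongr)⟩

/-- A quantitative form of the `A_∞` property. -/
theorem exists_exceptional_set (hμ : IsDoubling ν μ) (hn : 1 ≤ n) (hw : IsWeight μ w) {K : ℕ}
    (hK : 2 ≤ K) (hKA : 2 * (doublingConst n ν * AinftyConst μ w) ≤ K) (α : Fin n → Fin 3)
    (k : ℤ) (m : Fin n → ℤ) (t : ℕ) : ∃ G ⊆ dyadicCube α k m, MeasurableSet G ∧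
      ∫⁻ x in G, ENNReal.ofReal (w x) ∂μ ≤ 8 * doublingConst n ν *
        ((1 - (K : ℝ≥0∞)⁻¹) ^ t * (ballAvg μ w α k m * μ (dyadicCube α k m))) ∧
      ∀ᵐ x ∂μ.restrict (dyadicCube α k m), x ∉ G →
        ENNReal.ofReal (w x) ≤ 8 * doublingConst n ν * (2 ^ t * ballAvg μ w α k m) := by
  set lam := ballAvg μ w α k m with hlam
  have h8 : (1 : ℝ≥0∞) ≤ 8 * (1 - (K : ℝ≥0∞)⁻¹) ^ K := by
    calc (1 : ℝ≥0∞) = 8 * 8⁻¹ := (ENNReal.mul_inv_cancel (by simp) (by simp)).symm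
      _ ≤ _ := by gcongr; exact inv_eight_le_one_sub_inv_pow hK
  have hθ : (1 - (K : ℝ≥0∞)⁻¹) ≤ 1 := tsub_le_self
  -- For `t < K` the required decay factor is at least `1/8`, so the whole cube can serve as the
  -- exceptional set.
  rcases lt_or_ge t K with htK | htK
  · refine ⟨dyadicCube α k m, subset_rfl, measurableSet_dyadicCube α k m, ?_, ?_⟩
    · rw [← wMeasure_apply (measurableSet_dyadicCube α k m)]
      refine (wMeasure_cube_le_ballAvg hμ hn α k m).trans ?_
      calc doublingConst n ν * (lam * μ (dyadicCube α k m))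
          = 1 * doublingConst n ν * (lam * μ (dyadicCube α k m)) := by rw [one_mul]
        _ ≤ (8 * (1 - (K : ℝ≥0∞)⁻¹) ^ t) * doublingConst n ν * (lam * μ (dyadicCube α k m)) := by
            gcongr
            refine h8.trans ?_
            exact mul_le_mul_right (pow_le_pow_of_le_one zero_le hθ htK.le) _
        _ = _ := by ring
    · filter_upwards [ae_restrict_mem (measurableSet_dyadicCube α k m)] with x hx hx'
      exact absurd hx hx'
  -- The level is `2^(j+i)` with `i < K`: at most `2^t`, as needed off the set, while the decay `(1
  -- - 1/K)^j` on the set is within a factor `8` of `(1 - 1/K)^t`.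
  · obtain ⟨j, rfl⟩ : ∃ j, t = j + K := ⟨t - K, by omega⟩
    obtain ⟨i, hi, hsmall⟩ := exists_levelSet_small hμ hn hw hK hKA α k m j
    refine ⟨levelSet μ w α k m (2 ^ (j + i) * lam), fun x hx => hx.1,
      measurableSet_levelSet _ _ _ _, ?_, ?_⟩
    · refine (lintegral_weight_levelSet_le hμ hn
        (le_mul_of_one_le_left zero_le (one_le_pow₀ (by norm_num)))).trans ?_
      calc doublingConst n ν * (2 ^ (j + i) * lam) *
            μ (levelSet μ w α k m (2 ^ (j + i) * lam))
          = doublingConst n ν * lam *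
            (2 ^ (j + i) * μ (levelSet μ w α k m (2 ^ (j + i) * lam))) := by ring
        _ ≤ doublingConst n ν * lam * (1 * ((1 - (K : ℝ≥0∞)⁻¹) ^ j * μ (dyadicCube α k m))) := by
            rw [one_mul]; gcongr
        _ ≤ doublingConst n ν * lam * ((8 * (1 - (K : ℝ≥0∞)⁻¹) ^ K) *
            ((1 - (K : ℝ≥0∞)⁻¹) ^ j * μ (dyadicCube α k m))) := by gcongr
        _ = _ := by rw [pow_add]; ring
    · filter_upwards [ae_restrict_mem (measurableSet_dyadicCube α k m),
        ae_restrict_of_ae (ae_le_cubeMaximal hμ hn hw α k)] with x hx hx2 hx'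
      have h1 : cubeMaximal μ w α k x ≤ 2 ^ (j + i) * lam := by
        by_contra hcon
        exact hx' ⟨hx, not_le.1 hcon⟩
      calc ENNReal.ofReal (w x) ≤ doublingConst n ν * cubeMaximal μ w α k x := hx2
        _ ≤ doublingConst n ν * (2 ^ (j + K) * lam) := by
            gcongr
            refine h1.trans ?_
            gcongr
            norm_num
        _ ≤ 8 * (doublingConst n ν * (2 ^ (j + K) * lam)) :=
            le_mul_of_one_le_left zero_le (by norm_num)
        _ = _ := by ring

/-- The layer decomposition of averages bounded by one. -/
lemma exists_layer {a : ℝ≥0∞} (ha0 : a ≠ 0) (ha1 : a ≤ 1) :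
    ∃ k : ℕ, a ≤ 2⁻¹ ^ k ∧ 2⁻¹ ^ k ≤ 2 * a := by
  have hat : a ≠ ∞ := ne_top_of_le_ne_top ENNReal.one_ne_top ha1
  have hpos : 0 < a.toReal := ENNReal.toReal_pos ha0 hat
  have hle : a.toReal ≤ 1 := by
    rw [← ENNReal.toReal_one]; exact ENNReal.toReal_mono ENNReal.one_ne_top ha1
  obtain ⟨k, hk1, hk2⟩ := exists_nat_pow_near_of_lt_one (y := (2⁻¹ : ℝ)) hpos hle (by norm_num)
    (by norm_num)
  have e : ∀ k : ℕ, (2⁻¹ : ℝ≥0∞) ^ k = ENNReal.ofReal ((2⁻¹ : ℝ) ^ k) := by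
    intro k
    rw [ENNReal.ofReal_pow (by norm_num), ENNReal.ofReal_inv_of_pos two_pos]
    simp
  refine ⟨k, ?_, ?_⟩
  · rw [e, ← ENNReal.ofReal_toReal hat]
    exact ENNReal.ofReal_le_ofReal hk2
  · rw [← two_mul_inv_two_pow_succ]
    gcongr
    rw [e, ← ENNReal.ofReal_toReal hat]
    exact ENNReal.ofReal_le_ofReal hk1.le

/-! ### Averages, reverse Hölder powers, and layers -/

section Averages

variable {X : Type*} [MeasurableSpace X] {μ : Measure X}

lemma avg_toReal {F : Type*} [NormedAddCommGroup F] {p : ℝ≥0∞} (hp0 : p ≠ 0) (hp : p ≠ ∞)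
    (E : Set X) (f : X → F) :
    avg μ p E f = ((μ E)⁻¹ * ∫⁻ x in E, ‖f x‖ₑ ^ p.toReal ∂μ) ^ (1 / p.toReal) := by
  rw [avg, eLpNorm_eq_lintegral_rpow_enorm_toReal hp0 hp, lintegral_smul_measure, smul_eq_mul]

lemma avg_top {F : Type*} [NormedAddCommGroup F] {E : Set X} (hE : μ E ≠ ∞) (f : X → F) :
    avg μ ∞ E f = essSup (fun x => ‖f x‖ₑ) (μ.restrict E) := by
  rw [avg, eLpNorm_exponent_top, eLpNormEssSup, essSup, essSup,
    Measure.ae_ennreal_smul_measure_eq (ENNReal.inv_ne_zero.2 hE)]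

end Averages

variable {n : ℕ} {ν : ℝ} {μ : Measure (EuclideanSpace ℝ (Fin n))}
  {w : EuclideanSpace ℝ (Fin n) → ℝ}

lemma IsWeight.ofReal_rpow (hw : IsWeight μ w) {s : ℝ} (x : EuclideanSpace ℝ (Fin n)) :
    ENNReal.ofReal (w x ^ s) = ENNReal.ofReal (w x) ^ s :=
  (ENNReal.ofReal_rpow_of_pos (hw.pos x)).symm

lemma IsWeight.wMeasure_cube_ne_top (hw : IsWeight μ w) (α : Fin n → Fin 3) (k : ℤ)
    (m : Fin n → ℤ) : wMeasure μ w (dyadicCube α k m) ≠ ∞ :=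
  ne_top_of_le_ne_top (hw.ball_lt_top _ _).ne (measure_mono (dyadicCube_subset_ball α k m))

lemma avg_le_RHconst (hμ : IsDoubling ν μ) (hw : IsWeight μ w) {s : ℝ≥0∞} (hs : s ≠ 1)
    {Q : Set (EuclideanSpace ℝ (Fin n))} (hQ : Q ∈ dyadicCubes n) :
    avg μ s Q w ≤ RHconst μ w s * avg μ 1 Q w := by
  obtain ⟨α, k, m, rfl⟩ := hQ
  have h1 : avg μ s (dyadicCube α k m) w * (avg μ 1 (dyadicCube α k m) w)⁻¹ ≤ RHconst μ w s := by
    rw [RHconst, if_neg hs]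
    exact le_iSup₂ (f := fun (Q : Set (EuclideanSpace ℝ (Fin n))) (_ : Q ∈ dyadicCubes n) =>
      avg μ s Q w * (avg μ 1 Q w)⁻¹) (dyadicCube α k m) ⟨α, k, m, rfl⟩
  have e := hw.avg_one_eq (μ := μ) (measurableSet_dyadicCube α k m)
  have h0 : avg μ 1 (dyadicCube α k m) w ≠ 0 := by
    rw [e]
    exact mul_ne_zero (ENNReal.inv_ne_zero.2 (hμ.cube_ne_top α k m))
      (hw.wMeasure_ne_zero (hμ.cube_ne_zero α k m))
  have ht : avg μ 1 (dyadicCube α k m) w ≠ ∞ := by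
    rw [e]
    exact ENNReal.mul_ne_top (ENNReal.inv_ne_top.2 (hμ.cube_ne_zero α k m))
      (hw.wMeasure_cube_ne_top α k m)
  rw [← div_eq_mul_inv, ENNReal.div_le_iff h0 ht] at h1
  exact h1

/-- The power `w ^ s` of a weight satisfying a reverse Hölder condition is a weight. -/
lemma IsWeight.rpow (hμ : IsDoubling ν μ) (hw : IsWeight μ w) {s : ℝ≥0∞} (hs0 : s ≠ 0) (hs : s ≠ 1)
    (hst : s ≠ ∞) (hRH : RHconst μ w s < ∞) : IsWeight μ (fun x => w x ^ s.toReal) where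
  measurable := hw.measurable.pow_const _
  pos x := Real.rpow_pos_of_pos (hw.pos x) _
  ball_lt_top x r := by
    rcases le_or_gt r 0 with hr | hr
    · rw [Metric.ball_eq_empty.2 hr]; simp
    obtain ⟨α, k, m, hsub, -⟩ := exists_ball_subset_dyadicCube x hr
    refine (measure_mono hsub).trans_lt ?_
    rw [wMeasure_apply (measurableSet_dyadicCube α k m)]
    have h1 := avg_le_RHconst hμ hw hs (Q := dyadicCube α k m) ⟨α, k, m, rfl⟩
    have hpos : 0 < s.toReal := ENNReal.toReal_pos hs0 hst
    have h2 : avg μ s (dyadicCube α k m) w < ∞ := by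
      refine h1.trans_lt (ENNReal.mul_lt_top hRH ?_)
      rw [hw.avg_one_eq (measurableSet_dyadicCube α k m)]
      exact ENNReal.mul_lt_top (ENNReal.inv_lt_top.2 (hμ.cube_ne_zero α k m).bot_lt)
        (hw.wMeasure_cube_ne_top α k m).lt_top
    rw [avg_toReal hs0 hst, ENNReal.rpow_lt_top_iff_of_pos (by positivity)] at h2
    have h3 : ∫⁻ y in dyadicCube α k m, ‖w y‖ₑ ^ s.toReal ∂μ ≠ ∞ := by
      intro h
      rw [h, ENNReal.mul_top (ENNReal.inv_ne_zero.2 (hμ.cube_ne_top α k m))] at h2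
      exact lt_irrefl _ h2
    simp_rw [hw.ofReal_rpow]
    simp_rw [hw.enorm_eq] at h3
    exact h3.lt_top

/-- The reverse Hölder condition replaces the `L^s` average of `w` by its mean, and the essential
supremum commutes with increasing powers. So `w^s` satisfies an `A_1` condition. -/
lemma A1const_rpow_le (hμ : IsDoubling ν μ) (hw : IsWeight μ w) {s : ℝ≥0∞} (hs0 : s ≠ 0)
    (hs : s ≠ 1) (hst : s ≠ ∞) :
    A1const μ (fun x => w x ^ s.toReal) ≤ (RHconst μ w s * A1const μ w) ^ s.toReal := by
  refine iSup₂_le fun Q hQ => ?_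
  have hle : avg μ 1 Q w * avg μ ∞ Q (fun x => (w x)⁻¹) ≤ A1const μ w :=
    le_iSup₂ (f := fun (Q : Set (EuclideanSpace ℝ (Fin n))) (_ : Q ∈ dyadicCubes n) =>
      avg μ 1 Q w * avg μ ∞ Q (fun x => (w x)⁻¹)) Q hQ
  have h1 := avg_le_RHconst hμ hw hs hQ
  have hpos : 0 < s.toReal := ENNReal.toReal_pos hs0 hst
  obtain ⟨α, k, m, rfl⟩ := hQ
  set Q := dyadicCube α k m
  have e1 : avg μ 1 Q (fun x => w x ^ s.toReal) = avg μ s Q w ^ s.toReal := by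
    rw [avg_toReal hs0 hst, ← ENNReal.rpow_mul, one_div_mul_cancel hpos.ne', ENNReal.rpow_one,
      avg_one]
    congr 1
    refine lintegral_congr fun x => ?_
    rw [Real.enorm_rpow_of_nonneg (hw.pos x).le hpos.le]
  have e2 : avg μ ∞ Q (fun x => (w x ^ s.toReal)⁻¹) =
      avg μ ∞ Q (fun x => (w x)⁻¹) ^ s.toReal := by
    rw [avg_top (hμ.cube_ne_top α k m), avg_top (hμ.cube_ne_top α k m)]
    have := (ENNReal.orderIsoRpow s.toReal hpos).essSup_apply (fun x => ‖(w x)⁻¹‖ₑ) (μ.restrict Q)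
    simp only [ENNReal.orderIsoRpow_apply] at this
    rw [this]
    congr 1
    funext x
    rw [← Real.inv_rpow (hw.pos x).le,
      Real.enorm_rpow_of_nonneg (inv_nonneg.2 (hw.pos x).le) hpos.le]
  rw [e1, e2, ← ENNReal.mul_rpow_of_nonneg _ _ hpos.le]
  refine ENNReal.rpow_le_rpow ?_ hpos.le
  calc avg μ s Q w * avg μ ∞ Q (fun x => (w x)⁻¹)
      ≤ RHconst μ w s * avg μ 1 Q w * avg μ ∞ Q (fun x => (w x)⁻¹) := by gcongr
    _ = RHconst μ w s * (avg μ 1 Q w * avg μ ∞ Q (fun x => (w x)⁻¹)) := by ring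
    _ ≤ _ := by gcongr

/-- A natural number comparable to the `A_∞` constant. -/
lemma exists_nat_AinftyConst (hμ : IsDoubling ν μ) (hw : IsWeight μ w)
    (hA : AinftyConst μ w ≠ ∞) : ∃ K : ℕ, 2 ≤ K ∧
      2 * (doublingConst n ν * AinftyConst μ w) ≤ K ∧
      (K : ℝ≥0∞) ≤ (2 * doublingConst n ν + 3) * AinftyConst μ w := by
  set x : ℝ≥0 := 2 * (doublingConst n ν * (AinftyConst μ w).toNNReal) with hx
  have hx' : (x : ℝ≥0∞) = 2 * (doublingConst n ν * AinftyConst μ w) := by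
    rw [hx]; push_cast; rw [ENNReal.coe_toNNReal hA]
  refine ⟨⌈x⌉₊ + 2, by omega, ?_, ?_⟩
  · rw [← hx']
    have : x ≤ ((⌈x⌉₊ + 2 : ℕ) : ℝ≥0) := by
      push_cast; exact (Nat.le_ceil x).trans (by simp)
    exact_mod_cast this
  · have h1 : ((⌈x⌉₊ + 2 : ℕ) : ℝ≥0) ≤ x + 3 := by
      push_cast
      have := (Nat.ceil_lt_add_one (zero_le (a := x))).le
      calc (⌈x⌉₊ : ℝ≥0) + 2 ≤ x + 1 + 2 := by gcongr
        _ = x + 3 := by ring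
    calc ((⌈x⌉₊ + 2 : ℕ) : ℝ≥0∞) ≤ (x : ℝ≥0∞) + 3 := by exact_mod_cast h1
      _ ≤ 2 * (doublingConst n ν * AinftyConst μ w) + 3 * AinftyConst μ w := by
          rw [hx']
          gcongr
          exact le_mul_of_one_le_right zero_le (one_le_AinftyConst hμ hw)
      _ = _ := by ring

/-! ### The threshold layer -/

/-- Taking `k₀` to be about `γ⁻¹ log₂(cK)` makes `2^(-γ k₀) cK ≤ 1`. The geometric sum with ratio
`2^(1-γ) > 1` is then of the order of its last term `2^((1-γ) k₀)`, that is `K^(1/γ - 1)`. -/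
lemma exists_threshold (c : ℝ) {γ : ℝ} (hγ : 0 < γ) (hγ1 : γ < 1) :
    ∃ C > 0, ∀ K : ℝ, 1 ≤ K → ∃ k₀ : ℕ, ((2⁻¹ : ℝ) ^ γ) ^ k₀ * (c * K) ≤ 1 ∧
      ∑ i ∈ Finset.range (k₀ + 1), (2 * (2⁻¹ : ℝ) ^ γ) ^ i ≤ C * K ^ (1 / γ - 1) := by
  set c' := max c 1 with hc'
  have hc1 : 1 ≤ c' := le_max_right _ _
  have hc0 : 0 < c' := by linarith
  set y : ℝ := 2 * (2⁻¹ : ℝ) ^ γ with hy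
  have hy' : y = 2 ^ (1 - γ) := by
    rw [hy, Real.inv_rpow two_pos.le, Real.rpow_sub two_pos, Real.rpow_one]; rfl
  have hy1 : 1 < y := by
    rw [hy']; exact Real.one_lt_rpow (by norm_num) (by linarith)
  refine ⟨y * y * c' ^ (1 / γ - 1) / (y - 1), by
    have : 0 < y - 1 := by linarith
    positivity, fun K hK => ?_⟩
  have hK0 : 0 < K := by linarith
  have hcK : 1 ≤ c' * K := one_le_mul_of_one_le_of_one_le hc1 hK
  set L := Real.logb 2 (c' * K) with hL
  have hL0 : 0 ≤ L := Real.logb_nonneg (by norm_num) hcK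
  have h2L : (2 : ℝ) ^ L = c' * K := Real.rpow_logb two_pos (by norm_num) (by positivity)
  refine ⟨⌈L / γ⌉₊, ?_, ?_⟩
  · have h1 : L ≤ γ * ⌈L / γ⌉₊ := by
      have := Nat.le_ceil (L / γ)
      rw [div_le_iff₀ hγ] at this
      linarith
    have h2 : c * K ≤ 2 ^ (γ * ⌈L / γ⌉₊) := by
      calc c * K ≤ c' * K := by gcongr; exact le_max_left _ _
        _ = 2 ^ L := h2L.symm
        _ ≤ _ := Real.rpow_le_rpow_of_exponent_le (by norm_num) h1
    have h3 : ((2⁻¹ : ℝ) ^ γ) ^ ⌈L / γ⌉₊ = (2 ^ (γ * ⌈L / γ⌉₊))⁻¹ := by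
      rw [← Real.rpow_natCast, ← Real.rpow_mul (by norm_num), Real.inv_rpow two_pos.le]
    rw [h3]
    rw [inv_mul_le_iff₀ (by positivity), mul_one]
    exact h2
  · rw [geom_sum_eq hy1.ne']
    have h4 : (⌈L / γ⌉₊ : ℝ) ≤ L / γ + 1 := (Nat.ceil_lt_add_one (by positivity)).le
    have h5 : y ^ ⌈L / γ⌉₊ ≤ y * (c' * K) ^ (1 / γ - 1) := by
      calc y ^ ⌈L / γ⌉₊ = y ^ (⌈L / γ⌉₊ : ℝ) := (Real.rpow_natCast _ _).symm
        _ ≤ y ^ (L / γ + 1) := Real.rpow_le_rpow_of_exponent_le hy1.le h4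
        _ = y * (c' * K) ^ (1 / γ - 1) := by
          rw [Real.rpow_add (by linarith), Real.rpow_one, ← h2L, hy', ← Real.rpow_mul two_pos.le,
            ← Real.rpow_mul two_pos.le, mul_comm]
          congr 2
          field_simp
    rw [div_mul_eq_mul_div]
    have hy0 : 0 < y - 1 := by linarith
    gcongr
    calc y ^ (⌈L / γ⌉₊ + 1) - 1 ≤ y ^ ⌈L / γ⌉₊ * y := by rw [pow_succ]; linarith
      _ ≤ (y * (c' * K) ^ (1 / γ - 1)) * y := by gcongr
      _ = _ := by rw [Real.mul_rpow hc0.le hK0.le]; ring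

/-- The endpoint `γ = 1`: the ratio of the geometric sum is `1`, so the sum merely counts the layers
and the power of `K` degenerates to a logarithm. -/
lemma exists_threshold_one (c : ℝ) :
    ∃ C > 0, ∀ K : ℝ, 1 ≤ K → ∃ k₀ : ℕ, (2⁻¹ : ℝ) ^ k₀ * (c * K) ≤ 1 ∧
      (k₀ : ℝ) + 1 ≤ C * Real.log (Real.exp 1 + K) := by
  set c' := max c 1 with hc'
  have hc1 : 1 ≤ c' := le_max_right _ _
  have hc0 : 0 < c' := by linarith
  have hl2 : 0 < Real.log 2 := Real.log_pos (by norm_num)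
  have hlc : 0 ≤ Real.log c' := Real.log_nonneg hc1
  refine ⟨Real.log c' / Real.log 2 + 1 / Real.log 2 + 2, by positivity, fun K hK => ?_⟩
  have hK0 : 0 < K := by linarith
  have hcK : 1 ≤ c' * K := one_le_mul_of_one_le_of_one_le hc1 hK
  set L := Real.logb 2 (c' * K) with hL
  have hL0 : 0 ≤ L := Real.logb_nonneg (by norm_num) hcK
  have h2L : (2 : ℝ) ^ L = c' * K := Real.rpow_logb two_pos (by norm_num) (by positivity)
  refine ⟨⌈L⌉₊, ?_, ?_⟩
  · have h2 : c * K ≤ 2 ^ ⌈L⌉₊ := by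
      calc c * K ≤ c' * K := by gcongr; exact le_max_left _ _
        _ = 2 ^ L := h2L.symm
        _ ≤ 2 ^ (⌈L⌉₊ : ℝ) := Real.rpow_le_rpow_of_exponent_le (by norm_num) (Nat.le_ceil L)
        _ = _ := Real.rpow_natCast _ _
    rw [inv_pow, inv_mul_le_iff₀ (by positivity), mul_one]
    exact h2
  · have h4 : (⌈L⌉₊ : ℝ) ≤ L + 1 := (Nat.ceil_lt_add_one hL0).le
    have h5 : L = Real.log c' / Real.log 2 + Real.log K / Real.log 2 := by
      rw [hL, Real.logb, Real.log_mul hc0.ne' hK0.ne', add_div]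
    have he : 0 < Real.exp 1 := Real.exp_pos 1
    set M := Real.log (Real.exp 1 + K) with hM
    have h6 : 1 ≤ M := by
      rw [hM, Real.le_log_iff_exp_le (by positivity)]; linarith
    have h7 : Real.log K ≤ M := Real.log_le_log hK0 (by linarith)
    calc (⌈L⌉₊ : ℝ) + 1 ≤ Real.log c' / Real.log 2 + Real.log K / Real.log 2 + 2 := by linarith
      _ ≤ Real.log c' / Real.log 2 * M + M / Real.log 2 + 2 * M := by
          gcongr
          · exact le_mul_of_one_le_right (by positivity) h6
          · linarith
      _ = _ := by ring

lemma logE_eq {a : ℝ≥0∞} (ha : a ≠ ∞) :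
    logE a = ENNReal.ofReal (Real.log (Real.exp 1 + a.toReal)) := by
  rw [logE]
  have h : ENNReal.ofReal (Real.exp 1) + a = ENNReal.ofReal (Real.exp 1 + a.toReal) := by
    rw [ENNReal.ofReal_add (Real.exp_pos 1).le ENNReal.toReal_nonneg, ENNReal.ofReal_toReal ha]
  rw [h, ENNReal.log_ofReal_of_pos (by positivity)]
  rfl

lemma one_le_logE (a : ℝ≥0∞) : 1 ≤ logE a := by
  rcases eq_or_ne a ∞ with rfl | ha
  · simp [logE]
  · rw [logE_eq ha, ← ENNReal.ofReal_one]
    apply ENNReal.ofReal_le_ofReal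
    rw [Real.le_log_iff_exp_le (by positivity)]
    linarith [ENNReal.toReal_nonneg (a := a)]

lemma ofReal_log_le_logE {K : ℕ} {a : ℝ≥0∞} (ha : a ≠ ∞) {c : ℝ≥0} (hc : 1 ≤ c)
    (h : (K : ℝ≥0∞) ≤ c * a) :
    ENNReal.ofReal (Real.log (Real.exp 1 + K)) ≤ ENNReal.ofReal (Real.log c + 1) * logE a := by
  rw [logE_eq ha, ← ENNReal.ofReal_mul (by
    have := Real.log_nonneg (x := c) (by exact_mod_cast hc)
    positivity)]
  apply ENNReal.ofReal_le_ofReal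
  have hK : (K : ℝ) ≤ c * a.toReal := by
    have := ENNReal.toReal_mono (ENNReal.mul_ne_top ENNReal.coe_ne_top ha) h
    simpa using this
  have he : 0 < Real.exp 1 := Real.exp_pos 1
  have ha0 : 0 ≤ a.toReal := ENNReal.toReal_nonneg
  have hc1 : (1 : ℝ) ≤ c := by exact_mod_cast hc
  have h1 : 1 ≤ Real.log (Real.exp 1 + a.toReal) := by
    rw [Real.le_log_iff_exp_le (by positivity)]; linarith
  have hlc : 0 ≤ Real.log c := Real.log_nonneg hc1
  calc Real.log (Real.exp 1 + K) ≤ Real.log (c * (Real.exp 1 + a.toReal)) := by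
        apply Real.log_le_log (by positivity)
        nlinarith
    _ = Real.log c + Real.log (Real.exp 1 + a.toReal) := by
        rw [Real.log_mul (by positivity) (by positivity)]
    _ ≤ Real.log c * Real.log (Real.exp 1 + a.toReal) + Real.log (Real.exp 1 + a.toReal) := by
        gcongr
        exact le_mul_of_one_le_right hlc h1
    _ = _ := by ring

variable {n : ℕ} {ν : ℝ}

open Classical in
/-- The factor in the estimate of sparse forms with `q₀ = ∞`, as a function of the
`A_∞` constant. -/
def topFactor (γ : ℝ) (a : ℝ≥0∞) : ℝ≥0∞ := if γ = 1 then logE a else a ^ (1 / γ - 1)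

lemma exists_threshold_ennreal (Λ : ℕ) (c₂ : ℝ≥0) (hc₂ : 1 ≤ c₂) {γ : ℝ} (hγ : 0 < γ)
    (hγ1 : γ ≤ 1) {ζ : ℝ≥0} (hζ : 0 < ζ) : ∃ C : ℝ≥0, ∀ (K : ℕ) (a : ℝ≥0∞), 2 ≤ K → a ≠ ∞ →
      (K : ℝ≥0∞) ≤ c₂ * a → ∃ k₀ : ℕ,
        ((2⁻¹ : ℝ≥0∞) ^ γ) ^ k₀ * (8 * Λ * K) * (1 - (2⁻¹ : ℝ≥0∞) ^ γ)⁻¹ ≤ ζ ∧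
        ∑ i ∈ Finset.range (k₀ + 1), (2 * (2⁻¹ : ℝ≥0∞) ^ γ) ^ i ≤ C * topFactor γ a := by
  set b : ℝ := (2⁻¹ : ℝ) ^ γ with hb
  have hb0 : 0 < b := by positivity
  have hb1 : b < 1 := Real.rpow_lt_one (by norm_num) (by norm_num) hγ
  have hbE : (2⁻¹ : ℝ≥0∞) ^ γ = ENNReal.ofReal b := by
    rw [hb, ← ENNReal.ofReal_rpow_of_pos (by norm_num), ENNReal.ofReal_inv_of_pos two_pos]
    simp
  have hζ' : (0 : ℝ) < ζ := by exact_mod_cast hζ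
  set c : ℝ := 8 * Λ * (1 - b)⁻¹ / ζ with hc
  have h1b : 0 < 1 - b := by linarith
  have hconv : ∀ (K k₀ : ℕ), b ^ k₀ * (c * K) ≤ 1 →
      ((2⁻¹ : ℝ≥0∞) ^ γ) ^ k₀ * (8 * Λ * K) * (1 - (2⁻¹ : ℝ≥0∞) ^ γ)⁻¹ ≤ ζ := by
    intro K k₀ h
    have e1 : (1 - (2⁻¹ : ℝ≥0∞) ^ γ)⁻¹ = ENNReal.ofReal (1 - b)⁻¹ := by
      rw [hbE, ENNReal.ofReal_inv_of_pos h1b, ENNReal.ofReal_sub _ hb0.le, ENNReal.ofReal_one]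
    have e2 : (8 * Λ * K : ℝ≥0∞) = ENNReal.ofReal (8 * Λ * K) := by
      rw [ENNReal.ofReal_mul (by positivity), ENNReal.ofReal_mul (by positivity),
        ENNReal.ofReal_natCast, ENNReal.ofReal_natCast]
      simp
    rw [e1, e2, hbE, ← ENNReal.ofReal_pow hb0.le, ← ENNReal.ofReal_mul (by positivity),
      ← ENNReal.ofReal_mul (by positivity), ← ENNReal.ofReal_coe_nnreal]
    apply ENNReal.ofReal_le_ofReal
    have e3 : b ^ k₀ * (8 * Λ * K) * (1 - b)⁻¹ = (b ^ k₀ * (c * K)) * ζ := by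
      rw [hc]; field_simp
    rw [e3]
    exact mul_le_of_le_one_left hζ'.le h
  have hsum : ∀ k₀ : ℕ, ∑ i ∈ Finset.range (k₀ + 1), (2 * (2⁻¹ : ℝ≥0∞) ^ γ) ^ i =
      ENNReal.ofReal (∑ i ∈ Finset.range (k₀ + 1), (2 * b) ^ i) := by
    intro k₀
    rw [ENNReal.ofReal_sum_of_nonneg fun i _ => by positivity]
    refine Finset.sum_congr rfl fun i _ => ?_
    rw [hbE, ENNReal.ofReal_pow (by positivity), ENNReal.ofReal_mul two_pos.le]
    simp
  rcases hγ1.lt_or_eq with hlt | rfl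
  · obtain ⟨C, hC, h⟩ := exists_threshold c hγ hlt
    have hexp : 0 ≤ 1 / γ - 1 := by
      rw [sub_nonneg, le_div_iff₀ hγ]; linarith
    refine ⟨Real.toNNReal C * c₂ ^ (1 / γ - 1), fun K a hK ha hKa => ?_⟩
    obtain ⟨k₀, h1, h2⟩ := h K (by exact_mod_cast (by omega : 1 ≤ K))
    refine ⟨k₀, hconv K k₀ h1, ?_⟩
    rw [hsum, topFactor, if_neg hlt.ne]
    calc _ ≤ ENNReal.ofReal (C * (K : ℝ) ^ (1 / γ - 1)) := ENNReal.ofReal_le_ofReal h2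
      _ = ENNReal.ofReal C * (K : ℝ≥0∞) ^ (1 / γ - 1) := by
          rw [ENNReal.ofReal_mul hC.le, ← ENNReal.ofReal_rpow_of_nonneg (by positivity) hexp,
            ENNReal.ofReal_natCast]
      _ ≤ ENNReal.ofReal C * (c₂ * a) ^ (1 / γ - 1) := by gcongr
      _ = _ := by
          rw [ENNReal.mul_rpow_of_nonneg _ _ hexp, ENNReal.coe_mul,
            ENNReal.coe_rpow_of_nonneg _ hexp, ENNReal.ofReal]
          ring
  · obtain ⟨C, hC, h⟩ := exists_threshold_one c
    refine ⟨Real.toNNReal C * Real.toNNReal (Real.log c₂ + 1), fun K a hK ha hKa => ?_⟩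
    obtain ⟨k₀, h1, h2⟩ := h K (by exact_mod_cast (by omega : 1 ≤ K))
    refine ⟨k₀, hconv K k₀ (by rw [hb, Real.rpow_one]; exact h1), ?_⟩
    rw [hsum, topFactor, if_pos rfl]
    have e : ∑ i ∈ Finset.range (k₀ + 1), (2 * b) ^ i = (k₀ : ℝ) + 1 := by
      rw [hb, Real.rpow_one]; norm_num
    rw [e]
    calc _ ≤ ENNReal.ofReal (C * Real.log (Real.exp 1 + K)) := ENNReal.ofReal_le_ofReal h2
      _ = ENNReal.ofReal C * ENNReal.ofReal (Real.log (Real.exp 1 + K)) := ENNReal.ofReal_mul hC.le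
      _ ≤ ENNReal.ofReal C * (ENNReal.ofReal (Real.log c₂ + 1) * logE a) := by
          gcongr
          exact ofReal_log_le_logE ha hc₂ hKa
      _ = _ := by rw [ENNReal.coe_mul, ENNReal.ofReal, ENNReal.ofReal]; ring

/-! ### The estimate in a single grid for `q₀ = ∞` -/

lemma exists_layer_fun {X : Type*} [MeasurableSpace X] {μ : Measure X} {S : Finset (Set X)} {Λ : ℕ}
    (hS : IsCarleson μ S Λ) {h : X → ℝ≥0∞} (hle : ∀ Q ∈ S, ∫⁻ x in Q, h x ∂μ ≤ μ Q)
    (hpos : ∀ Q ∈ S, ∫⁻ x in Q, h x ∂μ ≠ 0) : ∃ k : Set X → ℕ,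
      (∀ Q ∈ S, ∫⁻ x in Q, h x ∂μ ≤ 2⁻¹ ^ k Q * μ Q) ∧
      (∀ Q ∈ S, 2⁻¹ ^ k Q * μ Q ≤ 2 * ∫⁻ x in Q, h x ∂μ) ∧
      (∀ Q ∈ S, (μ Q)⁻¹ * ∫⁻ x in Q, h x ∂μ ≤ 2⁻¹ ^ k Q) := by
  have hex : ∀ Q : Set X, ∃ k : ℕ, Q ∈ S → (μ Q)⁻¹ * ∫⁻ x in Q, h x ∂μ ≤ 2⁻¹ ^ k ∧
      2⁻¹ ^ k ≤ 2 * ((μ Q)⁻¹ * ∫⁻ x in Q, h x ∂μ) := by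
    intro Q
    by_cases hQ : Q ∈ S
    · obtain ⟨k, hk⟩ := exists_layer (a := (μ Q)⁻¹ * ∫⁻ x in Q, h x ∂μ)
        (mul_ne_zero (ENNReal.inv_ne_zero.2 (hS.ne_top Q hQ)) (hpos Q hQ))
        (by
          rw [ENNReal.inv_mul_le_iff (hS.ne_zero Q hQ) (hS.ne_top Q hQ), mul_one]
          exact hle Q hQ)
      exact ⟨k, fun _ => hk⟩
    · exact ⟨0, fun h => absurd h hQ⟩
  choose k hk using hex
  refine ⟨k, fun Q hQ => ?_, fun Q hQ => ?_, fun Q hQ => (hk Q hQ).1⟩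
  · have := (hk Q hQ).1
    rwa [ENNReal.inv_mul_le_iff (hS.ne_zero Q hQ) (hS.ne_top Q hQ), mul_comm] at this
  · calc 2⁻¹ ^ k Q * μ Q ≤ 2 * ((μ Q)⁻¹ * ∫⁻ x in Q, h x ∂μ) * μ Q := by
          gcongr; exact (hk Q hQ).2
      _ = 2 * (∫⁻ x in Q, h x ∂μ) * ((μ Q)⁻¹ * μ Q) := by ring
      _ = _ := by rw [ENNReal.inv_mul_cancel (hS.ne_zero Q hQ) (hS.ne_top Q hQ), mul_one]

/-- Cubes with vanishing average belong to no layer; they contribute nothing because `γ > 0`. -/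
lemma IsCarleson.sum_filter_pos {X : Type*} [MeasurableSpace X] {μ : Measure X}
    (S : Finset (Set X)) (h : X → ℝ≥0∞) {γ : ℝ} (hγ : 0 < γ) (b : Set X → ℝ≥0∞) :
    ∑ Q ∈ S, ((μ Q)⁻¹ * ∫⁻ x in Q, h x ∂μ) ^ γ * b Q =
      ∑ Q ∈ (open Classical in S.filter fun Q => ∫⁻ x in Q, h x ∂μ ≠ 0),
        ((μ Q)⁻¹ * ∫⁻ x in Q, h x ∂μ) ^ γ * b Q := by
  classical
  symm
  apply Finset.sum_subset (Finset.filter_subset _ _)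
  intro Q hQ hQ'
  have : ∫⁻ x in Q, h x ∂μ = 0 := by
    by_contra hne
    exact hQ' (Finset.mem_filter.2 ⟨hQ, hne⟩)
  rw [this, mul_zero, ENNReal.zero_rpow_of_pos hγ, zero_mul]

/-- The estimate of a sparse form in a single grid for `q₀ = ∞`. -/
theorem exists_grid_bound_top (hn : 1 ≤ n) (ν : ℝ) {Λ : ℕ} (hΛ : 1 ≤ Λ) {γ : ℝ} (hγ : 0 < γ)
    (hγ1 : γ ≤ 1) {ζ : ℝ≥0} (hζ : 0 < ζ) : ∃ C : ℝ≥0,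
      ∀ (μ : Measure (EuclideanSpace ℝ (Fin n))) (w : EuclideanSpace ℝ (Fin n) → ℝ),
      IsDoubling ν μ → IsWeight μ w → AinftyConst μ w ≠ ∞ →
      ∀ (α : Fin n → Fin 3) (S : Finset (Set (EuclideanSpace ℝ (Fin n)))),
      (∀ Q ∈ S, Q ∈ dyadicGrid α) → IsCarleson μ S Λ →
      ∀ (h : EuclideanSpace ℝ (Fin n) → ℝ≥0∞), Measurable h →
      (∀ Q ∈ S, ∫⁻ x in Q, h x ∂μ ≤ μ Q) → ∀ E : Set (EuclideanSpace ℝ (Fin n)),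
      ∑ Q ∈ S, ((μ Q)⁻¹ * ∫⁻ x in Q, h x ∂μ) ^ γ * ∫⁻ x in E ∩ Q, ENNReal.ofReal (w x) ∂μ ≤
        ζ * ∫⁻ x in E, ENNReal.ofReal (w x) ∂μ +
        C * (topFactor γ (AinftyConst μ w) * A1const μ w *
          ∫⁻ x, h x * ENNReal.ofReal (w x) ∂μ) := by
  classical
  obtain ⟨C, hC⟩ := exists_threshold_ennreal Λ (2 * doublingConst n ν + 3)
    (le_add_of_nonneg_of_le zero_le (by norm_num)) hγ hγ1 hζ
  refine ⟨32 * Λ * (8 * doublingConst n ν) * C * doublingConst n ν,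
    fun μ w hμ hw hA α S hSα hS h hh hle E => ?_⟩
  obtain ⟨K, hK2, hKA, hKle⟩ := exists_nat_AinftyConst hμ hw hA
  -- The threshold is chosen after `K`, so that the coefficient of `w(E)` is at most `ζ` whatever
  -- the weight.
  obtain ⟨k₀, hk1, hk2⟩ := hC K _ hK2 hA (by push_cast; exact hKle)
  rw [IsCarleson.sum_filter_pos S h hγ]
  set S' := S.filter fun Q => ∫⁻ x in Q, h x ∂μ ≠ 0 with hS'
  have hsub : S' ⊆ S := Finset.filter_subset _ _
  have hcar := hS.mono hsub
  obtain ⟨k, h1, h2, h3⟩ := exists_layer_fun hcar (fun Q hQ => hle Q (hsub hQ))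
    (fun Q hQ => (Finset.mem_filter.1 hQ).2)
  have hgrid : ∀ Q ∈ S', ∃ k m, Q = dyadicCube α k m := fun Q hQ => hSα Q (hsub hQ)
  choose! lev ind hQeq using hgrid
  set lam : Set (EuclideanSpace ℝ (Fin n)) → ℝ≥0∞ := fun Q => ballAvg μ w α (lev Q) (ind Q)
  have hW : ∀ Q ∈ S', ∀ t : ℕ, ∃ G ⊆ Q, MeasurableSet G ∧
      ∫⁻ x in G, ENNReal.ofReal (w x) ∂μ ≤
        8 * doublingConst n ν * ((1 - (K : ℝ≥0∞)⁻¹) ^ t * (lam Q * μ Q)) ∧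
      ∀ᵐ x ∂μ.restrict Q, x ∉ G →
        ENNReal.ofReal (w x) ≤ 8 * doublingConst n ν * (2 ^ t * lam Q) := by
    intro Q hQ t
    have := exists_exceptional_set hμ hn hw hK2 hKA α (lev Q) (ind Q) t
    rw [← hQeq Q hQ] at this
    exact this
  have hT : ∀ Q ∈ S', ∫⁻ x in Q, ENNReal.ofReal (w x) ∂μ ≤
      8 * doublingConst n ν * (lam Q * μ Q) := by
    intro Q hQ
    have := wMeasure_cube_le_ballAvg (w := w) hμ hn α (lev Q) (ind Q)
    rw [← hQeq Q hQ, wMeasure_apply (hS.measurable Q (hsub hQ))] at this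
    refine this.trans ?_
    gcongr
    exact le_mul_of_one_le_left zero_le (by norm_num)
  have hB : ∀ Q ∈ S', ∀ᵐ x ∂μ.restrict Q,
      lam Q ≤ (doublingConst n ν * A1const μ w) * ENNReal.ofReal (w x) := by
    intro Q hQ
    filter_upwards [ae_restrict_of_ae (A1_ballAvg_ae hμ hn hw),
      ae_restrict_mem (hS.measurable Q (hsub hQ))] with x hx hxQ
    apply hx
    rwa [← hQeq Q hQ]
  have hmain := hcar.sum_weight_le hΛ hh hw.measurable_ofReal k h1 h2 hK2 hT hW hB (E := E)
    ((2⁻¹ : ℝ≥0∞) ^ γ) (ENNReal.rpow_le_one (by rw [ENNReal.inv_le_one]; norm_num) hγ.le) k₀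
  calc _ ≤ ∑ Q ∈ S', ((2⁻¹ : ℝ≥0∞) ^ γ) ^ k Q * ∫⁻ x in E ∩ Q, ENNReal.ofReal (w x) ∂μ := by
        refine Finset.sum_le_sum fun Q hQ => mul_le_mul_left ?_ _
        calc ((μ Q)⁻¹ * ∫⁻ x in Q, h x ∂μ) ^ γ ≤ (2⁻¹ ^ k Q) ^ γ :=
              ENNReal.rpow_le_rpow (h3 Q hQ) hγ.le
          _ = _ := by rw [← ENNReal.rpow_natCast, ← ENNReal.rpow_natCast, ← ENNReal.rpow_mul,
              ← ENNReal.rpow_mul, mul_comm]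
    _ ≤ _ := hmain
    _ ≤ ζ * ∫⁻ x in E, ENNReal.ofReal (w x) ∂μ + 32 * Λ * (8 * doublingConst n ν) *
        (C * topFactor γ (AinftyConst μ w)) * (doublingConst n ν * A1const μ w *
          ∫⁻ x, h x * ENNReal.ofReal (w x) ∂μ) := by gcongr
    _ = _ := by push_cast; ring

/-! ### The estimate in a single grid for `q₀ < ∞` -/

section Abstract

variable {X : Type*} [MeasurableSpace X] {μ : Measure X}

/-- `IsCarleson.sum_interpolated_le` with an optimal choice of the free parameter. -/
lemma exists_sum_interpolated_le (Λ d : ℕ) (C D ζ : ℝ≥0) (hζ : 0 < ζ) {g : ℝ} (hg : 0 < g)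
    (hg1 : g ≤ 1) : ∃ A : ℝ≥0, ∀ (X : Type) [MeasurableSpace X] (μ : Measure X)
      (S : Finset (Set X)), IsCarleson μ S Λ → 1 ≤ Λ → d ≠ 0 →
      ∀ (h w : X → ℝ≥0∞), Measurable h → Measurable w → ∀ (k : Set X → ℕ),
      (∀ Q ∈ S, ∫⁻ x in Q, h x ∂μ ≤ 2⁻¹ ^ k Q * μ Q) →
      (∀ Q ∈ S, 2⁻¹ ^ k Q * μ Q ≤ 2 * ∫⁻ x in Q, h x ∂μ) →
      ∀ (B : ℝ≥0∞) (Y : Set X → ℝ≥0∞),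
      (∀ Q ∈ S, ∀ t : ℕ, ∫⁻ x in deep S Q (4 * Λ * (d * t)), w x ∂μ ≤
        C * (4⁻¹ ^ t * (Y Q * μ Q))) →
      (∀ Q ∈ S, ∀ᵐ x ∂μ.restrict Q, Y Q ≤ B * w x) →
      ∀ (E : Set X) (r : ℝ≥0∞) (R : ℝ≥0), r ≤ 1 → 1 ≤ R → (1 - r)⁻¹ ≤ R →
      D * ∑ Q ∈ S, r ^ k Q * ((2⁻¹ ^ k Q * Y Q) ^ g *
        ((μ Q)⁻¹ * ∫⁻ x in E ∩ Q, w x ∂μ) ^ (1 - g)) * μ Q ≤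
      ζ * ∫⁻ x in E, w x ∂μ + A * ((R : ℝ≥0∞) ^ (1 / g) * (B * ∫⁻ x, h x * w x ∂μ)) := by
  -- Large enough that `D (4Λd) / c ≤ ζ`; the summand `1` ensures `c ≥ 1`.
  set c : ℝ≥0 := D * (4 * Λ * d) / ζ + 1 with hc
  have hc1 : 1 ≤ c := le_add_of_nonneg_left zero_le
  have hcD : D * (4 * Λ * d) ≤ ζ * c := by
    rw [hc, mul_add, mul_div_cancel₀ _ hζ.ne']
    exact le_self_add
  have hexp : 0 ≤ 1 / g - 1 := by
    rw [sub_nonneg, le_div_iff₀ hg]; linarith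
  refine ⟨D * (16 * Λ * c ^ (1 / g - 1) + 32 * Λ * C), ?_⟩
  intro X _ μ S hS hΛ hd h w hh hw k h1 h2 B Y hU hB E r R hr hR1 hR
  -- Then `M^(-g) = 1/(cR)` cancels the factor `(1 - r)⁻¹ ≤ R` in front of `w(E)`, leaving at most
  -- `ζ`, while `M^(1-g) R` is of order `R^(1/g)` in front of `∫ h w`.
  set M : ℝ≥0 := (c * R) ^ (1 / g) with hM
  have hcR : 1 ≤ c * R := one_le_mul_of_one_le_of_one_le hc1 hR1
  have hcR0 : c * R ≠ 0 := (zero_lt_one.trans_le hcR).ne'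
  have hM0 : M ≠ 0 := by
    rw [hM]; exact (NNReal.rpow_pos (zero_lt_one.trans_le hcR)).ne'
  have e1 : (M : ℝ≥0∞) ^ (-g) = ((c * R : ℝ≥0) : ℝ≥0∞)⁻¹ := by
    rw [ENNReal.rpow_neg, hM, ENNReal.coe_rpow_of_ne_zero hcR0, ← ENNReal.rpow_mul,
      one_div_mul_cancel hg.ne', ENNReal.rpow_one]
  have e2 : (M : ℝ≥0∞) ^ (1 - g) = ((c * R : ℝ≥0) : ℝ≥0∞) ^ (1 / g - 1) := by
    rw [hM, ENNReal.coe_rpow_of_ne_zero hcR0, ← ENNReal.rpow_mul]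
    congr 1; field_simp
  have hmain := hS.sum_interpolated_le hΛ hh hw k h1 h2 hd hU hB (E := E) hr
    (ENNReal.coe_ne_zero.2 hM0) ENNReal.coe_ne_top hg.le hg1
  rw [e1, e2] at hmain
  set I := B * ∫⁻ x, h x * w x ∂μ
  set P := ∫⁻ x in E, w x ∂μ
  have hR0 : (R : ℝ≥0∞) ≠ 0 := by
    exact_mod_cast (zero_lt_one.trans_le hR1).ne'
  have hinv : ((c * R : ℝ≥0) : ℝ≥0∞)⁻¹ ≤ 1 := by
    rw [ENNReal.inv_le_one]; exact_mod_cast hcR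
  have hRpow : (1 : ℝ≥0∞) ≤ (R : ℝ≥0∞) ^ (1 / g) :=
    ENNReal.one_le_rpow (by exact_mod_cast hR1) (by positivity)
  have t1 : ((c * R : ℝ≥0) : ℝ≥0∞) ^ (1 / g - 1) * R = (c : ℝ≥0∞) ^ (1 / g - 1) *
      (R : ℝ≥0∞) ^ (1 / g) := by
    rw [ENNReal.coe_mul, ENNReal.mul_rpow_of_nonneg _ _ hexp, mul_assoc]
    congr 1
    nth_rewrite 2 [← ENNReal.rpow_one (R : ℝ≥0∞)]
    rw [← ENNReal.rpow_add _ _ hR0 ENNReal.coe_ne_top]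
    congr 1; ring
  have t2 : (D : ℝ≥0∞) * (((c * R : ℝ≥0) : ℝ≥0∞)⁻¹ * (4 * Λ * d) * R) ≤ ζ := by
    have hcR' : ((c * R : ℝ≥0) : ℝ≥0∞) ≠ 0 := ENNReal.coe_ne_zero.2 hcR0
    calc (D : ℝ≥0∞) * (((c * R : ℝ≥0) : ℝ≥0∞)⁻¹ * (4 * Λ * d) * R)
        = ((c * R : ℝ≥0) : ℝ≥0∞)⁻¹ * (((D * (4 * Λ * d) : ℝ≥0) : ℝ≥0∞) * R) := by
          push_cast; ring
      _ ≤ ((c * R : ℝ≥0) : ℝ≥0∞)⁻¹ * (((ζ * c : ℝ≥0) : ℝ≥0∞) * R) := by gcongr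
      _ = ζ * (((c * R : ℝ≥0) : ℝ≥0∞)⁻¹ * ((c * R : ℝ≥0) : ℝ≥0∞)) := by push_cast; ring
      _ = ζ := by rw [ENNReal.inv_mul_cancel hcR' ENNReal.coe_ne_top, mul_one]
  calc _ ≤ (D : ℝ≥0∞) * ((16 * Λ * ((c * R : ℝ≥0) : ℝ≥0∞) ^ (1 / g - 1) * R +
        1 * (32 * Λ * C)) * I + ((c * R : ℝ≥0) : ℝ≥0∞)⁻¹ * (4 * Λ * d) * R * P) := by
        refine mul_le_mul_right (hmain.trans ?_) _
        gcongr
    _ = (D : ℝ≥0∞) * (((c * R : ℝ≥0) : ℝ≥0∞)⁻¹ * (4 * Λ * d) * R) * P +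
        (D : ℝ≥0∞) * (16 * Λ * (((c * R : ℝ≥0) : ℝ≥0∞) ^ (1 / g - 1) * R) +
        1 * (32 * Λ * C)) * I := by ring
    _ ≤ ζ * P + (D : ℝ≥0∞) * (16 * Λ * ((c : ℝ≥0∞) ^ (1 / g - 1) * (R : ℝ≥0∞) ^ (1 / g)) +
        (R : ℝ≥0∞) ^ (1 / g) * (32 * Λ * C)) * I := by
        rw [t1]
        gcongr
    _ = _ := by
        push_cast
        rw [ENNReal.coe_rpow_of_nonneg _ hexp]
        ring

/-- Interpolation of the average of `w χ_E` between the average of `w` and the average of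
`w ^ σ`, outside and inside an exceptional set. -/
lemma interpolated_average_le {W : X → ℝ≥0∞} (hW : Measurable W) {Q E G : Set X}
    (hQ : MeasurableSet Q) (hQ0 : μ Q ≠ 0) (hQt : μ Q ≠ ∞) (hG : MeasurableSet G)
    {p q : ℝ} (hp : 1 ≤ p) (hpq : p < q) {a b : ℝ≥0∞}
    (h1 : ∫⁻ x in G, W x ^ (q / (q - p)) ∂μ ≤ a * μ Q)
    (h2 : ∀ᵐ x ∂μ.restrict Q, x ∉ G → W x ^ (q / (q - p)) ≤ b) :
    ((μ Q)⁻¹ * ∫⁻ x in E ∩ Q, W x ^ (q / (q - 1)) ∂μ) ^ ((q - 1) / q) ≤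
      a ^ (1 / p - 1 / q) * ((μ Q)⁻¹ * ∫⁻ x in E ∩ Q, W x ∂μ) ^ (1 - 1 / p) +
      b ^ ((q - p) / q * (1 / q)) * ((μ Q)⁻¹ * ∫⁻ x in E ∩ Q, W x ∂μ) ^ (1 - 1 / q) := by
  have hq1 : 0 < q - 1 := by linarith
  have hqp : 0 < q - p := by linarith
  have hq0 : 0 < q := by linarith
  have hp0 : 0 < p := by linarith
  set s := q / (q - 1) with hs
  set σ := q / (q - p) with hσ
  have hs0 : 0 < s := by positivity
  have hσ0 : 0 < σ := by positivity
  have hexp : 0 ≤ (q - 1) / q := by positivity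
  set Y := (μ Q)⁻¹ * ∫⁻ x in E ∩ Q, W x ∂μ with hY
  have hinvt : (μ Q)⁻¹ ≠ ∞ := ENNReal.inv_ne_top.2 hQ0
  -- Chosen so that `s = θσ + (1 - θ)`, placing the exponent `s` between `1` and `σ`.
  set θ := (q - p) / (p * (q - 1)) with hθ
  have hθ0 : 0 ≤ θ := by positivity
  have hθ1 : 0 ≤ 1 - θ := by
    rw [hθ, sub_nonneg, div_le_one (by positivity)]; nlinarith
  -- On `G` Hölder's inequality interpolates between the small integral of `W^σ` and the integral of
  -- `W` over `E`.
  have hin : (μ Q)⁻¹ * ∫⁻ x in (E ∩ Q) ∩ G, W x ^ s ∂μ ≤ a ^ θ * Y ^ (1 - θ) := by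
    have e1 : ∀ x, W x ^ s = (W x ^ σ) ^ θ * W x ^ (1 - θ) := by
      intro x
      rw [← ENNReal.rpow_mul, ← ENNReal.rpow_add_of_nonneg _ _ (by positivity) hθ1]
      congr 1
      rw [hs, hσ, hθ]
      field_simp
      ring
    have hH := ENNReal.lintegral_mul_norm_pow_le (μ := μ.restrict ((E ∩ Q) ∩ G))
      (f := fun x => W x ^ σ) (g := W) (hW.pow_const σ).aemeasurable hW.aemeasurable hθ0 hθ1
      (by ring)
    calc (μ Q)⁻¹ * ∫⁻ x in (E ∩ Q) ∩ G, W x ^ s ∂μ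
        = (μ Q)⁻¹ * ∫⁻ x in (E ∩ Q) ∩ G, (W x ^ σ) ^ θ * W x ^ (1 - θ) ∂μ := by simp_rw [e1]
      _ ≤ (μ Q)⁻¹ * ((∫⁻ x in (E ∩ Q) ∩ G, W x ^ σ ∂μ) ^ θ *
          (∫⁻ x in (E ∩ Q) ∩ G, W x ∂μ) ^ (1 - θ)) := by
          gcongr
      _ ≤ (μ Q)⁻¹ * ((a * μ Q) ^ θ * (∫⁻ x in E ∩ Q, W x ∂μ) ^ (1 - θ)) := by
          exact mul_le_mul_right (mul_le_mul'
            (ENNReal.rpow_le_rpow ((lintegral_mono_set inter_subset_right).trans h1) hθ0)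
            (ENNReal.rpow_le_rpow (lintegral_mono_set inter_subset_left) hθ1)) _
      _ = ((μ Q)⁻¹ ^ θ * (a * μ Q) ^ θ) * ((μ Q)⁻¹ ^ (1 - θ) *
          (∫⁻ x in E ∩ Q, W x ∂μ) ^ (1 - θ)) := by
          have : (μ Q)⁻¹ = (μ Q)⁻¹ ^ θ * (μ Q)⁻¹ ^ (1 - θ) := by
            rw [← ENNReal.rpow_add_of_nonneg _ _ hθ0 hθ1]; simp
          nth_rewrite 1 [this]
          ring
      _ = a ^ θ * Y ^ (1 - θ) := by
          rw [← ENNReal.mul_rpow_of_nonneg _ _ hθ0, ← ENNReal.mul_rpow_of_nonneg _ _ hθ1,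
            mul_comm a, ← mul_assoc, ENNReal.inv_mul_cancel hQ0 hQt, one_mul]
  -- Off `G` the pointwise bound on `W^σ` absorbs all but the first power of `W`.
  have hout : (μ Q)⁻¹ * ∫⁻ x in (E ∩ Q) \ G, W x ^ s ∂μ ≤ b ^ ((s - 1) / σ) * Y := by
    have hs1 : 0 ≤ s - 1 := by
      rw [hs, sub_nonneg, le_div_iff₀ hq1]; linarith
    calc (μ Q)⁻¹ * ∫⁻ x in (E ∩ Q) \ G, W x ^ s ∂μ
        ≤ (μ Q)⁻¹ * ∫⁻ x in (E ∩ Q) \ G, b ^ ((s - 1) / σ) * W x ∂μ := by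
          refine mul_le_mul_right ?_ _
          have hrs : μ.restrict ((E ∩ Q) \ G) = ((μ.restrict E).restrict Q).restrict Gᶜ := by
            rw [Measure.restrict_restrict hG.compl, Measure.restrict_restrict (hG.compl.inter hQ)]
            congr 1
            ext x; simp only [mem_sdiff, mem_inter_iff, mem_compl_iff]; tauto
          refine lintegral_mono_ae ?_
          have h2' : ∀ᵐ x ∂μ.restrict ((E ∩ Q) \ G), x ∉ G → W x ^ σ ≤ b :=
            ae_restrict_of_ae_restrict_of_subset (sdiff_subset.trans inter_subset_right) h2
          have hmem : ∀ᵐ x ∂μ.restrict ((E ∩ Q) \ G), x ∉ G := by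
            rw [hrs]
            exact ae_restrict_mem hG.compl
          filter_upwards [h2', hmem] with x hx hxG
          calc W x ^ s = (W x ^ σ) ^ ((s - 1) / σ) * W x := by
                rw [← ENNReal.rpow_mul]
                nth_rewrite 3 [← ENNReal.rpow_one (W x)]
                rw [← ENNReal.rpow_add_of_nonneg _ _ (by positivity) zero_le_one]
                congr 1
                field_simp
                ring
            _ ≤ _ := by
                gcongr
                exact hx hxG
      _ = b ^ ((s - 1) / σ) * ((μ Q)⁻¹ * ∫⁻ x in (E ∩ Q) \ G, W x ∂μ) := by
          rw [lintegral_const_mul _ hW]; ring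
      _ ≤ _ := mul_le_mul_right (mul_le_mul_right (lintegral_mono_set sdiff_subset) _) _
  have hexp1 : (q - 1) / q ≤ 1 := by
    rw [div_le_one hq0]; linarith
  calc ((μ Q)⁻¹ * ∫⁻ x in E ∩ Q, W x ^ s ∂μ) ^ ((q - 1) / q)
      = ((μ Q)⁻¹ * ∫⁻ x in (E ∩ Q) ∩ G, W x ^ s ∂μ +
          (μ Q)⁻¹ * ∫⁻ x in (E ∩ Q) \ G, W x ^ s ∂μ) ^ ((q - 1) / q) := by
        rw [← mul_add, lintegral_inter_add_sdiff (μ := μ) _ _ hG]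
    _ ≤ (a ^ θ * Y ^ (1 - θ) + b ^ ((s - 1) / σ) * Y) ^ ((q - 1) / q) := by gcongr
    _ ≤ (a ^ θ * Y ^ (1 - θ)) ^ ((q - 1) / q) + (b ^ ((s - 1) / σ) * Y) ^ ((q - 1) / q) :=
        ENNReal.rpow_add_le_add_rpow _ _ hexp hexp1
    _ = _ := by
        rw [ENNReal.mul_rpow_of_nonneg _ _ hexp, ENNReal.mul_rpow_of_nonneg _ _ hexp,
          ← ENNReal.rpow_mul, ← ENNReal.rpow_mul, ← ENNReal.rpow_mul]
        have x1 : θ * ((q - 1) / q) = 1 / p - 1 / q := by rw [hθ]; field_simp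
        have x2 : (1 - θ) * ((q - 1) / q) = 1 - 1 / p := by rw [hθ]; field_simp; ring
        have x3 : (s - 1) / σ * ((q - 1) / q) = (q - p) / q * (1 / q) := by
          rw [hs, hσ]; field_simp; ring
        have x4 : (q - 1) / q = 1 - 1 / q := by field_simp
        rw [x1, x2, x3, x4]

/-- Decay on the deep parts of a Carleson family of a weight with an integrable power. -/
lemma IsCarleson.weight_deep_le_of_rpow {S : Finset (Set X)} {Λ : ℕ} (hS : IsCarleson μ S Λ)
    (hΛ : 1 ≤ Λ) {W : X → ℝ≥0∞} (hW : Measurable W) {p q : ℝ} (hp : 1 ≤ p) (hpq : p < q)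
    {Q : Set X} (hQ : Q ∈ S) {a : ℝ≥0∞} (h1 : ∫⁻ x in Q, W x ^ (q / (q - p)) ∂μ ≤ a * μ Q)
    {d : ℕ} (hd : q / p ≤ d) (t : ℕ) :
    ∫⁻ x in deep S Q (4 * Λ * (d * t)), W x ∂μ ≤ 4⁻¹ ^ t * (a ^ ((q - p) / q) * μ Q) := by
  have hqp : 0 < q - p := by linarith
  have hq0 : 0 < q := by linarith
  have hp0 : 0 < p := by linarith
  set U := deep S Q (4 * Λ * (d * t)) with hU
  have hUμ : μ U ≤ 4⁻¹ ^ (d * t) * μ Q := by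
    have := hS.measure_deep_le hΛ hQ (d * t)
    rw [← ENNReal.inv_pow, mul_comm, ← div_eq_mul_inv, ENNReal.le_div_iff_mul_le (by simp)
      (by simp), mul_comm]
    exact this
  have x1 : 0 ≤ (q - p) / q := by positivity
  have x2 : 0 ≤ p / q := by positivity
  -- Hölder's inequality against the constant `1` leaves the power `p/q` of the measure of the deep
  -- part. Since `d ≥ q/p`, the `d t` blocks of depth turn this into the full decay `4^(-t)`.
  have hH := ENNReal.lintegral_mul_norm_pow_le (μ := μ.restrict U)
    (f := fun x => W x ^ (q / (q - p))) (g := fun _ => 1) (hW.pow_const _).aemeasurable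
    aemeasurable_const x1 x2 (by field_simp; ring)
  have e : ∀ x, W x = (W x ^ (q / (q - p))) ^ ((q - p) / q) * 1 ^ (p / q) := by
    intro x
    rw [ENNReal.one_rpow, mul_one, ← ENNReal.rpow_mul, div_mul_div_cancel₀ hqp.ne',
      div_self hq0.ne', ENNReal.rpow_one]
  calc ∫⁻ x in U, W x ∂μ = ∫⁻ x in U, (W x ^ (q / (q - p))) ^ ((q - p) / q) * 1 ^ (p / q) ∂μ :=
        lintegral_congr e
    _ ≤ (∫⁻ x in U, W x ^ (q / (q - p)) ∂μ) ^ ((q - p) / q) * (∫⁻ _ in U, 1 ∂μ) ^ (p / q) := hH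
    _ ≤ (a * μ Q) ^ ((q - p) / q) * (4⁻¹ ^ (d * t) * μ Q) ^ (p / q) := by
        gcongr
        · exact (lintegral_mono_set (deep_subset _ _ _)).trans h1
        · rw [setLIntegral_one]; exact hUμ
    _ = ((4⁻¹ : ℝ≥0∞) ^ (d * t)) ^ (p / q) * (a ^ ((q - p) / q) *
        (μ Q ^ ((q - p) / q) * μ Q ^ (p / q))) := by
        rw [ENNReal.mul_rpow_of_nonneg _ _ x1, ENNReal.mul_rpow_of_nonneg _ _ x2]; ring
    _ ≤ 4⁻¹ ^ t * (a ^ ((q - p) / q) * μ Q) := by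
        have e3 : μ Q ^ ((q - p) / q) * μ Q ^ (p / q) = μ Q := by
          rw [← ENNReal.rpow_add_of_nonneg _ _ x1 x2, show (q - p) / q + p / q = 1 by
            field_simp; ring, ENNReal.rpow_one]
        rw [e3]
        gcongr
        rw [← ENNReal.rpow_natCast, ← ENNReal.rpow_natCast, ← ENNReal.rpow_mul]
        apply ENNReal.rpow_le_rpow_of_exponent_ge (by rw [ENNReal.inv_le_one]; norm_num)
        push_cast
        have : 1 ≤ d * (p / q) := by
          calc 1 = q / p * (p / q) := by field_simp
            _ ≤ d * (p / q) := by gcongr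
        calc (t : ℝ) = 1 * t := (one_mul _).symm
          _ ≤ d * (p / q) * t := by gcongr
          _ = _ := by ring

end Abstract

/-- Bernoulli's inequality in the form needed for geometric series. -/
lemma inv_one_sub_rpow_le {K : ℕ} (hK : 2 ≤ K) {β : ℝ} (hβ : 0 < β) (hβ1 : β ≤ 1) :
    (1 - (1 - (K : ℝ≥0∞)⁻¹) ^ β)⁻¹ ≤ ENNReal.ofReal (1 / β) * K := by
  have hK0 : (0 : ℝ) < K := by exact_mod_cast (by omega : 0 < K)
  have h2 : (2 : ℝ) ≤ K := by exact_mod_cast hK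
  have h0 : (0 : ℝ) < 1 - 1 / K := by
    rw [sub_pos, div_lt_one hK0]; linarith
  have h1 : (1 - 1 / K : ℝ) ^ β ≤ 1 - β / K := by
    have := _root_.rpow_one_add_le_one_add_mul_self (s := -(1 / K : ℝ)) (by
      rw [neg_le_neg_iff, div_le_one hK0]; linarith) hβ.le hβ1
    rw [← sub_eq_add_neg] at this
    refine this.trans (le_of_eq ?_)
    ring
  rw [one_sub_inv_eq_ofReal hK, ENNReal.ofReal_rpow_of_pos h0, ← ENNReal.ofReal_one,
    ← ENNReal.ofReal_sub _ (by positivity), ← ENNReal.ofReal_natCast (n := K),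
    ← ENNReal.ofReal_mul (by positivity)]
  have h3 : 0 < β / K := by positivity
  rw [← ENNReal.ofReal_inv_of_pos (by linarith)]
  apply ENNReal.ofReal_le_ofReal
  calc (1 - (1 - 1 / K : ℝ) ^ β)⁻¹ ≤ (β / K)⁻¹ := by
        apply inv_anti₀ h3; linarith
    _ = _ := by field_simp

/-- The estimate of a sparse form in a single grid for `q₀ < ∞`. -/
theorem exists_grid_bound_lt_top {n : ℕ} (hn : 1 ≤ n) (ν : ℝ) {Λ : ℕ} (hΛ : 1 ≤ Λ) {p q : ℝ}
    (hp : 1 ≤ p) (hpq : p < q) {ζ : ℝ≥0} (hζ : 0 < ζ) : ∃ C : ℝ≥0,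
      ∀ (μ : Measure (EuclideanSpace ℝ (Fin n))) (w : EuclideanSpace ℝ (Fin n) → ℝ),
      IsDoubling ν μ → IsWeight μ w → IsWeight μ (fun x => w x ^ (q / (q - p))) →
      AinftyConst μ (fun x => w x ^ (q / (q - p))) ≠ ∞ →
      ∀ (α : Fin n → Fin 3) (S : Finset (Set (EuclideanSpace ℝ (Fin n)))),
      (∀ Q ∈ S, Q ∈ dyadicGrid α) → IsCarleson μ S Λ →
      ∀ (h : EuclideanSpace ℝ (Fin n) → ℝ≥0∞), Measurable h →
      (∀ Q ∈ S, ∫⁻ x in Q, h x ∂μ ≤ μ Q) → ∀ E : Set (EuclideanSpace ℝ (Fin n)),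
      ∑ Q ∈ S, ((μ Q)⁻¹ * ∫⁻ x in Q, h x ∂μ) ^ (1 / p) *
        (((μ Q)⁻¹ * ∫⁻ x in E ∩ Q, ENNReal.ofReal (w x) ^ (q / (q - 1)) ∂μ) ^ ((q - 1) / q) *
          μ Q) ≤
        ζ * ∫⁻ x in E, ENNReal.ofReal (w x) ∂μ +
        C * (AinftyConst μ (fun x => w x ^ (q / (q - p))) ^ p *
          A1const μ (fun x => w x ^ (q / (q - p))) ^ ((q - p) / q) *
          ∫⁻ x, h x * ENNReal.ofReal (w x) ∂μ) := by
  classical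
  have hq1 : 0 < q - 1 := by linarith
  have hqp : 0 < q - p := by linarith
  have hq0 : 0 < q := by linarith
  have hp0 : 0 < p := by linarith
  set β := 1 / p - 1 / q with hβ
  have hβ' : β = (q - p) / (p * q) := by rw [hβ]; field_simp
  have hβ0 : 0 < β := by rw [hβ']; positivity
  have hβ1 : β ≤ 1 := by
    rw [hβ', div_le_one (by positivity)]; nlinarith
  set γ := 1 / p with hγ
  have hγ0 : 0 < γ := by positivity
  have hγ1 : γ ≤ 1 := by rw [hγ, div_le_one hp0]; exact hp
  set g := 1 / q with hg
  have hg0 : 0 < g := by positivity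
  have hg1 : g ≤ 1 := by rw [hg, div_le_one hq0]; linarith
  set τ := (q - p) / q with hτ
  have hτ0 : 0 < τ := by positivity
  have hτ1 : τ ≤ 1 := by rw [hτ, div_le_one hq0]; linarith
  -- The decay per layer that survives in the part off the exceptional set, where the height `2^k`
  -- enters with the power `τ g`; it equals `(q-p)²/(pq²)`, hence is positive.
  set e := γ - g - τ * g with he
  have he0 : 0 < e := by
    have : e = (q - p) * (q - p) / (p * q * q) := by
      rw [he, hγ, hg, hτ]; field_simp
    rw [this]; positivity
  set d : ℕ := ⌈q / p⌉₊ with hd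
  have hd0 : d ≠ 0 := (Nat.ceil_pos.2 (by positivity)).ne'
  set C₀ : ℝ≥0 := 8 * doublingConst n ν with hC₀
  set D₁ : ℝ≥0 := C₀ ^ β with hD₁
  set D₂ : ℝ≥0 := C₀ ^ (τ * g) with hD₂
  set Cd : ℝ≥0 := C₀ ^ τ with hCd
  -- The parts inside and outside the exceptional set are summed separately, with interpolation
  -- exponents `1/p` and `1/q`, each absorbing half of `ζ`.
  obtain ⟨A₁, hA₁⟩ := exists_sum_interpolated_le Λ d Cd D₁ (ζ / 2) (half_pos hζ) hγ0 hγ1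
  obtain ⟨A₂, hA₂⟩ := exists_sum_interpolated_le Λ d Cd D₂ (ζ / 2) (half_pos hζ) hg0 hg1
  set r₂ : ℝ≥0∞ := (2⁻¹ : ℝ≥0∞) ^ e with hr₂
  have hr₂1 : r₂ < 1 := ENNReal.rpow_lt_one (by
    rw [ENNReal.inv_lt_one]; norm_num) he0
  set R₂ : ℝ≥0 := ((1 - r₂)⁻¹).toNNReal with hR₂
  have hR₂t : (1 - r₂)⁻¹ ≠ ∞ := ENNReal.inv_ne_top.2 (tsub_pos_of_lt hr₂1).ne'
  have hR₂e : (R₂ : ℝ≥0∞) = (1 - r₂)⁻¹ := ENNReal.coe_toNNReal hR₂t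
  have hR₂1 : 1 ≤ R₂ := by
    have : (1 : ℝ≥0∞) ≤ R₂ := by
      rw [hR₂e, ENNReal.one_le_inv]; exact tsub_le_self
    exact_mod_cast this
  set c₁ : ℝ≥0 := Real.toNNReal (1 / β) * (2 * doublingConst n ν + 3) with hc₁
  refine ⟨(A₁ * c₁ ^ p + A₂ * R₂ ^ q) * doublingConst n ν ^ τ,
    fun μ w hμ hw hv hA α S hSα hS h hh hle E => ?_⟩
  set v : EuclideanSpace ℝ (Fin n) → ℝ := fun x => w x ^ (q / (q - p)) with hvdef
  set W : EuclideanSpace ℝ (Fin n) → ℝ≥0∞ := fun x => ENNReal.ofReal (w x) with hWdef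
  have hWm : Measurable W := hw.measurable_ofReal
  have hvW : ∀ x, ENNReal.ofReal (v x) = W x ^ (q / (q - p)) := fun x => hw.ofReal_rpow x
  obtain ⟨K, hK2, hKA, hKle⟩ := exists_nat_AinftyConst hμ hv hA
  rw [IsCarleson.sum_filter_pos S h hγ0]
  set S' := S.filter fun Q => ∫⁻ x in Q, h x ∂μ ≠ 0 with hS'
  have hsub : S' ⊆ S := Finset.filter_subset _ _
  have hcar := hS.mono hsub
  obtain ⟨k, h1, h2, h3⟩ := exists_layer_fun hcar (fun Q hQ => hle Q (hsub hQ))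
    (fun Q hQ => (Finset.mem_filter.1 hQ).2)
  have hgrid : ∀ Q ∈ S', ∃ k m, Q = dyadicCube α k m := fun Q hQ => hSα Q (hsub hQ)
  choose! lev ind hQeq using hgrid
  set lam : Set (EuclideanSpace ℝ (Fin n)) → ℝ≥0∞ := fun Q => ballAvg μ v α (lev Q) (ind Q)
    with hlam
  set Y : Set (EuclideanSpace ℝ (Fin n)) → ℝ≥0∞ := fun Q => lam Q ^ τ with hYdef
  -- The exceptional set is taken at height `t = k Q`: its decay then becomes a geometric factor in
  -- the layer, and the growth `2^k` outside is beaten by the smallness `2^(-k)` of the averages of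
  -- `h`.
  have hG : ∀ Q ∈ S', ∃ G ⊆ Q, MeasurableSet G ∧
      ∫⁻ x in G, W x ^ (q / (q - p)) ∂μ ≤ C₀ * ((1 - (K : ℝ≥0∞)⁻¹) ^ k Q * (lam Q * μ Q)) ∧
      ∀ᵐ x ∂μ.restrict Q, x ∉ G → W x ^ (q / (q - p)) ≤ C₀ * (2 ^ k Q * lam Q) := by
    intro Q hQ
    have := exists_exceptional_set hμ hn hv hK2 hKA α (lev Q) (ind Q) (k Q)
    rw [← hQeq Q hQ] at this
    simp_rw [hvW] at this
    rw [hC₀]; push_cast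
    exact this
  have hT : ∀ Q ∈ S', ∫⁻ x in Q, W x ^ (q / (q - p)) ∂μ ≤ C₀ * lam Q * μ Q := by
    intro Q hQ
    have := wMeasure_cube_le_ballAvg (w := v) hμ hn α (lev Q) (ind Q)
    rw [← hQeq Q hQ, wMeasure_apply (hS.measurable Q (hsub hQ))] at this
    simp_rw [hvW] at this
    refine this.trans ?_
    rw [← mul_assoc, hC₀]
    gcongr
    exact le_mul_of_one_le_left zero_le (by norm_num)
  have hU : ∀ Q ∈ S', ∀ t : ℕ, ∫⁻ x in deep S' Q (4 * Λ * (d * t)), W x ∂μ ≤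
      Cd * (4⁻¹ ^ t * (Y Q * μ Q)) := by
    intro Q hQ t
    refine (hcar.weight_deep_le_of_rpow hΛ hWm hp hpq hQ (hT Q hQ) (Nat.le_ceil _) t).trans
      (le_of_eq ?_)
    rw [ENNReal.mul_rpow_of_nonneg _ _ hτ0.le, hCd, ENNReal.coe_rpow_of_nonneg _ hτ0.le]
    ring
  set B : ℝ≥0∞ := (doublingConst n ν * A1const μ v) ^ τ with hBdef
  have hB : ∀ Q ∈ S', ∀ᵐ x ∂μ.restrict Q, Y Q ≤ B * W x := by
    intro Q hQ
    filter_upwards [ae_restrict_of_ae (A1_ballAvg_ae hμ hn hv),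
      ae_restrict_mem (hS.measurable Q (hsub hQ))] with x hx hxQ
    have hx' := hx α (lev Q) (ind Q) (by rwa [← hQeq Q hQ])
    calc Y Q ≤ (doublingConst n ν * A1const μ v * ENNReal.ofReal (v x)) ^ τ := by
          exact ENNReal.rpow_le_rpow hx' hτ0.le
      _ = B * (W x ^ (q / (q - p))) ^ τ := by
          rw [ENNReal.mul_rpow_of_nonneg _ _ hτ0.le, hvW]
      _ = B * W x := by
          rw [← ENNReal.rpow_mul, hτ, div_mul_div_cancel₀ hqp.ne', div_self hq0.ne',
            ENNReal.rpow_one]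
  -- Inside the exceptional set the ratio tends to `1` as `K` grows: `(1 - r₁)⁻¹` is at most of
  -- order `K`, and the exponent `1/γ = p` produces the power `K^p`. The ratio `r₂` outside does not
  -- depend on the weight.
  set r₁ : ℝ≥0∞ := (1 - (K : ℝ≥0∞)⁻¹) ^ β with hr₁
  have hr₁1 : r₁ ≤ 1 := ENNReal.rpow_le_one tsub_le_self hβ0.le
  set R₁ : ℝ≥0 := Real.toNNReal (1 / β) * K with hR₁
  have hR₁1 : 1 ≤ R₁ := by
    have ha : 1 ≤ Real.toNNReal (1 / β) := by
      rw [Real.one_le_toNNReal, le_div_iff₀ hβ0]; linarith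
    have hb : (1 : ℝ≥0) ≤ K := by exact_mod_cast (by omega : 1 ≤ K)
    exact one_le_mul_of_one_le_of_one_le ha hb
  have hR₁e : (1 - r₁)⁻¹ ≤ R₁ := by
    refine (inv_one_sub_rpow_le hK2 hβ0 hβ1).trans (le_of_eq ?_)
    rw [hR₁, ENNReal.coe_mul, ENNReal.ofReal, ENNReal.coe_natCast]
  have b₁ := hA₁ _ μ S' hcar hΛ hd0 h W hh hWm k h1 h2 B Y hU hB E r₁ R₁ hr₁1 hR₁1 hR₁e
  have b₂ := hA₂ _ μ S' hcar hΛ hd0 h W hh hWm k h1 h2 B Y hU hB E r₂ R₂ hr₂1.le hR₂1 hR₂e.ge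
  have hpoint : ∀ Q ∈ S', ((μ Q)⁻¹ * ∫⁻ x in Q, h x ∂μ) ^ γ *
      (((μ Q)⁻¹ * ∫⁻ x in E ∩ Q, W x ^ (q / (q - 1)) ∂μ) ^ ((q - 1) / q) * μ Q) ≤
      D₁ * (r₁ ^ k Q * ((2⁻¹ ^ k Q * Y Q) ^ γ *
        ((μ Q)⁻¹ * ∫⁻ x in E ∩ Q, W x ∂μ) ^ (1 - γ)) * μ Q) +
      D₂ * (r₂ ^ k Q * ((2⁻¹ ^ k Q * Y Q) ^ g *
        ((μ Q)⁻¹ * ∫⁻ x in E ∩ Q, W x ∂μ) ^ (1 - g)) * μ Q) := by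
    intro Q hQ
    obtain ⟨G, -, hGm, hG1, hG2⟩ := hG Q hQ
    have hQS := hsub hQ
    have hip := interpolated_average_le (E := E) hWm (hS.measurable Q hQS) (hS.ne_zero Q hQS)
      (hS.ne_top Q hQS) hGm hp hpq
      (a := C₀ * ((1 - (K : ℝ≥0∞)⁻¹) ^ k Q * lam Q)) (b := C₀ * (2 ^ k Q * lam Q))
      (hG1.trans (le_of_eq (by ring))) hG2
    set Z := (μ Q)⁻¹ * ∫⁻ x in E ∩ Q, W x ∂μ with hZ
    have hpow : ∀ (x : ℝ≥0∞) (m : ℕ) (s : ℝ), (x ^ m) ^ s = (x ^ s) ^ m := by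
      intro x m s
      rw [← ENNReal.rpow_natCast, ← ENNReal.rpow_natCast, ← ENNReal.rpow_mul, ← ENNReal.rpow_mul,
        mul_comm]
    have ea : (C₀ * ((1 - (K : ℝ≥0∞)⁻¹) ^ k Q * lam Q)) ^ β = D₁ * (r₁ ^ k Q * Y Q ^ γ) := by
      rw [ENNReal.mul_rpow_of_nonneg _ _ hβ0.le, ENNReal.mul_rpow_of_nonneg _ _ hβ0.le, hpow,
        hD₁, ENNReal.coe_rpow_of_nonneg _ hβ0.le, hYdef]
      simp only
      rw [← ENNReal.rpow_mul]
      congr 4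
      rw [hβ', hτ, hγ]; field_simp
    have eb : (C₀ * (2 ^ k Q * lam Q)) ^ (τ * g) =
        D₂ * (((2 : ℝ≥0∞) ^ (τ * g)) ^ k Q * Y Q ^ g) := by
      have hτg : 0 ≤ τ * g := by positivity
      rw [ENNReal.mul_rpow_of_nonneg _ _ hτg, ENNReal.mul_rpow_of_nonneg _ _ hτg, hpow,
        hD₂, ENNReal.coe_rpow_of_nonneg _ hτg, hYdef]
      simp only
      rw [← ENNReal.rpow_mul]
    have ec : (2⁻¹ ^ k Q : ℝ≥0∞) ^ γ * ((2 : ℝ≥0∞) ^ (τ * g)) ^ k Q =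
        r₂ ^ k Q * (2⁻¹ ^ k Q) ^ g := by
      rw [hpow, hpow, ← mul_pow, ← mul_pow]
      congr 1
      have h20 : (2⁻¹ : ℝ≥0∞) ≠ 0 := by simp
      have h2t : (2⁻¹ : ℝ≥0∞) ≠ ∞ := by simp
      have : (2 : ℝ≥0∞) ^ (τ * g) = 2⁻¹ ^ (-(τ * g)) := by
        rw [ENNReal.rpow_neg, ENNReal.inv_rpow, inv_inv]
      rw [this, hr₂, ← ENNReal.rpow_add _ _ h20 h2t, ← ENNReal.rpow_add _ _ h20 h2t]
      congr 1
      rw [he]; ring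
    rw [ea, eb] at hip
    calc _ ≤ (2⁻¹ ^ k Q) ^ γ * ((D₁ * (r₁ ^ k Q * Y Q ^ γ) * Z ^ (1 - γ) +
          D₂ * (((2 : ℝ≥0∞) ^ (τ * g)) ^ k Q * Y Q ^ g) * Z ^ (1 - g)) * μ Q) := by
          exact mul_le_mul' (ENNReal.rpow_le_rpow (h3 Q hQ) hγ0.le) (mul_le_mul_left hip _)
      _ = D₁ * (r₁ ^ k Q * (((2⁻¹ ^ k Q) ^ γ * Y Q ^ γ) * Z ^ (1 - γ)) * μ Q) +
          D₂ * (((2⁻¹ ^ k Q : ℝ≥0∞) ^ γ * ((2 : ℝ≥0∞) ^ (τ * g)) ^ k Q) *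
            (Y Q ^ g * Z ^ (1 - g)) * μ Q) := by ring
      _ = _ := by
          rw [ec, ENNReal.mul_rpow_of_nonneg _ _ hγ0.le, ENNReal.mul_rpow_of_nonneg _ _ hg0.le]
          ring
  have hKc : (R₁ : ℝ≥0∞) ≤ c₁ * AinftyConst μ v := by
    rw [hR₁, hc₁, ENNReal.coe_mul, ENNReal.coe_mul, mul_assoc, ENNReal.coe_natCast]
    gcongr
    push_cast
    exact hKle
  set I := ∫⁻ x, h x * W x ∂μ with hI
  have hA1 := one_le_AinftyConst hμ hv
  have x1 : 1 / γ = p := by rw [hγ, one_div_one_div]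
  have x2 : 1 / g = q := by rw [hg, one_div_one_div]
  rw [x1] at b₁
  rw [x2] at b₂
  calc _ ≤ D₁ * ∑ Q ∈ S', r₁ ^ k Q * ((2⁻¹ ^ k Q * Y Q) ^ γ *
        ((μ Q)⁻¹ * ∫⁻ x in E ∩ Q, W x ∂μ) ^ (1 - γ)) * μ Q +
      D₂ * ∑ Q ∈ S', r₂ ^ k Q * ((2⁻¹ ^ k Q * Y Q) ^ g *
        ((μ Q)⁻¹ * ∫⁻ x in E ∩ Q, W x ∂μ) ^ (1 - g)) * μ Q := by
        rw [Finset.mul_sum, Finset.mul_sum, ← Finset.sum_add_distrib]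
        exact Finset.sum_le_sum hpoint
    _ ≤ _ := add_le_add b₁ b₂
    _ = (((ζ / 2 : ℝ≥0) : ℝ≥0∞) + ((ζ / 2 : ℝ≥0) : ℝ≥0∞)) * ∫⁻ x in E, W x ∂μ +
        (A₁ * (R₁ : ℝ≥0∞) ^ p + A₂ * (R₂ : ℝ≥0∞) ^ q) * (B * I) := by ring
    _ ≤ ζ * ∫⁻ x in E, W x ∂μ + (A₁ * (c₁ * AinftyConst μ v) ^ p +
        A₂ * ((R₂ : ℝ≥0∞) ^ q * AinftyConst μ v ^ p)) * (B * I) := by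
        gcongr
        · rw [← ENNReal.coe_add, add_halves]
        · exact le_mul_of_one_le_right zero_le (ENNReal.one_le_rpow hA1 hp0)
    _ = _ := by
        rw [ENNReal.mul_rpow_of_nonneg _ _ hp0.le, hBdef, ENNReal.mul_rpow_of_nonneg _ _ hτ0.le]
        push_cast
        rw [ENNReal.coe_rpow_of_nonneg _ hp0.le, ENNReal.coe_rpow_of_nonneg _ hq0.le,
          ENNReal.coe_rpow_of_nonneg _ hτ0.le]
        ring

/-! ### Maximal members, the Carleson embedding and unweighted form bounds -/

section Maximal

lemma IsLaminar.exists_maximal {X : Type*} {S : Finset (Set X)} (hS : IsLaminar S) :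
    ∃ M ⊆ S, (M : Set (Set X)).PairwiseDisjoint id ∧ ∀ Q ∈ S, ∃ R ∈ M, Q ⊆ R := by
  classical
  refine ⟨S.filter fun Q => Maximal (· ∈ S) Q, Finset.filter_subset _ _, ?_, ?_⟩
  · intro P hP R hR hne
    have hP' := (Finset.mem_filter.1 (Finset.mem_coe.1 hP)).2
    have hR' := (Finset.mem_filter.1 (Finset.mem_coe.1 hR)).2
    rcases hS P hP'.1 R hR'.1 with h | h | h
    · exact absurd (hP'.eq_of_le hR'.1 h) hne
    · exact absurd (hR'.eq_of_le hP'.1 h).symm hne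
    · exact h
  · intro Q hQ
    obtain ⟨R, hQR, hR⟩ := S.exists_le_maximal hQ
    exact ⟨R, Finset.mem_filter.2 ⟨hR.1, hR⟩, hQR⟩

variable {X : Type*} [MeasurableSpace X] {μ : Measure X}

lemma sum_setLIntegral_le {M : Finset (Set X)} (hM : (M : Set (Set X)).PairwiseDisjoint id)
    (hm : ∀ Q ∈ M, MeasurableSet Q) (h : X → ℝ≥0∞) :
    ∑ Q ∈ M, ∫⁻ x in Q, h x ∂μ ≤ ∫⁻ x, h x ∂μ := by
  exact (lintegral_biUnion_finset hM hm h).symm.le.trans (setLIntegral_le_lintegral _ _)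

/-- The union of a finite laminar family is controlled by the integral of a function with
large integrals over all the members. -/
lemma IsLaminar.measure_biUnion_le {S : Finset (Set X)} (hS : IsLaminar S)
    (hm : ∀ Q ∈ S, MeasurableSet Q) {m : Measure X} {h : X → ℝ≥0∞}
    (hh : ∀ Q ∈ S, m Q ≤ ∫⁻ x in Q, h x ∂μ) : m (⋃ Q ∈ S, Q) ≤ ∫⁻ x, h x ∂μ := by
  obtain ⟨M, hMS, hMd, hM⟩ := hS.exists_maximal
  calc m (⋃ Q ∈ S, Q) ≤ m (⋃ Q ∈ M, Q) := by
        refine measure_mono (iUnion₂_subset fun Q hQ => ?_)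
        obtain ⟨R, hR, hQR⟩ := hM Q hQ
        exact hQR.trans (subset_biUnion_of_mem (u := fun Q => Q) hR)
    _ ≤ ∑ Q ∈ M, m Q := measure_biUnion_finset_le _ _
    _ ≤ ∑ Q ∈ M, ∫⁻ x in Q, h x ∂μ := Finset.sum_le_sum fun Q hQ => hh Q (hMS hQ)
    _ ≤ _ := sum_setLIntegral_le hMd (fun Q hQ => hm Q (hMS hQ)) h

/-- Packing is applied below each maximal member; these are disjoint and contain all the others. -/
lemma IsCarleson.sum_measure_le {S : Finset (Set X)} {Λ : ℕ} (hS : IsCarleson μ S Λ)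
    {h : X → ℝ≥0∞} (hh : ∀ Q ∈ S, μ Q ≤ ∫⁻ x in Q, h x ∂μ) :
    ∑ Q ∈ S, μ Q ≤ Λ * ∫⁻ x, h x ∂μ := by
  classical
  obtain ⟨M, hMS, hMd, hM⟩ := hS.laminar.exists_maximal
  calc ∑ Q ∈ S, μ Q ≤ ∑ Q ∈ S, ∑ R ∈ M, if Q ⊆ R then μ Q else 0 := by
        refine Finset.sum_le_sum fun Q hQ => ?_
        obtain ⟨R, hR, hQR⟩ := hM Q hQ
        calc μ Q = if Q ⊆ R then μ Q else 0 := by rw [if_pos hQR]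
          _ ≤ _ := Finset.single_le_sum (f := fun R => if Q ⊆ R then μ Q else 0)
            (fun _ _ => zero_le) hR
    _ = ∑ R ∈ M, ∑ Q ∈ S.filter (· ⊆ R), μ Q := by
        rw [Finset.sum_comm]
        simp_rw [Finset.sum_filter]
    _ ≤ ∑ R ∈ M, Λ * ∫⁻ x in R, h x ∂μ := Finset.sum_le_sum fun R hR =>
        (hS.packing R (hMS hR)).trans (mul_le_mul_right (hh R (hMS hR)) _)
    _ ≤ _ := by
        rw [← Finset.mul_sum]
        exact mul_le_mul_right (sum_setLIntegral_le hMd (fun Q hQ => hS.measurable Q (hMS hQ)) h) _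

/-- Values of `f` up to `l` account for at most `l μ(Q)` of an integral that is at least `2l μ(Q)`,
so the truncation of `f` to `{f > l}` still has average at least `l`. The level-set form of the
embedding theorem. -/
lemma IsCarleson.sum_large_average_le {S : Finset (Set X)} {Λ : ℕ} (hS : IsCarleson μ S Λ)
    {f : X → ℝ} (hf : AEMeasurable f μ) {l : ℝ} (hl : 0 < l)
    (hA : ∀ Q ∈ S, ENNReal.ofReal (2 * l) * μ Q ≤ ∫⁻ x in Q, ENNReal.ofReal (f x) ∂μ) :
    ∑ Q ∈ S, μ Q ≤ Λ * ((ENNReal.ofReal l)⁻¹ *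
      (μ.withDensity fun x => ENNReal.ofReal (f x)) {x | l < f x}) := by
  have hl0 : ENNReal.ofReal l ≠ 0 := by simpa using hl
  have hn : NullMeasurableSet {x | l < f x} μ := nullMeasurableSet_lt aemeasurable_const hf
  have key : ∀ Q ∈ S, ENNReal.ofReal l * μ Q ≤
      ∫⁻ x in Q, {x | l < f x}.indicator (fun x => ENNReal.ofReal (f x)) x ∂μ := by
    intro Q hQ
    have h1 : ∫⁻ x in Q, ENNReal.ofReal (f x) ∂μ ≤
        ∫⁻ x in Q, {x | l < f x}.indicator (fun x => ENNReal.ofReal (f x)) x ∂μ +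
          ENNReal.ofReal l * μ Q := by
      rw [← setLIntegral_const, ← lintegral_add_right _ measurable_const]
      refine lintegral_mono fun x => ?_
      by_cases hx : l < f x
      · rw [indicator_of_mem (by exact hx)]; exact le_self_add
      · rw [indicator_of_notMem (by exact hx), zero_add]
        exact ENNReal.ofReal_le_ofReal (not_lt.1 hx)
    have h2 := (hA Q hQ).trans h1
    rw [ENNReal.ofReal_mul two_pos.le, ENNReal.ofReal_ofNat, two_mul, add_mul] at h2
    exact (ENNReal.add_le_add_iff_right
      (ENNReal.mul_ne_top ENNReal.ofReal_ne_top (hS.ne_top Q hQ))).1 h2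
  have := hS.sum_measure_le (h := fun x => (ENNReal.ofReal l)⁻¹ *
    {x | l < f x}.indicator (fun x => ENNReal.ofReal (f x)) x) (fun Q hQ => by
      rw [lintegral_const_mul' _ _ (ENNReal.inv_ne_top.2 hl0)]
      calc μ Q = (ENNReal.ofReal l)⁻¹ * (ENNReal.ofReal l * μ Q) := by
            rw [← mul_assoc, ENNReal.inv_mul_cancel hl0 ENNReal.ofReal_ne_top, one_mul]
        _ ≤ _ := mul_le_mul_right (key Q hQ) _)
  refine this.trans (le_of_eq ?_)
  rw [lintegral_const_mul' _ _ (ENNReal.inv_ne_top.2 hl0), lintegral_indicator₀ hn,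
    withDensity_apply₀ _ hn]

/-- The Carleson embedding theorem. -/
lemma IsCarleson.sum_average_rpow_le {S : Finset (Set X)} {Λ : ℕ} (hS : IsCarleson μ S Λ)
    {f : X → ℝ} (hf : AEMeasurable f μ) (hf0 : ∀ x, 0 ≤ f x) {t : ℝ} (ht : 1 < t) :
    ∑ Q ∈ S, ((μ Q)⁻¹ * ∫⁻ x in Q, ENNReal.ofReal (f x) ∂μ) ^ t * μ Q ≤
      (2 ^ t * ENNReal.ofReal (t / (t - 1)) * Λ) * ∫⁻ x, ENNReal.ofReal (f x) ^ t ∂μ := by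
  classical
  have ht0 : 0 < t := by linarith
  have ht1 : 0 < t - 1 := by linarith
  by_cases hfin : ∫⁻ x, ENNReal.ofReal (f x) ^ t ∂μ = ∞
  · rcases S.eq_empty_or_nonempty with rfl | ⟨Q, hQ⟩
    · simp
    · have hΛ : (Λ : ℝ≥0∞) ≠ 0 := by
        intro h0
        have h1 := hS.packing Q hQ
        rw [h0, zero_mul, nonpos_iff_eq_zero, Finset.sum_eq_zero_iff] at h1
        exact hS.ne_zero Q hQ (h1 Q (Finset.mem_filter.2 ⟨hQ, Subset.rfl⟩))
      rw [hfin, ENNReal.mul_top]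
      · exact le_top
      · refine mul_ne_zero (mul_ne_zero (by simp) ?_) hΛ
        simp only [ne_eq, ENNReal.ofReal_eq_zero, not_le]
        positivity
  set A : Set X → ℝ≥0∞ := fun Q => (μ Q)⁻¹ * ∫⁻ x in Q, ENNReal.ofReal (f x) ∂μ with hA
  set F : X → ℝ≥0∞ := fun x => ENNReal.ofReal (f x) with hF
  have hFm : AEMeasurable F μ := hf.ennreal_ofReal
  have hAt : ∀ Q ∈ S, A Q ≠ ∞ := by
    intro Q hQ
    refine ENNReal.mul_ne_top (ENNReal.inv_ne_top.2 (hS.ne_zero Q hQ)) ?_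
    refine ne_top_of_le_ne_top (ENNReal.add_ne_top.2 ⟨hS.ne_top Q hQ, hfin⟩)
      (?_ : _ ≤ μ Q + ∫⁻ x, F x ^ t ∂μ)
    calc ∫⁻ x in Q, F x ∂μ ≤ ∫⁻ x in Q, (1 + F x ^ t) ∂μ := by
          refine lintegral_mono fun x => ?_
          rcases le_total (F x) 1 with h | h
          · exact h.trans le_self_add
          · calc F x = F x ^ (1 : ℝ) := (ENNReal.rpow_one _).symm
              _ ≤ F x ^ t := ENNReal.rpow_le_rpow_of_exponent_le h ht.le
              _ ≤ _ := le_add_self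
      _ = μ Q + ∫⁻ x in Q, F x ^ t ∂μ := by
          rw [lintegral_add_left measurable_const, setLIntegral_one]
      _ ≤ _ := add_le_add le_rfl (setLIntegral_le_lintegral _ _)
  set ν := μ.withDensity F with hν
  have hmono : ∀ Q : Set X, Antitone fun l : ℝ => μ.restrict Q {_x : X | l < (A Q).toReal / 2} :=
    fun Q l l' hll => measure_mono fun x hx => lt_of_le_of_lt hll hx
  -- The layer cake formula for a constant function on `Q`: the set whose measure is taken is
  -- everything or empty according to whether `l` is below half the average.
  have hcut : ∀ Q ∈ S, (A Q / 2) ^ t * μ Q = ENNReal.ofReal t * ∫⁻ l in Ioi (0 : ℝ),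
      μ.restrict Q {_x : X | l < (A Q).toReal / 2} * ENNReal.ofReal (l ^ (t - 1)) := by
    intro Q hQ
    have := lintegral_rpow_eq_lintegral_meas_lt_mul (μ.restrict Q)
      (f := fun _ => (A Q).toReal / 2) (Filter.Eventually.of_forall fun _ => by positivity)
      aemeasurable_const ht0
    rw [← this, setLIntegral_const, ← ENNReal.ofReal_rpow_of_nonneg (by positivity) ht0.le,
      ENNReal.ofReal_div_of_pos two_pos, ENNReal.ofReal_toReal (hAt Q hQ), ENNReal.ofReal_ofNat]
  have hlevel : ∀ l ∈ Ioi (0 : ℝ), ∑ Q ∈ S, μ.restrict Q {_x : X | l < (A Q).toReal / 2} *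
      ENNReal.ofReal (l ^ (t - 1)) ≤ Λ * (ν {x | l < f x} * ENNReal.ofReal (l ^ (t - 1 - 1))) := by
    intro l hl
    have hl' : 0 < l := hl
    rw [← Finset.sum_mul]
    have h1 : ∑ Q ∈ S, μ.restrict Q {_x : X | l < (A Q).toReal / 2} =
        ∑ Q ∈ S.filter (fun Q => l < (A Q).toReal / 2), μ Q := by
      rw [Finset.sum_filter]
      refine Finset.sum_congr rfl fun Q hQ => ?_
      split_ifs with h
      · simp [h]
      · simp [h]
    have h2 := (hS.mono (Finset.filter_subset (fun Q => l < (A Q).toReal / 2) S)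
      ).sum_large_average_le hf hl' (fun Q hQ => by
        obtain ⟨hQ, hlQ⟩ := Finset.mem_filter.1 hQ
        have h3 : ENNReal.ofReal (2 * l) ≤ A Q := by
          rw [← ENNReal.ofReal_toReal (hAt Q hQ)]
          exact ENNReal.ofReal_le_ofReal (by linarith)
        calc _ ≤ A Q * μ Q := mul_le_mul_left h3 _
          _ = _ := by
            rw [hA, mul_comm, ← mul_assoc, ENNReal.mul_inv_cancel (hS.ne_zero Q hQ)
              (hS.ne_top Q hQ), one_mul])
    rw [h1]
    refine (mul_le_mul_left h2 _).trans (le_of_eq ?_)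
    rw [Real.rpow_sub_one hl'.ne' (t - 1), ENNReal.ofReal_div_of_pos hl', div_eq_mul_inv]
    ring
  -- The layer cake formula for the measure `f dμ` with exponent `t - 1`, which integrates the
  -- level-set bound to `∫ f^t`.
  have hν' : ∫⁻ x, ENNReal.ofReal (f x ^ (t - 1)) ∂ν = ENNReal.ofReal (t - 1) *
      ∫⁻ l in Ioi (0 : ℝ), ν {x | l < f x} * ENNReal.ofReal (l ^ (t - 1 - 1)) :=
    lintegral_rpow_eq_lintegral_meas_lt_mul ν (Filter.Eventually.of_forall hf0)
      (hf.mono_ac (withDensity_absolutelyContinuous _ _)) ht1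
  have hνF : ∫⁻ x, ENNReal.ofReal (f x ^ (t - 1)) ∂ν = ∫⁻ x, F x ^ t ∂μ := by
    rw [hν, lintegral_withDensity_eq_lintegral_mul₀ hFm
      (hf.pow_const _).ennreal_ofReal]
    refine lintegral_congr fun x => ?_
    rw [Pi.mul_apply, ← ENNReal.ofReal_rpow_of_nonneg (hf0 x) ht1.le]
    nth_rewrite 1 [← ENNReal.rpow_one (F x)]
    rw [← ENNReal.rpow_add_of_nonneg _ _ zero_le_one ht1.le]
    congr 1; ring
  have hone : ENNReal.ofReal (t / (t - 1)) * ENNReal.ofReal (t - 1) = ENNReal.ofReal t := by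
    rw [← ENNReal.ofReal_mul (by positivity), div_mul_cancel₀ _ ht1.ne']
  calc ∑ Q ∈ S, A Q ^ t * μ Q = 2 ^ t * ∑ Q ∈ S, (A Q / 2) ^ t * μ Q := by
        rw [Finset.mul_sum]
        refine Finset.sum_congr rfl fun Q hQ => ?_
        rw [← mul_assoc, ← ENNReal.mul_rpow_of_nonneg _ _ ht0.le, ENNReal.mul_div_cancel
          (by simp) (by simp)]
    _ = 2 ^ t * (ENNReal.ofReal t * ∫⁻ l in Ioi (0 : ℝ), ∑ Q ∈ S,
          μ.restrict Q {_x : X | l < (A Q).toReal / 2} * ENNReal.ofReal (l ^ (t - 1))) := by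
        rw [lintegral_finsetSum, Finset.sum_congr rfl hcut, Finset.mul_sum, ← Finset.mul_sum,
          ← Finset.mul_sum]
        intro Q hQ
        exact (hmono Q).measurable.mul (by fun_prop)
    _ ≤ 2 ^ t * (ENNReal.ofReal t * ∫⁻ l in Ioi (0 : ℝ),
          Λ * (ν {x | l < f x} * ENNReal.ofReal (l ^ (t - 1 - 1)))) :=
        mul_le_mul_right (mul_le_mul_right (setLIntegral_mono' measurableSet_Ioi hlevel) _) _
    _ = _ := by
        rw [lintegral_const_mul' _ _ (ENNReal.natCast_ne_top _), ← hνF, hν', ← hone]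
        ring

/-- Unweighted bounds for the forms given by Carleson families. -/
lemma IsCarleson.form_le {F : Type*} [NormedAddCommGroup F] (Λ : ℕ) {p s r r' : ℝ≥0∞} (hp : p ≠ 0)
    (hs : s ≠ 0) (hpr : p < r') (hsr : s < r) (hr : r ≠ ∞) (hr' : r' ≠ ∞)
    (hrr : r'.HolderConjugate r) : ∃ C : ℝ≥0, ∀ (μ : Measure X) (S : Finset (Set X)),
      IsCarleson μ S Λ → ∀ f g : X → F, AEStronglyMeasurable f μ → AEStronglyMeasurable g μ →
      ∑ Q ∈ S, avg μ p Q f * avg μ s Q g * μ Q ≤ C * (eLpNorm f r' μ * eLpNorm g r μ) := by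
  -- Each factor is handled by the embedding theorem applied to `‖f‖^p` with exponent `r/p > 1`;
  -- Hölder's inequality for sums then combines the two.
  have hone : ∀ {p r : ℝ≥0∞}, p ≠ 0 → p < r → r ≠ ∞ → ∃ C : ℝ≥0, ∀ (μ : Measure X)
      (S : Finset (Set X)), IsCarleson μ S Λ → ∀ f : X → F, AEStronglyMeasurable f μ →
      (∑ Q ∈ S, (avg μ p Q f * μ Q ^ (1 / r.toReal)) ^ r.toReal) ^ (1 / r.toReal) ≤
        C * eLpNorm f r μ := by
    intro p r hp hpr hr
    have hpt : p ≠ ∞ := hpr.ne_top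
    have hp0 : 0 < p.toReal := ENNReal.toReal_pos hp hpt
    have hr0 : 0 < r.toReal := hp0.trans ((ENNReal.toReal_lt_toReal hpt hr).2 hpr)
    have ht : 1 < r.toReal / p.toReal := by
      rw [one_lt_div hp0]; exact (ENNReal.toReal_lt_toReal hpt hr).2 hpr
    set t := r.toReal / p.toReal with htdef
    have hCt : ((2 : ℝ≥0∞) ^ t * ENNReal.ofReal (t / (t - 1)) * Λ) ^ (1 / r.toReal) ≠ ∞ := by
      refine ENNReal.rpow_ne_top_of_nonneg (by positivity) (ENNReal.mul_ne_top
        (ENNReal.mul_ne_top ?_ ENNReal.ofReal_ne_top) (ENNReal.natCast_ne_top _))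
      exact ENNReal.rpow_ne_top_of_nonneg (by positivity) (by simp)
    refine ⟨(((2 : ℝ≥0∞) ^ t * ENNReal.ofReal (t / (t - 1)) * Λ) ^ (1 / r.toReal)).toNNReal,
      fun μ S hS f hf => ?_⟩
    have := hS.sum_average_rpow_le (f := fun x => ‖f x‖ ^ p.toReal)
      (hf.norm.aemeasurable.pow_const _) (fun x => by positivity) ht
    have e : ∀ x, ENNReal.ofReal (‖f x‖ ^ p.toReal) = ‖f x‖ₑ ^ p.toReal := by
      intro x
      rw [← ENNReal.ofReal_rpow_of_nonneg (norm_nonneg _) hp0.le, ofReal_norm]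
    simp_rw [e, ← ENNReal.rpow_mul] at this
    rw [ENNReal.coe_toNNReal hCt, eLpNorm_eq_lintegral_rpow_enorm_toReal (hp.bot_lt.trans hpr).ne'
      hr, ← ENNReal.mul_rpow_of_nonneg _ _ (by positivity)]
    refine ENNReal.rpow_le_rpow (le_trans (le_of_eq ?_) (this.trans (le_of_eq ?_))) (by positivity)
    · refine Finset.sum_congr rfl fun Q hQ => ?_
      rw [avg_toReal hp hpt, ENNReal.mul_rpow_of_nonneg _ _ hr0.le, ← ENNReal.rpow_mul,
        ← ENNReal.rpow_mul, one_div_mul_cancel hr0.ne', ENNReal.rpow_one, htdef,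
        one_div_mul_eq_div]
    · rw [htdef, mul_div_cancel₀ _ hp0.ne']
  obtain ⟨C₁, h₁⟩ := hone hp hpr hr'
  obtain ⟨C₂, h₂⟩ := hone hs hsr hr
  refine ⟨C₁ * C₂, fun μ S hS f g hf hg => ?_⟩
  have hpos : ∀ {p r : ℝ≥0∞}, p < r → r ≠ ∞ → 0 < r.toReal := fun h h' =>
    ENNReal.toReal_pos (pos_of_gt h).ne' h'
  have hconj : r'.toReal.HolderConjugate r.toReal :=
    ENNReal.HolderTriple.toReal (r := 1) (hpos hpr hr') (hpos hsr hr)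
  calc ∑ Q ∈ S, avg μ p Q f * avg μ s Q g * μ Q
      = ∑ Q ∈ S, (avg μ p Q f * μ Q ^ (1 / r'.toReal)) * (avg μ s Q g * μ Q ^ (1 / r.toReal)) := by
        refine Finset.sum_congr rfl fun Q hQ => ?_
        have : μ Q = μ Q ^ (1 / r'.toReal) * μ Q ^ (1 / r.toReal) := by
          rw [← ENNReal.rpow_add_of_nonneg _ _ (by positivity) (by positivity), one_div, one_div,
            hconj.inv_add_inv_eq_one, ENNReal.rpow_one]
        nth_rewrite 1 [this]
        ring
    _ ≤ _ := ENNReal.inner_le_Lp_mul_Lq _ _ _ hconj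
    _ ≤ (C₁ * eLpNorm f r' μ) * (C₂ * eLpNorm g r μ) :=
        mul_le_mul' (h₁ μ S hS f hf) (h₂ μ S hS g hg)
    _ = _ := by push_cast; ring

end Maximal

/-! ### Sparse collections and sparse forms -/

section SparseForms

variable {n : ℕ} {ν : ℝ} {μ : Measure (EuclideanSpace ℝ (Fin n))}

/-- The sets `E R` of the members inside `Q` are disjoint subsets of `Q`, so their measures add up
to at most `μ(Q)`; each member costs `η⁻¹`. -/
lemma IsSparse.isCarleson (hμ : IsDoubling ν μ) {η : ℝ} (hη : 0 < η)
    {S : Set (Set (EuclideanSpace ℝ (Fin n)))} (hS : IsSparse μ η S) {α : Fin n → Fin 3}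
    {F : Finset (Set (EuclideanSpace ℝ (Fin n)))} (hF : ↑F ⊆ S ∩ dyadicGrid α) :
    IsCarleson μ F ⌈1 / η⌉₊ := by
  classical
  obtain ⟨E, hEd, hE⟩ := hS.2 α
  have hgrid : ∀ Q ∈ F, Q ∈ dyadicGrid α := fun Q hQ => (hF (Finset.mem_coe.2 hQ)).2
  refine ⟨isLaminar_of_subset_dyadicGrid hgrid, fun Q hQ => ?_, fun Q hQ => ?_, fun Q hQ => ?_,
    fun Q hQ => ?_⟩
  · obtain ⟨k, m, rfl⟩ := hgrid Q hQ
    exact measurableSet_dyadicCube α k m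
  · obtain ⟨k, m, rfl⟩ := hgrid Q hQ
    exact hμ.cube_ne_zero α k m
  · obtain ⟨k, m, rfl⟩ := hgrid Q hQ
    exact hμ.cube_ne_top α k m
  · have hsub : ∀ R ∈ F.filter (· ⊆ Q), R ∈ S ∩ dyadicGrid α := fun R hR =>
      hF (Finset.mem_coe.2 (Finset.mem_filter.1 hR).1)
    calc ∑ R ∈ F.filter (· ⊆ Q), μ R
        ≤ ∑ R ∈ F.filter (· ⊆ Q), (ENNReal.ofReal η)⁻¹ * μ (E R) :=
          Finset.sum_le_sum fun R hR => (hE R (hsub R hR)).2.2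
      _ = (ENNReal.ofReal η)⁻¹ * μ (⋃ R ∈ F.filter (· ⊆ Q), E R) := by
          rw [← Finset.mul_sum, measure_biUnion_finset]
          · exact hEd.subset fun R hR => hsub R (Finset.mem_coe.1 hR)
          · exact fun R hR => (hE R (hsub R hR)).1
      _ ≤ ⌈1 / η⌉₊ * μ Q := by
          refine mul_le_mul' ?_ (measure_mono (iUnion₂_subset fun R hR =>
            (hE R (hsub R hR)).2.1.trans (Finset.mem_filter.1 hR).2))
          rw [← ENNReal.ofReal_inv_of_pos hη, ← ENNReal.ofReal_natCast]
          apply ENNReal.ofReal_le_ofReal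
          rw [← one_div]
          exact Nat.le_ceil _

/-- Reduction of a sum over dyadic cubes to finite sums over a single grid. -/
lemma tsum_le_of_forall_grid {S : Set (Set (EuclideanSpace ℝ (Fin n)))} (hS : S ⊆ dyadicCubes n)
    {x : Set (EuclideanSpace ℝ (Fin n)) → ℝ≥0∞} {B : ℝ≥0∞}
    (h : ∀ (α : Fin n → Fin 3) (F : Finset (Set (EuclideanSpace ℝ (Fin n)))),
      ↑F ⊆ S ∩ dyadicGrid α → ∑ Q ∈ F, x Q ≤ B) : ∑' Q : S, x Q ≤ 3 ^ n * B := by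
  classical
  rw [ENNReal.tsum_eq_iSup_sum]
  refine iSup_le fun F => ?_
  have e : ∑ Q ∈ F, x Q = ∑ Q ∈ F.map (Function.Embedding.subtype _), x Q := by
    rw [Finset.sum_map]; rfl
  rw [e]
  set G := F.map (Function.Embedding.subtype _) with hG
  have hGS : ∀ Q ∈ G, Q ∈ S := by
    intro Q hQ
    obtain ⟨R, -, rfl⟩ := Finset.mem_map.1 hQ
    exact R.2
  calc ∑ Q ∈ G, x Q ≤ ∑ Q ∈ G, ∑ α : Fin n → Fin 3, if Q ∈ dyadicGrid α then x Q else 0 := by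
        refine Finset.sum_le_sum fun Q hQ => ?_
        obtain ⟨α, hα⟩ := hS (hGS Q hQ)
        calc x Q = if Q ∈ dyadicGrid α then x Q else 0 := by rw [if_pos hα]
          _ ≤ _ := Finset.single_le_sum (f := fun α => if Q ∈ dyadicGrid α then x Q else 0)
            (fun _ _ => zero_le) (Finset.mem_univ α)
    _ = ∑ α : Fin n → Fin 3, ∑ Q ∈ G.filter (· ∈ dyadicGrid α), x Q := by
        rw [Finset.sum_comm]
        simp_rw [Finset.sum_filter]
    _ ≤ ∑ _α : Fin n → Fin 3, B := by
        refine Finset.sum_le_sum fun α _ => h α _ fun Q hQ => ?_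
        obtain ⟨h1, h2⟩ := Finset.mem_filter.1 (Finset.mem_coe.1 hQ)
        exact ⟨hGS Q h1, h2⟩
    _ = _ := by simp

/-- The sparse form. -/
def sparseForm {F : Type*} [NormedAddCommGroup F] (μ : Measure (EuclideanSpace ℝ (Fin n)))
    (p s : ℝ≥0∞) (S : Set (Set (EuclideanSpace ℝ (Fin n)))) (f g : EuclideanSpace ℝ (Fin n) → F) :
    ℝ≥0∞ :=
  ∑' Q : S, avg μ p (Q : Set _) f * avg μ s (Q : Set _) g * μ (Q : Set _)

lemma sparseForm_add_le {F : Type*} [NormedAddCommGroup F] {p s : ℝ≥0∞} (hs : 1 ≤ s)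
    (S : Set (Set (EuclideanSpace ℝ (Fin n)))) (f : EuclideanSpace ℝ (Fin n) → F)
    {g h : EuclideanSpace ℝ (Fin n) → F} (hg : AEStronglyMeasurable g μ)
    (hh : AEStronglyMeasurable h μ) :
    sparseForm μ p s S f (g + h) ≤ sparseForm μ p s S f g + sparseForm μ p s S f h := by
  rw [sparseForm, sparseForm, sparseForm, ← ENNReal.tsum_add]
  refine ENNReal.tsum_le_tsum fun Q => ?_
  rw [← add_mul, ← mul_add]
  refine mul_le_mul_left (mul_le_mul_right ?_ _) _
  have hac : (μ (Q : Set _))⁻¹ • μ.restrict (Q : Set _) ≪ μ :=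
    Measure.AbsolutelyContinuous.smul_left Measure.restrict_le_self.absolutelyContinuous _
  exact eLpNorm_add_le (hg.mono_ac hac) (hh.mono_ac hac) hs

/-- Sparse forms are bounded on unweighted Lebesgue spaces. -/
lemma exists_sparseForm_le {F : Type*} [NormedAddCommGroup F] (hμ : IsDoubling ν μ) {η : ℝ}
    (hη : 0 < η) {p s r r' : ℝ≥0∞}
    (hp : p ≠ 0) (hs : s ≠ 0) (hpr : p < r') (hsr : s < r) (hr : r ≠ ∞) (hr' : r' ≠ ∞)
    (hrr : r'.HolderConjugate r) : ∃ C : ℝ≥0, ∀ S, IsSparse μ η S →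
      ∀ f g : EuclideanSpace ℝ (Fin n) → F, AEStronglyMeasurable f μ → AEStronglyMeasurable g μ →
      sparseForm μ p s S f g ≤ C * (eLpNorm f r' μ * eLpNorm g r μ) := by
  obtain ⟨C, hC⟩ := IsCarleson.form_le (X := EuclideanSpace ℝ (Fin n)) (F := F) ⌈1 / η⌉₊ hp hs
    hpr hsr hr hr' hrr
  refine ⟨3 ^ n * C, fun S hS f g hf hg => ?_⟩
  have := tsum_le_of_forall_grid (x := fun Q => avg μ p Q f * avg μ s Q g * μ Q) hS.1
    (fun α F hF => hC μ F (hS.isCarleson hμ hη hF) f g hf hg)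
  refine this.trans (le_of_eq ?_)
  push_cast
  rw [mul_assoc]

end SparseForms

/-! ### The single-grid estimate in terms of `ψ(w)` -/

section Unified

variable {n : ℕ}

lemma avg_indicator {X F : Type*} [MeasurableSpace X] [NormedAddCommGroup F] {μ : Measure X}
    {p : ℝ≥0∞} (hp0 : p ≠ 0) (hp : p ≠ ∞) (Q : Set X) {E : Set X} (hE : MeasurableSet E)
    (f : X → F) :
    avg μ p Q (E.indicator f) =
      ((μ Q)⁻¹ * ∫⁻ x in E ∩ Q, ‖f x‖ₑ ^ p.toReal ∂μ) ^ (1 / p.toReal) := by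
  have h0 : 0 < p.toReal := ENNReal.toReal_pos hp0 hp
  rw [avg_toReal hp0 hp, ← Measure.restrict_restrict hE, ← lintegral_indicator hE]
  congr 3
  ext x
  by_cases hx : x ∈ E
  · simp [hx]
  · simp [hx, h0]

lemma conjExponent_toReal {q : ℝ≥0∞} (hq : 1 < q) (hqt : q ≠ ∞) :
    q.conjExponent.toReal = q.toReal / (q.toReal - 1) := by
  have h1 : 1 < q.toReal := by
    rw [← ENNReal.toReal_one]; exact (ENNReal.toReal_lt_toReal (by simp) hqt).2 hq
  have h2 : q - 1 ≠ 0 := (tsub_pos_of_lt hq).ne'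
  rw [ENNReal.conjExponent, ENNReal.toReal_add (by simp) (ENNReal.inv_ne_top.2 h2),
    ENNReal.toReal_inv, ENNReal.toReal_sub_of_le hq.le hqt, ENNReal.toReal_one]
  have : q.toReal - 1 ≠ 0 := by linarith
  field_simp
  ring

lemma rhExp_toReal {p q : ℝ≥0∞} (hp : 1 ≤ p) (hpq : p < q) (hqt : q ≠ ∞) :
    (rhExp p q).toReal = q.toReal / (q.toReal - p.toReal) := by
  have hpt := hpq.ne_top
  have hp0 : 0 < p.toReal := ENNReal.toReal_pos (by positivity) hpt
  have hpq' := (ENNReal.toReal_lt_toReal hpt hqt).2 hpq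
  rw [rhExp, conjExponent_toReal, ENNReal.toReal_div]
  · have : q.toReal - p.toReal ≠ 0 := by linarith
    have : q.toReal / p.toReal - 1 ≠ 0 := by
      rw [div_sub_one hp0.ne']; exact div_ne_zero this hp0.ne'
    field_simp
  · rw [ENNReal.lt_div_iff_mul_lt (Or.inr (by simp)) (Or.inr (by simp)), one_mul]; exact hpq
  · exact ENNReal.div_ne_top hqt (by positivity)

lemma rhExp_one (q : ℝ≥0∞) : rhExp 1 q = q.conjExponent := by rw [rhExp, div_one]

lemma rhExp_ne_one {p q : ℝ≥0∞} (hp : 1 ≤ p) (hq : q ≠ ∞) : rhExp p q ≠ 1 := by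
  rw [rhExp, ENNReal.conjExponent]
  intro h
  have h2 : (q / p - 1)⁻¹ = 0 := by
    have := ENNReal.add_right_inj (a := 1) ENNReal.one_ne_top |>.1 (h.trans (add_zero 1).symm)
    exact this
  rw [ENNReal.inv_eq_zero] at h2
  exact (ENNReal.sub_ne_top (ENNReal.div_ne_top hq (by positivity))) h2

lemma rhExp_ne_zero (p q : ℝ≥0∞) : rhExp p q ≠ 0 := by
  rw [rhExp, ENNReal.conjExponent]; simp

lemma rhExp_ne_top {p q : ℝ≥0∞} (hpq : p < q) : rhExp p q ≠ ∞ := by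
  rw [rhExp, ENNReal.conjExponent]
  refine ENNReal.add_ne_top.2 ⟨by simp, ENNReal.inv_ne_top.2 (tsub_pos_of_lt ?_).ne'⟩
  rw [ENNReal.lt_div_iff_mul_lt (Or.inr (by simp)) (Or.inr (by simp)), one_mul]
  exact hpq

/-- The estimate of a sparse form in a single grid. -/
theorem exists_grid_bound (hn : 1 ≤ n) (ν : ℝ) {Λ : ℕ} (hΛ : 1 ≤ Λ) {p₀ q₀ : ℝ≥0∞} (hp₀ : 1 ≤ p₀)
    (hpq : p₀ < q₀) {ζ : ℝ≥0} (hζ : 0 < ζ) : ∃ C : ℝ≥0,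
      ∀ (μ : Measure (EuclideanSpace ℝ (Fin n))) (w : EuclideanSpace ℝ (Fin n) → ℝ),
      IsDoubling ν μ → InA1 μ w → InRH μ w (rhExp p₀ q₀) →
      psi μ p₀ q₀ w < ∞ ∧
      ∀ (α : Fin n → Fin 3) (S : Finset (Set (EuclideanSpace ℝ (Fin n)))),
      (∀ Q ∈ S, Q ∈ dyadicGrid α) → IsCarleson μ S Λ →
      ∀ (h : EuclideanSpace ℝ (Fin n) → ℝ≥0∞), Measurable h →
      (∀ Q ∈ S, ∫⁻ x in Q, h x ∂μ ≤ μ Q) →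
      ∀ E : Set (EuclideanSpace ℝ (Fin n)), MeasurableSet E →
      ∑ Q ∈ S, ((μ Q)⁻¹ * ∫⁻ x in Q, h x ∂μ) ^ (1 / p₀.toReal) *
        avg μ q₀.conjExponent Q (E.indicator w) * μ Q ≤
        ζ * wMeasure μ w E +
        C * (psi μ p₀ q₀ w ^ p₀.toReal * ∫⁻ x, h x * ENNReal.ofReal (w x) ∂μ) := by
  have hpt : p₀ ≠ ∞ := hpq.ne_top
  have hp1 : 1 ≤ p₀.toReal := by
    rw [← ENNReal.toReal_one]; exact ENNReal.toReal_mono hpt hp₀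
  have hp0 : 0 < p₀.toReal := by linarith
  have hone : p₀.toReal = 1 ↔ p₀ = 1 := by
    rw [← ENNReal.toReal_one, ENNReal.toReal_eq_toReal_iff' hpt (by simp)]
  rcases eq_or_ne q₀ ∞ with rfl | hqt
  · have hs : (∞ : ℝ≥0∞).conjExponent = 1 := by rw [ENNReal.conjExponent]; simp
    obtain ⟨C, hC⟩ := exists_grid_bound_top hn ν hΛ (γ := 1 / p₀.toReal) (by positivity)
      (by rw [div_le_one hp0]; exact hp1) hζ
    refine ⟨C, fun μ w hμ hA1 hRH => ?_⟩
    have hw := hA1.1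
    have hAt : AinftyConst μ w ≠ ∞ := ne_top_of_le_ne_top
      (ENNReal.mul_ne_top (by simp) hA1.2.ne) (AinftyConst_le hμ hn hw)
    have hlogt : logE (AinftyConst μ w) ≠ ∞ := by rw [logE_eq hAt]; exact ENNReal.ofReal_ne_top
    -- With `γ = 1/p₀`, both sides equal `p₀ - 1`: the power of the `A_∞` constant in `ψ^p₀` is
    -- exactly the one produced by the threshold.
    have hpc : p₀ ≠ 1 → 1 / p₀.conjExponent.toReal * p₀.toReal = 1 / (1 / p₀.toReal) - 1 := by
      intro h1
      rw [conjExponent_toReal (hp₀.lt_of_ne' h1) hpt]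
      have : p₀.toReal - 1 ≠ 0 := fun h => h1 (hone.1 (by linarith))
      field_simp
    have hψ : psi μ p₀ ∞ w < ∞ := by
      rw [psi, if_pos rfl]
      split_ifs with h1
      · exact ENNReal.mul_lt_top hA1.2 hlogt.lt_top
      · refine ENNReal.mul_lt_top (ENNReal.mul_lt_top ?_ ?_) ?_
        · exact ENNReal.rpow_lt_top_of_nonneg (by positivity) hA1.2.ne
        · exact ENNReal.rpow_lt_top_of_nonneg (by positivity) hAt
        · exact ENNReal.rpow_lt_top_of_nonneg (by positivity) hlogt
    refine ⟨hψ, fun α S hS hSc h hh hhS E hE => ?_⟩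
    have key : topFactor (1 / p₀.toReal) (AinftyConst μ w) * A1const μ w ≤
        psi μ p₀ ∞ w ^ p₀.toReal := by
      rw [psi, if_pos rfl, topFactor]
      split_ifs with h1 h2 h2
      · rw [h2, ENNReal.toReal_one, ENNReal.rpow_one, mul_comm]
      · exact absurd (hone.1 ((div_eq_one_iff_eq hp0.ne').1 h1).symm) h2
      · exact absurd (by rw [h2]; simp) h1
      · rw [ENNReal.mul_rpow_of_nonneg _ _ hp0.le, ENNReal.mul_rpow_of_nonneg _ _ hp0.le,
          ← ENNReal.rpow_mul, ← ENNReal.rpow_mul, ← ENNReal.rpow_mul, hpc h2,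
          one_div_mul_cancel hp0.ne', ENNReal.rpow_one, mul_comm]
        -- The bound obtained for `p₀ > 1` carries no logarithm; the one in `ψ` is only used as a
        -- factor at least `1`.
        exact le_mul_of_one_le_right' (ENNReal.one_le_rpow (one_le_logE _) (by positivity))
    have hsum := hC μ w hμ hw hAt α S hS hSc h hh hhS E
    rw [wMeasure_apply hE]
    refine le_trans (le_of_eq ?_) (hsum.trans (add_le_add le_rfl (mul_le_mul_right
      (mul_le_mul_left key _) _)))
    refine Finset.sum_congr rfl fun Q hQ => ?_
    rw [hs, avg_indicator one_ne_zero ENNReal.one_ne_top Q hE, ENNReal.toReal_one]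
    simp_rw [ENNReal.rpow_one, hw.enorm_eq]
    rw [div_one, ENNReal.rpow_one, mul_assoc, mul_comm _ (μ Q), ← mul_assoc (μ Q),
      ENNReal.mul_inv_cancel (hSc.ne_zero Q hQ) (hSc.ne_top Q hQ), one_mul]
  · have hpq' : p₀.toReal < q₀.toReal := (ENNReal.toReal_lt_toReal hpt hqt).2 hpq
    have hq1 : 1 < q₀ := hp₀.trans_lt hpq
    have hσ := rhExp_toReal hp₀ hpq hqt
    have hs := conjExponent_toReal hq1 hqt
    obtain ⟨C, hC⟩ := exists_grid_bound_lt_top hn ν hΛ hp1 hpq' hζ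
    refine ⟨C, fun μ w hμ hA1 hRH => ?_⟩
    have hw := hA1.1
    have hσ1 := rhExp_ne_one hp₀ hqt
    have hR := (hRH.2 hσ1).2
    have hv := hw.rpow hμ (rhExp_ne_zero p₀ q₀) hσ1 (rhExp_ne_top hpq) hR
    have hA1v := A1const_rpow_le hμ hw (rhExp_ne_zero p₀ q₀) hσ1 (rhExp_ne_top hpq)
    have hA1vt : A1const μ (fun x => w x ^ (rhExp p₀ q₀).toReal) ≠ ∞ :=
      ne_top_of_le_ne_top (ENNReal.rpow_ne_top_of_nonneg (by positivity)
        (ENNReal.mul_ne_top hR.ne hA1.2.ne)) hA1v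
    have hAv : AinftyConst μ (fun x => w x ^ (rhExp p₀ q₀).toReal) ≠ ∞ := ne_top_of_le_ne_top
      (ENNReal.mul_ne_top (by simp) hA1vt) (AinftyConst_le hμ hn hv)
    have hψ : psi μ p₀ q₀ w < ∞ := by
      rw [psi, if_neg hqt]
      split_ifs with h1
      · subst h1
        rw [rhExp_one] at *
        exact ENNReal.mul_lt_top (ENNReal.mul_lt_top hAv.lt_top hA1.2) hR
      · exact ENNReal.mul_lt_top (ENNReal.rpow_lt_top_of_nonneg (by positivity) hAv)
          (ENNReal.rpow_lt_top_of_nonneg (by positivity) (ENNReal.mul_ne_top hA1.2.ne hR.ne))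
    refine ⟨hψ, fun α S hS hSc h hh hhS E hE => ?_⟩
    have hAv1 := one_le_AinftyConst hμ hv
    have key : AinftyConst μ (fun x => w x ^ (rhExp p₀ q₀).toReal) ^ p₀.toReal *
        A1const μ (fun x => w x ^ (rhExp p₀ q₀).toReal) ^
          ((q₀.toReal - p₀.toReal) / q₀.toReal) ≤ psi μ p₀ q₀ w ^ p₀.toReal := by
      have h2 : A1const μ (fun x => w x ^ (rhExp p₀ q₀).toReal) ^
          ((q₀.toReal - p₀.toReal) / q₀.toReal) ≤ A1const μ w * RHconst μ w (rhExp p₀ q₀) := by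
        refine (ENNReal.rpow_le_rpow hA1v (by
          have : 0 < q₀.toReal - p₀.toReal := by linarith
          positivity)).trans (le_of_eq ?_)
        have e : (rhExp p₀ q₀).toReal * ((q₀.toReal - p₀.toReal) / q₀.toReal) = 1 := by
          rw [hσ]
          have : q₀.toReal - p₀.toReal ≠ 0 := by linarith
          have : q₀.toReal ≠ 0 := by linarith
          field_simp
        rw [← ENNReal.rpow_mul, e, ENNReal.rpow_one, mul_comm]
      rw [psi, if_neg hqt]
      split_ifs with h1
      · subst h1
        rw [rhExp_one] at *
        rw [ENNReal.toReal_one] at *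
        rw [ENNReal.rpow_one, ENNReal.rpow_one, mul_assoc]
        exact mul_le_mul_right h2 _
      · rw [ENNReal.mul_rpow_of_nonneg _ _ hp0.le, ← ENNReal.rpow_mul, ← ENNReal.rpow_mul,
          one_div_mul_cancel hp0.ne', ENNReal.rpow_one]
        -- The power `p₀` of the `A_∞` constant suffices here, and `ψ^p₀` contains the power `p₀ +
        -- 1`.
        refine mul_le_mul' (ENNReal.rpow_le_rpow_of_exponent_le hAv1 ?_) h2
        have : (1 + 1 / p₀.toReal) * p₀.toReal = p₀.toReal + 1 := by field_simp
        linarith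
    have hsum := hC μ w hμ hw (by rw [← hσ]; exact hv) (by rw [← hσ]; exact hAv) α S hS hSc h hh hhS E
    rw [← hσ] at hsum
    rw [wMeasure_apply hE]
    refine le_trans (le_of_eq ?_) (hsum.trans (add_le_add le_rfl (mul_le_mul_right
      (mul_le_mul_left key _) _)))
    refine Finset.sum_congr rfl fun Q hQ => ?_
    rw [avg_indicator (by rw [ENNReal.conjExponent]; simp) (by
      rw [← rhExp_one]; exact rhExp_ne_top hq1) Q hE, hs, one_div_div, mul_assoc]
    simp_rw [hw.enorm_eq]

end Unified

/-! ### Conjugate phases -/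

section Phase

variable {𝕜 : Type*} [RCLike 𝕜]

/-- The unimodular factor `conj z / |z|`, or `0` for `z = 0`. -/
def phase (z : 𝕜) : 𝕜 := ((‖z‖ : ℝ) : 𝕜)⁻¹ * starRingEnd 𝕜 z

lemma mul_phase (z : 𝕜) : z * phase z = ((‖z‖ : ℝ) : 𝕜) := by
  rcases eq_or_ne z 0 with rfl | hz
  · simp [phase]
  · have : ((‖z‖ : ℝ) : 𝕜) ≠ 0 := by simpa using hz
    rw [phase, mul_left_comm, RCLike.mul_conj, sq, ← mul_assoc, inv_mul_cancel₀ this, one_mul]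

lemma norm_phase_le (z : 𝕜) : ‖phase z‖ ≤ 1 := by
  rcases eq_or_ne z 0 with rfl | hz
  · simp [phase]
  · rw [phase, norm_mul, norm_inv, RCLike.norm_ofReal, abs_norm, RCLike.norm_conj,
      inv_mul_cancel₀ (norm_ne_zero_iff.2 hz)]

lemma measurable_phase : Measurable (phase : 𝕜 → 𝕜) := by
  have h : Measurable fun z : 𝕜 => ((‖z‖ : ℝ) : 𝕜) :=
    RCLike.continuous_ofReal.measurable.comp measurable_norm
  exact h.inv.mul RCLike.continuous_conj.measurable

end Phase

/-! ### Riesz representation of bounded functionals on `L^r` -/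

section Representation

variable {X 𝕜 : Type*} [MeasurableSpace X] [RCLike 𝕜] {μ : Measure X} {r : ℝ≥0∞}

lemma tendsto_eLpNorm_zero_of_dominated {ι E F : Type*} [NormedAddCommGroup E]
    [NormedAddCommGroup F] {l : Filter ι} [l.IsCountablyGenerated]
    (hr0 : r ≠ 0) (hr : r ≠ ∞) {G : ι → X → E} {b : X → F}
    (hG : ∀ i, AEStronglyMeasurable (G i) μ) (hb : MemLp b r μ) (hGb : ∀ i x, ‖G i x‖ ≤ ‖b x‖)
    (hlim : ∀ x, Filter.Tendsto (fun i => G i x) l (nhds 0)) :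
    Filter.Tendsto (fun i => eLpNorm (G i) r μ) l (nhds 0) := by
  have hr' : 0 < r.toReal := ENNReal.toReal_pos hr0 hr
  have h1 : Filter.Tendsto (fun i => ∫⁻ x, ‖G i x‖ₑ ^ r.toReal ∂μ) l (nhds (∫⁻ _, 0 ∂μ)) := by
    refine tendsto_lintegral_filter_of_dominated_convergence' (fun x => ‖b x‖ₑ ^ r.toReal)
      (Filter.Eventually.of_forall fun i => (hG i).enorm.pow_const _)
      (Filter.Eventually.of_forall fun i => Filter.Eventually.of_forall fun x => ?_) ?_
      (Filter.Eventually.of_forall fun x => ?_)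
    · exact ENNReal.rpow_le_rpow (enorm_le_iff_norm_le.2 (hGb i x)) hr'.le
    · exact (lintegral_rpow_enorm_lt_top_of_eLpNorm_lt_top hr0 hr hb.2).ne
    · have := ((ENNReal.continuous_rpow_const (y := r.toReal)).tendsto 0).comp
        ((continuous_enorm.tendsto (0 : E)).comp (hlim x) |>.trans (by rw [enorm_zero]))
      rwa [ENNReal.zero_rpow_of_pos hr'] at this
  rw [lintegral_zero] at h1
  have := ((ENNReal.continuous_rpow_const (y := 1 / r.toReal)).tendsto 0).comp h1
  rw [ENNReal.zero_rpow_of_pos (by positivity)] at this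
  refine this.congr fun i => ?_
  rw [eLpNorm_eq_lintegral_rpow_enorm_toReal hr0 hr]; rfl

/-- A bounded linear functional on `L^r`, as a functional on functions. -/
structure IsLpFunctional (μ : Measure X) (r : ℝ≥0∞) (C : ℝ≥0) (Φ : (X → 𝕜) → 𝕜) : Prop where
  map_add : ∀ g h, MemLp g r μ → MemLp h r μ → Φ (g + h) = Φ g + Φ h
  map_smul : ∀ (a : 𝕜) g, MemLp g r μ → Φ (a • g) = a * Φ g
  bound : ∀ g, MemLp g r μ → ‖Φ g‖ₑ ≤ C * eLpNorm g r μ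

namespace IsLpFunctional

variable {C : ℝ≥0} {Φ : (X → 𝕜) → 𝕜}

lemma map_zero (h : IsLpFunctional μ r C Φ) : Φ 0 = 0 := by
  have := h.bound 0 MemLp.zero'
  simpa using this

lemma map_sub (h : IsLpFunctional μ r C Φ) {g k : X → 𝕜} (hg : MemLp g r μ) (hk : MemLp k r μ) :
    Φ (g - k) = Φ g - Φ k := by
  have e : g - k = g + (-1 : 𝕜) • k := by simp [sub_eq_add_neg]
  rw [e, h.map_add _ _ hg (hk.const_smul _), h.map_smul _ _ hk]
  ring

lemma map_sum (h : IsLpFunctional μ r C Φ) {ι : Type*} (s : Finset ι) {g : ι → X → 𝕜}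
    (hg : ∀ i, MemLp (g i) r μ) : Φ (∑ i ∈ s, g i) = ∑ i ∈ s, Φ (g i) := by
  classical
  induction s using Finset.induction_on with
  | empty => simp [h.map_zero]
  | insert a s ha ih =>
    rw [Finset.sum_insert ha, Finset.sum_insert ha, h.map_add _ _ (hg a)
      (memLp_finsetSum' s fun i _ => hg i), ih]

lemma tendsto {ι : Type*} {l : Filter ι} (h : IsLpFunctional μ r C Φ) {G : ι → X → 𝕜} {g : X → 𝕜}
    (hG : ∀ i, MemLp (G i) r μ) (hg : MemLp g r μ)
    (hlim : Filter.Tendsto (fun i => eLpNorm (G i - g) r μ) l (nhds 0)) :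
    Filter.Tendsto (fun i => Φ (G i)) l (nhds (Φ g)) := by
  rw [tendsto_iff_edist_tendsto_0]
  have hC : Filter.Tendsto (fun i => C * eLpNorm (G i - g) r μ) l (nhds 0) := by
    have := ENNReal.Tendsto.const_mul (a := (C : ℝ≥0∞)) hlim (Or.inr ENNReal.coe_ne_top)
    rwa [mul_zero] at this
  refine tendsto_of_tendsto_of_tendsto_of_le_of_le tendsto_const_nhds hC (fun _ => zero_le)
    fun i => ?_
  simp only []
  rw [edist_eq_enorm_sub, ← h.map_sub (hG i) hg]
  exact h.bound _ ((hG i).sub hg)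

lemma tendsto_of_dominated {F ι : Type*} [NormedAddCommGroup F] {l : Filter ι}
    [l.IsCountablyGenerated]
    (h : IsLpFunctional μ r C Φ) (hr0 : r ≠ 0) (hr : r ≠ ∞) {G : ι → X → 𝕜} {g : X → 𝕜}
    (hG : ∀ i, MemLp (G i) r μ) (hg : MemLp g r μ) {b : X → F} (hb : MemLp b r μ)
    (hGb : ∀ i x, ‖G i x - g x‖ ≤ ‖b x‖)
    (hlim : ∀ x, Filter.Tendsto (fun i => G i x) l (nhds (g x))) :
    Filter.Tendsto (fun i => Φ (G i)) l (nhds (Φ g)) := by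
  refine h.tendsto hG hg (tendsto_eLpNorm_zero_of_dominated hr0 hr
    (fun i => ((hG i).sub hg).1) hb hGb fun x => ?_)
  have := (hlim x).sub_const (g x)
  rwa [sub_self] at this

open Classical in
/-- The vector measure `A ↦ Φ (ρ χ_A)`. -/
def toVectorMeasure (h : IsLpFunctional μ r C Φ) (hr0 : r ≠ 0) (hr : r ≠ ∞) {ρ : X → 𝕜}
    (hρ : MemLp ρ r μ) : VectorMeasure X 𝕜 where
  measureOf' A := if MeasurableSet A then Φ (A.indicator ρ) else 0
  empty' := by simp [h.map_zero, ← Pi.zero_def]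
  not_measurable' A hA := if_neg hA
  m_iUnion' f hf hd := by
    simp only [hf, MeasurableSet.iUnion hf, if_true]
    have hm : ∀ i, MemLp ((f i).indicator ρ) r μ := fun i => hρ.indicator (hf i)
    rw [HasSum]
    have e : ∀ s : Finset ℕ, ∑ i ∈ s, Φ ((f i).indicator ρ) =
        Φ ((⋃ i ∈ s, f i).indicator ρ) := by
      intro s
      rw [← h.map_sum s hm]
      congr 1
      rw [Finset.indicator_biUnion s f (fun i _ j _ hij => hd hij)]
      ext x; simp
    simp_rw [e]
    have hmm : ∀ s : Finset ℕ, MeasurableSet (⋃ i ∈ s, f i) := fun s =>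
      s.measurableSet_biUnion fun i _ => hf i
    -- Countable additivity: along finite partial unions the functions `ρ χ` converge pointwise and
    -- are dominated by `ρ` in `L^r`.
    refine h.tendsto_of_dominated hr0 hr (b := ρ) (fun s => hρ.indicator (hmm s))
      (hρ.indicator (MeasurableSet.iUnion hf)) hρ (fun s x => ?_) fun x => ?_
    · by_cases h1 : x ∈ ⋃ i, f i
      · by_cases h2 : x ∈ ⋃ i ∈ s, f i
        · simp [indicator_of_mem h1, indicator_of_mem h2]
        · simp [indicator_of_mem h1, indicator_of_notMem h2]
      · have h2 : x ∉ ⋃ i ∈ s, f i := fun hx => h1 (by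
          obtain ⟨i, -, hi⟩ := mem_iUnion₂.1 hx
          exact mem_iUnion.2 ⟨i, hi⟩)
        simp [indicator_of_notMem h1, indicator_of_notMem h2]
    · by_cases h1 : x ∈ ⋃ i, f i
      · obtain ⟨j, hj⟩ := mem_iUnion.1 h1
        refine tendsto_const_nhds.congr' ?_
        filter_upwards [Filter.eventually_ge_atTop {j}] with s hs
        rw [indicator_of_mem h1, indicator_of_mem]
        exact mem_iUnion₂.2 ⟨j, hs (Finset.mem_singleton_self j), hj⟩
      · have : ∀ s : Finset ℕ, (⋃ i ∈ s, f i).indicator ρ x = 0 := fun s =>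
          indicator_of_notMem (fun hx => h1 (by
            obtain ⟨i, -, hi⟩ := mem_iUnion₂.1 hx
            exact mem_iUnion.2 ⟨i, hi⟩)) _
        simp_rw [this, indicator_of_notMem h1]
        exact tendsto_const_nhds

lemma toVectorMeasure_apply (h : IsLpFunctional μ r C Φ) (hr0 : r ≠ 0) (hr : r ≠ ∞) {ρ : X → 𝕜}
    (hρ : MemLp ρ r μ) {A : Set X} (hA : MeasurableSet A) :
    h.toVectorMeasure hr0 hr hρ A = Φ (A.indicator ρ) := if_pos hA

/-- The set function vanishes on null sets by boundedness of the functional, so the Radon–Nikodym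
theorem applies to its real and imaginary parts. -/
lemma exists_density [SigmaFinite μ] (h : IsLpFunctional μ r C Φ) (hr0 : r ≠ 0) (hr : r ≠ ∞)
    {ρ : X → 𝕜} (hρ : MemLp ρ r μ) : ∃ u : X → 𝕜, Measurable u ∧ Integrable u μ ∧
      ∀ A, MeasurableSet A → Φ (A.indicator ρ) = ∫ x in A, u x ∂μ := by
  set V := h.toVectorMeasure hr0 hr hρ with hV
  have hreal : ∀ (T : 𝕜 →+ ℝ) (hT : Continuous T), ∃ v : X → ℝ, Measurable v ∧ Integrable v μ ∧
      ∀ A, MeasurableSet A → T (Φ (A.indicator ρ)) = ∫ x in A, v x ∂μ := by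
    intro T hT
    set s : SignedMeasure X := V.mapRange T hT with hs
    have hac : s ≪ᵥ μ.toENNRealVectorMeasure := by
      refine VectorMeasure.AbsolutelyContinuous.mk fun A hA hA0 => ?_
      rw [Measure.toENNRealVectorMeasure_apply_measurable hA] at hA0
      rw [hs, VectorMeasure.mapRange_apply, hV, toVectorMeasure_apply _ _ _ _ hA]
      have h0 := h.bound _ (hρ.indicator hA)
      rw [eLpNorm_indicator_eq_eLpNorm_restrict hA, Measure.restrict_eq_zero.2 hA0,
        eLpNorm_measure_zero, mul_zero, nonpos_iff_eq_zero, enorm_eq_zero] at h0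
      rw [h0, T.map_zero]
    refine ⟨s.rnDeriv μ, s.measurable_rnDeriv μ, s.integrable_rnDeriv μ, fun A hA => ?_⟩
    rw [← withDensityᵥ_apply (s.integrable_rnDeriv μ) hA,
      SignedMeasure.withDensityᵥ_rnDeriv_eq s μ hac, hs, VectorMeasure.mapRange_apply, hV,
      toVectorMeasure_apply _ _ _ _ hA]
  obtain ⟨v, hv, hvi, hv'⟩ := hreal RCLike.re RCLike.continuous_re
  obtain ⟨v', hvm', hvi', hv''⟩ := hreal RCLike.im RCLike.continuous_im
  refine ⟨fun x => (v x : 𝕜) + (v' x : 𝕜) * RCLike.I, ?_, ?_, fun A hA => ?_⟩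
  · exact (RCLike.continuous_ofReal.measurable.comp hv).add
      ((RCLike.continuous_ofReal.measurable.comp hvm').mul_const _)
  · exact hvi.ofReal.add (hvi'.ofReal.mul_const _)
  · rw [integral_add hvi.ofReal.restrict (hvi'.ofReal.mul_const _).restrict,
      integral_mul_const, integral_ofReal, integral_ofReal, ← hv' A hA, ← hv'' A hA]
    exact (RCLike.re_add_im _).symm

lemma eq_integral_simpleFunc (h : IsLpFunctional μ r C Φ) {ρ u : X → 𝕜} (hρ : MemLp ρ r μ)
    (hu : Integrable u μ)
    (hA : ∀ A, MeasurableSet A → Φ (A.indicator ρ) = ∫ x in A, u x ∂μ) (k : SimpleFunc X 𝕜) :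
    Φ (fun x => k x * ρ x) = ∫ x, u x * k x ∂μ := by
  have hbdd : ∀ k : SimpleFunc X 𝕜, ∃ c : ℝ, ∀ x, ‖k x‖ ≤ c := fun k => k.exists_forall_norm_le
  have hmem : ∀ k : SimpleFunc X 𝕜, MemLp (fun x => k x * ρ x) r μ := fun k => by
    obtain ⟨c, hc⟩ := hbdd k
    exact hρ.of_le_mul (k.measurable.aestronglyMeasurable.mul hρ.1)
      (Filter.Eventually.of_forall fun x => (norm_mul_le _ _).trans
        (mul_le_mul_of_nonneg_right (hc x) (norm_nonneg _)))
  have hint : ∀ k : SimpleFunc X 𝕜, Integrable (fun x => u x * k x) μ := fun k => by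
    obtain ⟨c, hc⟩ := hbdd k
    exact hu.mul_bdd (c := c) k.measurable.aestronglyMeasurable (Filter.Eventually.of_forall hc)
  induction k using SimpleFunc.induction with
  | @const c A hmA =>
    have e1 : (fun x => (SimpleFunc.piecewise A hmA (SimpleFunc.const X c)
        (SimpleFunc.const X 0)) x * ρ x) = c • A.indicator ρ := by
      ext x
      by_cases hx : x ∈ A <;> simp [hx]
    have e2 : (fun x => u x * (SimpleFunc.piecewise A hmA (SimpleFunc.const X c)
        (SimpleFunc.const X 0)) x) = A.indicator (fun x => u x * c) := by
      ext x
      by_cases hx : x ∈ A <;> simp [hx]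
    rw [e1, e2, h.map_smul _ _ (hρ.indicator hmA), hA A hmA, integral_indicator hmA,
      integral_mul_const, mul_comm]
  | @add f g _ hf hg =>
    have e1 : (fun x => (f + g) x * ρ x) = (fun x => f x * ρ x) + fun x => g x * ρ x := by
      ext x; simp [add_mul]
    have e2 : ∀ x, u x * (f + g) x = u x * f x + u x * g x := fun x => by simp [mul_add]
    simp_rw [e2]
    rw [e1, h.map_add _ _ (hmem f) (hmem g), hf, hg, integral_add (hint f) (hint g)]

lemma eq_integral_bounded (h : IsLpFunctional μ r C Φ) (hr0 : r ≠ 0) (hr : r ≠ ∞)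
    {ρ u : X → 𝕜} (hρ : MemLp ρ r μ) (hu : Integrable u μ)
    (hA : ∀ A, MeasurableSet A → Φ (A.indicator ρ) = ∫ x in A, u x ∂μ) {k : X → 𝕜}
    (hk : Measurable k) {c : ℝ} (hc : ∀ x, ‖k x‖ ≤ c) :
    Φ (fun x => k x * ρ x) = ∫ x, u x * k x ∂μ := by
  have hks : StronglyMeasurable k := hk.stronglyMeasurable
  have hc0 : ∀ x : X, 0 ≤ c := fun x => (norm_nonneg _).trans (hc x)
  rcases isEmpty_or_nonempty X with hX | ⟨⟨x₀⟩⟩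
  · have e : (fun x => k x * ρ x) = 0 := funext fun x => isEmptyElim x
    rw [e, h.map_zero, integral_eq_zero_of_ae]
    exact Filter.Eventually.of_forall fun x => isEmptyElim x
  have hmem : ∀ {k : X → 𝕜}, Measurable k → (∀ x, ‖k x‖ ≤ c) →
      MemLp (fun x => k x * ρ x) r μ := fun hk hc =>
    hρ.of_le_mul (hk.aestronglyMeasurable.mul hρ.1)
      (Filter.Eventually.of_forall fun x => (norm_mul_le _ _).trans
        (mul_le_mul_of_nonneg_right (hc x) (norm_nonneg _)))
  have hb : ∀ j x, ‖hks.approxBounded c j x‖ ≤ c := fun j x =>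
    hks.norm_approxBounded_le (hc0 x) j x
  have hl : ∀ x, Filter.Tendsto (fun j => hks.approxBounded c j x) Filter.atTop (nhds (k x)) :=
    fun x => hks.tendsto_approxBounded_of_norm_le (hc x)
  have t1 : Filter.Tendsto (fun j => Φ (fun x => hks.approxBounded c j x * ρ x)) Filter.atTop
      (nhds (Φ fun x => k x * ρ x)) := by
    refine h.tendsto_of_dominated hr0 hr (b := fun x => ((2 * c : ℝ) : 𝕜) * ρ x)
      (fun j => hmem (hks.approxBounded c j).measurable (hb j)) (hmem hk hc) (hρ.const_mul _)
      (fun j x => ?_) fun x => (hl x).mul_const _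
    rw [← sub_mul, norm_mul, norm_mul, RCLike.norm_ofReal, abs_of_nonneg (by linarith [hc0 x])]
    refine mul_le_mul_of_nonneg_right ?_ (norm_nonneg _)
    linarith [norm_sub_le (hks.approxBounded c j x) (k x), hb j x, hc x]
  have t2 : Filter.Tendsto (fun j => ∫ x, u x * hks.approxBounded c j x ∂μ) Filter.atTop
      (nhds (∫ x, u x * k x ∂μ)) := by
    refine tendsto_integral_of_dominated_convergence (fun x => ‖u x‖ * c)
      (fun j => hu.1.mul (hks.approxBounded c j).measurable.aestronglyMeasurable)
      (hu.norm.mul_const _) (fun j => Filter.Eventually.of_forall fun x => ?_)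
      (Filter.Eventually.of_forall fun x => (hl x).const_mul _)
    rw [norm_mul]
    exact mul_le_mul_of_nonneg_left (hb j x) (norm_nonneg _)
  refine tendsto_nhds_unique t1 (t2.congr fun j => ?_)
  exact (h.eq_integral_simpleFunc hρ hu hA _).symm

/-- The Riesz representation theorem for bounded linear functionals on `L^r`, `0 < r < ∞`. -/
theorem exists_representation [SigmaFinite μ] (h : IsLpFunctional μ r C Φ) (hr0 : r ≠ 0)
    (hr : r ≠ ∞) : ∃ u : X → 𝕜, Measurable u ∧ ∀ g, MemLp g r μ →
      Integrable (fun x => u x * g x) μ ∧ Φ g = ∫ x, u x * g x ∂μ := by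
  have hr' : 0 < r.toReal := ENNReal.toReal_pos hr0 hr
  -- A strictly positive integrable function exists by σ-finiteness; its power `1/r` is a strictly
  -- positive element of `L^r` that replaces the constant `1`. The density is divided by it
  -- afterwards.
  obtain ⟨ρ₁, hρ₁0, hρ₁m, hρ₁⟩ := exists_pos_lintegral_lt_of_sigmaFinite μ one_ne_zero
  set σ : X → ℝ := fun x => (ρ₁ x : ℝ) ^ (1 / r.toReal) with hσ
  have hσ0 : ∀ x, 0 < σ x := fun x => Real.rpow_pos_of_pos (by exact_mod_cast hρ₁0 x) _
  have hσm : Measurable σ := (measurable_coe_nnreal_real.comp hρ₁m).pow_const _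
  have hρm : Measurable fun x => (σ x : 𝕜) := RCLike.continuous_ofReal.measurable.comp hσm
  have hρ : MemLp (fun x => (σ x : 𝕜)) r μ := by
    refine ⟨hρm.aestronglyMeasurable, ?_⟩
    rw [eLpNorm_lt_top_iff_lintegral_rpow_enorm_lt_top hr0 hr]
    have e : ∀ x, ‖(σ x : 𝕜)‖ₑ ^ r.toReal = ρ₁ x := by
      intro x
      rw [← ofReal_norm, RCLike.norm_ofReal, abs_of_pos (hσ0 x),
        ENNReal.ofReal_rpow_of_pos (hσ0 x), hσ, ← Real.rpow_mul NNReal.zero_le_coe,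
        one_div_mul_cancel hr'.ne', Real.rpow_one, ENNReal.ofReal_coe_nnreal]
    simp_rw [e]
    exact hρ₁.trans (by simp)
  obtain ⟨u₀, hu₀m, hu₀, hA⟩ := h.exists_density hr0 hr hρ
  have hσne : ∀ x, (σ x : 𝕜) ≠ 0 := fun x => by simpa using (hσ0 x).ne'
  set u : X → 𝕜 := fun x => u₀ x * (σ x : 𝕜)⁻¹ with hu
  have hum : Measurable u := hu₀m.mul hρm.inv
  have hrep : ∀ (g : X → 𝕜), Measurable g → ∀ c : ℝ, (∀ x, ‖g x‖ ≤ c * σ x) →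
      Φ g = ∫ x, u x * g x ∂μ := by
    intro g hg c hc
    have := h.eq_integral_bounded hr0 hr hρ hu₀ hA (k := fun x => (σ x : 𝕜)⁻¹ * g x)
      (hρm.inv.mul hg) (c := c) (fun x => by
        rw [norm_mul, norm_inv, RCLike.norm_ofReal, abs_of_pos (hσ0 x), inv_mul_le_iff₀ (hσ0 x),
          mul_comm]
        exact hc x)
    rw [show (fun x => (σ x : 𝕜)⁻¹ * g x * (σ x : 𝕜)) = g from funext fun x => by
      rw [mul_right_comm, inv_mul_cancel₀ (hσne x), one_mul]] at this
    rw [this]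
    exact integral_congr_ae (Filter.Eventually.of_forall fun x => by simp only [hu]; ring)
  refine ⟨u, hum, fun g₀ hg₀ => ?_⟩
  obtain ⟨g, hgm, hgg⟩ : ∃ g : X → 𝕜, Measurable g ∧ g₀ =ᵐ[μ] g :=
    ⟨hg₀.1.mk g₀, hg₀.1.stronglyMeasurable_mk.measurable, hg₀.1.ae_eq_mk⟩
  have hg : MemLp g r μ := (memLp_congr_ae hgg).1 hg₀
  set A : ℕ → Set X := fun j => {x | ‖g x‖ ≤ j * σ x} with hAdef
  have hAm : ∀ j, MeasurableSet (A j) := fun j =>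
    measurableSet_le hgm.norm (hσm.const_mul _)
  have hAev : ∀ x, ∀ᶠ j in Filter.atTop, x ∈ A j := by
    intro x
    obtain ⟨j₀, hj₀⟩ := exists_nat_ge (‖g x‖ / σ x)
    filter_upwards [Filter.eventually_ge_atTop j₀] with j hj
    have : (j₀ : ℝ) ≤ j := by exact_mod_cast hj
    exact (div_le_iff₀ (hσ0 x)).1 (hj₀.trans this)
  -- Testing on `g` times the conjugate phase of `u g`, truncated so that the representation already
  -- holds, bounds the integral of `|u g|` uniformly in `j`; monotone convergence then gives
  -- integrability.
  have hbound : ∀ j, ∫⁻ x in A j, ‖u x * g x‖ₑ ∂μ ≤ C * eLpNorm g r μ := by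
    intro j
    set k : X → 𝕜 := (A j).indicator fun x => g x * phase (u x * g x) with hk
    have hkm : Measurable k := (hgm.mul (measurable_phase.comp (hum.mul hgm))).indicator (hAm j)
    have hkg : ∀ x, ‖k x‖ ≤ ‖g x‖ := fun x => by
      refine (norm_indicator_le_norm_self _ _).trans ?_
      rw [norm_mul]
      exact mul_le_of_le_one_right (norm_nonneg _) (norm_phase_le _)
    have hkmem : MemLp k r μ := hg.of_le hkm.aestronglyMeasurable (Filter.Eventually.of_forall hkg)
    have hkc : ∀ x, ‖k x‖ ≤ j * σ x := fun x => by
      by_cases hx : x ∈ A j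
      · exact (hkg x).trans hx
      · rw [hk, indicator_of_notMem hx, norm_zero]
        have := (hσ0 x).le
        positivity
    have h1 := hrep k hkm j hkc
    have e : ∀ x, u x * k x = (((A j).indicator (fun x => ‖u x * g x‖) x : ℝ) : 𝕜) := by
      intro x
      by_cases hx : x ∈ A j
      · rw [hk, indicator_of_mem hx, indicator_of_mem hx, ← mul_assoc, mul_phase]
      · rw [hk, indicator_of_notMem hx, indicator_of_notMem hx]; simp
    have hint : Integrable (fun x => (A j).indicator (fun x => ‖u x * g x‖) x) μ := by
      refine (hu₀.norm.mul_const (j : ℝ)).mono'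
        ((hum.mul hgm).norm.indicator (hAm j)).aestronglyMeasurable
        (Filter.Eventually.of_forall fun x => ?_)
      by_cases hx : x ∈ A j
      · rw [indicator_of_mem hx, norm_norm, norm_mul, hu, norm_mul, norm_inv, RCLike.norm_ofReal,
          abs_of_pos (hσ0 x), mul_assoc]
        refine mul_le_mul_of_nonneg_left ?_ (norm_nonneg _)
        rw [inv_mul_le_iff₀ (hσ0 x), mul_comm]
        exact hx
      · rw [indicator_of_notMem hx, norm_zero]; positivity
    simp_rw [e] at h1
    rw [integral_ofReal] at h1
    have h2 := h.bound k hkmem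
    rw [h1, ← ofReal_norm, RCLike.norm_ofReal, abs_of_nonneg (integral_nonneg fun x =>
      indicator_nonneg (fun _ _ => norm_nonneg _) x), ofReal_integral_eq_lintegral_ofReal hint
      (Filter.Eventually.of_forall fun x => indicator_nonneg (fun _ _ => norm_nonneg _) x)] at h2
    calc ∫⁻ x in A j, ‖u x * g x‖ₑ ∂μ
        = ∫⁻ x, ENNReal.ofReal ((A j).indicator (fun x => ‖u x * g x‖) x) ∂μ := by
          rw [← lintegral_indicator (hAm j)]
          refine lintegral_congr fun x => ?_
          by_cases hx : x ∈ A j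
          · rw [indicator_of_mem hx, indicator_of_mem hx, ofReal_norm]
          · rw [indicator_of_notMem hx, indicator_of_notMem hx, ENNReal.ofReal_zero]
      _ ≤ C * eLpNorm k r μ := h2
      _ ≤ _ := mul_le_mul_right (eLpNorm_mono hkg) _
  have hmono : Monotone A := fun i j hij x hx => by
    have hx' : ‖g x‖ ≤ i * σ x := hx
    refine hx'.trans ?_
    have : (i : ℝ) ≤ j := by exact_mod_cast hij
    exact mul_le_mul_of_nonneg_right this (hσ0 x).le
  have hUn : ⋃ j, A j = univ := eq_univ_of_forall fun x => mem_iUnion.2 (hAev x).exists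
  have hint : Integrable (fun x => u x * g x) μ := by
    refine ⟨(hum.mul hgm).aestronglyMeasurable, ?_⟩
    rw [HasFiniteIntegral]
    have hsup : ∫⁻ x, ‖u x * g x‖ₑ ∂μ ≤ C * eLpNorm g r μ := by
      rw [← setLIntegral_univ, ← hUn, setLIntegral_iUnion_of_directed _
        (hmono.directed_le)]
      exact iSup_le hbound
    exact hsup.trans_lt (ENNReal.mul_lt_top (by simp) hg.2)
  have hcongr : (fun x => u x * g₀ x) =ᵐ[μ] fun x => u x * g x := by
    filter_upwards [hgg] with x hx
    rw [hx]
  have hΦ : Φ g₀ = Φ g := by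
    have h1 := h.bound _ (hg₀.sub hg)
    have h2 : g₀ - g =ᵐ[μ] 0 := by
      filter_upwards [hgg] with x hx
      simp [hx]
    rw [eLpNorm_congr_ae h2, eLpNorm_zero, mul_zero, nonpos_iff_eq_zero, enorm_eq_zero,
      h.map_sub hg₀ hg] at h1
    exact sub_eq_zero.1 h1
  refine ⟨hint.congr hcongr.symm, ?_⟩
  rw [integral_congr_ae hcongr, hΦ]
  have hgA : ∀ j, MemLp ((A j).indicator g) r μ := fun j => hg.indicator (hAm j)
  have hev : ∀ x, Filter.Tendsto (fun j => (A j).indicator g x) Filter.atTop (nhds (g x)) := by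
    intro x
    refine tendsto_const_nhds.congr' ?_
    filter_upwards [hAev x] with j hj
    rw [indicator_of_mem hj]
  have t1 := h.tendsto_of_dominated hr0 hr hgA hg hg (fun j x => by
    by_cases hx : x ∈ A j
    · simp [indicator_of_mem hx]
    · simp [indicator_of_notMem hx]) hev
  have t2 : Filter.Tendsto (fun j => ∫ x, u x * (A j).indicator g x ∂μ) Filter.atTop
      (nhds (∫ x, u x * g x ∂μ)) := by
    refine tendsto_integral_of_dominated_convergence (fun x => ‖u x * g x‖)
      (fun j => (hum.mul (hgm.indicator (hAm j))).aestronglyMeasurable) hint.norm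
      (fun j => Filter.Eventually.of_forall fun x => ?_)
      (Filter.Eventually.of_forall fun x => (hev x).const_mul _)
    rw [norm_mul (u x), norm_mul (u x)]
    exact mul_le_mul_of_nonneg_left (norm_indicator_le_norm_self _ _) (norm_nonneg _)
  refine tendsto_nhds_unique t1 (t2.congr fun j => (hrep _ (hgm.indicator (hAm j)) j fun x => ?_).symm)
  by_cases hx : x ∈ A j
  · rw [indicator_of_mem hx]; exact hx
  · rw [indicator_of_notMem hx, norm_zero]
    have := (hσ0 x).le
    positivity

end IsLpFunctional

end Representation

/-! ### Extension of functionals from a dense subspace -/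

section ExtendFunctional

variable {X 𝕜 : Type*} [MeasurableSpace X] [RCLike 𝕜] {μ : Measure X} {r : ℝ≥0∞}

/-- Extension of a bounded functional from a dense subspace of `L^r`. -/
lemma exists_isLpFunctional (hr1 : 1 ≤ r) {D : Submodule 𝕜 (X → 𝕜)}
    (hD : ∀ g ∈ D, MemLp g r μ)
    (hdense : ∀ g, MemLp g r μ → ∀ ε : ℝ≥0, 0 < ε → ∃ k ∈ D, eLpNorm (g - k) r μ ≤ ε)
    (L : D →ₗ[𝕜] 𝕜) {C : ℝ≥0} (hL : ∀ g : D, ‖L g‖ₑ ≤ C * eLpNorm (g : X → 𝕜) r μ) :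
    ∃ Φ : (X → 𝕜) → 𝕜, IsLpFunctional μ r C Φ ∧ ∀ g : D, Φ g = L g := by
  classical
  have : Fact (1 ≤ r) := ⟨hr1⟩
  let e : D →ₗ[𝕜] Lp 𝕜 r μ :=
    { toFun := fun g => (hD g g.2).toLp g
      map_add' := fun g k => MemLp.toLp_add (hD g g.2) (hD k k.2)
      map_smul' := fun a g => MemLp.toLp_const_smul a (hD g g.2) }
  have he : DenseRange e := by
    rw [Metric.denseRange_iff]
    intro x ε hε
    obtain ⟨k, hk, hxk⟩ := hdense x (Lp.memLp x) (ε / 2).toNNReal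
      (Real.toNNReal_pos.2 (half_pos hε))
    refine ⟨⟨k, hk⟩, ?_⟩
    rw [dist_eq_norm]
    have h1 : x - e ⟨k, hk⟩ = ((Lp.memLp x).sub (hD k hk)).toLp ((x : X → 𝕜) - k) := by
      rw [MemLp.toLp_sub (Lp.memLp x) (hD k hk), Lp.toLp_coeFn]
      rfl
    rw [h1, Lp.norm_toLp]
    refine (ENNReal.toReal_mono (by simp) hxk).trans_lt ?_
    rw [ENNReal.coe_toReal, Real.coe_toNNReal _ (half_pos hε).le]
    exact half_lt_self hε
  have hbd : ∀ g : D, ‖L g‖ ≤ C * ‖e g‖ := by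
    intro g
    have h1 := ENNReal.toReal_mono (ENNReal.mul_ne_top (by simp) (hD g g.2).2.ne) (hL g)
    rw [ENNReal.toReal_mul, toReal_enorm, ENNReal.coe_toReal] at h1
    change _ ≤ C * ‖(hD g g.2).toLp (g : X → 𝕜)‖
    rwa [Lp.norm_toLp]
  set φ := L.extendOfNorm e with hφ
  refine ⟨fun g => if h : MemLp g r μ then φ (h.toLp g) else 0, ⟨?_, ?_, ?_⟩, ?_⟩
  · intro g h hg hh
    rw [dif_pos hg, dif_pos hh, dif_pos (hg.add hh), MemLp.toLp_add hg hh, _root_.map_add]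
  · intro a g hg
    rw [dif_pos hg, dif_pos (hg.const_smul a), MemLp.toLp_const_smul a hg, _root_.map_smul,
      smul_eq_mul]
  · intro g hg
    rw [dif_pos hg]
    have h1 := LinearMap.norm_extendOfNorm_apply_le (f := L) (e := e) he C hbd (hg.toLp g)
    rw [Lp.norm_toLp] at h1
    rw [← ofReal_norm, ← ENNReal.ofReal_toReal hg.2.ne, ← ENNReal.ofReal_coe_nnreal (p := C),
      ← ENNReal.ofReal_mul NNReal.zero_le_coe]
    exact ENNReal.ofReal_le_ofReal h1
  · intro g
    refine (dif_pos (hD g g.2)).trans ?_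
    exact LinearMap.extendOfNorm_eq he ⟨C, hbd⟩ g

end ExtendFunctional

/-! ### Sparse domination beyond test functions -/

section Domination

variable {n : ℕ} {ν : ℝ} {μ : Measure (EuclideanSpace ℝ (Fin n))}

lemma wMeasure_one : wMeasure μ (fun _ => 1) = μ := by
  rw [wMeasure]
  simp

/-- The constant weight brings in the unweighted Lebesgue spaces, in which the test functions are
therefore dense. -/
lemma inAinfty_one (hn : 1 ≤ n) (hμ : IsDoubling ν μ) : InAinfty μ (fun _ => 1) := by
  have hw : IsWeight μ (fun _ => 1) :=
    ⟨measurable_const, fun _ => one_pos, fun x r => by rw [wMeasure_one]; exact hμ.ball_lt_top x r⟩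
  refine ⟨hw, (AinftyConst_le hμ hn hw).trans_lt (ENNReal.mul_lt_top (by simp) ?_)⟩
  refine lt_of_le_of_lt (b := 1) (iSup₂_le fun Q hQ => ?_) (by simp)
  obtain ⟨α, k, m, rfl⟩ := hQ
  rw [hw.avg_one_eq (measurableSet_dyadicCube α k m), wMeasure_one,
    ENNReal.inv_mul_cancel (hμ.cube_ne_zero α k m) (hμ.cube_ne_top α k m), one_mul,
    avg_top (hμ.cube_ne_top α k m)]
  refine essSup_le_of_ae_le _ (Filter.Eventually.of_forall fun x => ?_)
  simp

/-- With `r'` strictly between `p` and `q`, the conjugate exponent `r` lies strictly above the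
conjugate of `q`. Both averages in the form then fall in the range of the embedding theorem. -/
lemma exists_intermediate_exponents {p q : ℝ≥0∞} (hp : 1 ≤ p) (hpq : p < q) :
    ∃ r' r : ℝ≥0∞, p < r' ∧ q.conjExponent < r ∧ r ≠ ∞ ∧ r' ≠ ∞ ∧ r'.HolderConjugate r := by
  obtain ⟨r', h1, h2⟩ := exists_between hpq
  have h3 : 1 < r' := hp.trans_lt h1
  refine ⟨r', r'.conjExponent, h1, ?_, ?_, h2.ne_top, .conjExponent h3.le⟩
  · rw [ENNReal.conjExponent, ENNReal.conjExponent]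
    refine ENNReal.add_lt_add_left (by simp) (ENNReal.inv_lt_inv.2 ?_)
    exact (ENNReal.cancel_of_ne (by simp)).tsub_lt_tsub_right_of_le h3.le h2
  · rw [ENNReal.conjExponent]
    exact ENNReal.add_ne_top.2 ⟨by simp, ENNReal.inv_ne_top.2 (tsub_pos_of_lt h3).ne'⟩

variable {𝕜 : Type*} [RCLike 𝕜] {D : Submodule 𝕜 (EuclideanSpace ℝ (Fin n) → 𝕜)}
  {T : (EuclideanSpace ℝ (Fin n) → 𝕜) → EuclideanSpace ℝ (Fin n) → 𝕜} {p₀ q₀ : ℝ≥0∞} {cT η : ℝ}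

/-- The sparse domination extends to general functions in the second argument. -/
theorem exists_exponent_domination (hn : 1 ≤ n) (hμ : IsDoubling ν μ) (hD : IsTestSpace μ D)
    (hp₀ : 1 ≤ p₀) (hpq : p₀ < q₀) (hη : 0 < η) (hT : SparselyDominated μ D p₀ q₀ cT η T) :
    ∃ r : ℝ≥0∞, r ≠ 0 ∧ r ≠ ∞ ∧ ∀ f ∈ D, ∀ g, MemLp g r μ →
      Integrable (fun x => T f x * g x) μ ∧
      ∀ B : ℝ≥0∞, (∀ S, IsSparse μ η S → sparseForm μ p₀ q₀.conjExponent S f g ≤ B) →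
        ‖∫ x, T f x * g x ∂μ‖ₑ ≤ ENNReal.ofReal cT * B := by
  obtain ⟨r', r, hr'p, hrs, hr, hr', hrr⟩ := exists_intermediate_exponents hp₀ hpq
  have := hμ.isLocallyFiniteMeasure
  have hs1 : 1 ≤ q₀.conjExponent := by rw [ENNReal.conjExponent]; exact le_self_add
  have hs0 : q₀.conjExponent ≠ 0 := (zero_lt_one.trans_le hs1).ne'
  have hr1 : 1 ≤ r := hs1.trans hrs.le
  have hr0 : r ≠ 0 := (zero_lt_one.trans_le hr1).ne'
  have hone := inAinfty_one hn hμ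
  have hmem : ∀ p : ℝ≥0∞, 1 ≤ p → p ≠ ∞ → ∀ f ∈ D, MemLp f p μ := fun p h1 ht f hf => by
    have := hD.memLp _ hone p h1 ht.lt_top f hf
    rwa [wMeasure_one] at this
  have hdense : ∀ g, MemLp g r μ → ∀ ε : ℝ≥0, 0 < ε → ∃ k ∈ D, eLpNorm (g - k) r μ ≤ ε :=
    fun g hg ε hε => by
      have := hD.dense _ hone r hr1 hr.lt_top g (by rwa [wMeasure_one]) ε (ENNReal.coe_pos.2 hε)
      rwa [wMeasure_one] at this
  obtain ⟨C₀, hC₀⟩ := exists_sparseForm_le (F := 𝕜) hμ hη (zero_lt_one.trans_le hp₀).ne' hs0 hr'p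
    hrs hr hr' hrr
  refine ⟨r, hr0, hr, fun f hf => ?_⟩
  have hfr' : MemLp f r' μ := hmem r' (hp₀.trans hr'p.le) hr' f hf
  set N : ℝ≥0 := (eLpNorm f r' μ).toNNReal with hN
  have hN' : eLpNorm f r' μ = N := (ENNReal.coe_toNNReal hfr'.2.ne).symm
  set C : ℝ≥0 := cT.toNNReal * (C₀ * N) with hC
  let L : D →ₗ[𝕜] 𝕜 :=
    { toFun := fun g => ∫ x, T f x * (g : EuclideanSpace ℝ (Fin n) → 𝕜) x ∂μ
      map_add' := fun g k => by
        rw [← integral_add (hT.integrable f hf g g.2) (hT.integrable f hf k k.2)]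
        refine integral_congr_ae (Filter.Eventually.of_forall fun x => ?_)
        simp [mul_add]
      map_smul' := fun a g => by
        rw [RingHom.id_apply, smul_eq_mul, ← integral_const_mul]
        refine integral_congr_ae (Filter.Eventually.of_forall fun x => ?_)
        simp [mul_left_comm] }
  have hL : ∀ g : D, ‖L g‖ₑ ≤ C * eLpNorm (g : EuclideanSpace ℝ (Fin n) → 𝕜) r μ := by
    intro g
    obtain ⟨S, hS, hSg⟩ := hT.sparse f hf g g.2
    refine hSg.trans ((mul_le_mul_right (hC₀ S hS f g hfr'.1 (hmem r hr1 hr g g.2).1) _).trans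
      (le_of_eq ?_))
    rw [hN', hC, ENNReal.ofReal]
    push_cast
    ring
  obtain ⟨Φ, hΦ, hΦL⟩ := exists_isLpFunctional hr1 (hmem r hr1 hr) hdense L hL
  obtain ⟨u, hum, hu⟩ := hΦ.exists_representation hr0 hr
  -- The functional on test functions is bounded on `L^r` and has a density `u` there; since the
  -- test functions separate, `u` is `T f` itself.
  have hTu : (fun x => T f x - u x) =ᵐ[μ] 0 := by
    refine hD.separating _ ((hT.aestronglyMeasurable f hf).sub hum.aestronglyMeasurable)
      fun g hg => ?_
    have h1 := hu g (hmem r hr1 hr g hg)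
    have h2 := hT.integrable f hf g hg
    simp_rw [sub_mul]
    refine ⟨h2.sub h1.1, ?_⟩
    rw [integral_sub h2 h1.1, ← h1.2, hΦL ⟨g, hg⟩]
    exact sub_self _
  have hTu' : ∀ g : EuclideanSpace ℝ (Fin n) → 𝕜,
      (fun x => T f x * g x) =ᵐ[μ] fun x => u x * g x := fun g => by
    filter_upwards [hTu] with x hx
    rw [sub_eq_zero.1 hx]
  intro g hg
  refine ⟨(hu g hg).1.congr (hTu' g).symm, fun B hB => ?_⟩
  rw [integral_congr_ae (hTu' g), ← (hu g hg).2]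
  -- Replace `g` by a nearby test function `k`. The sparse collection depends on `k`, which is why
  -- `B` must bound the forms of all sparse collections.
  refine ENNReal.le_of_forall_pos_le_add fun ε hε _ => ?_
  obtain ⟨k, hk, hgk⟩ := hdense g hg (ε / (2 * C + 1)) (by positivity)
  have hkr := hmem r hr1 hr k hk
  obtain ⟨S, hS, hSk⟩ := hT.sparse f hf k hk
  have h1 : ‖Φ g‖ₑ ≤ ‖Φ k‖ₑ + C * eLpNorm (g - k) r μ := by
    have e : Φ g = Φ k + Φ (g - k) := by rw [hΦ.map_sub hg hkr]; ring
    rw [e]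
    exact (enorm_add_le _ _).trans (add_le_add le_rfl (hΦ.bound _ (hg.sub hkr)))
  have h2 : ‖Φ k‖ₑ ≤ ENNReal.ofReal cT * B + C * eLpNorm (g - k) r μ := by
    calc ‖Φ k‖ₑ = ‖∫ x, T f x * k x ∂μ‖ₑ := by rw [hΦL ⟨k, hk⟩]; rfl
      _ ≤ ENNReal.ofReal cT * sparseForm μ p₀ q₀.conjExponent S f k := hSk
      _ ≤ ENNReal.ofReal cT * (sparseForm μ p₀ q₀.conjExponent S f g +
          sparseForm μ p₀ q₀.conjExponent S f (k - g)) := by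
          refine mul_le_mul_right ?_ _
          have := sparseForm_add_le (p := p₀) hs1 S f hg.1 (hkr.sub hg).1
          rwa [add_sub_cancel] at this
      _ ≤ ENNReal.ofReal cT * (B + C₀ * (eLpNorm f r' μ * eLpNorm (k - g) r μ)) :=
          mul_le_mul_right (add_le_add (hB S hS) (hC₀ S hS f _ hfr'.1 (hkr.sub hg).1)) _
      _ = _ := by
          rw [hN', hC, ENNReal.ofReal, eLpNorm_sub_comm]
          push_cast
          ring
  calc ‖Φ g‖ₑ ≤ (ENNReal.ofReal cT * B + C * eLpNorm (g - k) r μ) + C * eLpNorm (g - k) r μ :=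
        h1.trans (add_le_add h2 le_rfl)
    _ = ENNReal.ofReal cT * B + (2 * C) * eLpNorm (g - k) r μ := by ring
    _ ≤ ENNReal.ofReal cT * B + (2 * C) * (ε / (2 * C + 1) : ℝ≥0) :=
        add_le_add le_rfl (mul_le_mul_right hgk _)
    _ ≤ _ := by
        refine add_le_add le_rfl ?_
        norm_cast
        rw [← mul_div_assoc, div_le_iff₀ (by positivity), mul_comm]
        exact mul_le_mul_right (by simp) ε

end Domination

/-! ### The exceptional set of large averages and the localised form -/

section WeakType

variable {n : ℕ} {ν : ℝ} {μ : Measure (EuclideanSpace ℝ (Fin n))}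
  {w : EuclideanSpace ℝ (Fin n) → ℝ}

lemma one_le_rpow_of_nonneg {a : ℝ≥0∞} (ha : 1 ≤ a) {z : ℝ} (hz : 0 ≤ z) : 1 ≤ a ^ z := by
  simpa using ENNReal.rpow_le_rpow ha hz

lemma IsWeight.lintegral_wMeasure (hw : IsWeight μ w) {h : EuclideanSpace ℝ (Fin n) → ℝ≥0∞}
    (hh : Measurable h) : ∫⁻ x, h x ∂wMeasure μ w = ∫⁻ x, h x * ENNReal.ofReal (w x) ∂μ := by
  rw [wMeasure, lintegral_withDensity_eq_lintegral_mul _ hw.measurable_ofReal hh]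
  exact lintegral_congr fun x => mul_comm _ _

lemma one_le_RHconst (hμ : IsDoubling ν μ) (hw : IsWeight μ w) {s : ℝ≥0∞} (hs : 1 ≤ s) :
    1 ≤ RHconst μ w s := by
  rcases eq_or_ne s 1 with rfl | hs1
  · rw [RHconst, if_pos rfl]
  · set Q := dyadicCube (n := n) 0 0 0 with hQ
    have hQ0 : μ Q ≠ 0 := hμ.cube_ne_zero _ _ _
    have hQt : μ Q ≠ ∞ := hμ.cube_ne_top _ _ _
    have hprob : IsProbabilityMeasure ((μ Q)⁻¹ • μ.restrict Q) :=
      ⟨by simp [ENNReal.inv_mul_cancel hQ0 hQt]⟩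
    have h1 : avg μ 1 Q w ≠ 0 := by
      rw [hw.avg_one_eq (measurableSet_dyadicCube _ _ _)]
      exact mul_ne_zero (ENNReal.inv_ne_zero.2 hQt) (hw.wMeasure_ne_zero hQ0)
    have h2 : avg μ 1 Q w ≠ ∞ := by
      rw [hw.avg_one_eq (measurableSet_dyadicCube _ _ _)]
      exact ENNReal.mul_ne_top (ENNReal.inv_ne_top.2 hQ0) (hw.wMeasure_cube_ne_top _ _ _)
    have h3 : avg μ 1 Q w ≤ avg μ s Q w :=
      eLpNorm_le_eLpNorm_of_exponent_le hs hw.measurable.aestronglyMeasurable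
    have h4 := h3.trans (avg_le_RHconst hμ hw hs1 (Q := Q) ⟨0, 0, 0, rfl⟩)
    by_contra hlt
    push Not at hlt
    have h5 := ENNReal.mul_lt_mul_left h1 h2 hlt
    rw [one_mul] at h5
    exact absurd h4 (not_le.2 h5)

/-- All other factors of `ψ^p₀` are at least `1`. Needed to absorb the contribution of the cubes
with large averages. -/
lemma A1const_le_psi (hμ : IsDoubling ν μ) (hw : IsWeight μ w) {p₀ q₀ : ℝ≥0∞} (hp₀ : 1 ≤ p₀)
    (hpq : p₀ < q₀) (hR : InRH μ w (rhExp p₀ q₀)) : A1const μ w ≤ psi μ p₀ q₀ w ^ p₀.toReal := by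
  have hp0 : 0 < p₀.toReal := ENNReal.toReal_pos (by positivity) hpq.ne_top
  have hrh : 1 ≤ rhExp p₀ q₀ := by rw [rhExp, ENNReal.conjExponent]; exact le_self_add
  rw [psi]
  split_ifs with h1 h2 h2
  · rw [h2, ENNReal.toReal_one, ENNReal.rpow_one]
    exact le_mul_of_one_le_right' (one_le_logE _)
  · rw [ENNReal.mul_rpow_of_nonneg _ _ hp0.le, ENNReal.mul_rpow_of_nonneg _ _ hp0.le,
      ← ENNReal.rpow_mul (A1const μ w), one_div_mul_cancel hp0.ne', ENNReal.rpow_one, mul_assoc]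
    refine le_mul_of_one_le_right' (one_le_mul ?_ ?_)
    · exact one_le_rpow_of_nonneg (one_le_rpow_of_nonneg (one_le_AinftyConst hμ hw) (by positivity))
        hp0.le
    · exact one_le_rpow_of_nonneg (one_le_rpow_of_nonneg (one_le_logE _) (by positivity)) hp0.le
  · subst h2
    have hσ1 := rhExp_ne_one hp₀ h1
    have hv := hw.rpow hμ (rhExp_ne_zero 1 q₀) hσ1 (rhExp_ne_top hpq) (hR.2 hσ1).2
    rw [rhExp_one] at *
    rw [ENNReal.toReal_one, ENNReal.rpow_one, mul_right_comm]
    exact le_mul_of_one_le_left' (one_le_mul (one_le_AinftyConst hμ hv)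
      (one_le_RHconst hμ hw hrh))
  · have hσ1 := rhExp_ne_one hp₀ h1
    have hv := hw.rpow hμ (rhExp_ne_zero p₀ q₀) hσ1 (rhExp_ne_top hpq) (hR.2 hσ1).2
    rw [ENNReal.mul_rpow_of_nonneg _ _ hp0.le, ← ENNReal.rpow_mul (A1const μ w * _),
      one_div_mul_cancel hp0.ne', ENNReal.rpow_one, mul_comm (A1const μ w), ← mul_assoc]
    refine le_mul_of_one_le_left' (one_le_mul ?_ (one_le_RHconst hμ hw hrh))
    exact one_le_rpow_of_nonneg (one_le_rpow_of_nonneg (one_le_AinftyConst hμ hv) (by positivity))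
        hp0.le

/-- The weighted weak type estimate for the dyadic maximal operators. -/
lemma wMeasure_large_cubes_le (hμ : IsDoubling ν μ) (hw : IsWeight μ w)
    {h : EuclideanSpace ℝ (Fin n) → ℝ≥0∞} (hh : Measurable h) :
    wMeasure μ w (⋃ Q ∈ {Q | Q ∈ dyadicCubes n ∧ μ Q < ∫⁻ x in Q, h x ∂μ}, Q) ≤
      3 ^ n * (A1const μ w * ∫⁻ x, h x * ENNReal.ofReal (w x) ∂μ) := by
  classical
  have hone : ∀ α : Fin n → Fin 3, wMeasure μ w
      (⋃ Q : {Q | Q ∈ dyadicGrid α ∧ μ Q < ∫⁻ x in Q, h x ∂μ}, (Q : Set _)) ≤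
      A1const μ w * ∫⁻ x, h x * ENNReal.ofReal (w x) ∂μ := by
    intro α
    set G := {Q | Q ∈ dyadicGrid α ∧ μ Q < ∫⁻ x in Q, h x ∂μ} with hG
    have : Countable G := by
      refine (countable_dyadicCubes (n := n)).mono ?_ |>.to_subtype
      exact fun Q hQ => ⟨α, hQ.1⟩
    have hU : (⋃ Q : G, (Q : Set (EuclideanSpace ℝ (Fin n)))) =
        ⋃ F : Finset G, ⋃ Q ∈ F, (Q : Set (EuclideanSpace ℝ (Fin n))) := by
      ext x
      simp only [mem_iUnion]
      constructor
      · rintro ⟨Q, hQ⟩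
        exact ⟨{Q}, Q, Finset.mem_singleton_self Q, hQ⟩
      · rintro ⟨F, Q, -, hQ⟩
        exact ⟨Q, hQ⟩
    have hmono : Monotone fun F : Finset G => ⋃ Q ∈ F, (Q : Set (EuclideanSpace ℝ (Fin n))) :=
      fun F F' hF => biUnion_subset_biUnion_left fun Q hQ => hF hQ
    rw [hU, hmono.directed_le.measure_iUnion]
    refine iSup_le fun F => ?_
    set F' := F.map (Function.Embedding.subtype _) with hF'
    have hF'G : ∀ Q ∈ F', Q ∈ G := by
      intro Q hQ
      obtain ⟨R, -, rfl⟩ := Finset.mem_map.1 hQ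
      exact R.2
    have e : (⋃ Q ∈ F, (Q : Set (EuclideanSpace ℝ (Fin n)))) = ⋃ Q ∈ F', Q := by
      ext x
      simp [hF']
    rw [e, ← lintegral_const_mul (A1const μ w)
      (f := fun x => h x * ENNReal.ofReal (w x)) (hh.mul hw.measurable_ofReal)]
    refine IsLaminar.measure_biUnion_le
      (isLaminar_of_subset_dyadicGrid fun Q hQ => (hF'G Q hQ).1) (fun Q hQ => ?_) fun Q hQ => ?_
    · obtain ⟨⟨k, m, rfl⟩, -⟩ := hF'G Q hQ
      exact measurableSet_dyadicCube α k m
    · obtain ⟨⟨k, m, rfl⟩, hlt⟩ := hF'G Q hQ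
      have hQ0 := hμ.cube_ne_zero α k m
      have hQt := hμ.cube_ne_top α k m
      set Q := dyadicCube α k m
      -- After multiplication by `μ(Q)`, the large average replaces `μ(Q)` by `∫_Q h`, and the `A_1`
      -- condition bounds `w(Q)` by `[w]_{A_1} μ(Q) w(x)` under that integral.
      rw [← ENNReal.mul_le_mul_iff_right hQ0 hQt]
      calc μ Q * wMeasure μ w Q ≤ (∫⁻ x in Q, h x ∂μ) * wMeasure μ w Q := mul_le_mul_left hlt.le _
        _ = ∫⁻ x in Q, h x * wMeasure μ w Q ∂μ := (lintegral_mul_const _ hh).symm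
        _ ≤ ∫⁻ x in Q, μ Q * (A1const μ w * (h x * ENNReal.ofReal (w x))) ∂μ := by
            refine lintegral_mono_ae ?_
            filter_upwards [A1_ae hμ hw α k m] with x hx
            exact (mul_le_mul_right hx _).trans (le_of_eq (by ring))
        _ = _ := lintegral_const_mul _ ((hh.mul hw.measurable_ofReal).const_mul _)
  calc wMeasure μ w (⋃ Q ∈ {Q | Q ∈ dyadicCubes n ∧ μ Q < ∫⁻ x in Q, h x ∂μ}, Q)
      ≤ wMeasure μ w (⋃ α : Fin n → Fin 3,
        ⋃ Q : {Q | Q ∈ dyadicGrid α ∧ μ Q < ∫⁻ x in Q, h x ∂μ}, (Q : Set _)) := by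
        refine measure_mono (iUnion₂_subset fun Q hQ => ?_)
        obtain ⟨⟨α, hα⟩, hlt⟩ := hQ
        exact subset_iUnion_of_subset α (subset_iUnion_of_subset ⟨Q, hα, hlt⟩ Subset.rfl)
    _ ≤ ∑ α : Fin n → Fin 3, wMeasure μ w
        (⋃ Q : {Q | Q ∈ dyadicGrid α ∧ μ Q < ∫⁻ x in Q, h x ∂μ}, (Q : Set _)) :=
        (measure_iUnion_le _).trans (le_of_eq (tsum_fintype _))
    _ ≤ ∑ _α : Fin n → Fin 3, A1const μ w * ∫⁻ x, h x * ENNReal.ofReal (w x) ∂μ :=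
        Finset.sum_le_sum fun α _ => hone α
    _ = _ := by simp

/-- Sparse forms tested against functions supported off the cubes with large averages. -/
lemma sparseForm_le_of_grid_bound (hμ : IsDoubling ν μ) {𝕜 : Type*} [RCLike 𝕜] {p₀ s : ℝ≥0∞}
    (hp₀ : 1 ≤ p₀) (hp₀t : p₀ ≠ ∞) {η : ℝ} (hη : 0 < η)
    {h : EuclideanSpace ℝ (Fin n) → ℝ≥0∞} {t : ℝ≥0} (ht : 0 < t)
    {f : EuclideanSpace ℝ (Fin n) → 𝕜} (hfh : ∀ᵐ x ∂μ, h x = (‖f x‖ₑ / t) ^ p₀.toReal)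
    {E : Set (EuclideanSpace ℝ (Fin n))} {g : EuclideanSpace ℝ (Fin n) → 𝕜}
    (hg : ∀ x, ‖g x‖ ≤ ‖E.indicator w x‖)
    (hE : ∀ Q ∈ dyadicCubes n, (E ∩ Q).Nonempty → ∫⁻ x in Q, h x ∂μ ≤ μ Q) {B : ℝ≥0∞}
    (hB : ∀ (α : Fin n → Fin 3) (S : Finset (Set (EuclideanSpace ℝ (Fin n)))),
      (∀ Q ∈ S, Q ∈ dyadicGrid α) → IsCarleson μ S ⌈1 / η⌉₊ →
      (∀ Q ∈ S, ∫⁻ x in Q, h x ∂μ ≤ μ Q) →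
      ∑ Q ∈ S, ((μ Q)⁻¹ * ∫⁻ x in Q, h x ∂μ) ^ (1 / p₀.toReal) *
        avg μ s Q (E.indicator w) * μ Q ≤ B)
    {S : Set (Set (EuclideanSpace ℝ (Fin n)))} (hS : IsSparse μ η S) :
    sparseForm μ p₀ s S f g ≤ 3 ^ n * (t * B) := by
  classical
  have hp0 : 0 < p₀.toReal := ENNReal.toReal_pos (by positivity) hp₀t
  have ht0 : (t : ℝ≥0∞) ≠ 0 := by exact_mod_cast ht.ne'
  refine tsum_le_of_forall_grid (x := fun Q => avg μ p₀ Q f * avg μ s Q g * μ Q) hS.1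
    fun α F hF => ?_
  have hgrid : ∀ Q ∈ F, Q ∈ dyadicGrid α := fun Q hQ => (hF (Finset.mem_coe.2 hQ)).2
  -- Cubes missing `E` contribute nothing because `g` vanishes on them; on the remaining ones the
  -- averages of `h` are at most `1`.
  set F' := F.filter fun Q => (E ∩ Q).Nonempty with hF'
  have hsub : F' ⊆ F := Finset.filter_subset _ _
  have hterm : ∀ Q ∈ F', avg μ p₀ Q f * avg μ s Q g * μ Q ≤
      t * (((μ Q)⁻¹ * ∫⁻ x in Q, h x ∂μ) ^ (1 / p₀.toReal) *
        avg μ s Q (E.indicator w) * μ Q) := by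
    intro Q hQ
    have e : avg μ p₀ Q f = t * ((μ Q)⁻¹ * ∫⁻ x in Q, h x ∂μ) ^ (1 / p₀.toReal) := by
      have e1 : ∫⁻ x in Q, ‖f x‖ₑ ^ p₀.toReal ∂μ =
          (t : ℝ≥0∞) ^ p₀.toReal * ∫⁻ x in Q, h x ∂μ := by
        rw [← lintegral_const_mul' _ _ (ENNReal.rpow_ne_top_of_nonneg hp0.le (by simp))]
        refine lintegral_congr_ae ?_
        filter_upwards [ae_restrict_of_ae hfh] with x hx
        rw [hx, ← ENNReal.mul_rpow_of_nonneg _ _ hp0.le, ENNReal.mul_div_cancel ht0 (by simp)]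
      rw [avg_toReal (by positivity) hp₀t, e1, mul_left_comm,
        ENNReal.mul_rpow_of_nonneg _ _ (by positivity), ← ENNReal.rpow_mul,
        mul_one_div_cancel hp0.ne', ENNReal.rpow_one]
    have e2 : avg μ s Q g ≤ avg μ s Q (E.indicator w) := eLpNorm_mono hg
    rw [e, ← mul_assoc, ← mul_assoc]
    exact mul_le_mul_left (mul_le_mul_right e2 _) _
  calc ∑ Q ∈ F, avg μ p₀ Q f * avg μ s Q g * μ Q
      = ∑ Q ∈ F', avg μ p₀ Q f * avg μ s Q g * μ Q := by
        refine (Finset.sum_subset hsub fun Q hQ hQ' => ?_).symm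
        have hempty : E ∩ Q = ∅ := by
          by_contra hne
          exact hQ' (Finset.mem_filter.2 ⟨hQ, nonempty_iff_ne_empty.2 hne⟩)
        have hmQ : MeasurableSet Q := by
          obtain ⟨k, m, rfl⟩ := hgrid Q hQ
          exact measurableSet_dyadicCube α k m
        have : avg μ s Q g = 0 := by
          rw [avg, eLpNorm_congr_ae (g := 0), eLpNorm_zero]
          refine Measure.ae_smul_measure ?_ _
          filter_upwards [ae_restrict_mem hmQ] with x hx
          have h1 := hg x
          rw [indicator_of_notMem (fun hxE => by
            have : x ∈ E ∩ Q := ⟨hxE, hx⟩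
            rw [hempty] at this; exact this), norm_zero] at h1
          exact norm_le_zero_iff.1 h1
        rw [this, mul_zero, zero_mul]
    _ ≤ ∑ Q ∈ F', t * (((μ Q)⁻¹ * ∫⁻ x in Q, h x ∂μ) ^ (1 / p₀.toReal) *
        avg μ s Q (E.indicator w) * μ Q) := Finset.sum_le_sum hterm
    _ ≤ t * B := by
        rw [← Finset.mul_sum]
        refine mul_le_mul_right (hB α F' (fun Q hQ => hgrid Q (hsub hQ))
          ((hS.isCarleson hμ hη hF).mono hsub) fun Q hQ => ?_) _
        exact hE Q ⟨α, hgrid Q (hsub hQ)⟩ (Finset.mem_filter.1 hQ).2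

end WeakType

/-! ### The weak type estimate on test functions -/

section WeakTypeOnTestSpace

lemma enorm_integral_ofReal {X 𝕜 : Type*} [MeasurableSpace X] [RCLike 𝕜] {μ : Measure X}
    {G : X → 𝕜} (hG : Integrable G μ) {F : X → ℝ} (hF : ∀ x, 0 ≤ F x)
    (hGF : G =ᵐ[μ] fun x => (F x : 𝕜)) : ‖∫ x, G x ∂μ‖ₑ = ∫⁻ x, ENNReal.ofReal (F x) ∂μ := by
  have hFi : Integrable F μ := by
    refine hG.norm.congr ?_
    filter_upwards [hGF] with x hx
    rw [hx, RCLike.norm_ofReal, abs_of_nonneg (hF x)]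
  rw [integral_congr_ae hGF, integral_ofReal, ← ofReal_norm, RCLike.norm_ofReal,
    abs_of_nonneg (integral_nonneg hF), ofReal_integral_eq_lintegral_ofReal hFi
      (Filter.Eventually.of_forall hF)]

variable {n : ℕ}

/-- The weak type estimate on test functions. -/
theorem exists_weak_type (hn : 1 ≤ n) (ν : ℝ) {p₀ q₀ : ℝ≥0∞} (hp₀ : 1 ≤ p₀) (hpq : p₀ < q₀)
    {cT η : ℝ} (hcT : 0 < cT) (hη : 0 < η) : ∃ K : ℝ≥0, 0 < K ∧
      ∀ (𝕜 : Type*) [RCLike 𝕜] (μ : Measure (EuclideanSpace ℝ (Fin n)))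
        (D : Submodule 𝕜 (EuclideanSpace ℝ (Fin n) → 𝕜))
        (T : (EuclideanSpace ℝ (Fin n) → 𝕜) → EuclideanSpace ℝ (Fin n) → 𝕜)
        (w : EuclideanSpace ℝ (Fin n) → ℝ), IsDoubling ν μ → IsTestSpace μ D →
        SparselyDominated μ D p₀ q₀ cT η T → InA1 μ w → InRH μ w (rhExp p₀ q₀) →
        psi μ p₀ q₀ w < ∞ ∧ ∀ f ∈ D, ∀ t : ℝ≥0, 0 < t →
          wMeasure μ w {x | (t : ℝ) < ‖T f x‖} ≤
            K * psi μ p₀ q₀ w ^ p₀.toReal * ∫⁻ x, (‖f x‖ₑ / t) ^ p₀.toReal ∂wMeasure μ w := by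
  have hpt : p₀ ≠ ∞ := hpq.ne_top
  have hp0 : 0 < p₀.toReal := ENNReal.toReal_pos (by positivity) hpt
  -- The domination constant times the number of grids. The choice `ζ = 1/(2b)` below leaves exactly
  -- half of `w(E)` for absorption.
  set b : ℝ≥0 := cT.toNNReal * 3 ^ n with hb
  have hb0 : 0 < b := by
    have := Real.toNNReal_pos.2 hcT
    positivity
  obtain ⟨C, hC⟩ := exists_grid_bound hn ν (Λ := ⌈1 / η⌉₊) (Nat.ceil_pos.2 (by positivity)) hp₀ hpq
    (ζ := (2 * b)⁻¹) (by positivity)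
  refine ⟨2 * b * C + 3 ^ n, by positivity, fun 𝕜 _ μ D T w hμ hD hT hA1 hRH => ?_⟩
  obtain ⟨hψ, hgrid⟩ := hC μ w hμ hA1 hRH
  refine ⟨hψ, fun f hf t ht => ?_⟩
  have hw := hA1.1
  obtain ⟨r, hr0, hr, hdom⟩ := exists_exponent_domination hn hμ hD hp₀ hpq hη hT
  have hfm : AEStronglyMeasurable f μ := by
    have := (hD.memLp _ (inAinfty_one hn hμ) 1 le_rfl (by simp) f hf).1
    rwa [wMeasure_one] at this
  have hTm := hT.aestronglyMeasurable f hf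
  set f' := hfm.mk f with hf'
  have hf'm : Measurable f' := hfm.stronglyMeasurable_mk.measurable
  set τ := hTm.mk (T f) with hτ
  have hτm : Measurable τ := hTm.stronglyMeasurable_mk.measurable
  set h : EuclideanSpace ℝ (Fin n) → ℝ≥0∞ := fun x => (‖f' x‖ₑ / t) ^ p₀.toReal with hh
  have hhm : Measurable h := (hf'm.enorm.div_const _).pow_const _
  have hfh : ∀ᵐ x ∂μ, h x = (‖f x‖ₑ / t) ^ p₀.toReal := by
    filter_upwards [hfm.ae_eq_mk] with x hx
    rw [hh, hx]
  set I := ∫⁻ x, h x * ENNReal.ofReal (w x) ∂μ with hI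
  have hI' : ∫⁻ x, (‖f x‖ₑ / t) ^ p₀.toReal ∂wMeasure μ w = I := by
    rw [hI, ← hw.lintegral_wMeasure hhm]
    exact lintegral_congr_ae ((hw.ae_iff).2 (hfh.mono fun x hx => hx.symm))
  set Ω : Set (EuclideanSpace ℝ (Fin n)) :=
    ⋃ Q ∈ {Q | Q ∈ dyadicCubes n ∧ μ Q < ∫⁻ x in Q, h x ∂μ}, Q with hΩ
  have hΩm : MeasurableSet Ω := by
    refine MeasurableSet.biUnion (countable_dyadicCubes.mono fun Q hQ => hQ.1) fun Q hQ => ?_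
    obtain ⟨⟨α, k, m, rfl⟩, -⟩ := hQ
    exact measurableSet_dyadicCube α k m
  have hΩle := wMeasure_large_cubes_le hμ hw hhm
  -- The superlevel set off `Ω`, truncated to a ball where `w` is bounded: then `w(E N)` is finite,
  -- which permits absorption, and the test function below lies in `L^r`.
  set E : ℕ → Set (EuclideanSpace ℝ (Fin n)) := fun N =>
    {x | (t : ℝ) < ‖τ x‖} \ Ω ∩ (Metric.ball 0 N ∩ {x | w x ≤ N}) with hE
  have hEm : ∀ N, MeasurableSet (E N) := fun N =>
    ((measurableSet_lt measurable_const hτm.norm).diff hΩm).inter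
      (Metric.isOpen_ball.measurableSet.inter (measurableSet_le hw.measurable measurable_const))
  have hEmono : Monotone E := fun N M hNM x hx => by
    have hNM' : (N : ℝ) ≤ M := by exact_mod_cast hNM
    exact ⟨hx.1, Metric.ball_subset_ball hNM' hx.2.1, le_trans (α := ℝ) hx.2.2 hNM'⟩
  have hEU : ⋃ N, E N = {x | (t : ℝ) < ‖τ x‖} \ Ω := by
    ext x
    simp only [mem_iUnion]
    refine ⟨fun ⟨N, hN⟩ => hN.1, fun hx => ?_⟩
    obtain ⟨N, hN⟩ := exists_nat_gt (max ‖x‖ (w x))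
    refine ⟨N, hx, ?_, ?_⟩
    · rw [mem_ball_zero_iff]; exact (le_max_left _ _).trans_lt hN
    · exact ((le_max_right _ _).trans_lt hN).le
  have hmain : ∀ N, wMeasure μ w (E N) ≤ 2 * b * C * psi μ p₀ q₀ w ^ p₀.toReal * I := by
    intro N
    -- The phase makes the pairing with `T f` equal to the integral of `|T f| w` over `E N`, which
    -- is at least `t w(E N)`.
    set g : EuclideanSpace ℝ (Fin n) → 𝕜 := (E N).indicator fun x => (w x : 𝕜) * phase (τ x) with hg
    have hgm : Measurable g :=
      ((RCLike.continuous_ofReal.measurable.comp hw.measurable).mul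
        (measurable_phase.comp hτm)).indicator (hEm N)
    have hgw : ∀ x, ‖g x‖ ≤ ‖(E N).indicator w x‖ := by
      intro x
      by_cases hx : x ∈ E N
      · rw [hg, indicator_of_mem hx, indicator_of_mem hx, norm_mul, RCLike.norm_ofReal]
        exact mul_le_of_le_one_right (abs_nonneg _) (norm_phase_le _)
      · rw [hg, indicator_of_notMem hx, indicator_of_notMem hx, norm_zero, norm_zero]
    have hgr : MemLp g r μ := by
      refine MemLp.of_le (memLp_indicator_const r (μ := μ) (s := Metric.ball 0 N)
        Metric.isOpen_ball.measurableSet (N : ℝ) (Or.inr (hμ.ball_lt_top 0 N).ne))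
        hgm.aestronglyMeasurable (Filter.Eventually.of_forall fun x => (hgw x).trans ?_)
      by_cases hx : x ∈ E N
      · rw [indicator_of_mem hx, indicator_of_mem hx.2.1, Real.norm_of_nonneg (hw.pos x).le,
          Real.norm_of_nonneg (Nat.cast_nonneg N)]
        exact hx.2.2
      · rw [indicator_of_notMem hx, norm_zero]; exact norm_nonneg _
    obtain ⟨hint, hbd⟩ := hdom f hf g hgr
    have hval : ‖∫ x, T f x * g x ∂μ‖ₑ =
        ∫⁻ x, ENNReal.ofReal ((E N).indicator (fun x => ‖τ x‖ * w x) x) ∂μ := by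
      refine enorm_integral_ofReal hint (fun x => indicator_nonneg (fun x _ =>
        mul_nonneg (norm_nonneg _) (hw.pos x).le) x) ?_
      filter_upwards [hTm.ae_eq_mk] with x hx
      rw [hx]
      by_cases hxE : x ∈ E N
      · rw [hg, indicator_of_mem hxE, indicator_of_mem hxE, mul_left_comm, mul_phase,
          RCLike.ofReal_mul, mul_comm]
      · rw [hg, indicator_of_notMem hxE, indicator_of_notMem hxE, mul_zero, RCLike.ofReal_zero]
    have hlow : t * wMeasure μ w (E N) ≤ ‖∫ x, T f x * g x ∂μ‖ₑ := by
      rw [hval, wMeasure_apply (hEm N), ← lintegral_const_mul _ hw.measurable_ofReal,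
        ← lintegral_indicator (hEm N)]
      refine lintegral_mono fun x => ?_
      by_cases hxE : x ∈ E N
      · rw [indicator_of_mem hxE, indicator_of_mem hxE, ENNReal.ofReal_mul (norm_nonneg _)]
        refine mul_le_mul_left ?_ _
        rw [← ENNReal.ofReal_coe_nnreal]
        have : (t : ℝ) < ‖τ x‖ := hxE.1.1
        exact ENNReal.ofReal_le_ofReal this.le
      · rw [indicator_of_notMem hxE]; exact zero_le
    set B : ℝ≥0∞ := ((2 * b)⁻¹ : ℝ≥0) * wMeasure μ w (E N) +
      C * (psi μ p₀ q₀ w ^ p₀.toReal * I) with hB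
    have hup := hbd (3 ^ n * (t * B)) fun S hS => sparseForm_le_of_grid_bound hμ hp₀ hpt hη ht hfh
      hgw (fun Q hQ hne => by
        by_contra hlt
        obtain ⟨x, hxE, hxQ⟩ := hne
        exact hxE.1.2 (mem_iUnion₂.2 ⟨Q, ⟨hQ, not_le.1 hlt⟩, hxQ⟩))
      (fun α S hSg hSc hSh => hgrid α S hSg hSc h hhm hSh (E N) (hEm N)) hS
    have ht0 : (t : ℝ≥0∞) ≠ 0 := by exact_mod_cast ht.ne'
    have h1 : wMeasure μ w (E N) ≤ b * B := by
      rw [← ENNReal.mul_le_mul_iff_right ht0 ENNReal.coe_ne_top]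
      refine (hlow.trans hup).trans (le_of_eq ?_)
      rw [hb, ENNReal.ofReal]
      push_cast
      ring
    have hfin : wMeasure μ w (E N) ≠ ∞ := ne_top_of_le_ne_top (hw.ball_lt_top 0 N).ne
      (measure_mono fun x hx => hx.2.1)
    have h2 : (2 * b : ℝ≥0) * (((2 * b)⁻¹ : ℝ≥0) : ℝ≥0∞) = 1 := by
      norm_cast
      rw [← NNReal.coe_inj]
      push_cast
      have : (b : ℝ) ≠ 0 := by exact_mod_cast hb0.ne'
      field_simp
    have h3 : 2 * wMeasure μ w (E N) ≤ wMeasure μ w (E N) +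
        2 * b * C * psi μ p₀ q₀ w ^ p₀.toReal * I := by
      calc 2 * wMeasure μ w (E N) ≤ 2 * (b * B) := mul_le_mul_right h1 _
        _ = ((2 * b : ℝ≥0) * (((2 * b)⁻¹ : ℝ≥0) : ℝ≥0∞)) * wMeasure μ w (E N) +
            2 * b * C * psi μ p₀ q₀ w ^ p₀.toReal * I := by
            rw [hB]; push_cast; ring
        _ = _ := by rw [h2, one_mul]
    rw [two_mul] at h3
    -- Absorption of `w(E N)`, legitimate since it is finite.
    exact (ENNReal.add_le_add_iff_left hfin).1 h3
  have hdiff : wMeasure μ w ({x | (t : ℝ) < ‖τ x‖} \ Ω) ≤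
      2 * b * C * psi μ p₀ q₀ w ^ p₀.toReal * I := by
    rw [← hEU, hEmono.directed_le.measure_iUnion]
    exact iSup_le hmain
  have heq : wMeasure μ w {x | (t : ℝ) < ‖T f x‖} = wMeasure μ w {x | (t : ℝ) < ‖τ x‖} := by
    refine measure_congr ?_
    have := (hw.ae_iff).2 hTm.ae_eq_mk
    filter_upwards [this] with x hx
    simp only [eq_iff_iff]
    change (t : ℝ) < ‖T f x‖ ↔ (t : ℝ) < ‖τ x‖
    rw [hx]
  rw [heq, hI']
  calc wMeasure μ w {x | (t : ℝ) < ‖τ x‖}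
      ≤ wMeasure μ w ({x | (t : ℝ) < ‖τ x‖} \ Ω) + wMeasure μ w Ω :=
        (measure_mono (by rw [sdiff_union_self]; exact subset_union_left)).trans
          (measure_union_le _ _)
    _ ≤ 2 * b * C * psi μ p₀ q₀ w ^ p₀.toReal * I +
        3 ^ n * (psi μ p₀ q₀ w ^ p₀.toReal * I) :=
        add_le_add hdiff (hΩle.trans (mul_le_mul_right (mul_le_mul_left
          (A1const_le_psi hμ hw hp₀ hpq hRH) _) _))
    _ = _ := by push_cast; ring

end WeakTypeOnTestSpace

/-! ### Extension by continuity in measure -/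

section Extension

variable {X 𝕜 : Type*} [MeasurableSpace X] [RCLike 𝕜] {m : Measure X} {p : ℝ≥0∞} {K : ℝ≥0∞}

lemma tendsto_coe_inv_pow {c : ℝ≥0} (hc : 1 < c) :
    Filter.Tendsto (fun j : ℕ => (((c⁻¹ : ℝ≥0) ^ j : ℝ≥0) : ℝ≥0∞)) Filter.atTop (nhds 0) := by
  rw [← ENNReal.coe_zero, ENNReal.tendsto_coe]
  exact tendsto_pow_atTop_nhds_zero_of_lt_one zero_le (inv_lt_one_of_one_lt₀ hc)

lemma tendsto_weak_bound (hK : K ≠ ∞) {s : ℝ} {ι : Type*} {l : Filter ι}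
    {a : ι → ℝ≥0∞} {b : ℝ≥0∞} (ha : Filter.Tendsto a l (nhds b)) {t : ℝ≥0} (ht : 0 < t) :
    Filter.Tendsto (fun i => K * (a i / t) ^ s) l (nhds (K * (b / t) ^ s)) := by
  refine ENNReal.Tendsto.const_mul ?_ (Or.inr hK)
  refine ((ENNReal.continuous_rpow_const (y := s)).tendsto _).comp ?_
  exact ENNReal.Tendsto.div_const ha (Or.inr (by exact_mod_cast ht.ne'))

/-- A function which is controlled by functions of arbitrarily small distribution is
nonpositive. -/
lemma ae_nonpos_of_approx (hK : K ≠ ∞) {s : ℝ} (hs : 0 < s) {Φ : X → ℝ}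
    (H : ∀ δ : ℝ≥0, 0 < δ → ∃ a b c : X → ℝ, (∀ᵐ x ∂m, Φ x ≤ a x + b x + c x) ∧
      ∀ t : ℝ≥0, 0 < t → m {x | (t : ℝ) < a x} ≤ K * (δ / t) ^ s ∧
        m {x | (t : ℝ) < b x} ≤ K * (δ / t) ^ s ∧ m {x | (t : ℝ) < c x} ≤ K * (δ / t) ^ s) :
    ∀ᵐ x ∂m, Φ x ≤ 0 := by
  have hzero : ∀ t : ℝ≥0, 0 < t → m {x | 3 * (t : ℝ) < Φ x} = 0 := by
    intro t ht
    have hle : ∀ j : ℕ, m {x | 3 * (t : ℝ) < Φ x} ≤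
        3 * (K * (((2⁻¹ : ℝ≥0) ^ j : ℝ≥0) / t : ℝ≥0∞) ^ s) := by
      intro j
      obtain ⟨a, b, c, h1, h2⟩ := H ((2⁻¹ : ℝ≥0) ^ j) (by positivity)
      obtain ⟨ha, hb, hc⟩ := h2 t ht
      have hsub : {x | 3 * (t : ℝ) < Φ x} ≤ᵐ[m]
          ({x | (t : ℝ) < a x} ∪ ({x | (t : ℝ) < b x} ∪ {x | (t : ℝ) < c x}) : Set X) := by
        filter_upwards [h1] with x hx hx3
        by_contra hnot
        have hn1 : ¬ (t : ℝ) < a x := fun h => hnot (Or.inl h)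
        have hn2 : ¬ (t : ℝ) < b x := fun h => hnot (Or.inr (Or.inl h))
        have hn3 : ¬ (t : ℝ) < c x := fun h => hnot (Or.inr (Or.inr h))
        have hx3' : 3 * (t : ℝ) < Φ x := hx3
        linarith
      calc m {x | 3 * (t : ℝ) < Φ x} ≤ _ := measure_mono_ae hsub
        _ ≤ m {x | (t : ℝ) < a x} + (m {x | (t : ℝ) < b x} + m {x | (t : ℝ) < c x}) :=
            (measure_union_le _ _).trans (add_le_add le_rfl (measure_union_le _ _))
        _ ≤ _ := (add_le_add ha (add_le_add hb hc)).trans (le_of_eq (by ring))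
    have hlim := ENNReal.Tendsto.const_mul (a := 3)
      (tendsto_weak_bound hK (s := s) (tendsto_coe_inv_pow (c := 2) one_lt_two) ht)
      (Or.inr (by simp))
    rw [ENNReal.zero_div, ENNReal.zero_rpow_of_pos hs, mul_zero, mul_zero] at hlim
    exact le_antisymm (ge_of_tendsto' hlim hle) zero_le
  have hall : ∀ᵐ x ∂m, ∀ j : ℕ, ¬ 3 * (((2⁻¹ : ℝ≥0) ^ j : ℝ≥0) : ℝ) < Φ x := by
    rw [ae_all_iff]
    intro j
    rw [ae_iff]
    simpa using hzero ((2⁻¹ : ℝ≥0) ^ j) (by positivity)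
  filter_upwards [hall] with x hx
  have hlim : Filter.Tendsto (fun j : ℕ => 3 * (((2⁻¹ : ℝ≥0) ^ j : ℝ≥0) : ℝ)) Filter.atTop
      (nhds (3 * 0)) := by
    refine Filter.Tendsto.const_mul _ ?_
    have := tendsto_pow_atTop_nhds_zero_of_lt_one (r := (2⁻¹ : ℝ)) (by norm_num) (by norm_num)
    simpa using this
  rw [mul_zero] at hlim
  exact ge_of_tendsto' hlim fun j => not_lt.1 (hx j)

/-- `G` is the value at `f` of the extension of the operator `S` of weak type `(p, p)` on `D`. -/
structure IsExtensionValue (m : Measure X) (p K : ℝ≥0∞) (D : Submodule 𝕜 (X → 𝕜))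
    (S : (X → 𝕜) → X → 𝕜) (f G : X → 𝕜) : Prop where
  aestronglyMeasurable : AEStronglyMeasurable G m
  measure_le : ∀ h ∈ D, ∀ t : ℝ≥0, 0 < t →
    m {x | (t : ℝ) < ‖G x - S h x‖} ≤ K * (eLpNorm (f - h) p m / t) ^ p.toReal

variable {D : Submodule 𝕜 (X → 𝕜)} {S : (X → 𝕜) → X → 𝕜}

/-- Approximants at distance `4^(-j)` have consecutive images differing by more than `2^(-j)` only
on sets of summable measure, so by Borel–Cantelli the images converge a.e. The distance of the limit
to every other image inherits the weak bound. -/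
lemma exists_isExtensionValue (hp1 : 1 ≤ p) (hpt : p ≠ ∞) (hK : K ≠ ∞)
    (hD : ∀ f ∈ D, MemLp f p m)
    (hSm : ∀ f ∈ D, AEStronglyMeasurable (S f) m)
    (hS : ∀ f ∈ D, ∀ g ∈ D, ∀ t : ℝ≥0, 0 < t →
      m {x | (t : ℝ) < ‖S f x - S g x‖} ≤ K * (eLpNorm (f - g) p m / t) ^ p.toReal)
    {f : X → 𝕜} (hf : MemLp f p m)
    (hdense : ∀ ε : ℝ≥0, 0 < ε → ∃ g ∈ D, eLpNorm (f - g) p m ≤ ε) :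
    ∃ G, IsExtensionValue m p K D S f G := by
  have hp0 : 0 < p.toReal := ENNReal.toReal_pos (zero_lt_one.trans_le hp1).ne' hpt
  choose h hhD hh using fun j : ℕ => hdense ((4⁻¹ : ℝ≥0) ^ j) (by positivity)
  have hdist : ∀ j, m {x | (((2⁻¹ : ℝ≥0) ^ j : ℝ≥0) : ℝ) < ‖S (h j) x - S (h (j + 1)) x‖} ≤
      K * (2 * 2⁻¹ ^ j) ^ p.toReal := by
    intro j
    refine (hS _ (hhD j) _ (hhD (j + 1)) ((2⁻¹ : ℝ≥0) ^ j) (by positivity)).trans ?_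
    refine mul_le_mul_right (ENNReal.rpow_le_rpow ?_ hp0.le) _
    have h1 : eLpNorm (h j - h (j + 1)) p m ≤ 2 * 4⁻¹ ^ j := by
      have e : h j - h (j + 1) = (f - h (j + 1)) - (f - h j) := by ring
      calc eLpNorm (h j - h (j + 1)) p m ≤ eLpNorm (f - h (j + 1)) p m + eLpNorm (f - h j) p m := by
            rw [e]
            exact eLpNorm_sub_le (hf.sub (hD _ (hhD _))).1 (hf.sub (hD _ (hhD _))).1 hp1
        _ ≤ ((4⁻¹ : ℝ≥0) ^ (j + 1) : ℝ≥0) + ((4⁻¹ : ℝ≥0) ^ j : ℝ≥0) := add_le_add (hh _) (hh _)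
        _ ≤ ((4⁻¹ : ℝ≥0) ^ j : ℝ≥0) + ((4⁻¹ : ℝ≥0) ^ j : ℝ≥0) := by
            refine add_le_add ?_ le_rfl
            norm_cast
            refine pow_le_pow_of_le_one zero_le ?_ (Nat.le_succ j)
            rw [← NNReal.coe_le_coe]; norm_num
        _ = 2 * 4⁻¹ ^ j := by
            rw [← two_mul, ENNReal.coe_pow, ENNReal.coe_inv (by norm_num)]
            rfl
    rw [ENNReal.div_le_iff_le_mul (Or.inl (by simp)) (Or.inl (by simp))]
    refine h1.trans (le_of_eq ?_)
    rw [ENNReal.coe_pow, ENNReal.coe_inv (by norm_num), mul_assoc, ← mul_pow]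
    congr 2
    rw [show (4 : ℝ≥0∞) = 2 * 2 by norm_num, ENNReal.mul_inv (by simp) (by simp)]
    simp
  have hsum : ∑' j : ℕ, K * ((2 : ℝ≥0∞) * 2⁻¹ ^ j) ^ p.toReal ≠ ∞ := by
    have e : ∀ j : ℕ, K * ((2 : ℝ≥0∞) * 2⁻¹ ^ j) ^ p.toReal =
        K * 2 ^ p.toReal * ((2⁻¹ : ℝ≥0∞) ^ p.toReal) ^ j := by
      intro j
      rw [ENNReal.mul_rpow_of_nonneg _ _ hp0.le, mul_assoc, ← ENNReal.rpow_natCast,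
        ← ENNReal.rpow_natCast, ← ENNReal.rpow_mul, ← ENNReal.rpow_mul, mul_comm (j : ℝ)]
    simp_rw [e]
    rw [ENNReal.tsum_mul_left, ENNReal.tsum_geometric]
    refine ENNReal.mul_ne_top (ENNReal.mul_ne_top hK
      (ENNReal.rpow_ne_top_of_nonneg hp0.le (by simp))) (ENNReal.inv_ne_top.2 ?_)
    refine (tsub_pos_of_lt (ENNReal.rpow_lt_one ?_ hp0)).ne'
    rw [ENNReal.inv_lt_one]; exact ENNReal.one_lt_two
  have hconv : ∀ᵐ x ∂m, ∃ l, Filter.Tendsto (fun j => S (h j) x) Filter.atTop (nhds l) := by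
    have hBC := ae_eventually_notMem (μ := m)
      (s := fun j => {x | (((2⁻¹ : ℝ≥0) ^ j : ℝ≥0) : ℝ) < ‖S (h j) x - S (h (j + 1)) x‖})
      (ne_top_of_le_ne_top hsum (ENNReal.tsum_le_tsum hdist))
    filter_upwards [hBC] with x hx
    refine cauchySeq_tendsto_of_complete (cauchySeq_of_summable_dist ?_)
    refine Summable.of_norm_bounded_eventually_nat (g := fun j : ℕ => (2⁻¹ : ℝ) ^ j)
      (summable_geometric_of_lt_one (by norm_num) (by norm_num)) ?_
    filter_upwards [hx] with j hj
    rw [Real.norm_of_nonneg dist_nonneg, dist_eq_norm]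
    have := not_lt.1 hj
    simpa using this
  obtain ⟨G, hG, hGlim⟩ := exists_stronglyMeasurable_limit_of_tendsto_ae
    (fun j => hSm _ (hhD j)) hconv
  refine ⟨G, hG.aestronglyMeasurable, fun k hk t ht => ?_⟩
  set A : ℕ → Set X := fun j => {x | (t : ℝ) < ‖S (h j) x - S k x‖} with hA
  -- The strict inequality at the limit holds eventually along the sequence, so the measure of the
  -- limit set is controlled by an increasing union of tail intersections.
  have hsub : {x | (t : ℝ) < ‖G x - S k x‖} ≤ᵐ[m] (⋃ J, ⋂ j ≥ J, A j : Set X) := by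
    filter_upwards [hGlim] with x hx hxt
    have h1 : Filter.Tendsto (fun j => ‖S (h j) x - S k x‖) Filter.atTop (nhds ‖G x - S k x‖) :=
      (hx.sub_const _).norm
    obtain ⟨J, hJ⟩ := Filter.eventually_atTop.1 (h1.eventually_const_lt hxt)
    exact mem_iUnion.2 ⟨J, mem_iInter₂.2 fun j hj => hJ j hj⟩
  have hmono : Monotone fun J => ⋂ j ≥ J, A j := fun J J' hJ =>
    biInter_subset_biInter_left fun j (hj : J' ≤ j) => hJ.trans hj
  refine (measure_mono_ae hsub).trans ?_
  rw [hmono.directed_le.measure_iUnion]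
  refine iSup_le fun J => ?_
  have hlim0 : Filter.Tendsto (fun j : ℕ => eLpNorm (f - k) p m + ((4⁻¹ : ℝ≥0) ^ j : ℝ≥0))
      Filter.atTop (nhds (eLpNorm (f - k) p m + 0)) := by
    exact Filter.Tendsto.add tendsto_const_nhds (tendsto_coe_inv_pow (by norm_num))
  rw [add_zero] at hlim0
  refine ge_of_tendsto (tendsto_weak_bound hK hlim0 ht) ?_
  filter_upwards [Filter.eventually_ge_atTop J] with j hj
  calc m (⋂ j ≥ J, A j) ≤ m (A j) := measure_mono (biInter_subset_of_mem hj)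
    _ ≤ K * (eLpNorm (h j - k) p m / t) ^ p.toReal := hS _ (hhD j) _ hk t ht
    _ ≤ _ := by
      refine mul_le_mul_right (ENNReal.rpow_le_rpow (ENNReal.div_le_div_right ?_ _) hp0.le) _
      have e : h j - k = (f - k) - (f - h j) := by ring
      rw [e]
      exact (eLpNorm_sub_le (hf.sub (hD _ hk)).1 (hf.sub (hD _ (hhD _))).1 hp1).trans
        (add_le_add le_rfl (hh j))

namespace IsExtensionValue

variable {f g G G' H : X → 𝕜}

lemma measure_le_of_le (hG : IsExtensionValue m p K D S f G) {h : X → 𝕜} (hh : h ∈ D)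
    {δ : ℝ≥0∞} (hδ : eLpNorm (f - h) p m ≤ δ) {t : ℝ≥0} (ht : 0 < t) :
    m {x | (t : ℝ) < ‖G x - S h x‖} ≤ K * (δ / t) ^ p.toReal :=
  (hG.measure_le h hh t ht).trans (mul_le_mul_right (ENNReal.rpow_le_rpow
    (ENNReal.div_le_div_right hδ _) ENNReal.toReal_nonneg) _)

lemma measure_mul_le_of_le (hG : IsExtensionValue m p K D S f G) {h : X → 𝕜} (hh : h ∈ D)
    (a : 𝕜) {δ : ℝ≥0} (hδ : eLpNorm (f - h) p m ≤ (δ / (‖a‖₊ + 1) : ℝ≥0)) {t : ℝ≥0} (ht : 0 < t) :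
    m {x | (t : ℝ) < ‖a‖ * ‖G x - S h x‖} ≤ K * (δ / t) ^ p.toReal := by
  have hpos : (0 : ℝ≥0) < ‖a‖₊ + 1 := by positivity
  calc m {x | (t : ℝ) < ‖a‖ * ‖G x - S h x‖}
      ≤ m {x | ((t / (‖a‖₊ + 1) : ℝ≥0) : ℝ) < ‖G x - S h x‖} := by
        refine measure_mono fun x hx => ?_
        have hx' : (t : ℝ) < ‖a‖ * ‖G x - S h x‖ := hx
        change ((t / (‖a‖₊ + 1) : ℝ≥0) : ℝ) < ‖G x - S h x‖
        push_cast
        rw [div_lt_iff₀ (by positivity)]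
        nlinarith [norm_nonneg (G x - S h x)]
    _ ≤ K * ((δ / (‖a‖₊ + 1) : ℝ≥0) / (t / (‖a‖₊ + 1) : ℝ≥0) : ℝ≥0∞) ^ p.toReal :=
        hG.measure_le_of_le hh hδ (by positivity)
    _ = _ := by
        congr 2
        rw [← ENNReal.coe_div (by positivity), ← ENNReal.coe_div ht.ne', div_div_div_cancel_right₀
          hpos.ne']

lemma measure_zero_le {δ : ℝ≥0∞} {t : ℝ≥0} {s : ℝ} :
    m {x | (t : ℝ) < (fun _ : X => (0 : ℝ)) x} ≤ K * (δ / t) ^ s := by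
  have : {x : X | (t : ℝ) < (fun _ : X => (0 : ℝ)) x} = ∅ := by
    ext x; simp
  rw [this, measure_empty]
  exact zero_le

/-- Uniqueness makes the extension agree with the operator on `D`: both values are close in measure
to the image of one approximant. -/
lemma ae_eq (hp0 : 0 < p.toReal) (hK : K ≠ ∞)
    (hdense : ∀ ε : ℝ≥0, 0 < ε → ∃ g ∈ D, eLpNorm (f - g) p m ≤ ε)
    (hG : IsExtensionValue m p K D S f G) (hG' : IsExtensionValue m p K D S f G') :
    G =ᵐ[m] G' := by
  have := ae_nonpos_of_approx (m := m) (Φ := fun x => ‖G x - G' x‖) hK hp0 fun δ hδ => by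
    obtain ⟨h, hh, hfh⟩ := hdense δ hδ
    refine ⟨fun x => ‖G x - S h x‖, fun x => ‖G' x - S h x‖, fun _ => 0,
      Filter.Eventually.of_forall fun x => ?_, fun t ht =>
      ⟨hG.measure_le_of_le hh hfh ht, hG'.measure_le_of_le hh hfh ht, measure_zero_le⟩⟩
    rw [add_zero]
    have := norm_sub_le (G x - S h x) (G' x - S h x)
    rwa [sub_sub_sub_cancel_right] at this
  filter_upwards [this] with x hx
  exact sub_eq_zero.1 (norm_le_zero_iff.1 hx)

/-- Subadditivity and additivity pass to extensions. -/
lemma add_approx (hp1 : 1 ≤ p) (hp0 : 0 < p.toReal) (hK : K ≠ ∞) (hD : ∀ f ∈ D, MemLp f p m)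
    (hf : MemLp f p m) (hg : MemLp g p m)
    (hfd : ∀ ε : ℝ≥0, 0 < ε → ∃ k ∈ D, eLpNorm (f - k) p m ≤ ε)
    (hgd : ∀ ε : ℝ≥0, 0 < ε → ∃ k ∈ D, eLpNorm (g - k) p m ≤ ε)
    (hG : IsExtensionValue m p K D S f G) (hG' : IsExtensionValue m p K D S g G')
    (hH : IsExtensionValue m p K D S (f + g) H) {Φ : X → ℝ}
    (hΦ : ∀ h ∈ D, ∀ k ∈ D, ∀ᵐ x ∂m, Φ x ≤ ‖H x - S (h + k) x‖ + ‖G x - S h x‖ + ‖G' x - S k x‖) :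
    ∀ᵐ x ∂m, Φ x ≤ 0 := by
  refine ae_nonpos_of_approx (m := m) hK hp0 fun δ hδ => ?_
  obtain ⟨h, hh, hfh⟩ := hfd (δ / 2) (by positivity)
  obtain ⟨k, hk, hgk⟩ := hgd (δ / 2) (by positivity)
  have hle : ((δ / 2 : ℝ≥0) : ℝ≥0∞) ≤ δ := by
    norm_cast
    exact NNReal.half_le_self δ
  refine ⟨_, _, _, hΦ h hh k hk, fun t ht => ⟨hH.measure_le_of_le (D.add_mem hh hk) ?_ ht,
    hG.measure_le_of_le hh (hfh.trans hle) ht, hG'.measure_le_of_le hk (hgk.trans hle) ht⟩⟩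
  have e : f + g - (h + k) = (f - h) + (g - k) := by ring
  rw [e]
  refine (eLpNorm_add_le (hf.sub (hD _ hh)).1 (hg.sub (hD _ hk)).1 hp1).trans
    ((add_le_add hfh hgk).trans (le_of_eq ?_))
  norm_cast
  exact add_halves δ

/-- Homogeneity passes to extensions. -/
lemma smul_approx (hp0 : 0 < p.toReal) (hK : K ≠ ∞)
    (hfd : ∀ ε : ℝ≥0, 0 < ε → ∃ k ∈ D, eLpNorm (f - k) p m ≤ ε) (a : 𝕜)
    (hG : IsExtensionValue m p K D S f G)
    (hH : IsExtensionValue m p K D S (a • f) H) {Φ : X → ℝ}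
    (hΦ : ∀ h ∈ D, ∀ᵐ x ∂m, Φ x ≤ ‖H x - S (a • h) x‖ + ‖a‖ * ‖G x - S h x‖) :
    ∀ᵐ x ∂m, Φ x ≤ 0 := by
  refine ae_nonpos_of_approx (m := m) hK hp0 fun δ hδ => ?_
  obtain ⟨h, hh, hfh⟩ := hfd (δ / (‖a‖₊ + 1)) (by positivity)
  refine ⟨_, _, fun _ => 0, (hΦ h hh).mono fun x hx => hx.trans (add_zero _).symm.le,
    fun t ht => ⟨hH.measure_le_of_le (D.smul_mem a hh) ?_ ht,
      hG.measure_mul_le_of_le hh a hfh ht, measure_zero_le⟩⟩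
  rw [← smul_sub, eLpNorm_const_smul]
  refine (mul_le_mul_right hfh _).trans ?_
  rw [enorm_eq_nnnorm]
  norm_cast
  rw [← mul_div_assoc, div_le_iff₀ (by positivity), mul_comm]
  exact mul_le_mul_right (by simp) δ

end IsExtensionValue

/-- Extension by continuity of sublinear operators of weak type `(p, p)`. -/
theorem exists_extension (hp1 : 1 ≤ p) (hpt : p ≠ ∞) (hK : K ≠ ∞)
    (hD : ∀ f ∈ D, MemLp f p m)
    (hdense : ∀ f, MemLp f p m → ∀ ε : ℝ≥0, 0 < ε → ∃ g ∈ D, eLpNorm (f - g) p m ≤ ε)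
    (hSm : ∀ f ∈ D, AEStronglyMeasurable (S f) m)
    (hS : ∀ f ∈ D, ∀ g ∈ D, ∀ t : ℝ≥0, 0 < t →
      m {x | (t : ℝ) < ‖S f x - S g x‖} ≤ K * (eLpNorm (f - g) p m / t) ^ p.toReal)
    (hsub : IsSublinearOn m (D : Set (X → 𝕜)) S) :
    ∃ G : (X → 𝕜) → X → 𝕜, (∀ f ∈ D, G f =ᵐ[m] S f) ∧ IsSublinearOn m {f | MemLp f p m} G ∧
      (IsLinearOn m (D : Set (X → 𝕜)) S → IsLinearOn m {f | MemLp f p m} G) ∧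
      ∀ f, MemLp f p m → AEStronglyMeasurable (G f) m ∧ ∀ t : ℝ≥0, 0 < t →
        m {x | (t : ℝ) < ‖G f x‖} ≤ K * (eLpNorm f p m / t) ^ p.toReal := by
  classical
  have hp0 : 0 < p.toReal := ENNReal.toReal_pos (zero_lt_one.trans_le hp1).ne' hpt
  choose! G hG using fun f (hf : MemLp f p m) =>
    exists_isExtensionValue hp1 hpt hK hD hSm hS hf (hdense f hf)
  refine ⟨G, fun f hf => ?_, ⟨fun f hf g hg => ?_, fun a f hf => ?_⟩,
    fun hlin => ⟨fun f hf g hg => ?_, fun a f hf => ?_⟩, fun f hf => ⟨(hG f hf).1, fun t ht => ?_⟩⟩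
  -- For `f` in `D` the function `S f` is itself an extension value, by the difference estimate.
  · exact (hG f (hD f hf)).ae_eq hp0 hK (hdense f (hD f hf)) ⟨hSm f hf, hS f hf⟩
  · have := IsExtensionValue.add_approx hp1 hp0 hK hD hf hg (hdense f hf) (hdense g hg)
      (hG f hf) (hG g hg) (hG (f + g) (hf.add hg))
      (Φ := fun x => ‖G (f + g) x‖ - (‖G f x‖ + ‖G g x‖)) fun h hh k hk => by
        filter_upwards [hsub.1 h hh k hk] with x hx
        have h1 := norm_sub_norm_le (G (f + g) x) (S (h + k) x)
        have h2 := norm_sub_norm_le (S h x) (G f x)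
        have h3 := norm_sub_norm_le (S k x) (G g x)
        rw [norm_sub_rev] at h2 h3
        linarith
    filter_upwards [this] with x hx
    linarith
  · have := IsExtensionValue.smul_approx hp0 hK (hdense f hf) a (hG f hf)
      (hG (a • f) (hf.const_smul a)) (Φ := fun x => |‖G (a • f) x‖ - ‖a‖ * ‖G f x‖|) fun h hh => by
        filter_upwards [hsub.2 a h hh] with x hx
        have h1 := abs_norm_sub_norm_le (G (a • f) x) (S (a • h) x)
        have h2 := mul_le_mul_of_nonneg_left (abs_norm_sub_norm_le (G f x) (S h x)) (norm_nonneg a)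
        have h3 := abs_sub_le ‖G (a • f) x‖ ‖S (a • h) x‖ (‖a‖ * ‖G f x‖)
        have h4 : |‖S (a • h) x‖ - ‖a‖ * ‖G f x‖| = ‖a‖ * |‖G f x‖ - ‖S h x‖| := by
          rw [hx, ← mul_sub, abs_mul, abs_norm, abs_sub_comm]
        linarith
    filter_upwards [this] with x hx
    exact sub_eq_zero.1 (abs_nonpos_iff.1 hx)
  · have := IsExtensionValue.add_approx hp1 hp0 hK hD hf hg (hdense f hf) (hdense g hg)
      (hG f hf) (hG g hg) (hG (f + g) (hf.add hg))
      (Φ := fun x => ‖G (f + g) x - (G f x + G g x)‖) fun h hh k hk => by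
        filter_upwards [hlin.1 h hh k hk] with x hx
        have e : G (f + g) x - (G f x + G g x) =
            (G (f + g) x - S (h + k) x) - (G f x - S h x) - (G g x - S k x) := by
          rw [hx, Pi.add_apply]; ring
        rw [e]
        exact (norm_sub_le _ _).trans (add_le_add (norm_sub_le _ _) le_rfl)
    filter_upwards [this] with x hx
    exact sub_eq_zero.1 (norm_le_zero_iff.1 hx)
  · have := IsExtensionValue.smul_approx hp0 hK (hdense f hf) a (hG f hf)
      (hG (a • f) (hf.const_smul a)) (Φ := fun x => ‖G (a • f) x - a * G f x‖) fun h hh => by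
        filter_upwards [hlin.2 a h hh] with x hx
        have e : G (a • f) x - a * G f x = (G (a • f) x - S (a • h) x) - a * (G f x - S h x) := by
          rw [hx, Pi.smul_apply, smul_eq_mul]; ring
        rw [e, ← norm_mul]
        exact norm_sub_le _ _
    filter_upwards [this] with x hx
    exact sub_eq_zero.1 (norm_le_zero_iff.1 hx)
  -- Homogeneity with the scalar `0` gives `S 0 = 0`, so the difference estimate against `0` is the
  -- weak type bound.
  · have h0 : ∀ᵐ x ∂m, S 0 x = 0 := by
      filter_upwards [hsub.2 0 0 D.zero_mem] with x hx
      rw [smul_zero, norm_zero, zero_mul] at hx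
      exact norm_eq_zero.1 hx
    have h1 := (hG f hf).measure_le 0 D.zero_mem t ht
    rw [sub_zero] at h1
    refine le_trans (le_of_eq (measure_congr ?_)) h1
    filter_upwards [h0] with x hx
    simp only [eq_iff_iff]
    change (t : ℝ) < ‖G f x‖ ↔ (t : ℝ) < ‖G f x - S 0 x‖
    rw [hx, sub_zero]

end Extension

/-! ### Weak norms, and differences of sublinear operators -/

section WeakNorm

variable {X F : Type*} [MeasurableSpace X] [NormedAddCommGroup F] {m : Measure X} {p : ℝ≥0∞}

lemma lintegral_enorm_div_rpow (hp0 : p ≠ 0) (hp : p ≠ ∞) (f : X → F) {t : ℝ≥0} (ht : 0 < t) :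
    ∫⁻ x, (‖f x‖ₑ / t) ^ p.toReal ∂m = (eLpNorm f p m / t) ^ p.toReal := by
  have hp' : 0 < p.toReal := ENNReal.toReal_pos hp0 hp
  have ht' : (t : ℝ≥0∞)⁻¹ ^ p.toReal ≠ ∞ :=
    ENNReal.rpow_ne_top_of_nonneg hp'.le (ENNReal.inv_ne_top.2 (by exact_mod_cast ht.ne'))
  simp_rw [div_eq_mul_inv, ENNReal.mul_rpow_of_nonneg _ _ hp'.le]
  rw [lintegral_mul_const' _ _ ht', eLpNorm_eq_lintegral_rpow_enorm_toReal hp0 hp,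
    ← ENNReal.rpow_mul, one_div_mul_cancel hp'.ne', ENNReal.rpow_one]

lemma weakLpNorm_le (hp0 : p ≠ 0) (hp : p ≠ ∞) {f : X → F} {K N : ℝ≥0∞}
    (h : ∀ t : ℝ≥0, 0 < t → m {x | (t : ℝ) < ‖f x‖} ≤ K * (N / t) ^ p.toReal) :
    weakLpNorm f p m ≤ K ^ (1 / p.toReal) * N := by
  have hp' : 0 < p.toReal := ENNReal.toReal_pos hp0 hp
  refine iSup_le fun t => ?_
  rcases eq_or_ne t 0 with rfl | ht
  · simp
  · have ht0 : (t : ℝ≥0∞) ≠ 0 := by exact_mod_cast ht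
    calc (t : ℝ≥0∞) * m {x | (t : ℝ) < ‖f x‖} ^ (1 / p.toReal)
        ≤ t * (K * (N / t) ^ p.toReal) ^ (1 / p.toReal) :=
          mul_le_mul_right (ENNReal.rpow_le_rpow (h t (pos_iff_ne_zero.2 ht)) (by positivity)) _
      _ = K ^ (1 / p.toReal) * N := by
          rw [ENNReal.mul_rpow_of_nonneg _ _ (by positivity), ← ENNReal.rpow_mul,
            mul_one_div_cancel hp'.ne', ENNReal.rpow_one, mul_left_comm,
            ENNReal.mul_div_cancel ht0 (by simp)]

end WeakNorm

section SublinearDifferences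

variable {X 𝕜 : Type*} [MeasurableSpace X] [RCLike 𝕜] {μ : Measure X} {D : Submodule 𝕜 (X → 𝕜)}
  {T : (X → 𝕜) → X → 𝕜}

lemma IsLinearOn.norm_sub_le (hT : IsLinearOn μ (D : Set (X → 𝕜)) T) {f g : X → 𝕜} (hf : f ∈ D)
    (hg : g ∈ D) : ∀ᵐ x ∂μ, ‖T f x - T g x‖ ≤ ‖T (f - g) x‖ := by
  have h := hT.1 (f - g) (D.sub_mem hf hg) g hg
  rw [sub_add_cancel] at h
  filter_upwards [h] with x hx
  rw [hx, Pi.add_apply, add_sub_cancel_right]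

/-- For a sublinear operator only the modulus is controlled along differences; `T f - T g` itself
need not be small. -/
lemma IsSublinearOn.abs_norm_sub_le (hT : IsSublinearOn μ (D : Set (X → 𝕜)) T) {f g : X → 𝕜}
    (hf : f ∈ D) (hg : g ∈ D) : ∀ᵐ x ∂μ, |‖T f x‖ - ‖T g x‖| ≤ ‖T (f - g) x‖ := by
  have h1 := hT.1 (f - g) (D.sub_mem hf hg) g hg
  have h2 := hT.1 (g - f) (D.sub_mem hg hf) f hf
  have h3 := hT.2 (-1) (f - g) (D.sub_mem hf hg)
  rw [sub_add_cancel] at h1 h2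
  rw [neg_one_smul, neg_sub, norm_neg, norm_one] at h3
  filter_upwards [h1, h2, h3] with x h1 h2 h3
  rw [abs_le]
  constructor <;> linarith

end SublinearDifferences

end SparseDom

end

/-! ### The weighted weak type bound and the extension -/

theorem theorem1p2 {n : ℕ} (hn : 1 ≤ n) (ν : ℝ) (p₀ q₀ : ℝ≥0∞) (hp₀ : 1 ≤ p₀) (hpq : p₀ < q₀)
    (cT η : ℝ) (hcT : 0 < cT) (hη : 0 < η) (hη1 : η ≤ 1) :
    ∃ c : ℝ≥0, 0 < c ∧
      ∀ (𝕜 : Type*) [RCLike 𝕜] (μ : Measure (EuclideanSpace ℝ (Fin n)))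
        (D : Submodule 𝕜 (EuclideanSpace ℝ (Fin n) → 𝕜))
        (T : (EuclideanSpace ℝ (Fin n) → 𝕜) → EuclideanSpace ℝ (Fin n) → 𝕜)
        (w : EuclideanSpace ℝ (Fin n) → ℝ),
        SparseDom.IsDoubling ν μ → SparseDom.IsTestSpace μ D →
        SparseDom.SparselyDominated μ D p₀ q₀ cT η T →
        SparseDom.InA1 μ w → SparseDom.InRH μ w (SparseDom.rhExp p₀ q₀) →
        SparseDom.psi μ p₀ q₀ w < ∞ ∧
        ∃ T' : (EuclideanSpace ℝ (Fin n) → 𝕜) → EuclideanSpace ℝ (Fin n) → 𝕜,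
          (∀ f ∈ D, T' f =ᵐ[μ] T f) ∧
          SparseDom.IsSublinearOn μ {f | MemLp f p₀ (SparseDom.wMeasure μ w)} T' ∧
          (SparseDom.IsLinearOn μ (D : Set (EuclideanSpace ℝ (Fin n) → 𝕜)) T →
            SparseDom.IsLinearOn μ {f | MemLp f p₀ (SparseDom.wMeasure μ w)} T') ∧
          ∀ f, MemLp f p₀ (SparseDom.wMeasure μ w) →
            AEStronglyMeasurable (T' f) μ ∧
            SparseDom.weakLpNorm (T' f) p₀ (SparseDom.wMeasure μ w) ≤
              c * SparseDom.psi μ p₀ q₀ w * eLpNorm f p₀ (SparseDom.wMeasure μ w) := by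
  classical
  have hpt : p₀ ≠ ∞ := hpq.ne_top
  have hp0' : p₀ ≠ 0 := (zero_lt_one.trans_le hp₀).ne'
  have hp0 : 0 < p₀.toReal := ENNReal.toReal_pos hp0' hpt
  obtain ⟨K, hK0, hK⟩ := SparseDom.exists_weak_type hn ν hp₀ hpq hcT hη
  refine ⟨K ^ (1 / p₀.toReal), NNReal.rpow_pos hK0, fun 𝕜 _ μ D T w hμ hD hT hA1 hRH => ?_⟩
  obtain ⟨hψ, hweak⟩ := hK 𝕜 μ D T w hμ hD hT hA1 hRH
  refine ⟨hψ, ?_⟩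
  have hw := hA1.1
  have hAinf : SparseDom.InAinfty μ w := ⟨hw, (SparseDom.AinftyConst_le hμ hn hw).trans_lt
    (ENNReal.mul_lt_top (by simp) hA1.2)⟩
  set m := SparseDom.wMeasure μ w with hm
  set M : ℝ≥0∞ := K * SparseDom.psi μ p₀ q₀ w ^ p₀.toReal with hM
  have hMt : M ≠ ∞ := ENNReal.mul_ne_top (by simp) (ENNReal.rpow_ne_top_of_nonneg hp0.le hψ.ne)
  have hac : m ≪ μ := withDensity_absolutelyContinuous _ _
  have hac' : μ ≪ m := Measure.ae_le_iff_absolutelyContinuous.1 fun s hs => hw.ae_iff.1 hs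
  have hDm := hD.memLp w hAinf p₀ hp₀ hpt.lt_top
  have hdense : ∀ f, MemLp f p₀ m → ∀ ε : ℝ≥0, 0 < ε → ∃ g ∈ D, eLpNorm (f - g) p₀ m ≤ ε :=
    fun f hf ε hε => hD.dense w hAinf p₀ hp₀ hpt.lt_top f hf ε (ENNReal.coe_pos.2 hε)
  have hweak' : ∀ f ∈ D, ∀ t : ℝ≥0, 0 < t →
      m {x | (t : ℝ) < ‖T f x‖} ≤ M * (eLpNorm f p₀ m / t) ^ p₀.toReal := fun f hf t ht => by
    rw [← SparseDom.lintegral_enorm_div_rpow hp0' hpt f ht]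
    exact hweak f hf t ht
  have hMp : M ^ (1 / p₀.toReal) = (K ^ (1 / p₀.toReal) : ℝ≥0) * SparseDom.psi μ p₀ q₀ w := by
    rw [hM, ENNReal.mul_rpow_of_nonneg _ _ (by positivity), ← ENNReal.rpow_mul,
      mul_one_div_cancel hp0.ne', ENNReal.rpow_one, ENNReal.coe_rpow_of_nonneg _ (by positivity)]
  -- Stated for any `S` whose differences are dominated by `T (f - g)`, so as to cover both `T`, if
  -- linear, and the modulus of `T`.
  have hext := fun (S : (EuclideanSpace ℝ (Fin n) → 𝕜) → EuclideanSpace ℝ (Fin n) → 𝕜)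
      (hSm : ∀ f ∈ D, AEStronglyMeasurable (S f) μ)
      (hS : ∀ f ∈ D, ∀ g ∈ D, ∀ᵐ x ∂μ, ‖S f x - S g x‖ ≤ ‖T (f - g) x‖)
      (hsub : SparseDom.IsSublinearOn μ (D : Set (EuclideanSpace ℝ (Fin n) → 𝕜)) S) =>
    SparseDom.exists_extension hp₀ hpt hMt hDm hdense (fun f hf => (hSm f hf).mono_ac hac)
      (fun f hf g hg t ht => (measure_mono_ae ((hw.ae_iff.2 (hS f hf g hg)).mono fun x hx hx' =>
        lt_of_lt_of_le hx' hx)).trans (hweak' _ (D.sub_mem hf hg) t ht))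
      ⟨fun f hf g hg => hw.ae_iff.2 (hsub.1 f hf g hg),
        fun a f hf => hw.ae_iff.2 (hsub.2 a f hf)⟩
  -- A linear `T` is continuous in measure and extends directly. Otherwise the continuous object is
  -- the modulus of `T f`, viewed as a scalar-valued function.
  by_cases hlin : SparseDom.IsLinearOn μ (D : Set (EuclideanSpace ℝ (Fin n) → 𝕜)) T
  · obtain ⟨G, hGD, hGs, hGl, hG⟩ := hext T hT.aestronglyMeasurable
      (fun f hf g hg => hlin.norm_sub_le hf hg) hT.sublinear
    have hGl' := hGl ⟨fun f hf g hg => hw.ae_iff.2 (hlin.1 f hf g hg),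
        fun a f hf => hw.ae_iff.2 (hlin.2 a f hf)⟩
    refine ⟨G, fun f hf => hw.ae_iff.1 (hGD f hf),
      ⟨fun f hf g hg => hw.ae_iff.1 (hGs.1 f hf g hg), fun a f hf => hw.ae_iff.1 (hGs.2 a f hf)⟩,
      fun _ => ⟨fun f hf g hg => hw.ae_iff.1 (hGl'.1 f hf g hg),
        fun a f hf => hw.ae_iff.1 (hGl'.2 a f hf)⟩,
      fun f hf => ⟨(hG f hf).1.mono_ac hac', ?_⟩⟩
    rw [← hMp]
    exact SparseDom.weakLpNorm_le hp0' hpt (hG f hf).2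
  · obtain ⟨G, hGD, hGs, -, hG⟩ := hext (fun f x => ((‖T f x‖ : ℝ) : 𝕜))
      (fun f hf => RCLike.continuous_ofReal.comp_aestronglyMeasurable
        (hT.aestronglyMeasurable f hf).norm)
      (fun f hf g hg => (hT.sublinear.abs_norm_sub_le hf hg).mono fun x hx => by
        rw [← RCLike.ofReal_sub, RCLike.norm_ofReal]
        exact hx)
      ⟨fun f hf g hg => (hT.sublinear.1 f hf g hg).mono fun x hx => by
        simpa only [RCLike.norm_ofReal, abs_norm] using hx,
        fun a f hf => (hT.sublinear.2 a f hf).mono fun x hx => by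
        simpa only [RCLike.norm_ofReal, abs_norm] using hx⟩
    -- The original values are kept on `D` and the extended modulus is used elsewhere. The two agree
    -- in modulus on `D`, and sublinearity and the weak norm depend only on moduli.
    set T' : (EuclideanSpace ℝ (Fin n) → 𝕜) → EuclideanSpace ℝ (Fin n) → 𝕜 :=
      fun f => if f ∈ D then T f else G f with hT'
    have hTG : ∀ f, ∀ᵐ x ∂μ, ‖T' f x‖ = ‖G f x‖ := by
      intro f
      by_cases hf : f ∈ D
      · filter_upwards [hw.ae_iff.1 (hGD f hf)] with x hx
        rw [hx, hT', RCLike.norm_ofReal, abs_norm]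
        simp only [if_pos hf]
      · simp only [hT', if_neg hf, Filter.eventually_true]
    refine ⟨T', fun f hf => ?_, ⟨fun f hf g hg => ?_, fun a f hf => ?_⟩,
      fun h => absurd h hlin, fun f hf => ⟨?_, ?_⟩⟩
    · simp only [hT', if_pos hf]
      exact Filter.EventuallyEq.rfl
    · filter_upwards [hw.ae_iff.1 (hGs.1 f hf g hg), hTG f, hTG g, hTG (f + g)] with x h h1 h2 h3
      rwa [h1, h2, h3]
    · filter_upwards [hw.ae_iff.1 (hGs.2 a f hf), hTG f, hTG (a • f)] with x h h1 h2
      rwa [h1, h2]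
    · by_cases hfD : f ∈ D
      · simp only [hT', if_pos hfD]
        exact hT.aestronglyMeasurable f hfD
      · simp only [hT', if_neg hfD]
        exact (hG f hf).1.mono_ac hac'
    · rw [← hMp]
      refine SparseDom.weakLpNorm_le hp0' hpt fun t ht => ?_
      refine le_trans (le_of_eq (measure_congr ?_)) ((hG f hf).2 t ht)
      filter_upwards [hw.ae_iff.2 (hTG f)] with x hx
      simp only [eq_iff_iff]
      change (t : ℝ) < ‖T' f x‖ ↔ (t : ℝ) < ‖G f x‖
      rw [hx]
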